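/- Let $n\ge 1$. Let $(M,g)$ be a $d$-dimensional Riemannian manifold, $H$ a closed $(n+1)$-form on $M$, $(E,\rho,[-,-])$ a Lie algebroid over $M$, and $\nabla$ a connection on the vector bundle $E$. Let $\Xi$ be a compact oriented $(n+1)$-dimensional manifold with non-empty boundary $\Sigma=\partial\Xi$, where $\Sigma$ carries the boundary orientation and a Riemannian metric $\gamma$ with Hodge star $*$. Let $\tilde\mu^{(k)}\in\Omega^k(M,\wedge^{n-k}E^*)$ for $0\le k\le n$. All data are smooth. For a map $X:\Xi\to M$ and $A\in\Omega^1(\Sigma,X^*E)$ put $DX=dX-\rho(A)$ and $S_{LA}=S_g+S_H+S_\mu$, where $$S_g=\int_\Sigma \tfrac12 g_{ij}(X)\,DX^i\wedge *DX^j,\qquad S_H=\int_\Xi X^*H,$$ $$S_\mu=\int_\Sigma\sum_{k=0}^{n}\frac{1}{k!(n-k)!}\,\tilde\mu^{(k)}_{i_1\ldots i_k a_{k+1}\ldots a_n}(X)\,dX^{i_1}\wedge\cdots\wedge dX^{i_k}\wedge A^{a_{k+1}}\wedge\cdots\wedge A^{a_n}.$$ For a gauge parameter $\epsilon\in\Gamma(X^*E)$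 the gauge transformation is, in every local frame $(e_a)$ of $E$ with $[e_b,e_c]=C^a_{bc}e_a$, $\nabla e_b=\omega^a_{bi}\,dx^i\otimes e_a$ and $\rho(e_a)=\rho_a^i\partial_i$, $$\delta X^i=\rho^i_a(X)\epsilon^a,\qquad \delta A^a=d\epsilon^a+C^a_{bc}(X)A^b\epsilon^c+\omega^a_{bi}(X)\,\epsilon^b\,DX^i .$$ The action is gauge invariant if $\delta S_{LA}=0$ for all smooth $X$, $A$, $\epsilon$, i.e. the derivative of $S_{LA}$ vanishes along every smooth path of fields through $(X,A)$ with this initial velocity. Let ${}^E\nabla_e v=[\rho(e),v]+\rho(\nabla_v e)$ be the canonical $E$-connection on $TM$ (extended to tensors on $M$). On $\Omega^k(M,\wedge^mE^*)$ let $\nabla$ be the exterior covariant derivative, and let ${}^Ed$ be the Lie algebroid differential $${}^Ed\alpha(e_1,\ldots,e_{m+1})=\sum_i(-1)^{i-1}\,{}^E\nabla_{e_i}\big(\alpha(e_1,\ldots,\check e_i,\ldots,e_{m+1})\big)+\sum_{i<j}(-1)^{i+j}\alpha([e_i,e_j],e_1,\ldots,\check e_i,\ldots,\check e_j,\ldots,e_{m+1}),$$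 where $({}^E\nabla_e\beta)(v_1,\ldots,v_k)=\rho(e)\big(\beta(v_1,\ldots,v_k)\big)-\sum_l\beta(v_1,\ldots,{}^E\nabla_e v_l,\ldots,v_k)$. Put $$(\iota_\rho^{m}\Omega)(e_1,\ldots,e_m)=\iota_{\rho(e_1)}\cdots\iota_{\rho(e_m)}\Omega.$$ A family $\mu=\sum_{k=0}^{n-1}\mu_k$, $\mu_k\in\Omega^k(M,\wedge^{n-k}E^*)$, is a homotopy momentum section for a closed $(n+1)$-form $\Omega$ if $$(\nabla+{}^Ed)\mu=-\sum_{k=0}^{n}\iota_\rho^{\,n+1-k}\Omega .$$ Theorem. Put $\mu_k:=(-1)^{(k+2)+(k+3)+\cdots+n}\,\tilde\mu^{(k)}$ for $0\le k\le n-1$ (so $\mu_{n-1}=\tilde\mu^{(n-1)}$) and $\Omega:=(-1)^n\,(H+d\tilde\mu^{(n)})$. Then $S_{LA}$ is gauge invariant if and only if all of the following hold: 1. ${}^E\nabla g=0$; 2. $\mu=\sum_{k=0}^{n-1}\mu_k$ is a homotopy momentum section for $\Omega$; 3. for $1\le k\le n-1$, $\mu_{k-1}=-\iota_\rho\mu_k$,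 i.e. $\mu_{k-1}(e_k,\ldots,e_n)=-\,\iota_{\rho(e_k)}\big(\mu_k(e_{k+1},\ldots,e_n)\big)$; equivalently $\tilde\mu^{(k-1)}(e_k,\ldots,e_n)=(-1)^k\,\iota_{\rho(e_k)}\tilde\mu^{(k)}(e_{k+1},\ldots,e_n)$. -/

import Mathlib

open Bundle Manifold MeasureTheory
open scoped ContDiff

noncomputable section

/-! ## Differential forms, Lie algebroids and Lie-algebroid-valued forms -/

namespace LASigma

section Target

variable {EM : Type*} [NormedAddCommGroup EM] [NormedSpace ℝ EM]
  {HM : Type*} [TopologicalSpace HM] (I : ModelWithCorners ℝ EM HM)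
  (M : Type*) [TopologicalSpace M] [ChartedSpace HM M] [IsManifold I ∞ M]

/-- Smooth vector fields on `M`. -/
abbrev VField : Type _ := ContMDiffSection I EM ∞ (fun x : M => TangentSpace I x)

/-- Smooth differential `k`-forms on `M`. -/
structure DForm (k : ℕ) where
  toFun : ∀ x : M, (TangentSpace I x) [⋀^Fin k]→L[ℝ] ℝ
  smooth : ∀ v : Fin k → VField I M,
    ContMDiff I 𝓘(ℝ, ℝ) ∞ (fun x => toFun x (fun i => v i x))

variable {I M} in
/-- The exterior derivative (with the normalisation
`dα(v₀,…,v_k) = ∑ (-1)^i v_i(α(…,v̌_i,…)) + …`), computed at each point in the preferred chart. -/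
def extD {k : ℕ} (α : ∀ x : M, (TangentSpace I x) [⋀^Fin k]→L[ℝ] ℝ) (x : M) :
    (TangentSpace I x) [⋀^Fin (k + 1)]→L[ℝ] ℝ :=
  (extDerivWithin
      (fun y : EM => (α ((extChartAt I x).symm y)).compContinuousLinearMap
        (mfderivWithin 𝓘(ℝ, EM) I (extChartAt I x).symm (Set.range I) y))
      (Set.range I) (extChartAt I x x)).compContinuousLinearMap
    (mfderiv I 𝓘(ℝ, EM) (extChartAt I x) x)

variable (F : Type*) [NormedAddCommGroup F] [NormedSpace ℝ F]
  (V : M → Type*) [TopologicalSpace (TotalSpace F V)]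
  [∀ x, AddCommGroup (V x)] [∀ x, Module ℝ (V x)] [∀ x, TopologicalSpace (V x)]
  [FiberBundle F V] [VectorBundle ℝ F V]

/-- Smooth sections of the vector bundle `V → M`. -/
abbrev VSection : Type _ := ContMDiffSection I F ∞ V

/-- A Lie algebroid structure on the vector bundle `V → M`: an anchor `ρ : V → TM` (a smooth bundle
map) and a Lie bracket on the smooth sections satisfying the Leibniz rule. -/
structure LieAlgebroid where
  anchor : ∀ x : M, V x →ₗ[ℝ] TangentSpace I x
  anchor_smooth : ∀ e : VSection I M F V,
    ContMDiff I I.tangent ∞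
      (fun x => (TotalSpace.mk' EM x (anchor x (e x)) : TangentBundle I M))
  bracket : VSection I M F V →ₗ[ℝ] VSection I M F V →ₗ[ℝ] VSection I M F V
  bracket_self : ∀ e, bracket e e = 0
  jacobi : ∀ e₁ e₂ e₃,
    bracket e₁ (bracket e₂ e₃) + bracket e₂ (bracket e₃ e₁) + bracket e₃ (bracket e₁ e₂) = 0
  /-- `[e₁, f e₂] = f [e₁, e₂] + (ρ(e₁) f) e₂`. -/
  leibniz : ∀ (f : M → ℝ), ContMDiff I 𝓘(ℝ, ℝ) ∞ f → ∀ e₁ e₂ fe₂ : VSection I M F V,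
    (∀ x, fe₂ x = f x • e₂ x) → ∀ x,
      bracket e₁ fe₂ x = f x • bracket e₁ e₂ x + (mvfderiv I f x (anchor x (e₁ x))) • e₂ x

/-- `Ω^p(M, ∧^q V^*)`: smooth `p`-forms on `M` with values in `∧^q V^*`. -/
structure EForm (p q : ℕ) where
  toFun : ∀ x : M, (TangentSpace I x) [⋀^Fin p]→ₗ[ℝ] ((V x) [⋀^Fin q]→ₗ[ℝ] ℝ)
  smooth : ∀ (v : Fin p → VField I M) (e : Fin q → VSection I M F V),
    ContMDiff I 𝓘(ℝ, ℝ) ∞ (fun x => toFun x (fun i => v i x) (fun j => e j x))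

variable {I M F V}

/-- Multiplication of a form by a constant. -/
def EForm.smul {p q : ℕ} (c : ℝ) (μ : EForm I M F V p q) : EForm I M F V p q where
  toFun x := c • μ.toFun x
  smooth v e := by
    have h := (contMDiff_const (I := I) (I' := 𝓘(ℝ, ℝ)) (n := ∞) (c := c)).mul (μ.smooth v e)
    exact h

variable [∀ x, IsTopologicalAddGroup (V x)] [∀ x, ContinuousSMul ℝ (V x)]

/-- The canonical `E`-connection on `TM`: `ᴱ∇_e v = [ρ(e), v] + ρ(∇_v e)`. -/
def eConn (L : LieAlgebroid I M F V) (cov : CovariantDerivative I F V)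
    (e : VSection I M F V) (v : VField I M) (x : M) : TangentSpace I x :=
  VectorField.mlieBracket I (fun y => L.anchor y (e y)) (fun y => v y) x
    + L.anchor x (cov (fun y => e y) x (v x))

/-- The exterior covariant derivative `∇ : Ω^p(M, ∧^q E^*) → Ω^{p+1}(M, ∧^q E^*)` induced by the
connection `∇` on `E`, evaluated on vector fields `v₀, …, v_p` and sections `e_1, …, e_q`:
`∑ᵢ (-1)^i ( vᵢ(μ(…v̌ᵢ…; e)) - ∑_l μ(…v̌ᵢ…; …, ∇_{vᵢ} e_l, …)
    - ∑_{j>i} μ(…v̌ᵢ…, [vᵢ, vⱼ] in the place of vⱼ, …; e) )`. -/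
def covD (cov : CovariantDerivative I F V) {p q : ℕ} (μ : EForm I M F V p q)
    (v : Fin (p + 1) → VField I M) (e : Fin q → VSection I M F V) (x : M) : ℝ :=
  ∑ i : Fin (p + 1), (-1 : ℝ) ^ (i : ℕ) *
    (mvfderiv I (fun y => μ.toFun y (fun a => v (i.succAbove a) y) (fun b => e b y)) x (v i x)
      - ∑ l : Fin q, μ.toFun x (fun a => v (i.succAbove a) x)
          (Function.update (fun b => e b x) l (cov (fun y => e l y) x (v i x)))
      - ∑ j : Fin p, if i < i.succAbove j then
          μ.toFun x (Function.update (fun a => v (i.succAbove a) x) j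
            (VectorField.mlieBracket I (fun y => v i y) (fun y => v (i.succAbove j) y) x))
            (fun b => e b x)
        else 0)

/-- The Lie algebroid differential `ᴱd : Ω^p(M, ∧^q E^*) → Ω^p(M, ∧^{q+1} E^*)`, where `ρ(e)` acts
on the form part through the canonical `E`-connection on `TM`, evaluated on `v_1, …, v_p` and
`e₀, …, e_q`:
`∑ᵢ (-1)^i ( ρ(eᵢ)(μ(v; …ěᵢ…)) - ∑_l μ(…, ᴱ∇_{eᵢ} v_l, …; …ěᵢ…)
    - ∑_{j>i} μ(v; …ěᵢ…, [eᵢ, eⱼ] in the place of eⱼ, …) )`. -/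
def algD (L : LieAlgebroid I M F V) (cov : CovariantDerivative I F V) {p q : ℕ}
    (μ : EForm I M F V p q) (v : Fin p → VField I M) (e : Fin (q + 1) → VSection I M F V)
    (x : M) : ℝ :=
  ∑ i : Fin (q + 1), (-1 : ℝ) ^ (i : ℕ) *
    (mvfderiv I (fun y => μ.toFun y (fun a => v a y) (fun b => e (i.succAbove b) y)) x
        (L.anchor x (e i x))
      - ∑ l : Fin p, μ.toFun x (Function.update (fun a => v a x) l (eConn L cov (e i) (v l) x))
          (fun b => e (i.succAbove b) x)
      - ∑ j : Fin q, if i < i.succAbove j then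
          μ.toFun x (fun a => v a x)
            (Function.update (fun b => e (i.succAbove b) x) j
              (L.bracket (e i) (e (i.succAbove j)) x))
        else 0)

/-- `ι_ρ^q Ω (v_1, …, v_p)(e_1, …, e_q) = Ω(ρ(e_q), …, ρ(e_1), v_1, …, v_p)`, for an
`(n+1)`-form `Ω` and `q + p = n + 1`. -/
def iotaPow (L : LieAlgebroid I M F V) {n p q : ℕ} (h : n + 1 = q + p)
    (Ω : ∀ x : M, (TangentSpace I x) [⋀^Fin (n + 1)]→L[ℝ] ℝ)
    (v : Fin p → VField I M) (e : Fin q → VSection I M F V) (x : M) : ℝ :=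
  Ω x (fun i => Fin.append (fun a : Fin q => L.anchor x (e a.rev x)) (fun b : Fin p => v b x)
    (Fin.cast h i))

variable (I M F V) in
/-- Families `μ = ∑_{k=0}^{n-1} μ_k` with `μ_k ∈ Ω^k(M, ∧^{n-k} E^*)`; the component `μ_p` is indexed
by `(p, q)` with `n - p = q + 1`. -/
abbrev Cochain (n : ℕ) : Type _ :=
  ∀ p q : ℕ, p + q + 1 = n → EForm I M F V p (q + 1)

/-- `μ` is a homotopy momentum section for the `(n+1)`-form `Ω`:
`(∇ + ᴱd) μ = - ∑_{k=0}^{n} ι_ρ^{n+1-k} Ω`, split by form degree into the `n`-form part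
`∇μ_{n-1} = -ι_ρ Ω`, the intermediate parts `∇μ_{k-1} + ᴱd μ_k = -ι_ρ^{n+1-k} Ω` for
`1 ≤ k ≤ n-1`, and the `0`-form part `ᴱd μ_0 = -ι_ρ^{n+1} Ω`. -/
def IsHomotopyMomentumSection (L : LieAlgebroid I M F V) (cov : CovariantDerivative I F V) {n : ℕ}
    (Ω : ∀ x : M, (TangentSpace I x) [⋀^Fin (n + 1)]→L[ℝ] ℝ) (μ : Cochain I M F V n) : Prop :=
  (∀ (p : ℕ) (h : p + 0 + 1 = n) (v : Fin (p + 1) → VField I M) (e : Fin 1 → VSection I M F V)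
      (x : M), covD cov (μ p 0 h) v e x = - iotaPow L (by omega) Ω v e x) ∧
  (∀ (p q : ℕ) (h : p + q + 2 = n) (v : Fin (p + 1) → VField I M)
      (e : Fin (q + 2) → VSection I M F V) (x : M),
      covD cov (μ p (q + 1) (by omega)) v e x + algD L cov (μ (p + 1) q (by omega)) v e x
        = - iotaPow L (by omega) Ω v e x) ∧
  (∀ (q : ℕ) (h : 0 + q + 1 = n) (v : Fin 0 → VField I M) (e : Fin (q + 2) → VSection I M F V)
      (x : M), algD L cov (μ 0 q h) v e x = - iotaPow L (by omega) Ω v e x)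

/-- The algebraic relation `μ_{k-1} = - ι_ρ μ_k` for `1 ≤ k ≤ n - 1`, i.e.
`μ_{k-1}(e_k, …, e_n) = - ι_{ρ(e_k)} (μ_k(e_{k+1}, …, e_n))`. -/
def AlgebraicRelation (L : LieAlgebroid I M F V) {n : ℕ} (μ : Cochain I M F V n) : Prop :=
  ∀ (p q : ℕ) (h : p + q + 2 = n) (x : M) (v : Fin p → TangentSpace I x) (e₀ : V x)
    (e : Fin (q + 1) → V x),
    (μ p (q + 1) (by omega)).toFun x v (Fin.cons e₀ e)
      = - (μ (p + 1) q (by omega)).toFun x (Fin.cons (L.anchor x e₀) v) e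

/-- `ᴱ∇g = 0` for the canonical `E`-connection. -/
def MetricInvariant (L : LieAlgebroid I M F V) (cov : CovariantDerivative I F V)
    (g : ContMDiffRiemannianMetric I ∞ EM (fun x : M => TangentSpace I x)) : Prop :=
  ∀ (e : VSection I M F V) (v w : VField I M) (x : M),
    mvfderiv I (fun y => g.inner y (v y) (w y)) x (L.anchor x (e x))
      - g.inner x (eConn L cov e v x) (w x) - g.inner x (v x) (eConn L cov e w x) = 0

/-- The rescaled coefficients `μ_k = (-1)^{(k+2)+(k+3)+⋯+n} μ̃^{(k)}`, `0 ≤ k ≤ n - 1`. -/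
def rescaled {n : ℕ} (μt : Cochain I M F V n) : Cochain I M F V n :=
  fun p q h => (μt p q h).smul ((-1 : ℝ) ^ (∑ j ∈ Finset.Icc (p + 2) n, j))

/-- The modified form `(-1)^n (H + dμ̃^{(n)})`. -/
def modifiedForm {n : ℕ} (H : DForm I M (n + 1)) (μtop : DForm I M n) (x : M) :
    (TangentSpace I x) [⋀^Fin (n + 1)]→L[ℝ] ℝ :=
  ((-1 : ℝ) ^ n) • (H.toFun x + extD μtop.toFun x)

end Target

/-! ## Integration on compact manifolds -/

section Integration

variable {m : ℕ} {HN : Type*} [TopologicalSpace HN]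
  (I : ModelWithCorners ℝ (EuclideanSpace ℝ (Fin m)) HN)
  {N : Type*} [TopologicalSpace N] [ChartedSpace HN N]

/-- The coordinate frame `∂_1, …, ∂_m` of the chart `extChartAt I i` at the point of coordinates
`y`. -/
def coordFrame (i : N) (y : EuclideanSpace ℝ (Fin m)) (a : Fin m) :
    TangentSpace I ((extChartAt I i).symm y) :=
  mfderivWithin 𝓘(ℝ, EuclideanSpace ℝ (Fin m)) I (extChartAt I i).symm (Set.range I) y
    (EuclideanSpace.single a (1 : ℝ))

variable [IsManifold I ∞ N] [T2Space N] [CompactSpace N]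

/-- A smooth partition of unity subordinate to the charts of `N`. -/
def chartPartition : SmoothPartitionOfUnity N I N Set.univ :=
  (SmoothPartitionOfUnity.exists_isSubordinate_chartAt_source I N).choose

/-- The integral over `N` of a density. A density is given by its values `D x (b_1, …, b_m)` on the
bases of `T_x N`, and satisfies `D x (A b) = |det A| D x b`; in each chart, the local integrand is the
value on the coordinate frame. -/
def integralDensity (D : ∀ x : N, (Fin m → TangentSpace I x) → ℝ) : ℝ :=
  ∑ᶠ i : N, ∫ y in (extChartAt I i).target,
    chartPartition I (N := N) i ((extChartAt I i).symm y)
      * D ((extChartAt I i).symm y) (coordFrame I i y)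

end Integration

/-! ## The gauged sigma model -/

section Model

variable {n : ℕ}
  (Ξ : Type*) [TopologicalSpace Ξ] [ChartedSpace (EuclideanHalfSpace (n + 1)) Ξ]
  [IsManifold (𝓡∂ (n + 1)) ∞ Ξ] [T2Space Ξ] [CompactSpace Ξ]
  (S : Type*) [TopologicalSpace S] [ChartedSpace (EuclideanSpace ℝ (Fin n)) S]
  [IsManifold (𝓡 n) ∞ S] [T2Space S] [CompactSpace S]

/-- A worldvolume: the compact manifold `Ξ`, oriented by a nowhere vanishing top form, with boundary
`Σ = ∂Ξ` presented as a closed manifold `S` smoothly embedded onto `∂Ξ`, and a Riemannian metric `γ`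
on `Σ`. -/
structure Worldvolume where
  orient : DForm (𝓡∂ (n + 1)) Ξ (n + 1)
  orient_ne : ∀ ξ, orient.toFun ξ ≠ 0
  incl : S → Ξ
  incl_embedding : IsSmoothEmbedding (𝓡 n) (𝓡∂ (n + 1)) ∞ incl
  range_incl : Set.range incl = (𝓡∂ (n + 1)).boundary Ξ
  γ : ContMDiffRiemannianMetric (𝓡 n) ∞ (EuclideanSpace ℝ (Fin n))
    (fun s : S => TangentSpace (𝓡 n) s)

variable {Ξ S} (W : Worldvolume (n := n) Ξ S)

/-- Sign of a basis of `T_ξ Ξ` for the orientation. -/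
def Worldvolume.bulkSign (ξ : Ξ) (b : Fin (n + 1) → TangentSpace (𝓡∂ (n + 1)) ξ) : ℝ :=
  Real.sign (W.orient.toFun ξ b)

/-- At a boundary point, the outward pointing vector `-∂_0`; the tangent space at `ξ` is identified
with the model space through the preferred chart at `ξ`, with values in the half-space `x_0 ≥ 0`. -/
def outward (ξ : Ξ) : TangentSpace (𝓡∂ (n + 1)) ξ :=
  -(EuclideanSpace.single (0 : Fin (n + 1)) (1 : ℝ) : EuclideanSpace ℝ (Fin (n + 1)))

/-- Sign of a basis of `T_s Σ` for the boundary orientation (outward vector first). -/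
def Worldvolume.bdrySign (s : S) (b : Fin n → TangentSpace (𝓡 n) s) : ℝ :=
  Real.sign (W.orient.toFun (W.incl s)
    (Fin.cons (outward (W.incl s)) (fun a => mfderiv (𝓡 n) (𝓡∂ (n + 1)) W.incl s (b a))))

variable {EM : Type*} [NormedAddCommGroup EM] [NormedSpace ℝ EM]
  {HM : Type*} [TopologicalSpace HM] {I : ModelWithCorners ℝ EM HM}
  {M : Type*} [TopologicalSpace M] [ChartedSpace HM M] [IsManifold I ∞ M]
  {F : Type*} [NormedAddCommGroup F] [NormedSpace ℝ F]
  {V : M → Type*} [TopologicalSpace (TotalSpace F V)]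
  [∀ x, AddCommGroup (V x)] [∀ x, Module ℝ (V x)] [∀ x, TopologicalSpace (V x)]
  [FiberBundle F V] [VectorBundle ℝ F V]

variable (V) in
/-- The fields: a map `X : Ξ → M` and a 1-form `A` on `Σ` with values in `X^*E` (smoothness is
imposed in `IsSmoothPath`). -/
structure Fields where
  X : Ξ → M
  A : ∀ s : S, TangentSpace (𝓡 n) s →ₗ[ℝ] V (X (W.incl s))

variable {W}

/-- `dX` along `Σ`. -/
def Fields.dXbdry (I : ModelWithCorners ℝ EM HM) (φ : Fields W V) (s : S)
    (u : TangentSpace (𝓡 n) s) : TangentSpace I (φ.X (W.incl s)) :=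
  mfderiv (𝓡∂ (n + 1)) I φ.X (W.incl s) (mfderiv (𝓡 n) (𝓡∂ (n + 1)) W.incl s u)

/-- `DX = dX - ρ(A)` along `Σ`. -/
def Fields.DX (L : LieAlgebroid I M F V) (φ : Fields W V) (s : S)
    (u : TangentSpace (𝓡 n) s) : TangentSpace I (φ.X (W.incl s)) :=
  φ.dXbdry I s u - L.anchor _ (φ.A s u)

/-- The density `½ g_{ij} √γ γ^{ab} D_aX^i D_bX^j` of `½ g_{ij} DX^i ∧ *DX^j`. -/
def Fields.kineticDensity (L : LieAlgebroid I M F V)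
    (g : ContMDiffRiemannianMetric I ∞ EM (fun x : M => TangentSpace I x))
    (φ : Fields W V) (s : S) (b : Fin n → TangentSpace (𝓡 n) s) : ℝ :=
  let G : Matrix (Fin n) (Fin n) ℝ := Matrix.of fun i j => W.γ.inner s (b i) (b j)
  (1 / 2) * Real.sqrt G.det *
    ∑ i, ∑ j, G⁻¹ i j * g.inner (φ.X (W.incl s)) (φ.DX L s (b i)) (φ.DX L s (b j))

/-- The value on `(b_1, …, b_n)` of the `n`-form
`1/(p! (n-p)!) μ̃_{i_1…i_p a_{p+1}…a_n}(X) dX^{i_1} ∧ ⋯ ∧ dX^{i_p} ∧ A^{a_{p+1}} ∧ ⋯ ∧ A^{a_n}` on `Σ`,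
where `n - p = q + 1`. -/
def Fields.mixedForm (φ : Fields W V) {p q : ℕ} (h : p + q + 1 = n)
    (μ : EForm I M F V p (q + 1)) (s : S) (b : Fin n → TangentSpace (𝓡 n) s) : ℝ :=
  (1 / ((p.factorial : ℝ) * ((q + 1).factorial : ℝ))) *
    ∑ w : Equiv.Perm (Fin n), ((Equiv.Perm.sign w : ℤ) : ℝ) *
      μ.toFun (φ.X (W.incl s))
        (fun i : Fin p => φ.dXbdry I s (b (w (Fin.cast h (Fin.castAdd (q + 1) i)))))
        (fun j : Fin (q + 1) => φ.A s (b (w (Fin.cast h (Fin.natAdd p j)))))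

/-- `S_g = ∫_Σ ½ g_{ij} DX^i ∧ *DX^j`. -/
def actionG (L : LieAlgebroid I M F V)
    (g : ContMDiffRiemannianMetric I ∞ EM (fun x : M => TangentSpace I x)) (φ : Fields W V) : ℝ :=
  integralDensity (𝓡 n) (N := S) (fun s b => φ.kineticDensity L g s b)

/-- `S_H = ∫_Ξ X^*H`. -/
def actionH (H : DForm I M (n + 1)) (φ : Fields W V) : ℝ :=
  integralDensity (𝓡∂ (n + 1)) (N := Ξ) (fun ξ b => W.bulkSign ξ b *
    H.toFun (φ.X ξ) (fun a => mfderiv (𝓡∂ (n + 1)) I φ.X ξ (b a)))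

/-- `S_μ = ∫_Σ ∑_{k=0}^{n} 1/(k!(n-k)!) μ̃^{(k)}_{i_1…i_k a_{k+1}…a_n}(X) dX^{i_1} ⋯ A^{a_n}`, with the
`k = n` term `∫_Σ X^*μ̃^{(n)}` written first. -/
def actionMu (μtop : DForm I M n) (μt : Cochain I M F V n) (φ : Fields W V) : ℝ :=
  integralDensity (𝓡 n) (N := S) (fun s b => W.bdrySign s b *
    (μtop.toFun (φ.X (W.incl s)) (fun a => φ.dXbdry I s (b a)) +
      ∑ k : Fin n,
        φ.mixedForm (show (k : ℕ) + (n - 1 - k) + 1 = n by omega) (μt k (n - 1 - k) (by omega)) s b))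

/-- The gauged action `S_LA = S_g + S_H + S_μ`. -/
def action (L : LieAlgebroid I M F V)
    (g : ContMDiffRiemannianMetric I ∞ EM (fun x : M => TangentSpace I x))
    (H : DForm I M (n + 1)) (μtop : DForm I M n) (μt : Cochain I M F V n) (φ : Fields W V) : ℝ :=
  actionG L g φ + actionH H φ + actionMu μtop μt φ

variable (I F) in
/-- A path `t ↦ (X_t, A_t)` of fields that is jointly smooth in `t` and in the point of the
worldvolume; `A_t` is viewed as a map `TΣ → E`. -/
def IsSmoothPath (φ : ℝ → Fields W V) : Prop :=
  ContMDiff (𝓘(ℝ, ℝ).prod (𝓡∂ (n + 1))) I ∞ (fun z : ℝ × Ξ => (φ z.1).X z.2) ∧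
  ContMDiff (𝓘(ℝ, ℝ).prod (𝓡 n).tangent) (I.prod 𝓘(ℝ, F)) ∞
    (fun z : ℝ × TangentBundle (𝓡 n) S =>
      TotalSpace.mk' F ((φ z.1).X (W.incl z.2.proj)) ((φ z.1).A z.2.proj z.2.snd))

variable [∀ x, IsTopologicalAddGroup (V x)] [∀ x, ContinuousSMul ℝ (V x)]

/-- The path `φ` starts at `(X, A) = φ 0` with velocity given by the gauge transformation with
parameter `ε ∈ Γ(X^*E)`:
`δX = ρ(ε)` and, in every local frame `e_a` of `E`,
`δA^a = dε^a + C^a_{bc}(X) A^b ε^c + ω^a_{bi}(X) ε^b DX^i`, where `[e_b, e_c] = C^a_{bc} e_a` and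
`∇e_b = ω^a_{bi} dx^i ⊗ e_a`. -/
def IsGaugeVariation (L : LieAlgebroid I M F V) (cov : CovariantDerivative I F V)
    (φ : ℝ → Fields W V) (ε : ∀ ξ : Ξ, V ((φ 0).X ξ)) : Prop :=
  (∀ ξ : Ξ, mfderiv 𝓘(ℝ, ℝ) I (fun t : ℝ => (φ t).X ξ) 0 (1 : ℝ) = L.anchor _ (ε ξ)) ∧
  ∀ (U : Set M) (_ : IsOpen U) (e : Fin (Module.finrank ℝ F) → VSection I M F V)
    (he : IsLocalFrameOn I F ∞ (fun a x => e a x) U) (s : S) (_ : (φ 0).X (W.incl s) ∈ U)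
    (u : TangentSpace (𝓡 n) s) (a : Fin (Module.finrank ℝ F)),
    deriv (fun t : ℝ => he.coeff a ((φ t).X (W.incl s)) ((φ t).A s u)) 0 =
      mvfderiv (𝓡 n) (fun τ : S => he.coeff a ((φ 0).X (W.incl τ)) (ε (W.incl τ))) s u
      + (∑ b, ∑ c, he.coeff a _ (L.bracket (e b) (e c) ((φ 0).X (W.incl s)))
          * he.coeff b _ ((φ 0).A s u) * he.coeff c _ (ε (W.incl s)))
      + ∑ b, he.coeff a _ (cov (fun y => e b y) ((φ 0).X (W.incl s)) ((φ 0).DX L s u))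
          * he.coeff b _ (ε (W.incl s))

variable (W) in
/-- Gauge invariance `δS_LA = 0`: for all smooth fields `(X, A)` and all smooth gauge parameters
`ε ∈ Γ(X^*E)`, the action is stationary in the direction of the gauge transformation. -/
def GaugeInvariant (L : LieAlgebroid I M F V) (cov : CovariantDerivative I F V)
    (g : ContMDiffRiemannianMetric I ∞ EM (fun x : M => TangentSpace I x))
    (H : DForm I M (n + 1)) (μtop : DForm I M n) (μt : Cochain I M F V n) : Prop :=
  ∀ (φ : ℝ → Fields W V), IsSmoothPath I F φ →
    ∀ ε : ∀ ξ : Ξ, V ((φ 0).X ξ),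
      ContMDiff (𝓡∂ (n + 1)) (I.prod 𝓘(ℝ, F)) ∞
        (fun ξ => TotalSpace.mk' F ((φ 0).X ξ) (ε ξ)) →
      IsGaugeVariation L cov φ ε →
      HasDerivAt (fun t => action L g H μtop μt (φ t)) 0 0

end Model

end LASigma

end

/-! The proof. -/

noncomputable section

set_option linter.unusedSectionVars false

namespace LASigma

open Topology VectorField
open EuclideanSpace (single)
open Function (update update_self update_of_ne)
open Finset (sum_congr sum_eq_zero sum_add_distrib mul_sum sum_neg_distrib sum_sub_distrib sum_comm sum_eq_single
  sum_mul sum_insert)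

/-! ### Differentiating multilinear maps along varying arguments -/

section Multilinear

variable {ι : Type*} [Fintype ι] [DecidableEq ι] {G : Type*} [NormedAddCommGroup G]
  [NormedSpace ℝ G] [FiniteDimensional ℝ G]

lemma multilinear_eq_sum_basis (f : MultilinearMap ℝ (fun _ : ι => G) ℝ)
    {κ : Type*} [Fintype κ] (b : Module.Basis κ ℝ G) (w : ι → G) :
    f w = ∑ r : ι → κ, (∏ i, b.repr (w i) (r i)) * f (fun i => b (r i)) := by
  classical
  conv_lhs => rw [show w = fun i => ∑ k, b.repr (w i) k • b k from
    funext fun i => (b.sum_repr (w i)).symm]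
  rw [f.map_sum]
  refine sum_congr rfl fun r _ => ?_
  rw [f.map_smul_univ, smul_eq_mul]

lemma contDiffWithinAt_multilinear {E : Type*} [NormedAddCommGroup E] [NormedSpace ℝ E]
    {k : WithTop ℕ∞} {s : Set E} {x : E} {f : E → MultilinearMap ℝ (fun _ : ι => G) ℝ}
    (hf : ∀ v, ContDiffWithinAt ℝ k (fun y => f y v) s x) {w : E → ι → G}
    (hw : ∀ i, ContDiffWithinAt ℝ k (fun y => w y i) s x) :
    ContDiffWithinAt ℝ k (fun y => f y (w y)) s x := by
  have b := Module.finBasis ℝ G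
  simp_rw [fun y => multilinear_eq_sum_basis (f y) b (w y)]
  refine ContDiffWithinAt.sum fun r _ => ContDiffWithinAt.mul ?_ (hf _)
  refine contDiffWithinAt_prod fun i _ => ?_
  have := (LinearMap.toContinuousLinearMap (b.coord (r i))).contDiff (n := k)
  exact this.contDiffAt.comp_contDiffWithinAt x (hw i)

lemma hasDerivAt_multilinear {f : ℝ → MultilinearMap ℝ (fun _ : ι => G) ℝ} {t : ℝ}
    {f' : MultilinearMap ℝ (fun _ : ι => G) ℝ}
    (hf : ∀ v, HasDerivAt (fun τ => f τ v) (f' v) t) {w : ℝ → ι → G} {w' : ι → G}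
    (hw : ∀ i, HasDerivAt (fun τ => w τ i) (w' i) t) :
    HasDerivAt (fun τ => f τ (w τ))
      (f' (w t) + ∑ i, f t (update (w t) i (w' i))) t := by
  have b := Module.finBasis ℝ G
  simp_rw [fun τ => multilinear_eq_sum_basis (f τ) b (w τ)]
  have hc : ∀ (r : ι → Fin (Module.finrank ℝ G)) (i : ι),
      HasDerivAt (fun τ => b.repr (w τ i) (r i)) (b.repr (w' i) (r i)) t := fun r i =>
    (LinearMap.toContinuousLinearMap (b.coord (r i))).hasFDerivAt.comp_hasDerivAt t (hw i)
  have key := HasDerivAt.fun_sum (u := Finset.univ) fun (r : ι → Fin (Module.finrank ℝ G)) _ =>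
    (HasDerivAt.fun_finsetProd (u := Finset.univ) fun i _ => hc r i).mul (hf (fun i => b (r i)))
  refine key.congr_deriv ?_
  rw [multilinear_eq_sum_basis f' b]
  simp_rw [fun i => multilinear_eq_sum_basis (f t) b (update (w t) i (w' i))]
  rw [sum_comm, ← sum_add_distrib]
  refine sum_congr rfl fun r _ => ?_
  rw [add_comm, sum_mul]
  congr 1
  refine sum_congr rfl fun i _ => ?_
  rw [← Finset.mul_prod_erase Finset.univ _ (Finset.mem_univ i)]
  congr 1
  rw [smul_eq_mul, mul_comm]
  congr 1
  · simp
  · refine Finset.prod_congr rfl fun j hj => ?_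
    rw [update_of_ne (Finset.ne_of_mem_erase hj)]

end Multilinear

/-! ### Coordinates of sections in local trivializations -/

variable {EM : Type*} [NormedAddCommGroup EM] [NormedSpace ℝ EM] {HM : Type*} [TopologicalSpace HM]
  {I : ModelWithCorners ℝ EM HM} {M : Type*} [TopologicalSpace M] [ChartedSpace HM M] {F : Type*}
  [NormedAddCommGroup F] [NormedSpace ℝ F] {V : M → Type*} [TopologicalSpace (TotalSpace F V)]
  [∀ x, AddCommGroup (V x)] [∀ x, Module ℝ (V x)] [∀ x, TopologicalSpace (V x)] [FiberBundle F V]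
  [VectorBundle ℝ F V]

local notation "TM" => fun x : M => TangentSpace I x
local notation "𝔼" k:max => EuclideanSpace ℝ (Fin k)
local notation "ΓE" => VSection I M F V
local notation "ΓT" => VField I M

variable (F V) in
/-- The coordinates of a vector of `V x` in the preferred trivialization of `V` at `x₀`
(junk value `0` when `x` is outside of its base set). -/
def hat (x₀ x : M) : V x →L[ℝ] F := (trivializationAt F V x₀).continuousLinearMapAt ℝ x

variable (F V) in
/-- The vector of `V x` with given coordinates in the preferred trivialization of `V` at `x₀`. -/
def unhat (x₀ x : M) : F →L[ℝ] V x := (trivializationAt F V x₀).symmL ℝ x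

variable (F V) in
abbrev triv (x₀ : M) : Set M := (trivializationAt F V x₀).baseSet

variable (F V) in
lemma mem_triv (x : M) : x ∈ triv F V x :=
  FiberBundle.mem_baseSet_trivializationAt' x

lemma hat_unhat {x₀ x : M} (hx : x ∈ triv F V x₀) (u : F) : hat F V x₀ x (unhat F V x₀ x u) = u :=
  (trivializationAt F V x₀).continuousLinearMapAt_symmL hx u

lemma unhat_hat {x₀ x : M} (hx : x ∈ triv F V x₀) (a : V x) :
    unhat F V x₀ x (hat F V x₀ x a) = a :=
  (trivializationAt F V x₀).symmL_continuousLinearMapAt hx a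

lemma hat_injective {x₀ x : M} (hx : x ∈ triv F V x₀) : Function.Injective (hat F V x₀ x) :=
  Function.LeftInverse.injective (unhat_hat hx)

variable [IsManifold I ∞ M] [ContMDiffVectorBundle ∞ F V I]

lemma contMDiffWithinAt_hat {E' : Type*} [NormedAddCommGroup E'] [NormedSpace ℝ E']
    {H' : Type*} [TopologicalSpace H'] {J : ModelWithCorners ℝ E' H'}
    {N : Type*} [TopologicalSpace N] [ChartedSpace H' N] {c : N → M} {a : ∀ y, V (c y)}
    {s : Set N} {y : N} {x₀ : M} (hy : c y ∈ triv F V x₀) :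
    ContMDiffWithinAt J (I.prod 𝓘(ℝ, F)) ∞ (fun y => TotalSpace.mk' F (c y) (a y)) s y ↔
      ContMDiffWithinAt J I ∞ c s y ∧
        ContMDiffWithinAt J 𝓘(ℝ, F) ∞ (fun y => hat F V x₀ (c y) (a y)) s y := by
  rw [(trivializationAt F V x₀).contMDiffWithinAt_iff
    ((trivializationAt F V x₀).mem_source.2 hy)]
  refine and_congr_right fun hc => ?_
  have hev : ∀ᶠ z in 𝓝[insert y s] y, c z ∈ triv F V x₀ := by
    have : ContinuousWithinAt c (insert y s) y := hc.continuousWithinAt.insert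
    exact this ((trivializationAt F V x₀).open_baseSet.mem_nhds hy)
  have key : ∀ z, c z ∈ triv F V x₀ →
      hat F V x₀ (c z) (a z) = ((trivializationAt F V x₀) (TotalSpace.mk' F (c z) (a z))).2 := by
    intro z hz
    simp only [hat, Trivialization.continuousLinearMapAt_apply]
    rw [Trivialization.coe_linearMapAt_of_mem _ hz]
  constructor <;> intro h
  · exact (h.insert.congr_of_eventuallyEq (hev.mono fun z hz => key z hz) (key y hy)).mono
      (Set.subset_insert _ _)
  · exact (h.insert.congr_of_eventuallyEq (hev.mono fun z hz => (key z hz).symm)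
      (key y hy).symm).mono (Set.subset_insert _ _)

lemma contMDiffAt_hat {E' : Type*} [NormedAddCommGroup E'] [NormedSpace ℝ E']
    {H' : Type*} [TopologicalSpace H'] {J : ModelWithCorners ℝ E' H'}
    {N : Type*} [TopologicalSpace N] [ChartedSpace H' N] {c : N → M} {a : ∀ y, V (c y)}
    {y : N} {x₀ : M} (hy : c y ∈ triv F V x₀) :
    ContMDiffAt J (I.prod 𝓘(ℝ, F)) ∞ (fun y => TotalSpace.mk' F (c y) (a y)) y ↔
      ContMDiffAt J I ∞ c y ∧ ContMDiffAt J 𝓘(ℝ, F) ∞ (fun y => hat F V x₀ (c y) (a y)) y := by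
  simp only [← contMDiffWithinAt_univ]
  exact contMDiffWithinAt_hat hy

lemma contMDiffAt_section_hat (σ : ΓE) {x₀ x : M} (hx : x ∈ triv F V x₀) :
    ContMDiffAt I 𝓘(ℝ, F) ∞ (fun y => hat F V x₀ y (σ y)) x :=
  ((contMDiffAt_hat (c := fun y => y) (a := fun y => σ y) hx).1 (σ.contMDiff x)).2

lemma contMDiffOn_unhat (x₀ : M) (u : F) :
    ContMDiffOn I (I.prod 𝓘(ℝ, F)) ∞ (fun x => TotalSpace.mk' F x (unhat F V x₀ x u))
      (triv F V x₀) := by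
  intro x hx
  refine (contMDiffWithinAt_hat (c := fun y => y) (x₀ := x₀) hx).2 ⟨contMDiffWithinAt_id, ?_⟩
  exact (contMDiffWithinAt_const (c := u)).congr (fun z hz => hat_unhat hz u) (hat_unhat hx u)

variable [FiniteDimensional ℝ EM] [T2Space M]

lemma exists_bump {x₀ : M} {U : Set M} (hU : U ∈ 𝓝 x₀) :
    ∃ χ : M → ℝ, ContMDiff I 𝓘(ℝ, ℝ) ∞ χ ∧ χ =ᶠ[𝓝 x₀] 1 ∧ tsupport χ ⊆ U ∧
      ∀ x, 0 ≤ χ x ∧ χ x ≤ 1 := by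
  obtain ⟨f, -, hf⟩ := (SmoothBumpFunction.nhds_basis_tsupport (I := I) x₀).mem_iff.1 hU
  exact ⟨f, f.contMDiff, f.eventuallyEq_one, hf, fun x => ⟨f.nonneg, f.le_one⟩⟩

variable (I F V) in
lemma exists_locFrame (x₀ : M) : ∃ Φ : F →ₗ[ℝ] ΓE,
    ∀ᶠ x in 𝓝 x₀, x ∈ triv F V x₀ ∧ ∀ u, Φ u x = unhat F V x₀ x u := by
  have hU : triv F V x₀ ∈ 𝓝 x₀ := (trivializationAt F V x₀).open_baseSet.mem_nhds
    (FiberBundle.mem_baseSet_trivializationAt' x₀)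
  obtain ⟨χ, hχ, hχ1, hχs, -⟩ := exists_bump (I := I) hU
  have hs : ∀ u : F, ContMDiff I (I.prod 𝓘(ℝ, F)) ∞
      (fun x => TotalSpace.mk' F x (χ x • unhat F V x₀ x u)) := fun u =>
    ContMDiffOn.smul_section_of_tsupport hχ.contMDiffOn
      (trivializationAt F V x₀).open_baseSet hχs (contMDiffOn_unhat x₀ u)
  refine ⟨{ toFun := fun u => ⟨fun x => χ x • unhat F V x₀ x u, hs u⟩, map_add' := ?_,
            map_smul' := ?_ }, ?_⟩
  · intro u v
    ext x
    simp [ContMDiffSection.coe_add]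
  · intro r u
    ext x
    change χ x • unhat F V x₀ x (r • u) = r • (χ x • unhat F V x₀ x u)
    rw [map_smul, smul_comm]
  · filter_upwards [hU, hχ1] with x hx h1
    refine ⟨hx, fun u => ?_⟩
    change χ x • unhat F V x₀ x u = _
    rw [h1]
    simp

variable (I F V) in
/-- Global smooth sections which, near `x₀`, have constant coordinates in the preferred
trivialization at `x₀`. -/
def locFrame (x₀ : M) : F →ₗ[ℝ] ΓE := (exists_locFrame I F V x₀).choose

variable (I F V) in
lemma eventually_locFrame (x₀ : M) :
    ∀ᶠ x in 𝓝 x₀, x ∈ triv F V x₀ ∧ ∀ u, locFrame I F V x₀ u x = unhat F V x₀ x u :=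
  (exists_locFrame I F V x₀).choose_spec

variable (I) in
lemma locFrame_hat_self {x : M} (a : V x) : locFrame I F V x (hat F V x x a) x = a := by
  obtain ⟨hx, h⟩ := (eventually_locFrame I F V x).self_of_nhds
  rw [h, unhat_hat hx]

lemma hat_locFrame_eventually (x₀ : M) (u : F) :
    ∀ᶠ x in 𝓝 x₀, hat F V x₀ x (locFrame I F V x₀ u x) = u :=
  (eventually_locFrame I F V x₀).mono fun x hx => by rw [hx.2, hat_unhat hx.1]

/-- The derivative of the coordinates of a section along a tangent vector. -/
def dhat (σ : ΓE) (x : M) : TangentSpace I x →L[ℝ] F :=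
  mvfderiv I (fun y => hat F V x y (σ y)) x

variable [FiniteDimensional ℝ F]

/-- Near a point, a section is a combination of local frame sections with global smooth
coefficients. -/
lemma exists_section_expansion (σ : ΓE) (x₀ : M) :
    ∃ f : Fin (Module.finrank ℝ F) → M → ℝ, (∀ a, ContMDiff I 𝓘(ℝ, ℝ) ∞ (f a)) ∧
      (∀ a, ∀ᶠ x in 𝓝 x₀, f a x = (Module.finBasis ℝ F).repr (hat F V x₀ x (σ x)) a) ∧
      ∀ᶠ x in 𝓝 x₀, σ x = ∑ a, f a x • locFrame I F V x₀ (Module.finBasis ℝ F a) x := by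
  have hU : triv F V x₀ ∈ 𝓝 x₀ := (trivializationAt F V x₀).open_baseSet.mem_nhds
    (FiberBundle.mem_baseSet_trivializationAt' x₀)
  obtain ⟨χ, hχ, hχ1, hχs, -⟩ := exists_bump (I := I) hU
  have h1 : ∀ a, ∀ᶠ x in 𝓝 x₀, χ x • (Module.finBasis ℝ F).repr (hat F V x₀ x (σ x)) a =
      (Module.finBasis ℝ F).repr (hat F V x₀ x (σ x)) a := fun a =>
    hχ1.mono fun x hx => by rw [hx]; simp
  refine ⟨fun a x => χ x • (Module.finBasis ℝ F).repr (hat F V x₀ x (σ x)) a, fun a => ?_, h1, ?_⟩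
  · refine contMDiff_of_tsupport fun x hx => ?_
    have hx' : x ∈ triv F V x₀ := hχs (tsupport_smul_subset_left _ _ hx)
    refine (hχ x).smul ?_
    have := (LinearMap.toContinuousLinearMap ((Module.finBasis ℝ F).coord a)).contMDiff (n := ∞)
    exact (this.contMDiffAt).comp x (contMDiffAt_section_hat σ hx')
  · filter_upwards [eventually_locFrame I F V x₀, Filter.eventually_all.2 h1] with x hx h
    simp_rw [h, hx.2, ← map_smul, ← map_sum]
    rw [(Module.finBasis ℝ F).sum_repr, unhat_hat hx.1]

/-! ### Local formulas for connections and brackets -/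

/-- The product of a section with a smooth function. -/
def fsmul (f : M → ℝ) (hf : ContMDiff I 𝓘(ℝ, ℝ) ∞ f) (σ : ΓE) : ΓE :=
  ⟨fun x => f x • σ x, hf.smul_section σ.contMDiff⟩

lemma two_le_infty : (2 : WithTop ℕ∞) ≤ ∞ := by
  rw [show (2 : WithTop ℕ∞) = ((2 : ℕ∞) : WithTop ℕ∞) from rfl]
  exact WithTop.coe_le_coe.2 le_top

lemma contMDiff_mdifferentiableAt {E' : Type*} [NormedAddCommGroup E'] [NormedSpace ℝ E']
    {f : M → E'} {x : M} (hf : ContMDiffAt I 𝓘(ℝ, E') ∞ f x) :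
    MDifferentiableAt I 𝓘(ℝ, E') f x := hf.mdifferentiableAt (by simp)

lemma mvfderiv_clm {E' E'' : Type*} [NormedAddCommGroup E'] [NormedSpace ℝ E']
    [NormedAddCommGroup E''] [NormedSpace ℝ E''] (T : E' →L[ℝ] E'') {f : M → E'} {x : M}
    (hf : MDifferentiableAt I 𝓘(ℝ, E') f x) (v : TangentSpace I x) :
    mvfderiv I (fun y => T (f y)) x v = T (mvfderiv I f x v) := by
  have h := ((T.hasMFDerivAt (x := f x)).comp x hf.hasMFDerivAt).mfderiv
  change (mfderiv I 𝓘(ℝ, E'') (T ∘ f) x v : E'') = _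
  rw [h]
  rfl

lemma mvfderiv_congr {E' : Type*} [NormedAddCommGroup E'] [NormedSpace ℝ E']
    {f g : M → E'} {x : M} (h : f =ᶠ[𝓝 x] g) (v : TangentSpace I x) :
    mvfderiv I f x v = mvfderiv I g x v := by
  change (mfderiv I 𝓘(ℝ, E') f x v : E') = (mfderiv I 𝓘(ℝ, E') g x v : E')
  rw [h.mfderiv_eq]
  rfl

lemma dhat_add [FiniteDimensional ℝ EM] [T2Space M] (σ τ : ΓE) (x : M)
    (v : TangentSpace I x) : dhat (σ + τ) x v = dhat σ x v + dhat τ x v := by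
  have hx := mem_triv F V x
  unfold dhat
  have h := mvfderiv_add (contMDiff_mdifferentiableAt (contMDiffAt_section_hat σ hx))
    (contMDiff_mdifferentiableAt (contMDiffAt_section_hat τ hx))
  rw [← add_apply, ← h]
  refine mvfderiv_congr (Filter.Eventually.of_forall fun y => ?_) v
  simp

lemma exists_section_expansion' (σ : ΓE) (x : M) :
    ∃ (f : Fin (Module.finrank ℝ F) → M → ℝ) (hf : ∀ a, ContMDiff I 𝓘(ℝ, ℝ) ∞ (f a)),
      (∀ᶠ y in 𝓝 x,
        σ y = (∑ a, fsmul (f a) (hf a) (locFrame I F V x (Module.finBasis ℝ F a))) y) ∧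
      (∑ a, f a x • Module.finBasis ℝ F a = hat F V x x (σ x)) ∧
      ∀ v, ∑ a, mvfderiv I (f a) x v • Module.finBasis ℝ F a = dhat σ x v := by
  have hx := mem_triv F V x
  obtain ⟨f, hf, h1, h2⟩ := exists_section_expansion σ x
  refine ⟨f, hf, ?_, ?_, fun v => ?_⟩
  · filter_upwards [h2] with y hy
    rw [hy]
    change _ = ContMDiffSection.coeAddHom I F ∞ V (∑ a, _) y
    rw [map_sum, Finset.sum_apply]
    rfl
  · simp_rw [fun a => (h1 a).self_of_nhds]
    exact (Module.finBasis ℝ F).sum_repr _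
  · have : ∀ a, mvfderiv I (f a) x v = (Module.finBasis ℝ F).repr (dhat σ x v) a := fun a => by
      rw [mvfderiv_congr (h1 a) v]
      exact mvfderiv_clm (LinearMap.toContinuousLinearMap ((Module.finBasis ℝ F).coord a))
        (contMDiff_mdifferentiableAt (contMDiffAt_section_hat σ hx)) v
    simp_rw [this]
    exact (Module.finBasis ℝ F).sum_repr _

variable [∀ x, IsTopologicalAddGroup (V x)] [∀ x, ContinuousSMul ℝ (V x)]

section Connection

variable (cov : CovariantDerivative I F V)

/-- The covariant derivative at a point as an additive map on smooth sections. -/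
def covHom (x : M) (v : TangentSpace I x) : ΓE →+ V x where
  toFun σ := cov (fun y => σ y) x v
  map_zero' := by
    change cov 0 x v = 0
    rw [CovariantDerivative.zero]
    rfl
  map_add' σ τ := by
    change cov ((fun y => σ y) + fun y => τ y) x v = _
    rw [cov.isCovariantDerivativeOnUniv.add σ.mdifferentiableAt τ.mdifferentiableAt]
    rfl

lemma covHom_fsmul (f : M → ℝ) (hf : ContMDiff I 𝓘(ℝ, ℝ) ∞ f) (σ : ΓE) (x : M)
    (v : TangentSpace I x) : covHom cov x v (fsmul f hf σ) =
      f x • covHom cov x v σ + mvfderiv I f x v • σ x := by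
  change cov (f • fun y => σ y) x v = _
  rw [cov.isCovariantDerivativeOnUniv.leibniz σ.mdifferentiableAt
    (contMDiff_mdifferentiableAt hf.contMDiffAt)]
  rfl

lemma covHom_smul (r : ℝ) (σ : ΓE) (x : M)
    (v : TangentSpace I x) : covHom cov x v (r • σ) = r • covHom cov x v σ := by
  have := covHom_fsmul cov (fun _ => r) contMDiff_const σ x v
  rw [mvfderiv_const] at this
  simpa using! this

lemma cov_local (σ : ΓE) (x : M) (v : TangentSpace I x) :
    hat F V x x (cov (fun y => σ y) x v) = dhat σ x v +
      hat F V x x (cov (fun y => locFrame I F V x (hat F V x x (σ x)) y) x v) := by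
  obtain ⟨f, hf, h1, h2, h3⟩ := exists_section_expansion' σ x
  have hx := mem_triv F V x
  rw [cov.isCovariantDerivativeOnUniv.congr_of_eventuallyEq σ.mdifferentiableAt
    (ContMDiffSection.mdifferentiableAt _) Filter.univ_mem h1]
  change hat F V x x (covHom cov x v _) = _ + hat F V x x (covHom cov x v _)
  have hE : ∀ u, hat F V x x (locFrame I F V x u x) = u := fun u =>
    (hat_locFrame_eventually x u).self_of_nhds
  rw [← h3 v, ← h2]
  simp only [map_sum, covHom_fsmul, map_add, map_smul, covHom_smul, hE]
  rw [sum_add_distrib, add_comm]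

end Connection

section Bracket

variable (L : LieAlgebroid I M F V)

lemma bracket_neg (σ τ : ΓE) : L.bracket σ τ = - L.bracket τ σ := by
  have h := L.bracket_self (σ + τ)
  rw [LinearMap.map_add₂, map_add, map_add, L.bracket_self, L.bracket_self, zero_add,
    add_zero] at h
  exact eq_neg_of_add_eq_zero_left h

lemma bracket_fsmul (f : M → ℝ) (hf : ContMDiff I 𝓘(ℝ, ℝ) ∞ f) (σ τ : ΓE) (x : M) :
    L.bracket σ (fsmul f hf τ) x =
      f x • L.bracket σ τ x + (mvfderiv I f x (L.anchor x (σ x))) • τ x :=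
  L.leibniz f hf σ τ _ (fun _ => rfl) x

lemma bracket_congr {σ τ τ' : ΓE} {x : M} (h : ∀ᶠ y in 𝓝 x, τ y = τ' y) :
    L.bracket σ τ x = L.bracket σ τ' x := by
  obtain ⟨χ, hχ, hχ1, hχs, -⟩ := exists_bump (I := I) h
  have h0 : fsmul χ hχ τ = fsmul χ hχ τ' := by
    ext y
    change χ y • τ y = χ y • τ' y
    by_cases hy : y ∈ tsupport χ
    · rw [show τ y = τ' y from hχs hy]
    · rw [image_eq_zero_of_notMem_tsupport hy, zero_smul, zero_smul]
  have hd : mvfderiv I χ x (L.anchor x (σ x)) = 0 := by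
    rw [mvfderiv_congr (g := fun _ => (1 : ℝ)) hχ1, mvfderiv_const]
    rfl
  have hx1 : χ x = 1 := hχ1.self_of_nhds
  have h1 := bracket_fsmul L χ hχ σ τ x
  have h2 := bracket_fsmul L χ hχ σ τ' x
  rw [h0, h2, hd, hx1] at h1
  simpa using h1.symm

lemma bracket_local_right (σ τ : ΓE) (x : M) :
    hat F V x x (L.bracket σ τ x) = dhat τ x (L.anchor x (σ x)) +
      hat F V x x (L.bracket σ (locFrame I F V x (hat F V x x (τ x))) x) := by
  obtain ⟨f, hf, h1, h2, h3⟩ := exists_section_expansion' τ x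
  have hx := mem_triv F V x
  have hE : ∀ u, hat F V x x (locFrame I F V x u x) = u := fun u =>
    (hat_locFrame_eventually x u).self_of_nhds
  have hsum : ∀ (s : Fin (Module.finrank ℝ F) → ΓE),
      (∑ a, s a) x = ∑ a, s a x := fun s => by
    change ContMDiffSection.coeAddHom I F ∞ V (∑ a, _) x = _
    rw [map_sum, Finset.sum_apply]
    rfl
  have hsm : ∀ (r : ℝ) (s : ΓE), (r • s) x = r • s x := fun _ _ => rfl
  rw [bracket_congr L h1, ← h3, ← h2]
  simp only [map_sum, hsum, bracket_fsmul, map_add, map_smul, hE, hsm]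
  rw [sum_add_distrib, add_comm]

lemma bracket_local (σ τ : ΓE) (x : M) :
    hat F V x x (L.bracket σ τ x) =
      dhat τ x (L.anchor x (σ x)) - dhat σ x (L.anchor x (τ x)) +
      hat F V x x (L.bracket (locFrame I F V x (hat F V x x (σ x)))
        (locFrame I F V x (hat F V x x (τ x))) x) := by
  have hn : ∀ (s : ΓE), (-s) x = -(s x) := fun _ => rfl
  rw [bracket_local_right, bracket_neg L σ, hn, map_neg, bracket_local_right, locFrame_hat_self,
    bracket_neg L _ (locFrame I F V x (hat F V x x (σ x))), hn, map_neg]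
  abel

/-- The anchor applied to a section. -/
def ρsec (σ : ΓE) : ΓT := ⟨fun x => L.anchor x (σ x), L.anchor_smooth σ⟩

end Bracket

section LieBracket

lemma hat_tangent {x₀ x : M} (hx : x ∈ (chartAt HM x₀).source) :
    hat EM TM x₀ x = mfderiv I 𝓘(ℝ, EM) (extChartAt I x₀) x := by
  have : IsManifold I 1 M := .of_le (n := ∞) (by simp)
  exact TangentBundle.continuousLinearMapAt_trivializationAt hx

lemma hat_tangent_self (x : M) (v : TangentSpace I x) :
    hat EM TM x x v = v := by
  have : IsManifold I 1 M := .of_le (n := ∞) (by simp)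
  rw [hat_tangent (mem_chart_source HM x), mfderiv_extChartAt_self]
  rfl

variable [I.Boundaryless]

lemma mvfderiv_eq_fderiv {E' : Type*} [NormedAddCommGroup E'] [NormedSpace ℝ E'] {f : M → E'}
    {x : M} (hf : MDifferentiableAt I 𝓘(ℝ, E') f x) (v : TangentSpace I x) :
    mvfderiv I f x v = fderiv ℝ (f ∘ (extChartAt I x).symm) (extChartAt I x x) v := by
  have h := hf.mfderiv
  rw [I.range_eq_univ, fderivWithin_univ] at h
  exact congrArg (fun T : EM →L[ℝ] E' => T v) h

lemma mpullbackWithin_eq_hat (v : ΓT) (x : M) :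
    (fun y => mpullbackWithin 𝓘(ℝ, EM) I (extChartAt I x).symm (fun y => v y) (Set.range I) y)
      =ᶠ[𝓝 (extChartAt I x x)]
      (fun y => hat EM TM x y (v y)) ∘ (extChartAt I x).symm := by
  have : IsManifold I 1 M := .of_le (n := ∞) (by simp)
  filter_upwards [extChartAt_target_mem_nhds (I := I) x] with y hy
  have hs := (extChartAt I x).map_target hy
  rw [extChartAt_source] at hs
  rw [mpullbackWithin_apply, Function.comp_apply, hat_tangent hs]
  have h1 := mfderiv_extChartAt_comp_mfderivWithin_extChartAt_symm (I := I) hy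
  have h2 := mfderivWithin_extChartAt_symm_comp_mfderiv_extChartAt (I := I) hy
  rw [ContinuousLinearMap.inverse_eq h2 h1]
  rfl

lemma mlieBracket_local (v w : ΓT) (x : M) :
    (mlieBracket I (fun y => v y) (fun y => w y) x : EM) = dhat w x (v x) - dhat v x (w x) := by
  have : IsManifold I 1 M := .of_le (n := ∞) (by simp)
  have hx := mem_triv EM TM x
  have hd : ∀ u : ΓT, MDifferentiableAt I 𝓘(ℝ, EM)
      (fun y => hat EM TM x y (u y)) x := fun u =>
    contMDiff_mdifferentiableAt (contMDiffAt_section_hat u hx)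
  have h0 : (mlieBracket I (fun y => v y) (fun y => w y) x : EM) = lieBracket ℝ
      (fun y => (mpullbackWithin 𝓘(ℝ, EM) I (extChartAt I x).symm (fun y => v y) (Set.range I) y :
        EM))
      (fun y => (mpullbackWithin 𝓘(ℝ, EM) I (extChartAt I x).symm (fun y => w y) (Set.range I) y :
        EM)) (extChartAt I x x) := by
    have h1 := mlieBracketWithin_apply (I := I) (V := fun y => v y) (W := fun y => w y)
      (s := Set.univ) (x₀ := x)
    rw [mlieBracketWithin_univ, Set.preimage_univ, Set.univ_inter, I.range_eq_univ] at h1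
    have h2 : ((mfderiv I 𝓘(ℝ, EM) (extChartAt I x) x).inverse : EM →L[ℝ] EM) =
        ContinuousLinearMap.id ℝ EM := by
      have h3 : (mfderiv I 𝓘(ℝ, EM) (extChartAt I x) x : EM →L[ℝ] EM) =
        ContinuousLinearMap.id ℝ EM := mfderiv_extChartAt_self
      exact (congrArg ContinuousLinearMap.inverse h3).trans ContinuousLinearMap.inverse_id
    refine h1.trans ((congrArg (fun T : EM →L[ℝ] EM => T _) h2).trans ?_)
    rw [I.range_eq_univ]
    exact congrFun (lieBracketWithin_univ (𝕜 := ℝ) (E := EM)) _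
  have hv := mpullbackWithin_eq_hat v x
  have hw := mpullbackWithin_eq_hat w x
  rw [h0]
  unfold dhat
  rw [mvfderiv_eq_fderiv (hd w), mvfderiv_eq_fderiv (hd v)]
  have hvx : ((fun y => hat EM TM x y (v y)) ∘ (extChartAt I x).symm)
      (extChartAt I x x) = v x := by
    rw [Function.comp_apply, extChartAt_to_inv, hat_tangent_self]
  have hwx : ((fun y => hat EM TM x y (w y)) ∘ (extChartAt I x).symm)
      (extChartAt I x x) = w x := by
    rw [Function.comp_apply, extChartAt_to_inv, hat_tangent_self]
  exact (congrArg₂ (· - ·) (congrArg₂ (fun (T : EM →L[ℝ] EM) u => T u) hw.fderiv_eq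
    (hv.self_of_nhds.trans hvx)) (congrArg₂ (fun (T : EM →L[ℝ] EM) u => T u) hv.fderiv_eq
    (hw.self_of_nhds.trans hwx)))

lemma dhat_eq_fderiv (v : ΓT) (x : M) (u : TangentSpace I x) :
    dhat v x u = fderiv ℝ ((fun y => hat EM TM x y (v y)) ∘
      (extChartAt I x).symm) (extChartAt I x x) u :=
  mvfderiv_eq_fderiv (contMDiff_mdifferentiableAt (contMDiffAt_section_hat v
    (mem_triv EM TM x))) u

lemma contDiffAt_comp_symm {E' : Type*} [NormedAddCommGroup E'] [NormedSpace ℝ E'] {f : M → E'}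
    {x : M} (hf : ContMDiffAt I 𝓘(ℝ, E') ∞ f x) :
    ContDiffAt ℝ ∞ (f ∘ (extChartAt I x).symm) (extChartAt I x x) := by
  have h : ContMDiffAt 𝓘(ℝ, EM) I ∞ (extChartAt I x).symm (extChartAt I x x) := by
    have := contMDiffWithinAt_extChartAt_symm_range (I := I) (n := ∞) x
      (mem_extChartAt_target (I := I) x)
    rwa [I.range_eq_univ, contMDiffWithinAt_univ] at this
  rw [← contMDiffAt_iff_contDiffAt]
  refine ContMDiffAt.comp _ ?_ h
  rwa [extChartAt_to_inv]

/-- Iterated derivative of a function along a vector field and then along a tangent vector. -/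
lemma mvfderiv_mvfderiv {f : M → ℝ} (hf : ContMDiff I 𝓘(ℝ, ℝ) ∞ f) (w : ΓT) (x : M)
    (u : TangentSpace I x) :
    mvfderiv I (fun y => mvfderiv I f y (w y)) x u =
      fderiv ℝ (fderiv ℝ (f ∘ (extChartAt I x).symm)) (extChartAt I x x) u (w x) +
      mvfderiv I f x (dhat w x u : EM) := by
  have : IsManifold I 1 M := .of_le (n := ∞) (by simp)
  set F₀ := f ∘ (extChartAt I x).symm with hF₀
  set W₀ := (fun y => hat EM TM x y (w y)) ∘ (extChartAt I x).symm
    with hW₀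
  have hx := mem_triv EM TM x
  have hF : ContDiffAt ℝ ∞ F₀ (extChartAt I x x) := contDiffAt_comp_symm hf.contMDiffAt
  have hW : ContDiffAt ℝ ∞ W₀ (extChartAt I x x) :=
    contDiffAt_comp_symm (contMDiffAt_section_hat w hx)
  have h1 : (1 : WithTop ℕ∞) ≤ ∞ := by simp
  have hfd : ContDiffAt ℝ 1 (fderiv ℝ F₀) (extChartAt I x x) :=
    hF.fderiv_right (one_add_one_eq_two.trans_le two_le_infty)
  have key : (fun y => mvfderiv I f y (w y)) =ᶠ[𝓝 x]
      (fun z => fderiv ℝ F₀ z (W₀ z)) ∘ extChartAt I x := by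
    filter_upwards [extChartAt_source_mem_nhds (I := I) x,
      (continuousAt_extChartAt (I := I) x).eventually ((hF.of_le h1).eventually
        (by simp))] with y hy hFy
    have hy' : y ∈ (chartAt HM x).source := by rwa [extChartAt_source] at hy
    have hfeq : f =ᶠ[𝓝 y] F₀ ∘ extChartAt I x := by
      filter_upwards [(isOpen_extChartAt_source (I := I) x).mem_nhds hy] with z hz
      change f z = f ((extChartAt I x).symm (extChartAt I x z))
      rw [(extChartAt I x).left_inv hz]
    have hφ := mdifferentiableAt_extChartAt (I := I) hy'
    rw [mvfderiv_congr hfeq]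
    have hc := ((hFy.differentiableAt (by simp)).mdifferentiableAt.hasMFDerivAt.comp y
      hφ.hasMFDerivAt).mfderiv
    change (mfderiv I 𝓘(ℝ, ℝ) (F₀ ∘ extChartAt I x) y (w y) : ℝ) = fderiv ℝ F₀ _ (W₀ _)
    have hW0 : W₀ (extChartAt I x y) = mfderiv I 𝓘(ℝ, EM) (extChartAt I x) y (w y) := by
      change hat EM TM x ((extChartAt I x).symm (extChartAt I x y))
        (w ((extChartAt I x).symm (extChartAt I x y))) = _
      rw [(extChartAt I x).left_inv hy, hat_tangent hy']
      rfl
    rw [hc, mfderiv_eq_fderiv, hW0]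
    rfl
  have hG : DifferentiableAt ℝ (fun z => fderiv ℝ F₀ z (W₀ z)) (extChartAt I x x) :=
    (hfd.differentiableAt (by simp)).clm_apply (hW.differentiableAt (by simp))
  rw [mvfderiv_congr key]
  have hc := (hG.mdifferentiableAt.hasMFDerivAt.comp x
    (mdifferentiableAt_extChartAt (I := I) (mem_chart_source HM x)).hasMFDerivAt).mfderiv
  have hval : (mfderiv I 𝓘(ℝ, ℝ) ((fun z => fderiv ℝ F₀ z (W₀ z)) ∘ extChartAt I x) x u : ℝ) =
      fderiv ℝ (fun z => fderiv ℝ F₀ z (W₀ z)) (extChartAt I x x) u := by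
    rw [hc, mfderiv_eq_fderiv, mfderiv_extChartAt_self]
    rfl
  have hwx : W₀ (extChartAt I x x) = w x := by
    rw [hW₀, Function.comp_apply, extChartAt_to_inv, hat_tangent_self]
  change (mfderiv I 𝓘(ℝ, ℝ) ((fun z => fderiv ℝ F₀ z (W₀ z)) ∘ extChartAt I x) x u : ℝ) = _
  have e1 : mvfderiv I f x (dhat w x u : EM) = fderiv ℝ F₀ (extChartAt I x x)
      (fderiv ℝ W₀ (extChartAt I x x) u) :=
    (mvfderiv_eq_fderiv (contMDiff_mdifferentiableAt hf.contMDiffAt) _).trans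
      (congrArg (fun z : EM => fderiv ℝ F₀ (extChartAt I x x) z) (dhat_eq_fderiv w x u))
  rw [e1, ← hwx, add_comm]
  exact hval.trans (congrArg (fun T : EM →L[ℝ] ℝ => T u)
    (fderiv_clm_apply (hfd.differentiableAt (by simp)) (hW.differentiableAt (by simp))))

lemma mvfderiv_mlieBracket {f : M → ℝ} (hf : ContMDiff I 𝓘(ℝ, ℝ) ∞ f) (v w : ΓT) (x : M) :
    mvfderiv I f x (mlieBracket I (fun y => v y) (fun y => w y) x) =
      mvfderiv I (fun y => mvfderiv I f y (w y)) x (v x) -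
      mvfderiv I (fun y => mvfderiv I f y (v y)) x (w x) := by
  have hF : ContDiffAt ℝ ∞ (f ∘ (extChartAt I x).symm) (extChartAt I x x) :=
    contDiffAt_comp_symm hf.contMDiffAt
  have hs := (hF.isSymmSndFDerivAt (by simpa using two_le_infty)).eq (v x : EM) (w x : EM)
  rw [mvfderiv_mvfderiv hf, mvfderiv_mvfderiv hf]
  have h := (mvfderiv I f x).map_sub (dhat w x (v x) : EM) (dhat v x (w x) : EM)
  have h0 := congrArg (fun u : EM => mvfderiv I f x u) (mlieBracket_local v w x)
  refine h0.trans (h.trans ?_)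
  linear_combination -hs

/-- A tangent vector is determined by its action on smooth functions. -/
lemma tangent_ext {x : M} {u v : TangentSpace I x}
    (h : ∀ f : M → ℝ, ContMDiff I 𝓘(ℝ, ℝ) ∞ f → mvfderiv I f x u = mvfderiv I f x v) : u = v := by
  obtain ⟨χ, hχ, hχ1, hχs, -⟩ := exists_bump (I := I) (extChartAt_source_mem_nhds (I := I) x)
  have hφ : ContMDiff I 𝓘(ℝ, EM) ∞ (fun y => χ y • extChartAt I x y) := by
    refine contMDiff_of_tsupport fun y hy => ?_
    have hy' : y ∈ (extChartAt I x).source := hχs (closure_mono (Function.support_smul_subset_left _ _) hy)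
    rw [extChartAt_source] at hy'
    exact hχ.contMDiffAt.smul (contMDiffAt_extChartAt' hy')
  have hx : ∀ w : TangentSpace I x,
      mvfderiv I (fun y => χ y • extChartAt I x y) x w = w := fun w => by
    have : IsManifold I 1 M := .of_le (n := ∞) (by simp)
    rw [mvfderiv_congr (g := extChartAt I x)]
    · exact congrArg (fun T : EM →L[ℝ] EM => T w) (mfderiv_extChartAt_self (I := I) (x := x))
    · filter_upwards [hχ1] with y hy
      rw [hy, Pi.one_apply, one_smul]
  have key : ∀ l : StrongDual ℝ EM, l u = l v := fun l => by
    have h1 := h _ (l.contMDiff.comp hφ)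
    have h2 := mvfderiv_clm l (contMDiff_mdifferentiableAt (hφ.contMDiffAt (x := x)))
    have e1 := (h2 u).trans (congrArg l (hx u))
    have e2 := (h2 v).trans (congrArg l (hx v))
    exact e1.symm.trans (h1.trans e2)
  exact (SeparatingDual.eq_iff_forall_dual_eq (R := ℝ) (V := EM)).2 key

lemma contMDiff_mvfderiv_apply {f : M → ℝ} (hf : ContMDiff I 𝓘(ℝ, ℝ) ∞ f) (v : ΓT) :
    ContMDiff I 𝓘(ℝ, ℝ) ∞ (fun y => mvfderiv I f y (v y)) :=
  (contMDiff_snd_tangentBundle_modelSpace ℝ 𝓘(ℝ, ℝ)).comp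
    ((hf.contMDiff_tangentMap (m := ∞) (by simp)).comp v.contMDiff)

/-- The anchor is a homomorphism of Lie brackets; this follows from the Jacobi identity and the
Leibniz rule applied to `f e₃` with `e₃` not vanishing at the given point. -/
lemma anchor_bracket (L : LieAlgebroid I M F V) (e₁ e₂ : ΓE) (x : M) :
    L.anchor x (L.bracket e₁ e₂ x) =
      mlieBracket I (fun y => L.anchor y (e₁ y)) (fun y => L.anchor y (e₂ y)) x := by
  have hx := mem_triv F V x
  rcases subsingleton_or_nontrivial F with hF | hF
  · have h0 : ∀ a : V x, a = 0 := fun a => hat_injective hx (Subsingleton.elim _ _)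
    have hb := mlieBracket_local (ρsec L e₁) (ρsec L e₂) x
    have h1 : ρsec L e₁ x = 0 := by change L.anchor x (e₁ x) = 0; rw [h0 (e₁ x), map_zero]
    have h2 : ρsec L e₂ x = 0 := by change L.anchor x (e₂ x) = 0; rw [h0 (e₂ x), map_zero]
    rw [h1, h2, map_zero, map_zero, sub_zero] at hb
    rw [h0 (L.bracket e₁ e₂ x), map_zero]
    exact hb.symm
  obtain ⟨u, hu⟩ := exists_ne (0 : F)
  set e₃ := locFrame I F V x u
  have he₃ : e₃ x ≠ 0 := fun h => hu (by
    have := (hat_locFrame_eventually (I := I) (V := V) x u).self_of_nhds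
    rw [show locFrame I F V x u x = 0 from h, map_zero] at this
    exact this.symm)
  refine tangent_ext fun f hf => ?_
  have hb := mvfderiv_mlieBracket hf (ρsec L e₁) (ρsec L e₂) x
  refine Eq.trans ?_ hb.symm
  have hneg : ∀ (σ : ΓE), (-σ) x = -(σ x) := fun _ => rfl
  have hadd : ∀ (σ τ : ΓE), (σ + τ) x = σ x + τ x := fun _ _ => rfl
  have expand : ∀ e : ΓE, L.bracket e (fsmul f hf e₃) = fsmul f hf (L.bracket e e₃) +
      fsmul _ (contMDiff_mvfderiv_apply hf (ρsec L e)) e₃ := fun e => by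
    ext y
    exact bracket_fsmul L f hf e e₃ y
  have J := congrArg (fun σ : ΓE => σ x) (L.jacobi e₁ e₂ (fsmul f hf e₃))
  have J' := congrArg (fun σ : ΓE => σ x) (L.jacobi e₁ e₂ e₃)
  rw [bracket_neg L _ e₁, bracket_neg L _ (L.bracket e₁ e₂), expand, expand, expand] at J
  rw [bracket_neg L e₃ e₁, bracket_neg L e₃ (L.bracket e₁ e₂)] at J'
  simp only [map_add, map_neg, neg_add, hadd, hneg, bracket_fsmul] at J J'
  have e0 : ∀ (σ : ΓE) g hg, fsmul (I := I) g hg σ x = g x • σ x := fun _ _ _ => rfl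
  have ez : (0 : ΓE) x = 0 := rfl
  simp only [e0, ez] at J J'
  have hs : (mvfderiv I (fun y => mvfderiv I f y (ρsec L e₂ y)) x (L.anchor x (e₁ x)) -
      mvfderiv I (fun y => mvfderiv I f y (ρsec L e₁ y)) x (L.anchor x (e₂ x)) -
      mvfderiv I f x (L.anchor x (L.bracket e₁ e₂ x))) • e₃ x = 0 := by
    have e1 : mvfderiv I f x (ρsec L (L.bracket e₁ e₂) x) =
      mvfderiv I f x (L.anchor x (L.bracket e₁ e₂ x)) := rfl
    have e2 : mvfderiv I f x (ρsec L e₁ x) = mvfderiv I f x (L.anchor x (e₁ x)) := rfl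
    have e3 : mvfderiv I f x (ρsec L e₂ x) = mvfderiv I f x (L.anchor x (e₂ x)) := rfl
    rw [e1, e2, e3] at J
    have J2 := congrArg (fun a => f x • a) J'
    simp only [smul_add, smul_neg, smul_zero] at J2
    rw [sub_smul, sub_smul, ← sub_eq_zero.2 (J.trans J2.symm)]
    abel
  have := (smul_eq_zero.1 hs).resolve_right he₃
  exact (sub_eq_zero.1 this).symm

end LieBracket

/-! ### Multilinear fields on `TM ⊕ E` and their derivatives along curves -/

section MixedFields

/-- The derivative of a family of multilinear maps that is differentiable on fixed arguments. -/
def derivMultilinear {ι G : Type*} [Fintype ι] [NormedAddCommGroup G] [NormedSpace ℝ G]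
    {f : ℝ → MultilinearMap ℝ (fun _ : ι => G) ℝ} {t : ℝ}
    (hf : ∀ v, DifferentiableAt ℝ (fun τ => f τ v) t) : MultilinearMap ℝ (fun _ : ι => G) ℝ where
  toFun v := deriv (fun τ => f τ v) t
  map_update_add' v i a b := by
    simp only [MultilinearMap.map_update_add]
    exact deriv_add (hf _) (hf _)
  map_update_smul' v i c a := by
    simp only [MultilinearMap.map_update_smul]
    exact deriv_const_smul c (hf _)

variable {ι : Type*} [Fintype ι] [DecidableEq ι]

variable (I V) in
/-- Families of multilinear forms on the fibres of `TM ⊕ V`. -/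
abbrev MixedField (ι : Type*) : Type _ :=
  ∀ x : M, MultilinearMap ℝ (fun _ : ι => TangentSpace I x × V x) ℝ

variable (F) in
/-- A family of multilinear forms is smooth if its values on smooth sections are smooth. -/
def MixedField.IsSmooth (Q : MixedField I V ι) : Prop :=
  ∀ (W : ι → ΓT) (Y : ι → ΓE),
    ContMDiff I 𝓘(ℝ, ℝ) ∞ (fun x => Q x (fun i => (W i x, Y i x)))

variable (I F V) in
/-- The vector of `T_x M ⊕ V_x` with given coordinates near `x₀`. -/
def framePair (x₀ x : M) : EM × F →ₗ[ℝ] TangentSpace I x × V x where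
  toFun z := (locFrame I EM TM x₀ z.1 x, locFrame I F V x₀ z.2 x)
  map_add' z z' := by
    rw [Prod.fst_add, Prod.snd_add, map_add, map_add]; rfl
  map_smul' c z := by
    rw [Prod.smul_fst, Prod.smul_snd, map_smul, map_smul]; rfl

/-- The coordinate expression of a multilinear field near `x₀`. -/
def MixedField.flat (Q : MixedField I V ι) (x₀ x : M) : MultilinearMap ℝ (fun _ : ι => EM × F) ℝ :=
  (Q x).compLinearMap (fun _ => framePair I F V x₀ x)

lemma MixedField.IsSmooth.flat {Q : MixedField I V ι} (hQ : Q.IsSmooth F) (x₀ : M)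
    (z : ι → EM × F) : ContMDiff I 𝓘(ℝ, ℝ) ∞ (fun x => Q.flat (F := F) x₀ x z) :=
  hQ (fun i => locFrame I EM TM x₀ (z i).1)
    (fun i => locFrame I F V x₀ (z i).2)

/-- The coordinates of a vector of `T_x M ⊕ V_x`. -/
abbrev hatPair (F : Type*) [NormedAddCommGroup F] [NormedSpace ℝ F]
    {V : M → Type*} [TopologicalSpace (TotalSpace F V)]
    [∀ x, AddCommGroup (V x)] [∀ x, Module ℝ (V x)] [∀ x, TopologicalSpace (V x)]
    [FiberBundle F V] [VectorBundle ℝ F V] (x₀ x : M) (z : TangentSpace I x × V x) : EM × F :=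
  (hat EM TM x₀ x z.1, hat F V x₀ x z.2)

lemma eventually_framePair_hatPair (x₀ : M) :
    ∀ᶠ x in 𝓝 x₀, ∀ z : TangentSpace I x × V x, framePair I F V x₀ x (hatPair F x₀ x z) = z := by
  filter_upwards [eventually_locFrame I F V x₀,
    eventually_locFrame I EM TM x₀] with x h1 h2 z
  exact Prod.ext ((h2.2 _).trans (unhat_hat h2.1 z.1)) ((h1.2 _).trans (unhat_hat h1.1 z.2))

lemma MixedField.eventually_flat (Q : MixedField I V ι) (x₀ : M) :
    ∀ᶠ x in 𝓝 x₀, ∀ z : ι → TangentSpace I x × V x,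
      Q x z = Q.flat x₀ x (fun i => hatPair F x₀ x (z i)) := by
  filter_upwards [eventually_framePair_hatPair (I := I) (F := F) (V := V) x₀] with x hx z
  refine congrArg (Q x) (funext fun i => (hx (z i)).symm)

lemma framePair_self (x : M) (z : EM × F) :
    framePair I F V x x z = ((z.1 : EM), unhat F V x x z.2) := by
  obtain ⟨h1, h2⟩ := (eventually_locFrame I F V x).self_of_nhds
  refine Prod.ext ?_ (h2 z.2)
  have := (hat_locFrame_eventually (I := I) (V := TM) x
    z.1).self_of_nhds
  rw [hat_tangent_self] at this
  exact this

lemma hasDerivAt_comp_curve {E' : Type*} [NormedAddCommGroup E'] [NormedSpace ℝ E'] {f : M → E'}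
    {c : ℝ → M} {t : ℝ}
    (hf : ContMDiffAt I 𝓘(ℝ, E') ∞ f (c t)) (hc : MDifferentiableAt 𝓘(ℝ, ℝ) I c t) :
    HasDerivAt (fun τ => f (c τ)) (mvfderiv I f (c t) (mfderiv 𝓘(ℝ, ℝ) I c t (1 : ℝ))) t := by
  have h := ((contMDiff_mdifferentiableAt hf).hasMFDerivAt.comp t hc.hasMFDerivAt)
  have h' : HasFDerivAt (f ∘ c) ((mvfderiv I f (c t) : EM →L[ℝ] E').comp
    (mfderiv 𝓘(ℝ, ℝ) I c t : ℝ →L[ℝ] EM)) t := hasMFDerivAt_iff_hasFDerivAt.1 h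
  exact h'.hasDerivAt

/-- The product rule for a multilinear field evaluated on vectors along a curve, in terms of its
values on global sections extending the vectors at the base point. -/
lemma MixedField.hasDerivAt {Q : MixedField I V ι} (hQ : Q.IsSmooth F) {c : ℝ → M} {t : ℝ}
    (hc : MDifferentiableAt 𝓘(ℝ, ℝ) I c t)
    {z : ∀ τ, ι → TangentSpace I (c τ) × V (c τ)} {w' : ι → EM} {a' : ι → F}
    (hw : ∀ i, HasDerivAt
      (fun τ => hat EM TM (c t) (c τ) (z τ i).1) (w' i) t)
    (ha : ∀ i, HasDerivAt (fun τ => hat F V (c t) (c τ) (z τ i).2) (a' i) t)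
    (W : ι → ΓT) (Y : ι → ΓE)
    (hWY : ∀ i, z t i = (W i (c t), Y i (c t))) :
    HasDerivAt (fun τ => Q (c τ) (z τ))
      (mvfderiv I (fun x => Q x (fun i => (W i x, Y i x))) (c t)
          (mfderiv 𝓘(ℝ, ℝ) I c t (1 : ℝ)) +
        ∑ i, Q (c t) (update (z t) i
          (w' i - dhat (W i) (c t) (mfderiv 𝓘(ℝ, ℝ) I c t (1 : ℝ)),
            unhat F V (c t) (c t)
              (a' i - dhat (Y i) (c t) (mfderiv 𝓘(ℝ, ℝ) I c t (1 : ℝ)))))) t := by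
  set x := c t with hx
  set v := mfderiv 𝓘(ℝ, ℝ) I c t (1 : ℝ) with hv
  have hcc : Filter.Tendsto c (𝓝 t) (𝓝 x) := hc.continuousAt
  have hloc := hcc.eventually (Q.eventually_flat (F := F) x)
  have hd : ∀ u : ι → EM × F, DifferentiableAt ℝ (fun τ => Q.flat x (c τ) u) t := fun u =>
    (hasDerivAt_comp_curve ((hQ.flat x u).contMDiffAt) hc).differentiableAt
  have hf : ∀ u, HasDerivAt (fun τ => Q.flat x (c τ) u) (derivMultilinear hd u) t := fun u =>
    (hd u).hasDerivAt
  have hT : x ∈ triv EM TM x :=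
    mem_triv EM TM x
  have hV : x ∈ triv F V x := mem_triv F V x
  have h1 := hasDerivAt_multilinear hf (w := fun τ i => hatPair F x (c τ) (z τ i))
    (w' := fun i => (w' i, a' i)) fun i => (hw i).prodMk (ha i)
  have h2 := hasDerivAt_multilinear hf
    (w := fun τ i => hatPair F x (c τ) (W i (c τ), Y i (c τ)))
    (w' := fun i => (dhat (W i) x v, dhat (Y i) x v)) fun i =>
      (hasDerivAt_comp_curve (f := fun y => hat EM TM x y (W i y))
        (contMDiffAt_section_hat (W i) hT) hc).prodMk
      (hasDerivAt_comp_curve (f := fun y => hat F V x y (Y i y))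
        (contMDiffAt_section_hat (Y i) hV) hc)
  have h3 : HasDerivAt (fun τ => Q (c τ) (fun i => (W i (c τ), Y i (c τ)))) _ t :=
    hasDerivAt_comp_curve (hQ W Y).contMDiffAt hc
  have h4 := h3.unique (h2.congr_of_eventuallyEq (hloc.mono fun τ h => h _))
  refine (h1.congr_of_eventuallyEq (hloc.mono fun τ h => h _)).congr_deriv ?_
  have hz : (fun i => hatPair F x x (z t i)) = fun i => hatPair F x x (W i x, Y i x) :=
    funext fun i => by rw [hWY]
  have hupd : ∀ i (u : EM × F), Q.flat x x (update (fun i => hatPair F x x (z t i)) i u) =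
      Q x (update (z t) i (framePair I F V x x u)) := fun i u => by
    refine congrArg (Q x) (funext fun j => ?_)
    rcases eq_or_ne j i with rfl | hj
    · simp
    · rw [update_of_ne hj, update_of_ne hj]
      exact (eventually_framePair_hatPair (I := I) (F := F) (V := V) x).self_of_nhds (z t j)
  change _ + ∑ i, Q.flat x x (update (fun i => hatPair F x x (z t i)) i _) = _
  rw [h4]
  change _ = _ + ∑ i, Q.flat x x (update (fun i => hatPair F x x (W i x, Y i x)) i _) + _
  rw [← hz]
  simp_rw [hupd]
  rw [add_assoc, ← sum_add_distrib]
  congr 1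
  refine sum_congr rfl fun i _ => ?_
  rw [← MultilinearMap.map_update_add]
  congr 2
  simp only [framePair_self]
  exact Prod.ext (add_sub_cancel _ _).symm (by
    change unhat F V x x _ = unhat F V x x _ + unhat F V x x _
    rw [← map_add, add_sub_cancel])

end MixedFields

/-! ### The variation of an alternating field along a gauge transformation -/

variable (L : LieAlgebroid I M F V) (cov : CovariantDerivative I F V)

section Boundaryless

variable [I.Boundaryless]

section Variation

lemma sum_ne_eq_sum_lt {ι : Type*} [Fintype ι] [LinearOrder ι] (g : ι → ι → ℝ) :
    ∑ m, ∑ l, (if l = m then 0 else g m l) = ∑ m, ∑ l, if m < l then g m l + g l m else 0 := by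
  have h : ∀ m l, (if l = m then 0 else g m l) =
      (if m < l then g m l else 0) + if l < m then g m l else 0 := fun m l => by
    rcases lt_trichotomy m l with h | h | h
    · simp [h, h.ne', h.not_gt]
    · simp [h]
    · simp [h, h.ne, h.not_gt]
  simp_rw [h, sum_add_distrib]
  rw [sum_comm (f := fun m l => if l < m then g m l else 0), ← sum_add_distrib]
  refine sum_congr rfl fun m _ => ?_
  rw [← sum_add_distrib]
  refine sum_congr rfl fun l _ => ?_
  split_ifs <;> simp

lemma AlternatingMap.update_update_swap {ι A : Type*} [Fintype ι] [DecidableEq ι] [AddCommGroup A]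
    [Module ℝ A] (Q : A [⋀^ι]→ₗ[ℝ] ℝ) (z : ι → A) {m l : ι} (h : m ≠ l) (a b : A) :
    Q (update (update z l a) m b) =
      - Q (update (update z m a) l b) := by
  rw [← Q.map_swap _ h]
  congr 1
  funext i
  simp only [Function.comp_apply]
  rcases eq_or_ne i m with rfl | hm
  · simp
  · rcases eq_or_ne i l with rfl | hl
    · rw [Equiv.swap_apply_right, update_of_ne hm, update_self,
        update_of_ne h, update_self]
    · rw [Equiv.swap_apply_of_ne_of_ne hm hl]
      simp [hm, hl]

lemma update_prodMk {ι A B : Type*} [DecidableEq ι] (w : ι → A) (y : ι → B) (m : ι) (a : A) (b : B) :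
    (fun i => (update w m a i, update y m b i)) =
      update (fun i => (w i, y i)) m (a, b) := by
  funext i
  rcases eq_or_ne i m with rfl | hm
  · simp
  · simp [hm]

/-- The canonical `E`-connection on `E`: `ᴱ∇_e u = [e, u] + ∇_{ρ(u)} e`. -/
def eConnV (e u : ΓE) (x : M) : V x :=
  L.bracket e u x + cov (fun y => e y) x (L.anchor x (u x))

/-- The anchor intertwines the canonical `E`-connections on `E` and on `TM`. -/
lemma anchor_eConnV (e u : ΓE) (x : M) :
    L.anchor x (eConnV L cov e u x) = eConn L cov e (ρsec L u) x := by
  rw [eConnV, map_add, anchor_bracket]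
  rfl

variable {ι : Type*} [Fintype ι] [DecidableEq ι]

/-- The derivative `(ᴱ∇_e Q)(W ⊕ Y)` of a multilinear field along the canonical `E`-connection. -/
def eDeriv (Q : MixedField I V ι) (e : ΓE) (W : ι → ΓT)
    (Y : ι → ΓE) (x : M) : ℝ :=
  mvfderiv I (fun y => Q y (fun i => (W i y, Y i y))) x (L.anchor x (e x)) -
    ∑ l, Q x (update (fun i => (W i x, Y i x)) l
      (eConn L cov e (W l) x, eConnV L cov e (Y l) x))

/-- The graph `(ρ(u), u)` of the anchor. -/
def graph (x : M) : V x →ₗ[ℝ] TangentSpace I x × V x := (L.anchor x).prod LinearMap.id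

/-- The part of the gauge variation of an alternating field that does not involve derivatives of
the gauge field. -/
def variation {n : ℕ} (Q : ∀ x : M, (TangentSpace I x × V x) [⋀^Fin n]→ₗ[ℝ] ℝ)
    (e : ΓE) (W : Fin n → ΓT) (Y : Fin n → ΓE) (x : M) : ℝ :=
  eDeriv L cov (fun x => (Q x).toMultilinearMap) e W Y x +
    ∑ l, Q x (update (fun i => (W i x, Y i x)) l
      (graph L x (cov (fun y => e y) x (W l x)))) -
    ∑ m, mvfderiv I (fun y => Q y (update (fun i => (W i y, Y i y)) m
      (graph L y (e y)))) x (W m x) +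
    ∑ m, ∑ l, if m < l then
      Q x (update (update (fun i => (W i x, Y i x)) m (graph L x (e x))) l
        (mlieBracket I (fun y => W m y) (fun y => W l y) x, 0)) else 0

lemma variation_identity {n : ℕ} (Q : ∀ x : M, (TangentSpace I x × V x) [⋀^Fin n]→ₗ[ℝ] ℝ)
    (e : ΓE) (W : Fin n → ΓT) (Y : Fin n → ΓE) (x : M)
    (wt : Fin n → EM) (aₜ s : Fin n → F) (wy : Fin n → Fin n → EM) (ay : Fin n → Fin n → F)
    (hsym : ∀ m l, wy m l = wy l m)
    (hinv : ∀ l, unhat F V x x (aₜ l - dhat (Y l) x (L.anchor x (e x))) -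
      unhat F V x x (s l - dhat e x (W l x)) =
      cov (fun y => e y) x (W l x - L.anchor x (Y l x)) - L.bracket e (Y l) x) :
    (mvfderiv I (fun y => Q y (fun i => (W i y, Y i y))) x (L.anchor x (e x)) +
      ∑ l, Q x (update (fun i => (W i x, Y i x)) l
        (wt l - dhat (W l) x (L.anchor x (e x)),
          unhat F V x x (aₜ l - dhat (Y l) x (L.anchor x (e x)))))) -
    ∑ m, (mvfderiv I (fun y => Q y (fun i => (update W m (ρsec L e) i y,
        update Y m e i y))) x (W m x) +
      ∑ l, Q x (update (fun i => (update W m (ρsec L e) i x,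
        update Y m e i x)) l
        (update (wy m) m (wt m) l - dhat (update W m (ρsec L e) l) x (W m x),
          unhat F V x x (update (ay m) m (s m) l -
            dhat (update Y m e l) x (W m x))))) =
    variation L cov Q e W Y x -
      ∑ m, ∑ l, if l = m then 0 else
        Q x (update (update (fun i => (W i x, Y i x)) m (graph L x (e x))) l
          (0, unhat F V x x (ay m l - dhat (Y l) x (W m x)))) := by
  set Z : Fin n → TangentSpace I x × V x := fun i => (W i x, Y i x) with hZ
  set J := graph L x (e x) with hJ
  have hJ' : ∀ y, graph L y (e y) = (ρsec L e y, e y) := fun y => rfl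
  have hZm : ∀ (m : Fin n) y, (fun i => (update W m (ρsec L e) i y,
      update Y m e i y)) = update (fun i => (W i y, Y i y)) m
        (graph L y (e y)) := fun m y => by
    rw [hJ', ← update_prodMk]
    funext i
    rcases eq_or_ne i m with rfl | hm
    · simp
    · simp [hm]
  simp_rw [hZm]
  rw [← hZ, ← hJ]
  -- splitting the inner sums into the diagonal and the off-diagonal terms
  have hsplit : ∀ m, ∑ l, Q x (update (update Z m J) l
        (update (wy m) m (wt m) l - dhat (update W m (ρsec L e) l) x (W m x),
          unhat F V x x (update (ay m) m (s m) l -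
            dhat (update Y m e l) x (W m x)))) =
      Q x (update Z m (wt m - dhat (ρsec L e) x (W m x),
        unhat F V x x (s m - dhat e x (W m x)))) +
      ((∑ l, if l = m then 0 else Q x (update (update Z m J) l (wy m l, 0))) -
      (∑ l, if l = m then 0 else
        Q x (update (update Z m J) l (dhat (W l) x (W m x), 0))) +
      ∑ l, if l = m then 0 else Q x (update (update Z m J) l
          (0, unhat F V x x (ay m l - dhat (Y l) x (W m x))))) := fun m => by
    rw [← sum_sub_distrib, ← sum_add_distrib,
      ← Finset.add_sum_erase _ _ (Finset.mem_univ m)]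
    congr 1
    · simp
    · refine (sum_congr rfl fun l hl => ?_).trans
        (Finset.sum_erase (a := m) Finset.univ (by simp))
      have hl' := Finset.ne_of_mem_erase hl
      simp only [update_of_ne hl', if_neg hl']
      rw [← AlternatingMap.map_update_sub, ← AlternatingMap.map_update_add]
      congr 2
      exact Prod.ext (by simp; rfl) (by simp)
  have hsymsum : ∑ m, ∑ l, (if l = m then 0 else
      Q x (update (update Z m J) l (wy m l, 0))) = 0 := by
    rw [sum_ne_eq_sum_lt]
    refine sum_eq_zero fun m _ => sum_eq_zero fun l _ => ?_
    split_ifs with h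
    · rw [AlternatingMap.update_update_swap _ _ h.ne, hsym l m, add_neg_cancel]
    · rfl
  have hbr : ∑ m, ∑ l, (if l = m then 0 else
      Q x (update (update Z m J) l (dhat (W l) x (W m x), 0))) =
      ∑ m, ∑ l, if m < l then Q x (update (update Z m J) l
        (mlieBracket I (fun y => W m y) (fun y => W l y) x, 0)) else 0 := by
    rw [sum_ne_eq_sum_lt]
    refine sum_congr rfl fun m _ => sum_congr rfl fun l _ => ?_
    split_ifs with h
    · rw [AlternatingMap.update_update_swap _ _ h.ne, ← sub_eq_add_neg,
        ← AlternatingMap.map_update_sub]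
      congr 2
      exact Prod.ext (mlieBracket_local (W m) (W l) x).symm (sub_zero _)
    · rfl
  have hdiag : ∀ l, Q x (update Z l (wt l - dhat (W l) x (L.anchor x (e x)),
          unhat F V x x (aₜ l - dhat (Y l) x (L.anchor x (e x))))) -
        Q x (update Z l (wt l - dhat (ρsec L e) x (W l x),
        unhat F V x x (s l - dhat e x (W l x)))) =
      Q x (update Z l (graph L x (cov (fun y => e y) x (W l x)))) -
      Q x (update Z l (eConn L cov e (W l) x, eConnV L cov e (Y l) x)) := fun l => by
    rw [← AlternatingMap.map_update_sub, ← AlternatingMap.map_update_sub]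
    congr 2
    refine Prod.ext ?_ ?_
    · have h1 := mlieBracket_local (ρsec L e) (W l) x
      have key : ∀ a b c d f : EM, f = b - c → (a - b) - (a - c) = d - (f + d) := by
        rintro a b c d f rfl
        abel
      exact key (wt l) _ _ (L.anchor x (cov (fun y => e y) x (W l x))) _ h1
    · change unhat F V x x _ - unhat F V x x _ = cov (fun y => e y) x (W l x) -
        (L.bracket e (Y l) x + cov (fun y => e y) x (L.anchor x (Y l x)))
      rw [hinv l, map_sub]
      abel
  simp_rw [hsplit, sum_add_distrib, sum_sub_distrib]
  rw [hsymsum, hbr, variation, eDeriv]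
  have hdiag' := sum_congr (rfl : (Finset.univ : Finset (Fin n)) = _) fun l _ => hdiag l
  rw [sum_sub_distrib, sum_sub_distrib] at hdiag'
  simp only [AlternatingMap.coe_multilinearMap]
  rw [← hZ, ← hJ]
  linear_combination hdiag'

end Variation

/-! ### Alternating forms on a direct sum -/

section MixedAlternating

variable {T A : Type*} [AddCommGroup T] [Module ℝ T] [AddCommGroup A] [Module ℝ A] {p q p' q' n : ℕ}

/-- The multilinear form `z ↦ μ(T-parts of the first p arguments; A-parts of the last q)`. -/
def mixedMul (μ : T [⋀^Fin p]→ₗ[ℝ] (A [⋀^Fin q]→ₗ[ℝ] ℝ)) :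
    MultilinearMap ℝ (fun _ : Fin p ⊕ Fin q => T × A) ℝ where
  toFun z := μ (fun i => (z (.inl i)).1) (fun j => (z (.inr j)).2)
  map_update_add' := by
    classical
    intro inst z k a b
    obtain rfl : inst = (instDecidableEqSum : DecidableEq (Fin p ⊕ Fin q)) := Subsingleton.elim _ _
    rcases k with k | k
    · have h1 : ∀ c : T × A, (fun i => (update z (.inl k) c (.inl i)).1) =
          update (fun i => (z (.inl i)).1) k c.1 := fun c => by
        funext i
        rcases eq_or_ne i k with rfl | hi
        · simp
        · simp [hi]
      have h2 : ∀ c : T × A, (fun j => (update z (.inl k) c (.inr j)).2) =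
          (fun j => (z (.inr j)).2) := fun c => by funext j; simp
      simp only [h1, h2, Prod.fst_add, AlternatingMap.map_update_add]
      rfl
    · have h1 : ∀ c : T × A, (fun i => (update z (.inr k) c (.inr i)).2) =
          update (fun i => (z (.inr i)).2) k c.2 := fun c => by
        funext i
        rcases eq_or_ne i k with rfl | hi
        · simp
        · simp [hi]
      have h2 : ∀ c : T × A, (fun j => (update z (.inr k) c (.inl j)).1) =
          (fun j => (z (.inl j)).1) := fun c => by funext j; simp
      simp only [h1, h2, Prod.snd_add, AlternatingMap.map_update_add]
  map_update_smul' := by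
    classical
    intro inst z k r a
    obtain rfl : inst = (instDecidableEqSum : DecidableEq (Fin p ⊕ Fin q)) := Subsingleton.elim _ _
    rcases k with k | k
    · have h1 : ∀ c : T × A, (fun i => (update z (.inl k) c (.inl i)).1) =
          update (fun i => (z (.inl i)).1) k c.1 := fun c => by
        funext i
        rcases eq_or_ne i k with rfl | hi
        · simp
        · simp [hi]
      have h2 : ∀ c : T × A, (fun j => (update z (.inl k) c (.inr j)).2) =
          (fun j => (z (.inr j)).2) := fun c => by funext j; simp
      simp only [h1, h2, Prod.smul_fst, AlternatingMap.map_update_smul]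
      rfl
    · have h1 : ∀ c : T × A, (fun i => (update z (.inr k) c (.inr i)).2) =
          update (fun i => (z (.inr i)).2) k c.2 := fun c => by
        funext i
        rcases eq_or_ne i k with rfl | hi
        · simp
        · simp [hi]
      have h2 : ∀ c : T × A, (fun j => (update z (.inr k) c (.inl j)).1) =
          (fun j => (z (.inl j)).1) := fun c => by funext j; simp
      simp only [h1, h2, Prod.smul_snd, AlternatingMap.map_update_smul]

/-- The identification of the index set `{1, …, n}` with its first `p` and its last `q` elements. -/
def splitEquiv (h : p + q = n) : Fin p ⊕ Fin q ≃ Fin n := finSumFinEquiv.trans (finCongr h)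

/-- The alternating form on `T ⊕ A` corresponding to an element of `∧^p T^* ⊗ ∧^q A^*`. -/
def mixedAlt (h : p + q = n) (μ : T [⋀^Fin p]→ₗ[ℝ] (A [⋀^Fin q]→ₗ[ℝ] ℝ)) :
    (T × A) [⋀^Fin n]→ₗ[ℝ] ℝ :=
  (1 / ((p.factorial : ℝ) * (q.factorial : ℝ))) •
    MultilinearMap.alternatization ((mixedMul μ).domDomCongr (splitEquiv h))

lemma mixedAlt_apply (h : p + q = n) (μ : T [⋀^Fin p]→ₗ[ℝ] (A [⋀^Fin q]→ₗ[ℝ] ℝ))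
    (z : Fin n → T × A) : mixedAlt h μ z = (1 / ((p.factorial : ℝ) * (q.factorial : ℝ))) *
      ∑ w : Equiv.Perm (Fin n), ((Equiv.Perm.sign w : ℤ) : ℝ) *
        mixedMul μ (fun i => z (w (splitEquiv h i))) := by
  rw [mixedAlt, AlternatingMap.smul_apply, MultilinearMap.alternatization_apply, smul_eq_mul]
  congr 1
  refine sum_congr rfl fun w _ => ?_
  rw [Units.smul_def, ← Int.cast_smul_eq_zsmul ℝ, smul_eq_mul]
  rfl

/-- The arguments `(v_1, 0), …, (v_p, 0), (0, a_1), …, (0, a_q)`. -/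
def pureArg (h : p + q = n) (v : Fin p → T) (a : Fin q → A) (i : Fin n) : T × A :=
  if hi : (i : ℕ) < p then (v ⟨i, hi⟩, 0) else (0, a ⟨i - p, by omega⟩)

lemma pureArg_inl (h : p + q = n) (v : Fin p → T) (a : Fin q → A) (i : Fin p) :
    pureArg h v a (splitEquiv h (.inl i)) = (v i, 0) := by
  simp [pureArg, splitEquiv]

lemma pureArg_inr (h : p + q = n) (v : Fin p → T) (a : Fin q → A) (j : Fin q) :
    pureArg h v a (splitEquiv h (.inr j)) = (0, a j) := by
  simp [pureArg, splitEquiv]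

lemma mixedMul_eq_zero (μ : T [⋀^Fin p]→ₗ[ℝ] (A [⋀^Fin q]→ₗ[ℝ] ℝ)) {z : Fin p ⊕ Fin q → T × A}
    (h : (∃ i, (z (.inl i)).1 = 0) ∨ ∃ j, (z (.inr j)).2 = 0) : mixedMul μ z = 0 := by
  rcases h with ⟨i, hi⟩ | ⟨j, hj⟩
  · change μ (fun i => (z (.inl i)).1) _ = 0
    rw [μ.map_coord_zero i hi]
    rfl
  · exact (μ _).map_coord_zero j hj

lemma mixedAlt_pure_ne (h : p + q = n) (h' : p' + q' = n) (hp : p ≠ p')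
    (μ : T [⋀^Fin p]→ₗ[ℝ] (A [⋀^Fin q]→ₗ[ℝ] ℝ)) (v : Fin p' → T) (a : Fin q' → A) :
    mixedAlt h μ (pureArg h' v a) = 0 := by
  rw [mixedAlt_apply, sum_eq_zero, mul_zero]
  intro w _
  suffices hz : mixedMul μ (fun i => pureArg h' v a (w (splitEquiv h i))) = 0 by
    rw [hz, mul_zero]
  apply mixedMul_eq_zero
  by_contra! hcon
  have key : ∀ k, ((splitEquiv h').symm k).elim (fun i => pureArg h' v a k = (v i, 0))
      (fun j => pureArg h' v a k = (0, a j)) := fun k => by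
    obtain ⟨m, rfl⟩ := (splitEquiv h').surjective k
    rw [Equiv.symm_apply_apply]
    rcases m with m | m
    · exact pureArg_inl h' v a m
    · exact pureArg_inr h' v a m
  have h1 : ∀ i : Fin p, ∃ i' : Fin p', (splitEquiv h').symm (w (splitEquiv h (.inl i))) = .inl i' := by
    intro i
    have := key (w (splitEquiv h (.inl i)))
    rcases hm : (splitEquiv h').symm (w (splitEquiv h (.inl i))) with m | m
    · exact ⟨m, rfl⟩
    · rw [hm] at this
      exact absurd (congrArg Prod.fst (this : pureArg h' v a _ = (0, a m))) (hcon.1 i)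
  have h2 : ∀ i : Fin q, ∃ i' : Fin q', (splitEquiv h').symm (w (splitEquiv h (.inr i))) = .inr i' := by
    intro i
    have := key (w (splitEquiv h (.inr i)))
    rcases hm : (splitEquiv h').symm (w (splitEquiv h (.inr i))) with m | m
    · rw [hm] at this
      exact absurd (congrArg Prod.snd (this : pureArg h' v a _ = (v m, 0))) (hcon.2 i)
    · exact ⟨m, rfl⟩
  choose f hf using h1
  choose g hg using h2
  have hfi : Function.Injective f := fun i j hij => by
    have := (hf i).trans ((congrArg Sum.inl hij).trans (hf j).symm)
    simpa using this
  have hgi : Function.Injective g := fun i j hij => by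
    have := (hg i).trans ((congrArg Sum.inr hij).trans (hg j).symm)
    simpa using this
  have e1 := Fintype.card_le_of_injective f hfi
  have e2 := Fintype.card_le_of_injective g hgi
  simp only [Fintype.card_fin] at e1 e2
  omega

lemma mixedAlt_pure (h : p + q = n) (μ : T [⋀^Fin p]→ₗ[ℝ] (A [⋀^Fin q]→ₗ[ℝ] ℝ)) (v : Fin p → T)
    (a : Fin q → A) : mixedAlt h μ (pureArg h v a) = μ v a := by
  rw [mixedAlt_apply]
  set z : Fin p ⊕ Fin q → T × A := Sum.elim (fun i => (v i, 0)) (fun j => (0, a j)) with hz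
  have hzp : ∀ k, pureArg h v a k = z ((splitEquiv h).symm k) := fun k => by
    obtain ⟨m, rfl⟩ := (splitEquiv h).surjective k
    rw [Equiv.symm_apply_apply]
    rcases m with m | m
    · exact pureArg_inl h v a m
    · exact pureArg_inr h v a m
  have hre : ∑ w : Equiv.Perm (Fin n), ((Equiv.Perm.sign w : ℤ) : ℝ) *
      mixedMul μ (fun i => pureArg h v a (w (splitEquiv h i))) =
      ∑ g : Equiv.Perm (Fin p ⊕ Fin q), ((Equiv.Perm.sign g : ℤ) : ℝ) *
        mixedMul μ (fun i => z (g i)) := by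
    refine Fintype.sum_equiv ((splitEquiv h).permCongr.symm) _ _ fun w => ?_
    have hs : Equiv.Perm.sign ((splitEquiv h).permCongr.symm w) = Equiv.Perm.sign w := by
      rw [Equiv.permCongr_symm, Equiv.Perm.sign_permCongr]
    rw [hs]
    congr 2
    funext i
    rw [hzp]
    rfl
  have hsum : ∑ g : Equiv.Perm (Fin p ⊕ Fin q), ((Equiv.Perm.sign g : ℤ) : ℝ) *
        mixedMul μ (fun i => z (g i)) =
      ∑ στ : Equiv.Perm (Fin p) × Equiv.Perm (Fin q), μ v a := by
    symm
    refine Finset.sum_of_injOn (Equiv.Perm.sumCongrHom (Fin p) (Fin q))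
      (Equiv.Perm.sumCongrHom_injective.injOn) (fun _ _ => Finset.mem_coe.2 (Finset.mem_univ _))
      (fun g _ hg => ?_) (fun στ _ => ?_)
    · suffices hz0 : mixedMul μ (fun i => z (g i)) = 0 by rw [hz0, mul_zero]
      apply mixedMul_eq_zero
      by_contra! hcon
      refine hg ?_
      have : Set.MapsTo g (Set.range Sum.inl) (Set.range Sum.inl) := by
        rintro _ ⟨i, rfl⟩
        rcases hm : g (Sum.inl i) with m | m
        · exact ⟨m, rfl⟩
        · refine absurd ?_ (hcon.1 i)
          rw [hm, hz]
          rfl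
      obtain ⟨στ, hστ⟩ := Equiv.Perm.mem_sumCongrHom_range_of_perm_mapsTo_inl this
      exact ⟨στ, Finset.mem_coe.2 (Finset.mem_univ _), hστ⟩
    · obtain ⟨σ, τ⟩ := στ
      rw [Equiv.Perm.sumCongrHom_apply, Equiv.Perm.sign_sumCongr]
      have e1 : mixedMul μ (fun i => z (Equiv.Perm.sumCongr σ τ i)) = μ (v ∘ σ) (a ∘ τ) := rfl
      rw [e1, μ.map_perm, AlternatingMap.smul_apply, (μ v).map_perm, Units.smul_def,
        Units.smul_def, ← Int.cast_smul_eq_zsmul ℝ, ← Int.cast_smul_eq_zsmul ℝ, smul_eq_mul,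
        smul_eq_mul, Units.val_mul, Int.cast_mul]
      have s1 : (((Equiv.Perm.sign σ : ℤ) : ℝ)) * ((Equiv.Perm.sign σ : ℤ) : ℝ) = 1 := by
        rw [← Int.cast_mul, Int.units_coe_mul_self, Int.cast_one]
      have s2 : (((Equiv.Perm.sign τ : ℤ) : ℝ)) * ((Equiv.Perm.sign τ : ℤ) : ℝ) = 1 := by
        rw [← Int.cast_mul, Int.units_coe_mul_self, Int.cast_one]
      linear_combination (-μ v a) * s2 - μ v a * ((Equiv.Perm.sign τ : ℤ) : ℝ) ^ 2 * s1
  rw [hre, hsum, Finset.sum_const, Finset.card_univ, Fintype.card_prod, Fintype.card_perm,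
    Fintype.card_perm, Fintype.card_fin, Fintype.card_fin, nsmul_eq_mul]
  have h1 : (p.factorial : ℝ) ≠ 0 := by positivity
  have h2 : (q.factorial : ℝ) ≠ 0 := by positivity
  push_cast
  field_simp

/-- An alternating form on `T ⊕ A` is determined by its values on pure arguments. -/
lemma eq_zero_of_pure (f : (T × A) [⋀^Fin n]→ₗ[ℝ] ℝ)
    (hf : ∀ (p q : ℕ) (h : p + q = n) (v : Fin p → T) (a : Fin q → A), f (pureArg h v a) = 0)
    (z : Fin n → T × A) : f z = 0 := by
  have hz : z = (fun i => ((z i).1, 0)) + fun i => (0, (z i).2) := by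
    funext i
    simp
  rw [hz, ← AlternatingMap.coe_multilinearMap, MultilinearMap.map_add_univ]
  refine sum_eq_zero fun s _ => ?_
  have hcard : s.card + sᶜ.card = n := by rw [Finset.card_add_card_compl, Fintype.card_fin]
  set σ : Equiv.Perm (Fin n) := (splitEquiv hcard).symm.trans (finSumEquivOfFinset rfl rfl) with hσ
  have hp := f.map_perm (s.piecewise (fun i => ((z i).1, 0)) fun i => (0, (z i).2)) σ
  have hpure : (s.piecewise (fun i => ((z i).1, (0 : A))) fun i => ((0 : T), (z i).2)) ∘ σ =
      pureArg hcard (fun i => (z (finSumEquivOfFinset (s := s) rfl rfl (.inl i))).1)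
        (fun i => (z (finSumEquivOfFinset (s := s) rfl rfl (.inr i))).2) := by
    funext k
    obtain ⟨m, rfl⟩ := (splitEquiv hcard).surjective k
    rw [Function.comp_apply, hσ, Equiv.trans_apply, Equiv.symm_apply_apply]
    rcases m with m | m
    · rw [pureArg_inl, Finset.piecewise_eq_of_mem]
      rw [finSumEquivOfFinset_inl]
      exact Finset.orderEmbOfFin_mem _ _ _
    · rw [pureArg_inr, Finset.piecewise_eq_of_notMem]
      rw [finSumEquivOfFinset_inr, ← Finset.mem_compl]
      exact Finset.orderEmbOfFin_mem _ _ _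
  rw [hpure, hf] at hp
  exact ((smul_eq_zero_iff_eq _).1 hp.symm)

lemma pureArg_cons (h : p + q = n) (h' : p + 1 + q = n + 1) (u : T) (v : Fin p → T)
    (a : Fin q → A) :
    pureArg h' (Fin.cons u v) a = (Fin.cons (u, 0) (pureArg h v a) : Fin (n + 1) → T × A) := by
  funext i
  refine Fin.cases ?_ (fun i => ?_) i
  · simp [pureArg]
  · rw [Fin.cons_succ, pureArg, pureArg]
    by_cases hi : (i : ℕ) < p
    · rw [dif_pos hi, dif_pos (by simpa using hi)]
      rfl
    · rw [dif_neg hi, dif_neg (by simpa using hi)]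
      congr 3
      simp

lemma pureArg_insertNth (h : p + q = n) (h' : p + (q + 1) = n + 1) (v : Fin p → T) (b : A)
    (a : Fin q → A) : pureArg h' v (Fin.cons b a) =
      Fin.insertNth (⟨p, by omega⟩ : Fin (n + 1)) ((0, b) : T × A) (pureArg h v a) := by
  rw [Fin.eq_insertNth_iff]
  constructor
  · simp [pureArg]
  · funext i
    rw [Fin.removeNth, pureArg, pureArg]
    by_cases hi : (i : ℕ) < p
    · have : ((Fin.succAbove (⟨p, by omega⟩ : Fin (n + 1)) i : Fin (n + 1)) : ℕ) = i := by
        rw [Fin.succAbove_of_castSucc_lt _ _ (by simpa [Fin.lt_def] using hi)]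
        rfl
      rw [dif_pos hi, dif_pos (by rw [this]; exact hi)]
      congr 3
    · have hs : ((Fin.succAbove (⟨p, by omega⟩ : Fin (n + 1)) i : Fin (n + 1)) : ℕ) = i + 1 := by
        rw [Fin.succAbove_of_le_castSucc _ _ (by simpa [Fin.le_def] using hi)]
        rfl
      rw [dif_neg hi, dif_neg (by rw [hs]; omega)]
      congr 1
      have : (⟨((Fin.succAbove (⟨p, by omega⟩ : Fin (n + 1)) i : Fin (n + 1)) : ℕ) - p, by omega⟩ :
          Fin (q + 1)) = Fin.succ ⟨i - p, by omega⟩ := Fin.ext (by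
            simp only [hs, Fin.val_succ]
            omega)
      rw [this, Fin.cons_succ]

lemma alt_cons_vert (f : (T × A) [⋀^Fin (n + 1)]→ₗ[ℝ] ℝ) (h : p + q = n) (h' : p + (q + 1) = n + 1)
    (v : Fin p → T) (b : A) (a : Fin q → A) :
    f (Fin.cons (0, b) (pureArg h v a)) = (-1) ^ p * f (pureArg h' v (Fin.cons b a)) := by
  rw [pureArg_insertNth h, f.map_insertNth, zsmul_eq_mul, Int.cast_pow, Int.cast_neg, Int.cast_one,
    ← mul_assoc, ← pow_add, Even.neg_one_pow ⟨p, rfl⟩, one_mul]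
  rfl

end MixedAlternating

/-! ### Homotopy momentum sections and the algebraic relation -/

section Momentum

variable {p q : ℕ}

/-- The derivative `(ᴱ∇_e μ)(v; a)` of an `E`-form along the canonical `E`-connections on `TM` and
on `E`. -/
def eDerivF (μ : EForm I M F V p q) (e : ΓE) (v : Fin p → ΓT)
    (a : Fin q → ΓE) (x : M) : ℝ :=
  mvfderiv I (fun y => μ.toFun y (fun i => v i y) (fun j => a j y)) x (L.anchor x (e x)) -
    ∑ l, μ.toFun x (update (fun i => v i x) l (eConn L cov e (v l) x)) (fun j => a j x) -
    ∑ l, μ.toFun x (fun i => v i x) (update (fun j => a j x) l (eConnV L cov e (a l) x))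

/-- The derivative of an `E`-form along `ρ(e)` that uses the canonical `E`-connection on `TM` and the
given connection on `E`. -/
def halfDeriv (μ : EForm I M F V p q) (e : ΓE) (v : Fin p → ΓT)
    (a : Fin q → ΓE) (x : M) : ℝ :=
  mvfderiv I (fun y => μ.toFun y (fun i => v i y) (fun j => a j y)) x (L.anchor x (e x)) -
    ∑ l, μ.toFun x (update (fun i => v i x) l (eConn L cov e (v l) x)) (fun j => a j x) -
    ∑ l, μ.toFun x (fun i => v i x)
      (update (fun j => a j x) l (cov (fun y => a l y) x (L.anchor x (e x))))

/-- `ν = -ι_ρ μ`. -/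
def IsContraction (ν : EForm I M F V p (q + 1)) (μ : EForm I M F V (p + 1) q) : Prop :=
  ∀ (x : M) (v : Fin p → TangentSpace I x) (e₀ : V x) (e : Fin q → V x),
    ν.toFun x v (Fin.cons e₀ e) = - μ.toFun x (Fin.cons (L.anchor x e₀) v) e

lemma update_cons_zero' {A : Type*} {n : ℕ} (x y : A) (p : Fin n → A) :
    update (Fin.cons x p : Fin (n + 1) → A) 0 y = Fin.cons y p :=
  Fin.update_cons_zero (α := fun _ => A) x p y

lemma update_cons_succ {A : Type*} {n : ℕ} (x : A) (p : Fin n → A) (i : Fin n) (y : A) :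
    update (Fin.cons x p : Fin (n + 1) → A) i.succ y =
      Fin.cons x (update p i y) :=
  (Fin.cons_update (α := fun _ => A) x p i y).symm

lemma fin_cons_apply {A : Type*} {B : Type*} {n : ℕ} (f : A → B) (x : A) (p : Fin n → A) :
    (fun i => f ((Fin.cons x p : Fin (n + 1) → A) i)) =
      (Fin.cons (f x) (fun i => f (p i)) : Fin (n + 1) → B) := by
  funext i
  refine Fin.cases ?_ (fun i => ?_) i <;> simp

lemma succ_succAbove_cons {A : Type*} {n : ℕ} (x : A) (p : Fin (n + 1) → A) (i : Fin (n + 1)) :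
    (fun j => (Fin.cons x p : Fin (n + 2) → A) (i.succ.succAbove j)) =
      (Fin.cons x (fun j => p (i.succAbove j)) : Fin (n + 1) → A) := by
  funext j
  refine Fin.cases ?_ (fun j => ?_) j
  · simp
  · simp

lemma alt_update_eq_cons {A B : Type*} [AddCommGroup A] [Module ℝ A] [AddCommGroup B] [Module ℝ B]
    {n : ℕ} (f : A [⋀^Fin (n + 1)]→ₗ[ℝ] B) (v : Fin (n + 1) → A) (i : Fin (n + 1)) (u : A) :
    f (update v i u) =
      ((-1 : ℝ) ^ (i : ℕ)) • f (Fin.cons u (fun j => v (i.succAbove j))) := by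
  have h1 : update v i u = i.insertNth u (fun j => v (i.succAbove j)) := by
    rw [Fin.eq_insertNth_iff]
    refine ⟨by simp, ?_⟩
    funext j
    simp [Fin.removeNth, Fin.succAbove_ne]
  rw [h1, f.map_insertNth, ← Int.cast_smul_eq_zsmul ℝ]
  push_cast
  rfl

variable {L} in
lemma IsContraction.covD {ν : EForm I M F V p (q + 1)} {μ : EForm I M F V (p + 1) q}
    (h : IsContraction L ν μ) (e₁ : ΓE) (v : Fin (p + 1) → ΓT)
    (e : Fin q → ΓE) (x : M) :
    LASigma.covD cov μ (Fin.cons (ρsec L e₁) v) e x =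
      LASigma.covD cov ν v (Fin.cons e₁ e) x + halfDeriv L cov μ e₁ v e x := by
  have hfun : ∀ i : Fin (p + 1), mvfderiv I (fun y => ν.toFun y (fun a => v (i.succAbove a) y)
      (fun b => (Fin.cons e₁ e : Fin (q + 1) → ΓE) b y)) x (v i x) =
      - mvfderiv I (fun y => μ.toFun y (fun a => (Fin.cons (ρsec L e₁) v : Fin (p + 2) → ΓT)
        (i.succ.succAbove a) y) (fun b => e b y)) x (v i x) := fun i => by
    have hf : (fun y => ν.toFun y (fun a => v (i.succAbove a) y)
      (fun b => (Fin.cons e₁ e : Fin (q + 1) → ΓE) b y)) = -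
      (fun y => μ.toFun y (fun a => (Fin.cons (ρsec L e₁) v : Fin (p + 2) → ΓT)
        (i.succ.succAbove a) y) (fun b => e b y)) := by
      funext y
      rw [fin_cons_apply (fun s : ΓE => s y), h, Pi.neg_apply]
      have := congrArg (fun w : Fin (p + 1) → ΓT => fun a => w a y)
        (succ_succAbove_cons (ρsec L e₁) v i)
      rw [this, fin_cons_apply (fun s : ΓT => s y)]
      rfl
    rw [hf, mvfderiv_neg]
    rfl
  unfold LASigma.covD halfDeriv
  rw [Fin.sum_univ_succ]
  have hi : ∀ i : Fin (p + 1),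
      (-1 : ℝ) ^ ((i.succ : Fin (p + 2)) : ℕ) *
        (mvfderiv I (fun y => μ.toFun y (fun a => (Fin.cons (ρsec L e₁) v : Fin (p + 2) → ΓT)
          (i.succ.succAbove a) y) (fun b => e b y)) x
            ((Fin.cons (ρsec L e₁) v : Fin (p + 2) → ΓT) i.succ x)
        - ∑ l : Fin q, μ.toFun x (fun a => (Fin.cons (ρsec L e₁) v : Fin (p + 2) → ΓT)
          (i.succ.succAbove a) x) (update (fun b => e b x) l (cov (fun y => e l y) x
            ((Fin.cons (ρsec L e₁) v : Fin (p + 2) → ΓT) i.succ x)))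
        - ∑ j : Fin (p + 1), if i.succ < i.succ.succAbove j then
          μ.toFun x (update (fun a => (Fin.cons (ρsec L e₁) v : Fin (p + 2) → ΓT)
            (i.succ.succAbove a) x) j
            (VectorField.mlieBracket I
              (fun y => (Fin.cons (ρsec L e₁) v : Fin (p + 2) → ΓT) i.succ y)
              (fun y => (Fin.cons (ρsec L e₁) v : Fin (p + 2) → ΓT)
                (i.succ.succAbove j) y) x)) (fun b => e b x)
          else 0) =
      (-1 : ℝ) ^ (i : ℕ) *
        (mvfderiv I (fun y => ν.toFun y (fun a => v (i.succAbove a) y)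
          (fun b => (Fin.cons e₁ e : Fin (q + 1) → ΓE) b y)) x (v i x)
        - ∑ l : Fin (q + 1), ν.toFun x (fun a => v (i.succAbove a) x)
          (update (fun b => (Fin.cons e₁ e : Fin (q + 1) → ΓE) b x) l
            (cov (fun y => (Fin.cons e₁ e : Fin (q + 1) → ΓE) l y) x (v i x)))
        - ∑ j : Fin p, if i < i.succAbove j then
          ν.toFun x (update (fun a => v (i.succAbove a) x) j
            (VectorField.mlieBracket I (fun y => v i y) (fun y => v (i.succAbove j) y) x))
            (fun b => (Fin.cons e₁ e : Fin (q + 1) → ΓE) b x)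
          else 0)
      - μ.toFun x (update (fun a => v a x) i (L.anchor x (cov (fun y => e₁ y) x (v i x))))
          (fun b => e b x) := fun i => by
    have hv : (fun a => (Fin.cons (ρsec L e₁) v : Fin (p + 2) → ΓT) (i.succ.succAbove a) x) =
        Fin.cons (L.anchor x (e₁ x)) (fun a => v (i.succAbove a) x) := by
      have := congrArg (fun w : Fin (p + 1) → ΓT => fun a => w a x)
        (succ_succAbove_cons (ρsec L e₁) v i)
      rw [this, fin_cons_apply (fun s : ΓT => s x)]
      rfl
    rw [hfun i, hv, Fin.sum_univ_succ (n := q), Fin.sum_univ_succ (n := p),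
      fin_cons_apply (fun s : ΓE => s x), alt_update_eq_cons (μ.toFun x) (fun a => v a x)
      i (L.anchor x (cov (fun y => e₁ y) x (v i x)))]
    simp only [Fin.cons_succ, Fin.cons_zero, update_cons_zero', update_cons_succ, h x,
      Fin.succ_succAbove_zero, Fin.succ_succAbove_succ, Fin.succ_lt_succ_iff, Fin.not_lt_zero,
      if_false, Fin.val_succ, pow_succ, AlternatingMap.smul_apply, smul_eq_mul]
    have hite : ∀ (c : Prop) [Decidable c] (r : ℝ), (if c then -r else 0) = -(if c then r else 0) :=
      fun c _ r => by split_ifs <;> simp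
    simp only [hite, sum_neg_distrib]
    ring
  simp_rw [hi]
  rw [sum_sub_distrib]
  simp only [Fin.val_zero, pow_zero, one_mul, Fin.cons_zero, Fin.zero_succAbove, Fin.cons_succ,
    Fin.succ_pos, if_true]
  have hc : ∀ l : Fin (p + 1), μ.toFun x (update (fun i => v i x) l
      (eConn L cov e₁ (v l) x)) (fun j => e j x) =
      μ.toFun x (update (fun i => v i x) l
        (mlieBracket I (fun y => ρsec L e₁ y) (fun y => v l y) x)) (fun j => e j x) +
      μ.toFun x (update (fun i => v i x) l
        (L.anchor x (cov (fun y => e₁ y) x (v l x)))) (fun j => e j x) := fun l => by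
    rw [eConn, AlternatingMap.map_update_add]
    rfl
  simp_rw [hc]
  rw [sum_add_distrib]
  have hr : ρsec L e₁ x = L.anchor x (e₁ x) := rfl
  rw [hr]
  ring

lemma covD_zero_form (μ : EForm I M F V 0 q) (e₁ : ΓE) (v : Fin 0 → ΓT)
    (e : Fin q → ΓE) (x : M) :
    LASigma.covD cov μ (Fin.cons (ρsec L e₁) v) e x = halfDeriv L cov μ e₁ v e x := by
  unfold LASigma.covD halfDeriv
  have h1 : ∀ y, (fun a : Fin 0 => v a y) = ![] := fun y => Subsingleton.elim _ _
  simp [h1]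
  rfl

variable {L} in
lemma IsContraction.algD {ν : EForm I M F V p (q + 1)} {μ : EForm I M F V (p + 1) q}
    (h : IsContraction L ν μ) (e₁ : ΓE) (v : Fin p → ΓT)
    (e : Fin (q + 1) → ΓE) (x : M) :
    LASigma.algD L cov ν v (Fin.cons e₁ e) x =
      LASigma.algD L cov μ (Fin.cons (ρsec L e₁) v) e x + halfDeriv L cov ν e₁ v e x := by
  have hfun : ∀ i : Fin (q + 1), mvfderiv I (fun y => ν.toFun y (fun a => v a y)
      (fun b => (Fin.cons e₁ e : Fin (q + 2) → ΓE) (i.succ.succAbove b) y)) x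
        (L.anchor x (e i x)) =
      - mvfderiv I (fun y => μ.toFun y (fun a => (Fin.cons (ρsec L e₁) v : Fin (p + 1) → ΓT)
        a y) (fun b => e (i.succAbove b) y)) x (L.anchor x (e i x)) := fun i => by
    have hf : (fun y => ν.toFun y (fun a => v a y)
      (fun b => (Fin.cons e₁ e : Fin (q + 2) → ΓE) (i.succ.succAbove b) y)) = -
      (fun y => μ.toFun y (fun a => (Fin.cons (ρsec L e₁) v : Fin (p + 1) → ΓT)
        a y) (fun b => e (i.succAbove b) y)) := by
      funext y
      have := congrArg (fun w : Fin (q + 1) → ΓE => fun a => w a y)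
        (succ_succAbove_cons e₁ e i)
      rw [this, fin_cons_apply (fun s : ΓE => s y), h, Pi.neg_apply,
        fin_cons_apply (fun s : ΓT => s y)]
      rfl
    rw [hf, mvfderiv_neg]
    rfl
  have hi : ∀ i : Fin (q + 1), (-1 : ℝ) ^ ((i.succ : Fin (q + 2)) : ℕ) *
      (mvfderiv I (fun y => ν.toFun y (fun a => v a y) (fun b =>
        (Fin.cons e₁ e : Fin (q + 2) → ΓE) (i.succ.succAbove b) y)) x
          (L.anchor x ((Fin.cons e₁ e : Fin (q + 2) → ΓE) i.succ x))
      - ∑ l : Fin p, ν.toFun x (update (fun a => v a x) l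
          (eConn L cov ((Fin.cons e₁ e : Fin (q + 2) → ΓE) i.succ) (v l) x))
          (fun b => (Fin.cons e₁ e : Fin (q + 2) → ΓE) (i.succ.succAbove b) x)
      - ∑ j : Fin (q + 1), if i.succ < i.succ.succAbove j then
          ν.toFun x (fun a => v a x)
            (update (fun b => (Fin.cons e₁ e : Fin (q + 2) → ΓE)
              (i.succ.succAbove b) x) j
              (L.bracket ((Fin.cons e₁ e : Fin (q + 2) → ΓE) i.succ)
                ((Fin.cons e₁ e : Fin (q + 2) → ΓE) (i.succ.succAbove j)) x))
        else 0) =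
      (-1 : ℝ) ^ (i : ℕ) *
      (mvfderiv I (fun y => μ.toFun y (fun a =>
        (Fin.cons (ρsec L e₁) v : Fin (p + 1) → ΓT) a y) (fun b =>
        e (i.succAbove b) y)) x (L.anchor x (e i x))
      - ∑ l : Fin (p + 1), μ.toFun x (update (fun a =>
          (Fin.cons (ρsec L e₁) v : Fin (p + 1) → ΓT) a x) l
          (eConn L cov (e i) ((Fin.cons (ρsec L e₁) v : Fin (p + 1) → ΓT) l) x))
          (fun b => e (i.succAbove b) x)
      - ∑ j : Fin q, if i < i.succAbove j then
          μ.toFun x (fun a => (Fin.cons (ρsec L e₁) v : Fin (p + 1) → ΓT) a x)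
            (update (fun b => e (i.succAbove b) x) j
              (L.bracket (e i) (e (i.succAbove j)) x))
        else 0)
      - ν.toFun x (fun a => v a x) (update (fun b => e b x) i
          (eConnV L cov (e i) e₁ x)) := fun i => by
    have hv : (fun b => (Fin.cons e₁ e : Fin (q + 2) → ΓE) (i.succ.succAbove b) x) =
        Fin.cons (e₁ x) (fun b => e (i.succAbove b) x) := by
      have := congrArg (fun w : Fin (q + 1) → ΓE => fun a => w a x)
        (succ_succAbove_cons e₁ e i)
      rw [this, fin_cons_apply (fun s : ΓE => s x)]
    have hρ : ρsec L e₁ x = L.anchor x (e₁ x) := rfl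
    rw [Fin.cons_succ, hfun i, hv, Fin.sum_univ_succ (n := q), Fin.sum_univ_succ (n := p),
      fin_cons_apply (fun s : ΓT => s x),
      alt_update_eq_cons (ν.toFun x (fun a => v a x)) (fun b => e b x) i]
    simp only [Fin.cons_succ, Fin.cons_zero, update_cons_zero', update_cons_succ, h x,
      Fin.succ_succAbove_zero, Fin.succ_succAbove_succ, Fin.succ_lt_succ_iff, Fin.not_lt_zero,
      if_false, Fin.val_succ, pow_succ, smul_eq_mul, hρ, anchor_eConnV]
    have hite : ∀ (c : Prop) [Decidable c] (r : ℝ), (if c then -r else 0) = -(if c then r else 0) :=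
      fun c _ r => by split_ifs <;> simp
    simp only [hite, sum_neg_distrib]
    ring
  unfold LASigma.algD halfDeriv
  rw [Fin.sum_univ_succ]
  simp_rw [hi]
  rw [sum_sub_distrib]
  simp only [Fin.val_zero, pow_zero, one_mul, Fin.cons_zero, Fin.zero_succAbove, Fin.cons_succ,
    Fin.succ_pos, if_true]
  have hneg : ∀ (s : ΓE), (-s) x = -(s x) := fun _ => rfl
  have hc : ∀ l : Fin (q + 1), ν.toFun x (fun a => v a x) (update (fun b => e b x) l
      (eConnV L cov (e l) e₁ x)) =
      - ν.toFun x (fun a => v a x) (update (fun b => e b x) l (L.bracket e₁ (e l) x)) +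
      ν.toFun x (fun a => v a x) (update (fun b => e b x) l
        (cov (fun y => e l y) x (L.anchor x (e₁ x)))) := fun l => by
    rw [eConnV, AlternatingMap.map_update_add, bracket_neg L (e l) e₁, hneg,
      AlternatingMap.map_update_neg]
  simp_rw [hc]
  rw [sum_add_distrib, sum_neg_distrib]
  ring

variable {L} in
lemma IsContraction.eDerivF {ν : EForm I M F V p (q + 1)} {μ : EForm I M F V (p + 1) q}
    (h : IsContraction L ν μ) (e : ΓE) (v : Fin p → ΓT)
    (a₀ : ΓE) (a : Fin q → ΓE) (x : M) :
    LASigma.eDerivF L cov ν e v (Fin.cons a₀ a) x =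
      - LASigma.eDerivF L cov μ e (Fin.cons (ρsec L a₀) v) a x := by
  have hf : (fun y => ν.toFun y (fun i => v i y)
      (fun j => (Fin.cons a₀ a : Fin (q + 1) → ΓE) j y)) =
      - fun y => μ.toFun y (fun i => (Fin.cons (ρsec L a₀) v : Fin (p + 1) → ΓT) i y)
        (fun j => a j y) := by
    funext y
    rw [fin_cons_apply (fun s : ΓE => s y), h, Pi.neg_apply,
        fin_cons_apply (fun s : ΓT => s y)]
    rfl
  have hρ : ρsec L a₀ x = L.anchor x (a₀ x) := rfl
  unfold LASigma.eDerivF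
  rw [hf, mvfderiv_neg, Fin.sum_univ_succ (n := q), Fin.sum_univ_succ (n := p),
    fin_cons_apply (fun s : ΓE => s x), fin_cons_apply (fun s : ΓT => s x)]
  simp only [Fin.cons_succ, Fin.cons_zero, update_cons_zero', update_cons_succ, h x,
      hρ, anchor_eConnV, sum_neg_distrib, neg_apply]
  ring

lemma algD_two (θ : EForm I M F V p 1) (v : Fin p → ΓT) (e : Fin 2 → ΓE)
    (x : M) : LASigma.algD L cov θ v e x = halfDeriv L cov θ (e 0) v (fun _ => e 1) x -
      LASigma.eDerivF L cov θ (e 1) v (fun _ => e 0) x := by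
  have hs : ∀ (i : Fin 1) (w : Fin 1 → V x) (u : V x), update w i u = fun _ => u := by
    intro i w u
    funext j
    rw [Subsingleton.elim j i, update_self]
  have hn : ∀ (s : ΓE), (-s) x = -(s x) := fun _ => rfl
  unfold LASigma.algD halfDeriv LASigma.eDerivF
  rw [Fin.sum_univ_two]
  have h0 : ∀ b : Fin 1, (0 : Fin 2).succAbove b = 1 := by decide
  have h1 : ∀ b : Fin 1, (1 : Fin 2).succAbove b = 0 := by decide
  simp only [h0, h1, hs, Finset.univ_unique, Finset.sum_singleton]
  have h3 : θ.toFun x (fun i => v i x) (fun _ => eConnV L cov (e 1) (e 0) x) =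
      - θ.toFun x (fun i => v i x) (fun _ => L.bracket (e 0) (e 1) x) +
      θ.toFun x (fun i => v i x)
        (fun _ => cov (fun y => e 1 y) x (L.anchor x (e 0 x))) := by
    have := (θ.toFun x (fun i => v i x)).map_update_add (fun _ => 0) 0
      (L.bracket (e 1) (e 0) x) (cov (fun y => e 1 y) x (L.anchor x (e 0 x)))
    rw [hs, hs, hs, bracket_neg, hn] at this
    have h4 := (θ.toFun x (fun i => v i x)).map_update_neg (fun _ => 0) 0
      (L.bracket (e 0) (e 1) x)
    rw [hs, hs] at h4
    rw [eConnV, bracket_neg, hn, this, h4]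
  rw [h3]
  simp
  ring

lemma append_cast_apply {A : Type*} {m k n : ℕ} (h : n = m + k) (u : Fin m → A) (w : Fin k → A)
    (i : Fin n) : Fin.append u w (Fin.cast h i) =
      if hi : (i : ℕ) < m then u ⟨i, hi⟩ else w ⟨i - m, by omega⟩ := by
  subst h
  refine Fin.addCases (fun i => ?_) (fun i => ?_) i
  · simp
  · simp

lemma iotaPow_cons {n : ℕ} (h : n + 1 = q + 1 + p) (h' : n + 1 = q + (p + 1))
    (Ω : ∀ x : M, (TangentSpace I x) [⋀^Fin (n + 1)]→L[ℝ] ℝ) (e₁ : ΓE)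
    (v : Fin p → ΓT) (e : Fin q → ΓE) (x : M) :
    iotaPow L h Ω v (Fin.cons e₁ e) x = iotaPow L h' Ω (Fin.cons (ρsec L e₁) v) e x := by
  unfold iotaPow
  refine congrArg (Ω x) (funext fun i => ?_)
  rw [append_cast_apply, append_cast_apply]
  rcases lt_trichotomy (i : ℕ) q with hi | hi | hi
  · rw [dif_pos (by omega), dif_pos hi]
    have : (Fin.rev ⟨i, by omega⟩ : Fin (q + 1)) = Fin.succ (Fin.rev ⟨i, hi⟩) := Fin.ext (by
      simp only [Fin.val_rev, Fin.val_succ]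
      omega)
    rw [this, Fin.cons_succ]
  · rw [dif_pos (by omega), dif_neg (by omega)]
    have h1 : (Fin.rev ⟨i, by omega⟩ : Fin (q + 1)) = 0 := Fin.ext (by
      simp only [Fin.val_rev, Fin.val_zero]
      omega)
    have h2 : (⟨(i : ℕ) - q, by omega⟩ : Fin (p + 1)) = 0 := Fin.ext (by
      simp only [Fin.val_zero]
      omega)
    rw [h1, h2]
    rfl
  · rw [dif_neg (by omega), dif_neg (by omega)]
    have h2 : (⟨(i : ℕ) - q, by omega⟩ : Fin (p + 1)) = Fin.succ ⟨i - (q + 1), by omega⟩ :=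
      Fin.ext (by
        simp only [Fin.val_succ]
        omega)
    rw [h2, Fin.cons_succ]

end Momentum

section MomentumSection

variable {L cov} {k : ℕ} {μ : Cochain I M F V (k + 1)}

lemma AlgebraicRelation.isContraction {n : ℕ} {μ : Cochain I M F V n}
    (h : AlgebraicRelation L μ) {p q : ℕ}
    (hpq : p + q + 2 = n) : IsContraction L (μ p (q + 1) (by omega)) (μ (p + 1) q (by omega)) :=
  h p q hpq

lemma AlgebraicRelation.eDerivF_eq_zero (h : AlgebraicRelation L μ)
    (h₀ : ∀ e v a x, eDerivF L cov (μ k 0 rfl) e v a x = 0) (q : ℕ) :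
    ∀ (p : ℕ) (hpq : p + q + 1 = k + 1) (e : ΓE) (v : Fin p → ΓT)
      (a : Fin (q + 1) → ΓE) (x : M), eDerivF L cov (μ p q hpq) e v a x = 0 := by
  induction q with
  | zero =>
    intro p hpq
    obtain rfl : p = k := by omega
    exact h₀
  | succ q ih =>
    intro p hpq e v a x
    rw [← Fin.cons_self_tail a, (h.isContraction (by omega)).eDerivF, ih, neg_zero]

/-- Under the algebraic relation, the momentum equations in all form degrees follow from the one in
top degree and from the invariance of the top component. -/
lemma isHomotopyMomentumSection_iff
    {Ω : ∀ x : M, (TangentSpace I x) [⋀^Fin (k + 1 + 1)]→L[ℝ] ℝ} (h : AlgebraicRelation L μ) :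
    IsHomotopyMomentumSection L cov Ω μ ↔
      (∀ (v : Fin (k + 1) → ΓT) (e : Fin 1 → ΓE) (x : M),
        covD cov (μ k 0 rfl) v e x = - iotaPow L (by omega) Ω v e x) ∧
      ∀ e v a x, eDerivF L cov (μ k 0 rfl) e v a x = 0 := by
  have hcons : ∀ e : Fin 2 → ΓE, e = Fin.cons (e 0) (fun _ : Fin 1 => e 1) :=
    fun e => by
      funext i
      fin_cases i <;> rfl
  have hfun1 : ∀ a : Fin 1 → ΓE, a = fun _ => a 0 := fun a => by
    funext i
    rw [Subsingleton.elim i 0]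
  constructor
  · rintro ⟨h1, h2, h3⟩
    refine ⟨h1 k rfl, fun e v a x => ?_⟩
    set E : Fin 2 → ΓE := Fin.cons (a 0) (fun _ : Fin 1 => e) with hE
    have ha := algD_two L cov (μ k 0 rfl) v E x
    have hE0 : E 0 = a 0 := rfl
    have hE1 : E 1 = e := rfl
    rw [hE0, hE1, ← hfun1 a] at ha
    rcases k with _ | p
    · have e3 := h3 0 rfl v E x
      have e1 := h1 0 rfl (Fin.cons (ρsec L (a 0)) v) (fun _ => e) x
      rw [covD_zero_form] at e1
      rw [hE, iotaPow_cons L _ (by omega)] at e3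
      linarith
    · have e2 := h2 p 0 (by omega) v E x
      have e1 := h1 (p + 1) rfl (Fin.cons (ρsec L (a 0)) v) (fun _ => e) x
      rw [(h.isContraction (p := p) (q := 0) (by omega)).covD] at e1
      rw [hE, iotaPow_cons L _ (by omega), ← hE] at e2
      rw [hE] at e2 ha
      linarith
  · rintro ⟨h1, h4⟩
    have h2 : ∀ (q p : ℕ) (hpq : p + q + 2 = k + 1) (v : Fin (p + 1) → ΓT)
      (e : Fin (q + 2) → ΓE) (x : M),
      covD cov (μ p (q + 1) (by omega)) v e x + algD L cov (μ (p + 1) q (by omega)) v e x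
        = - iotaPow L (by omega) Ω v e x := by
      intro q
      induction q with
      | zero =>
        intro p hpq v e x
        obtain rfl : k = p + 1 := by omega
        have e1 := h1 (Fin.cons (ρsec L (e 0)) v) (fun _ => e 1) x
        rw [(h.isContraction (p := p) (q := 0) (by omega)).covD] at e1
        have ha := algD_two L cov (μ (p + 1) 0 rfl) v e x
        rw [h4] at ha
        rw [ha, hcons e, iotaPow_cons L _ (by omega)]
        have hE0 : (Fin.cons (e 0) (fun _ : Fin 1 => e 1) : Fin 2 → ΓE) 0 = e 0 := rfl
        have hE1 : (Fin.cons (e 0) (fun _ : Fin 1 => e 1) : Fin 2 → ΓE) 1 = e 1 := rfl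
        rw [hE0, hE1]
        linarith
      | succ q ih =>
        intro p hpq v e x
        have e2 := ih (p + 1) (by omega) (Fin.cons (ρsec L (e 0)) v) (Fin.tail e) x
        rw [(h.isContraction (p := p) (q := q + 1) (by omega)).covD] at e2
        rw [← Fin.cons_self_tail e, iotaPow_cons L _ (by omega),
          (h.isContraction (p := p + 1) (q := q) (by omega)).algD]
        rw [Fin.cons_self_tail e] at e2 ⊢
        linarith
    refine ⟨?_, fun p q hpq => h2 q p hpq, ?_⟩
    · intro p hp
      obtain rfl : p = k := by omega
      exact h1
    · intro q hq v e x
      rcases k with _ | k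
      · obtain rfl : q = 0 := by omega
        have ha := algD_two L cov (μ 0 0 rfl) v e x
        have e1 := h1 (Fin.cons (ρsec L (e 0)) v) (fun _ => e 1) x
        rw [covD_zero_form] at e1
        rw [h4] at ha
        rw [ha, hcons e, iotaPow_cons L _ (by omega)]
        have hE0 : (Fin.cons (e 0) (fun _ : Fin 1 => e 1) : Fin 2 → ΓE) 0 = e 0 := rfl
        have hE1 : (Fin.cons (e 0) (fun _ : Fin 1 => e 1) : Fin 2 → ΓE) 1 = e 1 := rfl
        rw [hE0, hE1]
        linarith
      · obtain rfl : q = k + 1 := by omega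
        have e2 := h2 k 0 (by omega) (Fin.cons (ρsec L (e 0)) v) (Fin.tail e) x
        rw [covD_zero_form] at e2
        rw [← Fin.cons_self_tail e, iotaPow_cons L _ (by omega),
          (h.isContraction (p := 0) (q := k) (by omega)).algD]
        linarith

end MomentumSection

/-! ### The alternating field of the mixed couplings -/

section MixedSum

variable {L cov} {n : ℕ}

/-- The alternating form on `T_x M ⊕ V_x` whose component in `∧^k T^* ⊗ ∧^{n-k} V^*` is the `k`-th
component of the family, `k < n`. -/
def mixedSum (μ : Cochain I M F V n) (x : M) : (TangentSpace I x × V x) [⋀^Fin n]→ₗ[ℝ] ℝ :=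
  ∑ k : Fin n, mixedAlt (show (k : ℕ) + (n - 1 - k + 1) = n by omega)
    ((μ k (n - 1 - k) (by omega)).toFun x)

lemma mixedSum_apply (μ : Cochain I M F V n) (x : M) (z : Fin n → TangentSpace I x × V x) :
    mixedSum μ x z = ∑ k : Fin n, mixedAlt (show (k : ℕ) + (n - 1 - k + 1) = n by omega)
      ((μ k (n - 1 - k) (by omega)).toFun x) z := by
  have : ∀ (s : Finset (Fin n)) (f : Fin n → (TangentSpace I x × V x) [⋀^Fin n]→ₗ[ℝ] ℝ),
      (∑ k ∈ s, f k) z = ∑ k ∈ s, f k z := fun s f => by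
    induction s using Finset.induction_on with
    | empty => simp
    | insert a s ha ih => rw [sum_insert ha, sum_insert ha, AlternatingMap.add_apply, ih]
  exact this _ _

lemma mixedSum_pure (μ : Cochain I M F V n) {p q : ℕ} (h : p + q + 1 = n) (x : M)
    (v : Fin p → TangentSpace I x) (a : Fin (q + 1) → V x) :
    mixedSum μ x (pureArg (show p + (q + 1) = n by omega) v a) = (μ p q h).toFun x v a := by
  obtain rfl : q = n - 1 - p := by omega
  rw [mixedSum_apply, sum_eq_single (⟨p, by omega⟩ : Fin n)]
  · exact mixedAlt_pure _ _ _ _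
  · intro b _ hb
    exact mixedAlt_pure_ne _ _ (fun h => hb (Fin.ext h)) _ _ _
  · simp

lemma mixedSum_tangent (μ : Cochain I M F V n) (x : M) (v : Fin n → TangentSpace I x) :
    mixedSum μ x (fun i => (v i, 0)) = 0 := by
  have h : (fun i => (v i, (0 : V x))) = pureArg (add_zero n) v ![] := by
    funext i
    rw [pureArg, dif_pos i.2]
  rw [h, mixedSum_apply]
  exact sum_eq_zero fun k _ => mixedAlt_pure_ne _ _ (by omega) _ _ _

/-- The alternating field vanishes when one of its arguments lies in the graph of the anchor and
another one is vertical. -/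
def GraphNull (L : LieAlgebroid I M F V)
    (Q : ∀ x : M, (TangentSpace I x × V x) [⋀^Fin n]→ₗ[ℝ] ℝ) : Prop :=
  ∀ (x : M) (z : Fin n → TangentSpace I x × V x) (m l : Fin n), m ≠ l → ∀ (u b : V x),
    Q x (update (update z m (graph L x u)) l (0, b)) = 0

lemma mixedSum_cons_cons (μ : Cochain I M F V n) {p q : ℕ} (h : p + q + 2 = n) (h' : p + q = n - 2)
    (hn : n - 2 + 1 + 1 = n) (x : M) (u b : V x)
    (v : Fin p → TangentSpace I x) (a : Fin q → V x) :
    mixedSum μ x ((Fin.cons (graph L x u) (Fin.cons (0, b) (pureArg h' v a)) :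
      Fin (n - 2 + 1 + 1) → TangentSpace I x × V x) ∘ Fin.cast hn.symm) =
      (μ p (q + 1) (by omega)).toFun x v (Fin.cons u (Fin.cons b a)) +
      (-1) ^ p * (μ (p + 1) q (by omega)).toFun x (Fin.cons (L.anchor x u) v) (Fin.cons b a) := by
  obtain ⟨k, rfl⟩ : ∃ k, n = k + 2 := ⟨n - 2, by omega⟩
  change p + q = k at h'
  change mixedSum μ x (Fin.cons (graph L x u) (Fin.cons (0, b) (pureArg h' v a)) :
      Fin (k + 1 + 1) → TangentSpace I x × V x) = _
  have hg : graph L x u = (L.anchor x u, 0) + (0, u) := by simp [graph]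
  have hadd := (mixedSum μ x).map_vecCons_add (Fin.cons (0, b) (pureArg h' v a))
    (L.anchor x u, 0) (0, u)
  rw [← hg] at hadd
  refine hadd.trans ?_
  have hmove : ∀ c, mixedSum μ x (Matrix.vecCons c (Fin.cons (0, b) (pureArg h' v a))) =
      (-1) ^ p * mixedSum μ x (Matrix.vecCons c
        (pureArg (show p + (q + 1) = k + 1 by omega) v (Fin.cons b a))) := fun c =>
    alt_cons_vert ((mixedSum μ x).curryLeft c) h' _ v b a
  rw [hmove, hmove, add_comm]
  congr 1
  · have h1 := alt_cons_vert (mixedSum μ x) (show p + (q + 1) = k + 1 by omega)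
      (show p + (q + 1 + 1) = k + 1 + 1 by omega) v u (Fin.cons b a)
    refine (congrArg ((-1 : ℝ) ^ p * ·) h1).trans ?_
    rw [mixedSum_pure μ (show p + (q + 1) + 1 = k + 2 by omega), ← mul_assoc, ← pow_add,
      Even.neg_one_pow ⟨p, rfl⟩, one_mul]
  · congr 1
    have h2 := pureArg_cons (show p + (q + 1) = k + 1 by omega)
      (show p + 1 + (q + 1) = k + 1 + 1 by omega) (L.anchor x u) v (Fin.cons b a)
    refine (congrArg (mixedSum μ x) h2.symm).trans ?_
    exact mixedSum_pure μ (show p + 1 + q + 1 = k + 2 by omega) x _ _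

lemma rescaled_sign (p n : ℕ) (h : p + 2 ≤ n) : (-1 : ℝ) ^ (∑ j ∈ Finset.Icc (p + 2) n, j) =
    (-1) ^ p * (-1) ^ (∑ j ∈ Finset.Icc (p + 1 + 2) n, j) := by
  have h1 : Finset.Icc (p + 2) n = insert (p + 2) (Finset.Icc (p + 1 + 2) n) := by
    ext j
    simp only [Finset.mem_Icc, Finset.mem_insert]
    omega
  rw [h1, sum_insert (by simp), pow_add, pow_add]
  norm_num

lemma algebraicRelation_rescaled_iff (μ : Cochain I M F V n) :
    AlgebraicRelation L (rescaled μ) ↔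
      ∀ (p q : ℕ) (h : p + q + 2 = n) (x : M) (v : Fin p → TangentSpace I x) (e₀ : V x)
        (e : Fin (q + 1) → V x), (μ p (q + 1) (by omega)).toFun x v (Fin.cons e₀ e) +
          (-1) ^ p * (μ (p + 1) q (by omega)).toFun x (Fin.cons (L.anchor x e₀) v) e = 0 := by
  refine forall_congr' fun p => forall_congr' fun q => forall_congr' fun h => forall_congr' fun x =>
    forall_congr' fun v => forall_congr' fun e₀ => forall_congr' fun e => ?_
  change (-1 : ℝ) ^ (∑ j ∈ Finset.Icc (p + 2) n, j) *
      (μ p (q + 1) (by omega)).toFun x v (Fin.cons e₀ e) =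
    -((-1 : ℝ) ^ (∑ j ∈ Finset.Icc (p + 1 + 2) n, j) *
      (μ (p + 1) q (by omega)).toFun x (Fin.cons (L.anchor x e₀) v) e) ↔ _
  rw [rescaled_sign p n (by omega)]
  set s := (-1 : ℝ) ^ (∑ j ∈ Finset.Icc (p + 1 + 2) n, j) with hs
  have hs0 : s ≠ 0 := pow_ne_zero _ (by norm_num)
  have hp : (-1 : ℝ) ^ p * (-1) ^ p = 1 := by rw [← pow_add, Even.neg_one_pow ⟨p, rfl⟩]
  have hp0 : (-1 : ℝ) ^ p ≠ 0 := pow_ne_zero _ (by norm_num)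
  constructor
  · intro h0
    refine mul_left_cancel₀ hs0 (mul_left_cancel₀ hp0 ?_)
    rw [mul_zero, mul_zero]
    linear_combination h0 + (s * (μ (p + 1) q (by omega)).toFun x (Fin.cons (L.anchor x e₀) v) e) * hp
  · intro h0
    linear_combination ((-1) ^ p * s) * h0 -
      (s * (μ (p + 1) q (by omega)).toFun x (Fin.cons (L.anchor x e₀) v) e) * hp

/-- Given two distinct indices, there is a permutation moving them to the first two positions. -/
lemma exists_perm_zero_one {k : ℕ} {m l : Fin (k + 2)} (h : m ≠ l) :
    ∃ τ : Equiv.Perm (Fin (k + 2)), τ 0 = m ∧ τ 1 = l := by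
  have h0 : Equiv.swap 0 m l ≠ 0 := fun h0 => h (by
    have := congrArg (Equiv.swap 0 m) h0
    simpa using this.symm)
  refine ⟨(Equiv.swap 1 (Equiv.swap 0 m l)).trans (Equiv.swap 0 m), ?_, ?_⟩
  · rw [Equiv.trans_apply, Equiv.swap_apply_of_ne_of_ne (by simp) h0.symm, Equiv.swap_apply_left]
  · rw [Equiv.trans_apply, Equiv.swap_apply_left, Equiv.swap_apply_self]

lemma graphNull_iff (μ : Cochain I M F V n) :
    GraphNull L (mixedSum μ) ↔ AlgebraicRelation L (rescaled μ) := by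
  rw [algebraicRelation_rescaled_iff]
  constructor
  · intro H p q h x v e₀ e
    obtain ⟨k, rfl⟩ : ∃ k, n = k + 2 := ⟨n - 2, by omega⟩
    have h1 := mixedSum_cons_cons (L := L) μ h (by omega) rfl x e₀ (e 0) v (Fin.tail e)
    rw [Fin.cons_self_tail] at h1
    rw [← h1]
    have h2 := H x (Fin.cons (graph L x e₀) (Fin.cons (0, e 0)
      (pureArg (show p + q = k by omega) v (Fin.tail e))) :
      Fin (k + 1 + 1) → TangentSpace I x × V x) 0 (Fin.succ 0) (by simp) e₀ (e 0)
    refine Eq.trans (congrArg (mixedSum μ x) (funext fun i => ?_)) h2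
    refine Fin.cases ?_ (fun i => Fin.cases ?_ (fun i => ?_) i) i
    · rw [update_of_ne (by simp), update_self]
      rfl
    · rw [update_self]
      rfl
    · rw [update_of_ne (fun h => by simpa using Fin.succ_injective _ h),
        update_of_ne (Fin.succ_ne_zero _)]
      rfl
  · intro H x z m l hml u b
    obtain ⟨k, rfl⟩ : ∃ k, n = k + 2 := ⟨n - 2, by
      have h1 := m.2; have h2 := l.2
      have h3 := Fin.val_ne_of_ne hml
      omega⟩
    obtain ⟨τ, h0, h1⟩ := exists_perm_zero_one hml
    set z' := update (update z m (graph L x u)) l (0, b) with hz'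
    have hp := (mixedSum μ x).map_perm z' τ
    have hz0 : z' ∘ τ = (Fin.cons (graph L x u) (Fin.cons (0, b) (fun i => z' (τ i.succ.succ))) :
        Fin (k + 1 + 1) → TangentSpace I x × V x) := by
      funext i
      refine Fin.cases ?_ (fun i => Fin.cases ?_ (fun i => ?_) i) i
      · rw [Function.comp_apply, h0, hz', update_of_ne hml, update_self]
        rfl
      · rw [Function.comp_apply]
        refine (congrArg z' h1).trans ?_
        rw [hz', update_self]
        rfl
      · rfl
    have hall : mixedSum μ x (z' ∘ τ) = 0 := by
      rw [hz0]
      refine eq_zero_of_pure (((mixedSum μ x).curryLeft (graph L x u)).curryLeft (0, b))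
        (fun p q h v a => ?_) _
      have h3 := mixedSum_cons_cons (L := L) μ (show p + q + 2 = k + 2 by omega) h rfl x u b v a
      exact h3.trans (H p q (by omega) x v u (Fin.cons b a))
    rw [hall] at hp
    exact (smul_eq_zero_iff_eq _).1 hp.symm

end MixedSum

section MixedVariation

variable {L cov}

lemma GraphNull.update_graph {n : ℕ} {Q : ∀ x : M, (TangentSpace I x × V x) [⋀^Fin n]→ₗ[ℝ] ℝ}
    (hQ : GraphNull L Q) (x : M) (z : Fin n → TangentSpace I x × V x) (m : Fin n) (u : V x) :
    Q x (update z m (graph L x u)) =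
      Q x (update (fun i => ((z i).1, 0)) m (graph L x u)) := by
  have key : ∀ s : Finset (Fin n), Q x (update z m (graph L x u)) =
      Q x (update (fun i => if i ∈ s then ((z i).1, 0) else z i) m (graph L x u)) := by
    intro s
    induction s using Finset.induction_on with
    | empty => simp
    | insert i s hi ih =>
      rw [ih]
      set z' : Fin n → TangentSpace I x × V x := fun i => if i ∈ s then ((z i).1, 0) else z i
        with hz'
      have h1 : (fun j => if j ∈ insert i s then ((z j).1, (0 : V x)) else z j) =
          update z' i ((z i).1, 0) := by
        funext j
        rcases eq_or_ne j i with rfl | hj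
        · simp
        · simp [hj, hz']
      rw [h1]
      rcases eq_or_ne m i with rfl | hm
      · rw [Function.update_idem]
      · rw [Function.update_comm hm.symm]
        have h2 : update z' m (graph L x u) = update
            (update z' m (graph L x u)) i (((z i).1, 0) + (0, (z i).2)) := by
          rw [Function.eq_update_iff]
          refine ⟨?_, fun _ _ => rfl⟩
          rw [update_of_ne hm.symm, hz']
          simp [hi]
        conv_lhs => rw [h2]
        rw [AlternatingMap.map_update_add, hQ x z' m i hm, add_zero]
  rw [key Finset.univ]
  simp

lemma mixedSum_update_graph {k : ℕ} {μ : Cochain I M F V (k + 1)}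
    (hQ : GraphNull L (mixedSum μ)) (x : M) (z : Fin (k + 1) → TangentSpace I x × V x)
    (m : Fin (k + 1)) (u : V x) :
    mixedSum μ x (update z m (graph L x u)) =
      (-1) ^ (m : ℕ) * ((-1) ^ k *
        (μ k 0 rfl).toFun x (fun a => (z (m.succAbove a)).1) (fun _ => u)) := by
  rw [hQ.update_graph]
  have hg : graph L x u = (L.anchor x u, 0) + (0, u) := by simp [graph]
  rw [hg, AlternatingMap.map_update_add]
  have h1 : update (fun i => ((z i).1, (0 : V x))) m (L.anchor x u, 0) =
      fun i => (update (fun i => (z i).1) m (L.anchor x u) i, 0) := by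
    funext i
    rcases eq_or_ne i m with rfl | hm
    · simp
    · simp [hm]
  rw [h1, mixedSum_tangent, zero_add, alt_update_eq_cons, smul_eq_mul]
  congr 1
  have h2 : (fun j => ((z (m.succAbove j)).1, (0 : V x))) =
      pureArg (add_zero k) (fun a => (z (m.succAbove a)).1) ![] := by
    funext i
    rw [pureArg, dif_pos i.2]
  rw [h2, alt_cons_vert _ _ (show k + (0 + 1) = k + 1 from rfl)]
  congr 1
  rw [mixedSum_pure μ (p := k) (q := 0) rfl]
  congr 1
  funext i
  obtain rfl : i = 0 := Fin.ext (by have := i.2; omega)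
  rw [Fin.cons_zero]

lemma mvfderiv_const_mul {f : M → ℝ} (c : ℝ) {x : M} (hf : MDifferentiableAt I 𝓘(ℝ, ℝ) f x)
    (v : TangentSpace I x) : mvfderiv I (fun y => c * f y) x v = c * mvfderiv I f x v :=
  mvfderiv_clm (c • ContinuousLinearMap.id ℝ ℝ) hf v

lemma covD_one {k : ℕ} (θ : EForm I M F V k 1) (W : Fin (k + 1) → ΓT)
    (e : ΓE) (x : M) : covD cov θ W (fun _ => e) x =
      ∑ i : Fin (k + 1), (-1 : ℝ) ^ (i : ℕ) *
        (mvfderiv I (fun y => θ.toFun y (fun a => W (i.succAbove a) y) (fun _ => e y)) x (W i x)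
        - θ.toFun x (fun a => W (i.succAbove a) x) (fun _ => cov (fun y => e y) x (W i x))
        - ∑ j : Fin k, if i < i.succAbove j then
            θ.toFun x (update (fun a => W (i.succAbove a) x) j
              (mlieBracket I (fun y => W i y) (fun y => W (i.succAbove j) y) x)) (fun _ => e x)
          else 0) := by
  have hu : ∀ (l : Fin 1) (u : V x), update (fun _ : Fin 1 => e x) l u = fun _ => u :=
    fun l u => by
      funext j
      rw [Subsingleton.elim j l, update_self]
  unfold covD
  simp only [Finset.univ_unique, Finset.sum_singleton, hu]

/-- If the alternating field of the mixed couplings vanishes on pairs (graph, vertical), then the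
terms of its variation other than the derivative along the canonical connection add up to the
exterior covariant derivative of the top component. -/
lemma variation_mixedSum {k : ℕ} {μ : Cochain I M F V (k + 1)}
    (hQ : GraphNull L (mixedSum μ)) (e : ΓE) (W : Fin (k + 1) → ΓT)
    (Y : Fin (k + 1) → ΓE) (x : M) :
    variation L cov (mixedSum μ) e W Y x =
      eDeriv L cov (fun x => (mixedSum μ x).toMultilinearMap) e W Y x -
        (-1) ^ k * covD cov (μ k 0 rfl) W (fun _ => e) x := by
  unfold variation
  have hd : ∀ m : Fin (k + 1), mvfderiv I (fun y => mixedSum μ y (update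
      (fun i => (W i y, Y i y)) m (graph L y (e y)))) x (W m x) =
      (-1) ^ (m : ℕ) * ((-1) ^ k * mvfderiv I (fun y => (μ k 0 rfl).toFun y
        (fun a => W (m.succAbove a) y) (fun _ => e y)) x (W m x)) := fun m => by
    have hs := contMDiff_mdifferentiableAt ((μ k 0 rfl).smooth (fun a => W (m.succAbove a))
      (fun _ => e)).contMDiffAt (x := x)
    have h1 := mvfderiv_const_mul ((-1) ^ (m : ℕ) * (-1) ^ k) hs (W m x)
    rw [← mul_assoc, ← h1]
    congr 2
    funext y
    rw [mixedSum_update_graph hQ, mul_assoc]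
  have hl : ∀ m, (∑ l, if m < l then mixedSum μ x (update (update
        (fun i => (W i x, Y i x)) m (graph L x (e x))) l
        (mlieBracket I (fun y => W m y) (fun y => W l y) x, 0)) else 0) =
      (-1) ^ (m : ℕ) * ((-1) ^ k * ∑ j, if m < m.succAbove j then
        (μ k 0 rfl).toFun x (update (fun a => W (m.succAbove a) x) j
          (mlieBracket I (fun y => W m y) (fun y => W (m.succAbove j) y) x)) (fun _ => e x)
        else 0) := fun m => by
    rw [Fin.sum_univ_succAbove _ m, if_neg (lt_irrefl m), zero_add, ← mul_assoc, mul_sum]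
    refine sum_congr rfl fun j _ => ?_
    split_ifs with h
    · rw [Function.update_comm (Fin.succAbove_ne m j).symm, mixedSum_update_graph hQ, mul_assoc]
      congr 4
      funext a
      rcases eq_or_ne a j with rfl | ha
      · simp
      · simp [ha]
    · simp
  simp_rw [hl, hd, mixedSum_update_graph hQ]
  rw [covD_one]
  rw [add_sub_assoc, add_assoc, ← sum_sub_distrib, ← sum_add_distrib]
  refine Eq.trans ?_ (sub_eq_add_neg _ _).symm
  rw [mul_sum, ← sum_neg_distrib]
  congr 1
  refine sum_congr rfl fun m _ => ?_
  ring

lemma mvfderiv_sum_mul {κ : Type} [Fintype κ] (c : κ → ℝ) {f : κ → M → ℝ} {x : M}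
    (hf : ∀ k, MDifferentiableAt I 𝓘(ℝ, ℝ) (f k) x) (v : TangentSpace I x) :
    mvfderiv I (fun y => ∑ k, c k * f k y) x v = ∑ k, c k * mvfderiv I (f k) x v := by
  have hk : ∀ k, HasMFDerivAt I 𝓘(ℝ, ℝ) (⇑(c k • ContinuousLinearMap.id ℝ ℝ) ∘ f k) x
      ((c k • ContinuousLinearMap.id ℝ ℝ).comp (mfderiv I 𝓘(ℝ, ℝ) (f k) x : EM →L[ℝ] ℝ)) :=
    fun k => ((c k • ContinuousLinearMap.id ℝ ℝ).hasMFDerivAt (x := f k x)).comp x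
      (hf k).hasMFDerivAt
  have h := HasMFDerivAt.sum (t := Finset.univ) fun k _ => hk k
  have h1 := h.mfderiv
  have h2 : (fun y => ∑ k, c k * f k y) =
      ∑ k, ⇑(c k • ContinuousLinearMap.id ℝ ℝ) ∘ f k := by
    funext y
    simp
  rw [h2]
  refine (congrArg (fun T : EM →L[ℝ] ℝ => T v) h1).trans ?_
  have h3 : ∀ s : Finset κ, (∑ k ∈ s, ((c k • ContinuousLinearMap.id ℝ ℝ).comp
      (mfderiv I 𝓘(ℝ, ℝ) (f k) x : EM →L[ℝ] ℝ))) v =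
      ∑ k ∈ s, c k * mvfderiv I (f k) x v := fun s => by
    rw [sum_apply]
    rfl
  exact h3 _

lemma smooth_mixedAlt {n p q : ℕ} (h : p + q = n) (μ : EForm I M F V p q) :
    MixedField.IsSmooth F (fun x => (mixedAlt h (μ.toFun x)).toMultilinearMap) := by
  intro W Y
  simp only [AlternatingMap.coe_multilinearMap, mixedAlt_apply]
  refine contMDiff_const.mul (contMDiff_finsetSum fun w _ => contMDiff_const.mul ?_)
  exact μ.smooth (fun i => W (w (splitEquiv h (.inl i)))) (fun i => Y (w (splitEquiv h (.inr i))))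

lemma smooth_mixedSum {n : ℕ} (μ : Cochain I M F V n) :
    MixedField.IsSmooth F (fun x => (mixedSum μ x).toMultilinearMap) := by
  intro W Y
  simp only [AlternatingMap.coe_multilinearMap, mixedSum_apply]
  exact contMDiff_finsetSum fun k _ => smooth_mixedAlt _ (μ k (n - 1 - k) (by omega)) W Y

lemma eDeriv_mixedAlt {n p q : ℕ} (h : p + q = n) (μ : EForm I M F V p q) (e : ΓE)
    (W : Fin n → ΓT) (Y : Fin n → ΓE) (x : M) :
    eDeriv L cov (fun x => (mixedAlt h (μ.toFun x)).toMultilinearMap) e W Y x =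
      ∑ w : Equiv.Perm (Fin n), ((1 / ((p.factorial : ℝ) * (q.factorial : ℝ))) *
        ((Equiv.Perm.sign w : ℤ) : ℝ)) *
        eDerivF L cov μ e (fun i => W (w (splitEquiv h (.inl i))))
          (fun j => Y (w (splitEquiv h (.inr j)))) x := by
  set c := 1 / ((p.factorial : ℝ) * (q.factorial : ℝ)) with hc
  have happ : ∀ y (z : Fin n → TangentSpace I y × V y), mixedAlt h (μ.toFun y) z =
      ∑ w : Equiv.Perm (Fin n), (c * ((Equiv.Perm.sign w : ℤ) : ℝ)) *
        mixedMul (μ.toFun y) (fun i => z (w (splitEquiv h i))) := fun y z => by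
    rw [mixedAlt_apply, mul_sum]
    exact sum_congr rfl fun w _ => by ring
  unfold eDeriv eDerivF
  simp only [AlternatingMap.coe_multilinearMap]
  have hmv : mvfderiv I (fun y => mixedAlt h (μ.toFun y) (fun i => (W i y, Y i y))) x
      (L.anchor x (e x)) = ∑ w : Equiv.Perm (Fin n), (c * ((Equiv.Perm.sign w : ℤ) : ℝ)) *
      mvfderiv I (fun y => μ.toFun y (fun i => W (w (splitEquiv h (.inl i))) y)
        (fun j => Y (w (splitEquiv h (.inr j))) y)) x (L.anchor x (e x)) := by
    rw [← mvfderiv_sum_mul _ fun w : Equiv.Perm (Fin n) => contMDiff_mdifferentiableAt (μ.smooth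
      (fun i => W (w (splitEquiv h (.inl i)))) (fun j => Y (w (splitEquiv h (.inr j))))).contMDiffAt]
    congr 2
    funext y
    rw [happ]
    rfl
  have hup : ∑ l, mixedAlt h (μ.toFun x) (update (fun i => (W i x, Y i x)) l
      (eConn L cov e (W l) x, eConnV L cov e (Y l) x)) =
      ∑ w : Equiv.Perm (Fin n), (c * ((Equiv.Perm.sign w : ℤ) : ℝ)) *
        ((∑ l, μ.toFun x (update (fun i => W (w (splitEquiv h (.inl i))) x) l
          (eConn L cov e (W (w (splitEquiv h (.inl l)))) x))
            (fun j => Y (w (splitEquiv h (.inr j))) x)) +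
        ∑ l, μ.toFun x (fun i => W (w (splitEquiv h (.inl i))) x) (update
          (fun j => Y (w (splitEquiv h (.inr j))) x) l
            (eConnV L cov e (Y (w (splitEquiv h (.inr l)))) x))) := by
    simp_rw [happ]
    rw [sum_comm]
    refine sum_congr rfl fun w _ => ?_
    rw [← mul_sum]
    congr 1
    rw [← Equiv.sum_comp ((splitEquiv h).trans w), Fintype.sum_sum_type]
    have hupd : ∀ (i : Fin p ⊕ Fin q) (u : TangentSpace I x × V x),
        (fun j => update (fun i => (W i x, Y i x)) (((splitEquiv h).trans w) i) u
          (w (splitEquiv h j))) = update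
            (fun j => (W (w (splitEquiv h j)) x, Y (w (splitEquiv h j)) x)) i u := fun i u =>
      Function.update_comp_eq_of_injective _ ((splitEquiv h).trans w).injective i u
    simp_rw [hupd]
    congr 1
    · refine sum_congr rfl fun l _ => ?_
      change μ.toFun x _ _ = _
      congr 1
      · congr 1
        funext i
        rcases eq_or_ne i l with rfl | hi
        · simp
        · simp [hi]
    · refine sum_congr rfl fun l _ => ?_
      change μ.toFun x _ _ = _
      congr 1
      funext i
      rcases eq_or_ne i l with rfl | hi
      · simp
      · simp [hi]
  rw [hmv, hup, ← sum_sub_distrib]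
  exact sum_congr rfl fun w _ => by ring

lemma eDeriv_mixedSum {n : ℕ} (μ : Cochain I M F V n) (e : ΓE)
    (W : Fin n → ΓT) (Y : Fin n → ΓE) (x : M) :
    eDeriv L cov (fun x => (mixedSum μ x).toMultilinearMap) e W Y x =
      ∑ k : Fin n, eDeriv L cov (fun x => (mixedAlt (show (k : ℕ) + (n - 1 - k + 1) = n by omega)
        ((μ k (n - 1 - k) (by omega)).toFun x)).toMultilinearMap) e W Y x := by
  unfold eDeriv
  simp only [AlternatingMap.coe_multilinearMap]
  rw [sum_sub_distrib, sum_comm]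
  congr 1
  · have h1 := mvfderiv_sum_mul (I := I) (fun _ : Fin n => (1 : ℝ)) (fun k => contMDiff_mdifferentiableAt
      (smooth_mixedAlt (show (k : ℕ) + (n - 1 - k + 1) = n by omega)
        (μ k (n - 1 - k) (by omega)) W Y).contMDiffAt) (x := x) (L.anchor x (e x))
    simp only [one_mul, AlternatingMap.coe_multilinearMap] at h1
    rw [← h1]
    congr 2
    funext y
    rw [mixedSum_apply]
  · exact sum_congr rfl fun l _ => mixedSum_apply _ _ _

lemma eDeriv_mixedSum_eq_zero {n : ℕ} {μ : Cochain I M F V n} 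
    (h : ∀ (p q : ℕ) (hpq : p + q + 1 = n) (e : ΓE) (v : Fin p → ΓT)
      (a : Fin (q + 1) → ΓE) (x : M), eDerivF L cov (μ p q hpq) e v a x = 0)
    (e : ΓE) (W : Fin n → ΓT) (Y : Fin n → ΓE) (x : M) :
    eDeriv L cov (fun x => (mixedSum μ x).toMultilinearMap) e W Y x = 0 := by
  rw [eDeriv_mixedSum]
  refine sum_eq_zero fun k _ => ?_
  rw [eDeriv_mixedAlt]
  refine sum_eq_zero fun w _ => ?_
  rw [h, mul_zero]

/-- The derivative of the mixed field along the canonical connection determines the derivatives of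
the components. -/
lemma exists_eDeriv_mixedSum_eq {n p q : ℕ} (μ : Cochain I M F V n) (h : p + q + 1 = n)
    (e : ΓE) (v : Fin p → ΓT) (a : Fin (q + 1) → ΓE) :
    ∃ (W : Fin n → ΓT) (Y : Fin n → ΓE), ∀ x,
      eDeriv L cov (fun x => (mixedSum μ x).toMultilinearMap) e W Y x =
        eDerivF L cov (μ p q h) e v a x := by
  have h' : p + (q + 1) = n := h
  refine ⟨fun i => if hi : (i : ℕ) < p then v ⟨i, hi⟩ else 0,
    fun i => if hi : (i : ℕ) < p then 0 else a ⟨i - p, by omega⟩, fun x => ?_⟩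
  set W : Fin n → ΓT := fun i => if hi : (i : ℕ) < p then v ⟨i, hi⟩ else 0
  set Y : Fin n → ΓE := fun i => if hi : (i : ℕ) < p then 0 else a ⟨i - p, by omega⟩
  have hW : ∀ i, W (splitEquiv h' (.inl i)) = v i := fun i => by simp [W, splitEquiv]
  have hW' : ∀ j, W (splitEquiv h' (.inr j)) = 0 := fun i => by simp [W, splitEquiv]
  have hY : ∀ i, Y (splitEquiv h' (.inl i)) = 0 := fun i => by simp [Y, splitEquiv]
  have hY' : ∀ j, Y (splitEquiv h' (.inr j)) = a j := fun i => by simp [Y, splitEquiv]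
  have hpure : ∀ y, (fun i => (W i y, Y i y)) = pureArg h' (fun i => v i y) (fun j => a j y) := by
    intro y
    funext i
    obtain ⟨m, rfl⟩ := (splitEquiv h').surjective i
    rcases m with m | m
    · rw [pureArg_inl, hW, hY]; rfl
    · rw [pureArg_inr, hW', hY']; rfl
  have c0 : eConn L cov e 0 x = 0 := by
    unfold eConn
    have h1 : mlieBracket I (fun y => L.anchor y (e y)) (fun y => (0 : ΓT) y) x = 0 :=
      congrFun mlieBracket_zero_right x
    have h2 : cov (fun y => e y) x ((0 : ΓT) x) = 0 := map_zero _
    rw [h1, h2, map_zero, add_zero]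
  have cV0 : eConnV L cov e 0 x = 0 := by
    unfold eConnV
    have h1 : (0 : ΓE) x = 0 := rfl
    rw [map_zero, h1, map_zero, map_zero, add_zero]
  unfold eDeriv eDerivF
  simp only [AlternatingMap.coe_multilinearMap, hpure]
  rw [← Equiv.sum_comp (splitEquiv h'), Fintype.sum_sum_type, sub_sub]
  simp only [hW, hW', hY, hY', c0, cV0]
  simp_rw [mixedSum_pure μ h]
  congr 1
  congr 1
  · refine sum_congr rfl fun l _ => ?_
    rw [← mixedSum_pure μ h]
    congr 1
    funext i
    obtain ⟨m, rfl⟩ := (splitEquiv h').surjective i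
    rcases m with m | m
    · rw [pureArg_inl]
      rcases eq_or_ne m l with rfl | hm
      · simp
      · rw [update_of_ne (by simpa using hm), pureArg_inl, update_of_ne hm]
    · rw [pureArg_inr, update_of_ne (by simp), pureArg_inr]
  · refine sum_congr rfl fun l _ => ?_
    rw [← mixedSum_pure μ h]
    congr 1
    funext i
    obtain ⟨m, rfl⟩ := (splitEquiv h').surjective i
    rcases m with m | m
    · rw [pureArg_inl, update_of_ne (by simp), pureArg_inl]
    · rw [pureArg_inr]
      rcases eq_or_ne m l with rfl | hm
      · simp
      · rw [update_of_ne (by simpa using hm), pureArg_inr, update_of_ne hm]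

end MixedVariation

end Boundaryless

/-! ### Integration of densities in coordinates -/

variable {m : ℕ} {HN : Type*} [TopologicalSpace HN]
  {J : ModelWithCorners ℝ (𝔼 m) HN} {N : Type*} [TopologicalSpace N]
  [ChartedSpace HN N]

local notation "χⱼ" => extChartAt J

/-- A family of functions on frames transforms as a density if it is multiplied by `|det A|` under
a linear substitution `A` of the frame. -/
def IsDensity (D : ∀ x : N, (Fin m → TangentSpace J x) → ℝ) : Prop :=
  ∀ (x : N) (b : Fin m → TangentSpace J x) (A : Matrix (Fin m) (Fin m) ℝ),
    D x (fun j => ∑ i, A i j • b i) = |A.det| * D x b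

/-- The matrix of an endomorphism of `ℝ^m`. -/
def matrixOf (f : 𝔼 m →L[ℝ] 𝔼 m) :
    Matrix (Fin m) (Fin m) ℝ := Matrix.of fun i j => f (single j 1) i

lemma det_matrixOf (f : 𝔼 m →L[ℝ] 𝔼 m) :
    (matrixOf f).det = f.det := by
  rw [ContinuousLinearMap.det, ← LinearMap.det_toMatrix (EuclideanSpace.basisFun (Fin m) ℝ).toBasis]
  refine congrArg Matrix.det ?_
  ext i j
  simp [matrixOf, LinearMap.toMatrix_apply]

lemma euclidean_eq_sum (v : 𝔼 m) :
    v = ∑ i, v i • single i (1 : ℝ) := by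
  have := (EuclideanSpace.basisFun (Fin m) ℝ).sum_repr v
  simpa using this.symm

lemma map_single_eq_sum {G : Type*} [AddCommGroup G] [Module ℝ G]
    (f : 𝔼 m →L[ℝ] 𝔼 m)
    (T : 𝔼 m →ₗ[ℝ] G) (j : Fin m) :
    T (f (single j 1)) =
      ∑ i, matrixOf f i j • T (single i 1) := by
  conv_lhs => rw [euclidean_eq_sum (f (single j 1)), map_sum]
  simp [matrixOf]

variable [IsManifold J ∞ N]

lemma infty_ne_zero : (∞ : WithTop ℕ∞) ≠ 0 := by simp

variable (J) in
/-- The derivative at `y` of the coordinate change from the chart at `j` to the chart at `i`. -/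
def coordChange (i j : N) (y : 𝔼 m) :
    𝔼 m →L[ℝ] 𝔼 m :=
  (mfderiv J 𝓘(ℝ, 𝔼 m) (χⱼ i) ((χⱼ j).symm y) :
      𝔼 m →L[ℝ] 𝔼 m).comp
    (mfderivWithin 𝓘(ℝ, 𝔼 m) J (χⱼ j).symm (Set.range J) y :
      𝔼 m →L[ℝ] 𝔼 m)

lemma hasFDerivWithinAt_coordChange {i j : N} {y : 𝔼 m}
    (hy : y ∈ (χⱼ j).target) (hi : (χⱼ j).symm y ∈ (chartAt HN i).source) :
    HasFDerivWithinAt (fun z => χⱼ i ((χⱼ j).symm z))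
      (coordChange J i j y) (Set.range J) y := by
  have h1 := (mdifferentiableWithinAt_extChartAt_symm hy (I := J)).hasMFDerivWithinAt
  have h2 := (mdifferentiableAt_extChartAt hi (I := J)).hasMFDerivAt
  exact hasMFDerivWithinAt_iff_hasFDerivWithinAt.1 (h2.comp_hasMFDerivWithinAt y h1)

lemma coordFrame_eq_sum {i j : N} {y : 𝔼 m}
    (hi : (χⱼ j).symm y ∈ (chartAt HN i).source)
    (a : Fin m) :
    (coordFrame J j y a : 𝔼 m) =
      ∑ b, matrixOf (coordChange J i j y) b a •
        (coordFrame J i (χⱼ i ((χⱼ j).symm y)) b : 𝔼 m) := by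
  have h := mfderivWithin_extChartAt_symm_comp_mfderiv_extChartAt' (I := J)
    (x := i) (y := (χⱼ j).symm y) (by rwa [extChartAt_source])
  let T : 𝔼 m →L[ℝ] 𝔼 m :=
    mfderivWithin 𝓘(ℝ, 𝔼 m) J
      (χⱼ i).symm (Set.range J) (χⱼ i ((χⱼ j).symm y))
  refine Eq.trans ?_ (map_single_eq_sum (coordChange J i j y) T.toLinearMap a)
  exact (congrArg (fun T : 𝔼 m →L[ℝ] 𝔼 m =>
    T (coordFrame J j y a)) h).symm

variable [T2Space N] [CompactSpace N]

variable (J N) in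
lemma finite_chartPartition : {i : N | (Function.support (chartPartition J (N := N) i)).Nonempty}.Finite :=
  (chartPartition J (N := N)).locallyFinite.finite_nonempty_of_compact

variable (J N) in
/-- The finitely many charts that carry the partition of unity. -/
def chartIndices : Finset N := (finite_chartPartition J N).toFinset

lemma chartPartition_eq_zero {i : N} (hi : i ∉ chartIndices J N) (x : N) :
    chartPartition J (N := N) i x = 0 := by
  by_contra h
  exact hi ((finite_chartPartition J N).mem_toFinset.2 ⟨x, h⟩)

lemma sum_chartPartition (x : N) : ∑ i ∈ chartIndices J N, chartPartition J (N := N) i x = 1 := by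
  rw [← (chartPartition J (N := N)).sum_eq_one (Set.mem_univ x), finsum_eq_sum_of_support_subset]
  intro i hi
  by_contra h
  exact hi (chartPartition_eq_zero h x)

lemma chartPartition_tsupport (i : N) :
    tsupport (chartPartition J (N := N) i) ⊆ (chartAt HN i).source :=
  (SmoothPartitionOfUnity.exists_isSubordinate_chartAt_source J N).choose_spec i

lemma chartPartition_eq_zero_of_notMem {i x : N} (hx : x ∉ (chartAt HN i).source) :
    chartPartition J (N := N) i x = 0 := by
  by_contra h
  exact hx (chartPartition_tsupport i (subset_tsupport _ h))

lemma integralDensity_eq_sum (D : ∀ x : N, (Fin m → TangentSpace J x) → ℝ) :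
    integralDensity J D = ∑ i ∈ chartIndices J N, ∫ y in (χⱼ i).target,
      chartPartition J (N := N) i ((χⱼ i).symm y)
        * D ((χⱼ i).symm y) (coordFrame J i y) := by
  rw [integralDensity, finsum_eq_sum_of_support_subset]
  intro i hi
  by_contra h
  exact hi (by simp [chartPartition_eq_zero h])

lemma measurableSet_extChartAt_target_inter (j : N) {O : Set N} (hO : IsOpen O) :
    MeasurableSet ((χⱼ j).target ∩ (χⱼ j).symm ⁻¹' O) := by
  have ht : MeasurableSet (χⱼ j).target := by
    rw [extChartAt_target]
    exact ((chartAt HN j).open_target.preimage J.continuous_symm).measurableSet.inter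
      J.isClosed_range.measurableSet
  obtain ⟨u, hu, h⟩ := continuousOn_iff'.1 (continuousOn_extChartAt_symm (I := J) j) O hO
  rw [Set.inter_comm, h]
  exact hu.measurableSet.inter ht

/-- Integration of a density supported in an open set `O` that is parametrized by an injective map
`κ` to `ℝ^m`: the chosen charts and partition of unity can be replaced by `κ`. -/
lemma integralDensity_eq_setIntegral {D : ∀ x : N, (Fin m → TangentSpace J x) → ℝ}
    {O : Set N} (hO : IsOpen O) (hD : ∀ x ∉ O, ∀ b, D x b = 0)
    {κ : N → 𝔼 m} (hκ : Set.InjOn κ O) {g : 𝔼 m → ℝ}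
    (hg : IntegrableOn g (κ '' O))
    (hf : ∀ j, ∀ y ∈ (χⱼ j).target, (χⱼ j).symm y ∈ O →
      ∃ f' : 𝔼 m →L[ℝ] 𝔼 m,
        HasFDerivWithinAt (fun z => κ ((χⱼ j).symm z)) f'
          ((χⱼ j).target ∩ (χⱼ j).symm ⁻¹' O) y ∧
        D ((χⱼ j).symm y) (coordFrame J j y) =
          |f'.det| * g (κ ((χⱼ j).symm y))) :
    (∀ j, IntegrableOn (fun y => chartPartition J (N := N) j ((χⱼ j).symm y)
        * D ((χⱼ j).symm y) (coordFrame J j y)) (χⱼ j).target) ∧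
    integralDensity J D = ∫ y in κ '' O, g y := by
  classical
  set p := chartPartition J (N := N) with hp
  choose! f' hf' hDf using hf
  set s : N → Set (𝔼 m) := fun j =>
    (χⱼ j).target ∩ (χⱼ j).symm ⁻¹' O with hs
  have hsm : ∀ j, MeasurableSet (s j) := fun j => measurableSet_extChartAt_target_inter j hO
  have hinj : ∀ j, Set.InjOn (fun z => κ ((χⱼ j).symm z)) (s j) := fun j y hy z hz h =>
    (χⱼ j).symm.injOn hy.1 hz.1 (hκ hy.2 hz.2 h)
  have hder : ∀ j, ∀ y ∈ s j, HasFDerivWithinAt (fun z => κ ((χⱼ j).symm z)) (f' j y)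
      (s j) y := fun j y hy => hf' j y hy.1 hy.2
  have himg : ∀ j, (fun z => κ ((χⱼ j).symm z)) '' s j =
      κ '' (O ∩ (chartAt HN j).source) := fun j => by
    ext w
    constructor
    · rintro ⟨y, hy, rfl⟩
      exact ⟨_, ⟨hy.2, by rw [← extChartAt_source J]; exact (χⱼ j).map_target hy.1⟩, rfl⟩
    · rintro ⟨x, hx, rfl⟩
      have hx2 : x ∈ (χⱼ j).source := by rw [extChartAt_source]; exact hx.2
      refine ⟨χⱼ j x, ⟨(χⱼ j).map_source hx2, ?_⟩, ?_⟩
      · rw [Set.mem_preimage, (χⱼ j).left_inv hx2]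
        exact hx.1
      · exact congrArg κ ((χⱼ j).left_inv hx2)
  rcases isEmpty_or_nonempty N with hN | hN
  · refine ⟨fun j => (hN.false j).elim, ?_⟩
    rw [integralDensity_eq_sum, sum_eq_zero fun i _ => (hN.false i).elim,
      Set.eq_empty_of_isEmpty O]
    simp
  set q : N → 𝔼 m → ℝ := fun j w => p j (Function.invFunOn κ O w) with hq
  have hqκ : ∀ j, ∀ x ∈ O, q j (κ x) = p j x := fun j x hx => by
    have h : ∃ a ∈ O, κ a = κ x := ⟨x, hx, rfl⟩
    simp only [hq]
    rw [hκ (Function.invFunOn_mem h) hx (Function.invFunOn_eq h)]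
  have hcont : ∀ j, ContinuousOn (fun y => p j ((χⱼ j).symm y)) (s j) := fun j =>
    ((p j).contMDiff.continuous.comp_continuousOn (continuousOn_extChartAt_symm (I := J) j)).mono
      Set.inter_subset_left
  have hgs : ∀ j, IntegrableOn (fun y => |(f' j y).det| • g (κ ((χⱼ j).symm y))) (s j) :=
    fun j => (integrableOn_image_iff_integrableOn_abs_det_fderiv_smul volume (hsm j) (hder j)
      (hinj j) g).1 (by rw [himg]; exact hg.mono_set (Set.image_mono Set.inter_subset_left))
  have hpgs : ∀ j, IntegrableOn (fun y => p j ((χⱼ j).symm y) *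
      (|(f' j y).det| • g (κ ((χⱼ j).symm y)))) (s j) := fun j => by
    refine Integrable.bdd_mul (c := 1) (hgs j) ((hcont j).aestronglyMeasurable (hsm j)) ?_
    refine Filter.Eventually.of_forall fun y => ?_
    rw [Real.norm_of_nonneg (p.nonneg j _)]
    exact p.le_one j _
  have hEq : ∀ j, Set.EqOn (fun y => p j ((χⱼ j).symm y)
        * D ((χⱼ j).symm y) (coordFrame J j y))
      (fun y => p j ((χⱼ j).symm y) *
      (|(f' j y).det| • g (κ ((χⱼ j).symm y)))) (s j) := fun j y hy => by
    simp only [smul_eq_mul]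
    rw [hDf j y hy.1 hy.2]
  have hzero : ∀ j, ∀ y ∈ (χⱼ j).target \ s j, p j ((χⱼ j).symm y)
        * D ((χⱼ j).symm y) (coordFrame J j y) = 0 := fun j y hy => by
    rw [hD _ (fun h => hy.2 ⟨hy.1, h⟩), mul_zero]
  have htm : ∀ j, MeasurableSet (χⱼ j).target := fun j => by
    simpa using measurableSet_extChartAt_target_inter (J := J) j (isOpen_univ (X := N))
  have hgq : ∀ j, IntegrableOn (fun w => q j w * g w) (κ '' (O ∩ (chartAt HN j).source)) ∧
      ∫ w in κ '' (O ∩ (chartAt HN j).source), q j w * g w =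
        ∫ y in s j, p j ((χⱼ j).symm y) *
          (|(f' j y).det| • g (κ ((χⱼ j).symm y))) := fun j => by
    have hEq2 : Set.EqOn (fun y => |(f' j y).det| • (q j (κ ((χⱼ j).symm y)) *
        g (κ ((χⱼ j).symm y)))) (fun y => p j ((χⱼ j).symm y) *
      (|(f' j y).det| • g (κ ((χⱼ j).symm y)))) (s j) := fun y hy => by
      simp only [smul_eq_mul]
      rw [hqκ j _ hy.2]
      ring
    rw [← himg]
    constructor
    · rw [integrableOn_image_iff_integrableOn_abs_det_fderiv_smul volume (hsm j) (hder j) (hinj j)]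
      exact (integrableOn_congr_fun hEq2 (hsm j)).2 (hpgs j)
    · rw [integral_image_eq_integral_abs_det_fderiv_smul volume (hsm j) (hder j) (hinj j)]
      exact setIntegral_congr_fun (hsm j) hEq2
  have hOm : ∀ j, MeasurableSet (κ '' (O ∩ (chartAt HN j).source)) := fun j => by
    rw [← himg]
    exact measurable_image_of_fderivWithin (hsm j) (hder j) (hinj j)
  have hUm : MeasurableSet (κ '' O) := by
    have : κ '' O = ⋃ j ∈ chartIndices J N, κ '' (O ∩ (chartAt HN j).source) := by
      rw [← Set.image_iUnion₂, ← Set.inter_iUnion₂]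
      congr 1
      refine (Set.inter_eq_left.2 fun x _ => ?_).symm
      by_contra h
      refine zero_ne_one ((sum_eq_zero fun i hi => ?_).symm.trans (sum_chartPartition (J := J) x))
      exact chartPartition_eq_zero_of_notMem fun h' => h (Set.mem_iUnion₂.2 ⟨i, hi, h'⟩)
    rw [this]
    exact Finset.measurableSet_biUnion _ fun j _ => hOm j
  have hzq : ∀ j, ∀ w ∈ κ '' O \ κ '' (O ∩ (chartAt HN j).source), q j w * g w = 0 := by
    rintro j w ⟨⟨x, hx, rfl⟩, h2⟩
    rw [hqκ j x hx, hp, chartPartition_eq_zero_of_notMem (fun h => h2 ⟨x, ⟨hx, h⟩, rfl⟩), zero_mul]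
  have hgq' : ∀ j, IntegrableOn (fun w => q j w * g w) (κ '' O) := fun j =>
    (hgq j).1.of_forall_sdiff_eq_zero hUm (hzq j)
  refine ⟨fun j => ?_, ?_⟩
  · refine IntegrableOn.of_forall_sdiff_eq_zero ?_ (htm j) (hzero j)
    exact (integrableOn_congr_fun (hEq j) (hsm j)).2 (hpgs j)
  · rw [integralDensity_eq_sum]
    have h1 : ∀ j, ∫ y in (χⱼ j).target, p j ((χⱼ j).symm y)
        * D ((χⱼ j).symm y) (coordFrame J j y) = ∫ w in κ '' O, q j w * g w := fun j => by
      rw [setIntegral_eq_of_subset_of_forall_sdiff_eq_zero (htm j) Set.inter_subset_left (hzero j),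
        setIntegral_eq_of_subset_of_forall_sdiff_eq_zero hUm
          (Set.image_mono Set.inter_subset_left) (hzq j), (hgq j).2]
      exact setIntegral_congr_fun (hsm j) (hEq j)
    rw [sum_congr rfl fun j _ => h1 j, ← integral_finsetSum _ fun j _ => hgq' j]
    refine setIntegral_congr_fun hUm ?_
    rintro w ⟨x, hx, rfl⟩
    simp only
    rw [← sum_mul, sum_congr rfl fun j _ => hqκ j x hx, sum_chartPartition, one_mul]

lemma IsDensity.apply_coordFrame {D : ∀ x : N, (Fin m → TangentSpace J x) → ℝ} (hD : IsDensity D)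
    {i j : N} {y : 𝔼 m} (hi : (χⱼ j).symm y ∈ (chartAt HN i).source) :
    D ((χⱼ j).symm y) (coordFrame J j y) =
      |(coordChange J i j y).det| *
      D ((χⱼ i).symm (χⱼ i ((χⱼ j).symm y)))
        (coordFrame J i (χⱼ i ((χⱼ j).symm y))) := by
  have h1 := congrArg (D ((χⱼ j).symm y))
    (funext fun a => coordFrame_eq_sum (J := J) hi a)
  refine h1.trans ?_
  refine (hD _ _ _).trans (congrArg₂ (· * ·) (congrArg abs (det_matrixOf _)) ?_)
  have h2 : (χⱼ i).symm (χⱼ i ((χⱼ j).symm y)) =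
      (χⱼ j).symm y := (χⱼ i).left_inv (by rwa [extChartAt_source])
  exact (congrArg (fun x => (D x : (Fin m → 𝔼 m) → ℝ)
    (coordFrame J i (χⱼ i ((χⱼ j).symm y)))) h2).symm

/-- A density supported in the domain of a chart can be integrated in that chart. -/
lemma IsDensity.integralDensity_eq {D : ∀ x : N, (Fin m → TangentSpace J x) → ℝ}
    (hD : IsDensity D) (i : N) (h0 : ∀ x ∉ (chartAt HN i).source, ∀ b, D x b = 0)
    (hg : IntegrableOn (fun y => D ((χⱼ i).symm y) (coordFrame J i y))
      (χⱼ i).target) :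
    (∀ j, IntegrableOn (fun y => chartPartition J (N := N) j ((χⱼ j).symm y)
        * D ((χⱼ j).symm y) (coordFrame J j y)) (χⱼ j).target) ∧
    integralDensity J D = ∫ y in (χⱼ i).target,
      D ((χⱼ i).symm y) (coordFrame J i y) := by
  have himg : χⱼ i '' (chartAt HN i).source = (χⱼ i).target := by
    rw [← extChartAt_source J, (χⱼ i).image_source_eq_target]
  have h := integralDensity_eq_setIntegral (D := D) (chartAt HN i).open_source h0
    (κ := χⱼ i) (g := fun y => D ((χⱼ i).symm y) (coordFrame J i y))
    (by rw [← extChartAt_source J]; exact (χⱼ i).injOn) (by rwa [himg])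
    (fun j y hy hi => ⟨_, (hasFDerivWithinAt_coordChange hy hi).mono
      (Set.inter_subset_left.trans (extChartAt_target_subset_range j)),
      hD.apply_coordFrame hi⟩)
  rwa [himg] at h

/-! ### The divergence theorem in Euclidean space and in a half-space -/

section Divergence

/-- The closed half-space `x_0 ≥ 0`. -/
abbrev halfSpace (n : ℕ) : Set (𝔼 (n + 1)) := {x | 0 ≤ x 0}

lemma uniqueDiffOn_halfSpace (n : ℕ) : UniqueDiffOn ℝ (halfSpace n) := by
  have := (𝓡∂ (n + 1)).uniqueDiffOn
  rwa [range_modelWithCornersEuclideanHalfSpace] at this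

lemma fderivWithin_eq_zero_of_notMem_tsupport {E : Type*} [NormedAddCommGroup E] [NormedSpace ℝ E]
    {f : E → ℝ} {s : Set E} {x : E} (hx : x ∉ tsupport f) : fderivWithin ℝ f s x = 0 := by
  have h : f =ᶠ[𝓝 x] fun _ => 0 := notMem_tsupport_iff_eventuallyEq.1 hx
  rw [(h.filter_mono nhdsWithin_le_nhds).fderivWithin_eq h.self_of_nhds]
  simp

lemma integral_fderiv_eq_zero {E : Type*} [NormedAddCommGroup E] [NormedSpace ℝ E]
    [MeasurableSpace E] [BorelSpace E] [FiniteDimensional ℝ E] (μ : Measure E)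
    [μ.IsAddHaarMeasure] {f : E → ℝ} (hf : ContDiff ℝ 1 f) (hc : HasCompactSupport f) (v : E) :
    ∫ x, fderiv ℝ f x v ∂μ = 0 := by
  have h := integral_bilinear_hasFDerivAt_right_eq_neg_left_of_integrable (μ := μ)
    (f := fun _ : E => (1 : ℝ)) (f' := fun _ => 0) (g := f) (g' := fun x => fderiv ℝ f x) (v := v)
    (B := ContinuousLinearMap.mul ℝ ℝ) (by simp)
    (by
      simp only [ContinuousLinearMap.mul_apply', one_mul]
      refine Continuous.integrable_of_hasCompactSupport ?_ ?_
      · exact (hf.continuous_fderiv one_ne_zero).clm_apply continuous_const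
      · exact hc.fderiv_apply (𝕜 := ℝ) v)
    (by simpa using hf.continuous.integrable_of_hasCompactSupport hc)
    (fun x _ => hasFDerivAt_const _ _) (fun x _ => (hf.differentiable one_ne_zero x).hasFDerivAt)
  simpa using h

lemma continuousOn_fderivWithin_halfSpace {n : ℕ} {f : 𝔼 (n + 1) → ℝ}
    (hf : ContDiffOn ℝ 1 f (halfSpace n)) (v : 𝔼 (n + 1)) :
    ContinuousOn (fun x => fderivWithin ℝ f (halfSpace n) x v) (halfSpace n) :=
  (hf.continuousOn_fderivWithin (uniqueDiffOn_halfSpace n) le_rfl).clm_apply continuousOn_const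

/-- The divergence theorem for compactly supported functions in the half-space `x_0 ≥ 0`. -/
lemma integral_halfSpace_divergence {n : ℕ}
    (f : Fin (n + 1) → 𝔼 (n + 1) → ℝ)
    (hf : ∀ m, ContDiffOn ℝ 1 (f m) (halfSpace n)) (hc : ∀ m, HasCompactSupport (f m)) :
    ∫ y in halfSpace n, ∑ m, fderivWithin ℝ (f m) (halfSpace n) y (single m 1) =
      - ∫ y : 𝔼 n, f 0 (WithLp.toLp 2 (Fin.cons 0 y)) := by
  obtain ⟨R, hR⟩ : ∃ R : ℝ, ∀ m, ∀ x ∈ tsupport (f m), ∀ i, |x i| < R := by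
    have hK : IsCompact (⋃ m, tsupport (f m)) := isCompact_iUnion hc
    obtain ⟨R, hR⟩ := hK.isBounded.exists_norm_le
    refine ⟨R + 1, fun m x hx i => ?_⟩
    have h1 := hR x (Set.mem_iUnion.2 ⟨m, hx⟩)
    have h2 := PiLp.norm_apply_le x i
    rw [Real.norm_eq_abs] at h2
    linarith
  set R' := max R 1
  have hR' : ∀ m, ∀ x ∈ tsupport (f m), ∀ i, |x i| < R' := fun m x hx i =>
    (hR m x hx i).trans_le (le_max_left _ _)
  have hR0 : 0 < R' := lt_of_lt_of_le one_pos (le_max_right _ _)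
  have hz : ∀ m x, (∃ i, R' ≤ |x i|) → f m x = 0 := by
    rintro m x ⟨i, hi⟩
    by_contra h
    exact absurd (hR' m x (subset_tsupport _ h) i) (not_lt.2 hi)
  set a : Fin (n + 1) → ℝ := Fin.cons 0 (fun _ => -R') with ha
  set b : Fin (n + 1) → ℝ := fun _ => R' with hb
  have hab : a ≤ b := by
    intro i
    refine Fin.cases ?_ (fun j => ?_) i
    · simpa [ha, hb] using hR0.le
    · simp only [ha, hb, Fin.cons_succ]; linarith
  set T : (Fin (n + 1) → ℝ) ≃L[ℝ] 𝔼 (n + 1) :=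
    (EuclideanSpace.equiv (Fin (n + 1)) ℝ).symm with hT
  have hTa : ∀ x, T x = WithLp.toLp 2 x := fun x => rfl
  have hmem : ∀ x ∈ Set.Icc a b, T x ∈ halfSpace n := fun x hx => by
    have h : (0 : ℝ) ≤ x 0 := hx.1 0
    exact h
  have hTs : ∀ i, T (Pi.single i 1) = single i 1 := fun i => rfl
  have hdiv := integral_divergence_of_hasFDerivAt_off_countable a b hab
    (fun x m => f m (T x))
    (fun x => ContinuousLinearMap.pi fun m =>
      (fderivWithin ℝ (f m) (halfSpace n) (T x)).comp (T : (Fin (n + 1) → ℝ) →L[ℝ] _))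
    ∅ Set.countable_empty
    (continuousOn_pi.2 fun m => (hf m).continuousOn.comp T.continuous.continuousOn hmem)
    (by
      rintro x ⟨hx, -⟩
      refine hasFDerivAt_pi.2 fun m => ?_
      have hx0 : 0 < (T x) 0 := by
        have h : (0 : ℝ) < x 0 := (hx 0 (Set.mem_univ _)).1
        exact h
      have hnh : halfSpace n ∈ 𝓝 (T x) := by
        have hco : Continuous fun z : 𝔼 (n + 1) => z 0 := by fun_prop
        exact Filter.mem_of_superset ((isOpen_lt continuous_const hco).mem_nhds hx0)
          fun z (hz : 0 < z 0) => hz.le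
      have h1 : HasFDerivAt (f m) (fderivWithin ℝ (f m) (halfSpace n) (T x)) (T x) :=
        (((hf m).differentiableOn one_ne_zero _ hx0.le).hasFDerivWithinAt).hasFDerivAt hnh
      exact h1.comp x T.hasFDerivAt)
    (by
      refine ContinuousOn.integrableOn_compact isCompact_Icc ?_
      refine continuousOn_finsetSum _ fun m _ => ?_
      exact (continuousOn_fderivWithin_halfSpace (hf m) (single m 1)).comp
        T.continuous.continuousOn hmem)
  have hL : ∫ y in halfSpace n, ∑ m, fderivWithin ℝ (f m) (halfSpace n) y
        (single m 1) =
      ∫ x in Set.Icc a b, ∑ m, fderivWithin ℝ (f m) (halfSpace n) (T x)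
        (single m 1) := by
    have hme := (MeasurableEquiv.toLp 2 (Fin (n + 1) → ℝ)).measurableEmbedding
    rw [← (PiLp.volume_preserving_toLp (Fin (n + 1))).setIntegral_preimage_emb hme]
    refine setIntegral_eq_of_subset_of_forall_sdiff_eq_zero ?_ (fun x hx => hmem x hx) ?_
    · have hco : Continuous fun z : Fin (n + 1) → ℝ => z 0 := by fun_prop
      exact (isClosed_le continuous_const hco).measurableSet
    · rintro x ⟨hx, hx2⟩
      refine sum_eq_zero fun m _ => ?_
      rw [fderivWithin_eq_zero_of_notMem_tsupport, zero_apply]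
      intro h
      refine hx2 ⟨fun i => ?_, fun i => (le_abs_self _).trans (hR' m _ h i).le⟩
      refine Fin.cases hx (fun j => ?_) i
      exact (abs_lt.1 (hR' m _ h j.succ)).1.le
  rw [hL]
  refine hdiv.trans ?_
  rw [Fin.sum_univ_succ]
  have hfront : ∀ (i : Fin (n + 1)) (x : Fin n → ℝ), f i (T (Fin.insertNth i (b i) x)) = 0 :=
    fun i x => hz _ _ ⟨i, by rw [hTa]; simp [hb, abs_of_pos hR0]⟩
  have hback : ∀ (i : Fin n) (x : Fin n → ℝ),
      f i.succ (T (Fin.insertNth (α := fun _ => ℝ) i.succ (a i.succ) x)) = 0 :=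
    fun i x => hz _ _ ⟨i.succ, by rw [hTa]; simp [ha, abs_of_pos hR0]⟩
  simp only [hfront, hback, sub_zero, Finset.sum_const_zero, add_zero, integral_zero, zero_sub]
  congr 1
  have hme := (MeasurableEquiv.toLp 2 (Fin n → ℝ)).measurableEmbedding
  rw [← (PiLp.volume_preserving_toLp (Fin n)).integral_comp hme]
  refine (setIntegral_eq_integral_of_forall_compl_eq_zero fun x hx => ?_).trans ?_
  · refine hz _ _ ?_
    by_contra! h
    refine hx ⟨fun i => ?_, fun i => ?_⟩
    · have := (abs_lt.1 (h i.succ)).1.le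
      rw [hTa] at this
      simpa [ha] using this
    · have := (abs_lt.1 (h i.succ)).2.le
      rw [hTa] at this
      simpa [hb] using this
  · refine integral_congr_ae (Filter.Eventually.of_forall fun x => ?_)
    simp [hTa, ha, Fin.insertNth_zero']

end Divergence

/-! ### Integration by parts with a partition of unity -/

section IntegrationByParts

lemma measurableSet_extChartAt_target (i : N) : MeasurableSet (χⱼ i).target := by
  simpa using measurableSet_extChartAt_target_inter (J := J) i (isOpen_univ (X := N))

variable (J) in
/-- The image in the chart at `i` of the support of the corresponding function of the partition of
unity. -/
def partitionSupport (i : N) : Set (𝔼 m) :=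
  χⱼ i '' tsupport (chartPartition J (N := N) i)

lemma isCompact_partitionSupport (i : N) : IsCompact (partitionSupport J i) :=
  ((isClosed_tsupport _).isCompact).image_of_continuousOn
    ((continuousOn_extChartAt (I := J) i).mono (by
      rw [extChartAt_source]; exact chartPartition_tsupport i))

lemma partitionSupport_subset (i : N) : partitionSupport J i ⊆ (χⱼ i).target := by
  rintro _ ⟨x, hx, rfl⟩
  exact (χⱼ i).map_source (by rw [extChartAt_source]; exact chartPartition_tsupport i hx)

lemma symm_notMem_tsupport {i : N} {y : 𝔼 m}
    (hy : y ∈ (χⱼ i).target) (h : y ∉ partitionSupport J i) :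
    (χⱼ i).symm y ∉ tsupport (chartPartition J (N := N) i) := fun h' =>
  h ⟨_, h', (χⱼ i).right_inv hy⟩

lemma integrableOn_target {i : N} {f : 𝔼 m → ℝ}
    (hf : ContinuousOn f (χⱼ i).target)
    (h0 : ∀ y ∈ (χⱼ i).target, y ∉ partitionSupport J i → f y = 0) :
    IntegrableOn f (χⱼ i).target :=
  IntegrableOn.of_forall_sdiff_eq_zero
    ((hf.mono (partitionSupport_subset i)).integrableOn_compact (isCompact_partitionSupport i))
    (measurableSet_extChartAt_target i) fun y hy => h0 y hy.1 hy.2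

lemma hasCompactSupport_indicator {i : N} {f : 𝔼 m → ℝ}
    (h0 : ∀ y ∈ (χⱼ i).target, y ∉ partitionSupport J i → f y = 0) :
    tsupport ((χⱼ i).target.indicator f) ⊆ partitionSupport J i := by
  refine closure_minimal (fun y hy => ?_) (isCompact_partitionSupport i).isClosed
  by_contra h
  refine hy ?_
  by_cases hyt : y ∈ (χⱼ i).target
  · rw [Set.indicator_of_mem hyt, h0 y hyt h]
  · rw [Set.indicator_of_notMem hyt]

lemma contDiffOn_indicator {i : N} {f : 𝔼 m → ℝ}
    (hf : ContDiffOn ℝ 1 f (χⱼ i).target)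
    (h0 : ∀ y ∈ (χⱼ i).target, y ∉ partitionSupport J i → f y = 0) :
    ContDiffOn ℝ 1 ((χⱼ i).target.indicator f) (Set.range J) := by
  intro y hy
  by_cases hK : y ∈ partitionSupport J i
  · have hyt := partitionSupport_subset i hK
    have hn := extChartAt_target_mem_nhdsWithin_of_mem hyt
    refine ((hf y hyt).mono_of_mem_nhdsWithin hn).congr_of_eventuallyEq ?_
      (Set.indicator_of_mem hyt f)
    filter_upwards [hn] with z hz using Set.indicator_of_mem hz f
  · refine (contDiffWithinAt_const (c := (0 : ℝ))).congr_of_eventuallyEq ?_ ?_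
    · filter_upwards [mem_nhdsWithin_of_mem_nhds
        ((isCompact_partitionSupport i).isClosed.isOpen_compl.mem_nhds hK)] with z hz
      by_contra h
      exact hz (hasCompactSupport_indicator h0 (subset_tsupport _ h))
    · by_contra h
      exact hK (hasCompactSupport_indicator h0 (subset_tsupport _ h))

/-- The coordinate expression, in the chart at `i`, of a function of frames. -/
def inFrame (Λ : ∀ x : N, (Fin m → TangentSpace J x) → ℝ) (i : N)
    (y : 𝔼 m) : ℝ :=
  Λ ((χⱼ i).symm y) (coordFrame J i y)

/-- The partition of unity in a chart. -/
def partitionAt (J : ModelWithCorners ℝ (𝔼 m) HN) [IsManifold J ∞ N] (i : N)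
    (y : 𝔼 m) : ℝ :=
  chartPartition J (N := N) i ((extChartAt J i).symm y)

lemma one_le_infty : (1 : WithTop ℕ∞) ≤ ∞ := le_trans one_le_two two_le_infty

lemma contDiffOn_partitionAt (i : N) :
    ContDiffOn ℝ 1 (partitionAt J i) (χⱼ i).target := by
  have h : ContMDiffOn 𝓘(ℝ, 𝔼 m) 𝓘(ℝ, ℝ) ∞ (partitionAt J i)
      (χⱼ i).target :=
    ContMDiff.comp_contMDiffOn (g := fun x => chartPartition J (N := N) i x)
      (chartPartition J (N := N) i).contMDiff
      (contMDiffOn_extChartAt_symm (I := J) (n := ∞) i)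
  exact (contMDiffOn_iff_contDiffOn.1 h).of_le one_le_infty

lemma partitionAt_eq_zero {i : N} {y : 𝔼 m}
    (hy : y ∈ (χⱼ i).target) (h : y ∉ partitionSupport J i) : partitionAt J i y = 0 := by
  by_contra h'
  exact symm_notMem_tsupport hy h (subset_tsupport _ h')

lemma mvfderiv_coordFrame {G : Type*} [NormedAddCommGroup G] [NormedSpace ℝ G] {f : N → G} {i : N} {y : 𝔼 m}
    (hf : MDifferentiableAt J 𝓘(ℝ, G) f ((χⱼ i).symm y))
    (hy : y ∈ (χⱼ i).target) (a : Fin m) :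
    mvfderiv J f ((χⱼ i).symm y) (coordFrame J i y a) =
      fderivWithin ℝ (fun z => f ((χⱼ i).symm z)) (Set.range J) y
        (single a 1) := by
  have h1 := (mdifferentiableWithinAt_extChartAt_symm hy (I := J)).hasMFDerivWithinAt
  have h2 : HasFDerivWithinAt (fun z => f ((χⱼ i).symm z))
      ((mvfderiv J f ((χⱼ i).symm y) : 𝔼 m →L[ℝ] G).comp
        (mfderivWithin 𝓘(ℝ, 𝔼 m) J (χⱼ i).symm (Set.range J) y :
          𝔼 m →L[ℝ] 𝔼 m)) (Set.range J) y :=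
    hasMFDerivWithinAt_iff_hasFDerivWithinAt.1 (hf.hasMFDerivAt.comp_hasMFDerivWithinAt y h1)
  have h3 := HasFDerivWithinAt.fderivWithin (𝕜 := ℝ) (E := 𝔼 m) (F := G) h2
    (J.uniqueDiffOn _ (extChartAt_target_subset_range i hy))
  exact (congrArg (fun T : 𝔼 m →L[ℝ] G => T (single a 1)) h3).symm

lemma sum_mvfderiv_chartPartition (x : N) (v : TangentSpace J x) :
    ∑ i ∈ chartIndices J N, mvfderiv J (chartPartition J (N := N) i) x v = 0 := by
  classical
  have hd : ∀ i : N, MDifferentiableAt J 𝓘(ℝ, ℝ) (chartPartition J (N := N) i) x := fun i =>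
    ((chartPartition J (N := N) i).contMDiff.contMDiffAt).mdifferentiableAt infty_ne_zero
  have h : ∀ s : Finset N, MDifferentiableAt J 𝓘(ℝ, ℝ)
        (fun y => ∑ i ∈ s, chartPartition J (N := N) i y) x ∧
      mvfderiv J (fun y => ∑ i ∈ s, chartPartition J (N := N) i y) x v =
        ∑ i ∈ s, mvfderiv J (chartPartition J (N := N) i) x v := by
    intro s
    induction s using Finset.induction_on with
    | empty =>
      simp only [Finset.sum_empty]
      refine ⟨mdifferentiableAt_const, ?_⟩
      unfold mvfderiv
      rw [mfderiv_const]
      rfl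
    | insert a s ha ih =>
      have hfun : (fun y => ∑ i ∈ insert a s, chartPartition J (N := N) i y) =
          ⇑(chartPartition J (N := N) a) + fun y => ∑ i ∈ s, chartPartition J (N := N) i y := by
        funext y
        rw [sum_insert ha]
        rfl
      rw [hfun, sum_insert ha, ← ih.2]
      have h3 := (hd a).hasMFDerivAt.add ih.1.hasMFDerivAt
      refine ⟨h3.mdifferentiableAt, ?_⟩
      exact congrArg (fun T : 𝔼 m →L[ℝ] ℝ => T v) h3.mfderiv
  rw [← (h _).2]
  simp only [sum_chartPartition]
  unfold mvfderiv
  rw [mfderiv_const]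
  rfl

variable {Λ : ∀ x : N, Fin m → (Fin m → TangentSpace J x) → ℝ}

/-- The contraction `ξ ∧ Λ` of the components `Λ_a` with a covector `ξ`. -/
def wedgeCovector (Λ : ∀ x : N, Fin m → (Fin m → TangentSpace J x) → ℝ)
    (ξ : ∀ x : N, TangentSpace J x →L[ℝ] ℝ) (x : N) (b : Fin m → TangentSpace J x) : ℝ :=
  ∑ a, ξ x (b a) * Λ x a b

lemma fderivWithin_target {i : N} {f : 𝔼 m → ℝ}
    {y : 𝔼 m} (hy : y ∈ (χⱼ i).target) :
    fderivWithin ℝ f (Set.range J) y = fderivWithin ℝ f (χⱼ i).target y := by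
  refine fderivWithin_congr_set ?_
  obtain ⟨u, hu, h⟩ := mem_nhdsWithin_iff_exists_mem_nhds_inter.1
    (extChartAt_target_mem_nhdsWithin_of_mem hy)
  filter_upwards [hu] with z hz
  exact propext ⟨fun h' => h ⟨hz, h'⟩, fun h' => extChartAt_target_subset_range i h'⟩

lemma continuousOn_fderivWithin_target {i : N} {f : 𝔼 m → ℝ}
    (hf : ContDiffOn ℝ 1 f (χⱼ i).target) (v : 𝔼 m) :
    ContinuousOn (fun y => fderivWithin ℝ f (Set.range J) y v) (χⱼ i).target := by
  have hu : UniqueDiffOn ℝ (χⱼ i).target := uniqueDiffOn_extChartAt_target i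
  exact ((hf.continuousOn_fderivWithin hu le_rfl).clm_apply
    (continuousOn_const (c := v))).congr fun y hy => by rw [fderivWithin_target hy]

/-- The total contribution of the derivatives of the partition of unity in an integration by parts
vanishes. -/
lemma sum_integral_wedgeCovector
    (hdens : ∀ ξ : ∀ x : N, TangentSpace J x →L[ℝ] ℝ, IsDensity (wedgeCovector Λ ξ))
    (hsm : ∀ i a, ContDiffOn ℝ 1 (inFrame (fun x => Λ x a) i) (χⱼ i).target) :
    ∑ i ∈ chartIndices J N, ∫ y in (χⱼ i).target,
      ∑ a, fderivWithin ℝ (partitionAt J i) (Set.range J) y (single a 1) *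
        inFrame (fun x => Λ x a) i y = 0 := by
  set D : N → ∀ x : N, (Fin m → TangentSpace J x) → ℝ := fun i =>
    wedgeCovector Λ (fun x => mvfderiv J (chartPartition J (N := N) i) x) with hD
  have hd : ∀ i x, MDifferentiableAt J 𝓘(ℝ, ℝ) (chartPartition J (N := N) i) x := fun i x =>
    ((chartPartition J (N := N) i).contMDiff.contMDiffAt).mdifferentiableAt infty_ne_zero
  have hDi : ∀ i, ∀ y ∈ (χⱼ i).target,
      D i ((χⱼ i).symm y) (coordFrame J i y) =
        ∑ a, fderivWithin ℝ (partitionAt J i) (Set.range J) y (single a 1) *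
        inFrame (fun x => Λ x a) i y := fun i y hy => by
    refine sum_congr rfl fun a _ => ?_
    exact congrArg (· * _) (mvfderiv_coordFrame (hd i _) hy a)
  have hD0 : ∀ i, ∀ x ∉ tsupport (chartPartition J (N := N) i), ∀ b, D i x b = 0 :=
    fun i x hx b => by
      refine sum_eq_zero fun a _ => ?_
      have h : (chartPartition J (N := N) i) =ᶠ[𝓝 x] fun _ => (0 : ℝ) :=
        notMem_tsupport_iff_eventuallyEq.1 hx
      have h2 : mvfderiv J (chartPartition J (N := N) i) x = 0 := by
        unfold mvfderiv
        rw [h.mfderiv_eq, mfderiv_const]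
        exact ContinuousLinearMap.comp_zero _
      exact (congrArg (fun T : TangentSpace J x →L[ℝ] ℝ => T (b a) * Λ x a b) h2).trans (zero_mul _)
  have hint : ∀ i, IntegrableOn (fun y => D i ((χⱼ i).symm y) (coordFrame J i y))
      (χⱼ i).target := fun i => by
    refine integrableOn_target (ContinuousOn.congr ?_ (hDi i)) fun y hy h =>
      hD0 i _ (symm_notMem_tsupport hy h) _
    exact continuousOn_finsetSum _ fun a _ =>
      (continuousOn_fderivWithin_target (contDiffOn_partitionAt i) _).mul (hsm i a).continuousOn
  have hL := fun i => (hdens fun x => mvfderiv J (chartPartition J (N := N) i) x).integralDensity_eq i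
    (fun x hx b => hD0 i x (fun h => hx (chartPartition_tsupport i h)) b) (hint i)
  calc _ = ∑ i ∈ chartIndices J N, integralDensity J (D i) :=
        sum_congr rfl fun i _ => by
          refine (setIntegral_congr_fun (measurableSet_extChartAt_target i)
            fun y hy => (hDi i y hy).symm).trans (hL i).2.symm
    _ = ∑ i ∈ chartIndices J N, ∑ j ∈ chartIndices J N, ∫ y in (χⱼ j).target,
          chartPartition J (N := N) j ((χⱼ j).symm y)
            * D i ((χⱼ j).symm y) (coordFrame J j y) :=
        sum_congr rfl fun i _ => integralDensity_eq_sum _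
    _ = 0 := by
        rw [sum_comm]
        refine sum_eq_zero fun j _ => ?_
        rw [← integral_finsetSum _ fun i _ => (hL i).1 j]
        refine integral_eq_zero_of_ae (Filter.Eventually.of_forall fun y => ?_)
        simp only [wedgeCovector]
        rw [← mul_sum, sum_comm]
        simp_rw [← sum_mul]
        refine mul_eq_zero_of_right _ (sum_eq_zero fun a _ => ?_)
        rw [sum_mvfderiv_chartPartition, zero_mul]

/-- The components of `p_i Λ` in the chart at `i`, extended by zero. -/
def cutoff (Λ : ∀ x : N, Fin m → (Fin m → TangentSpace J x) → ℝ) (i : N) (a : Fin m) :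
    𝔼 m → ℝ :=
  (χⱼ i).target.indicator fun y => partitionAt J i y * inFrame (fun x => Λ x a) i y

lemma contDiffOn_cutoff {i : N} {a : Fin m}
    (hsm : ContDiffOn ℝ 1 (inFrame (fun x => Λ x a) i) (χⱼ i).target) :
    ContDiffOn ℝ 1 (cutoff Λ i a) (Set.range J) :=
  contDiffOn_indicator ((contDiffOn_partitionAt i).mul hsm) fun y hy h => by
    rw [partitionAt_eq_zero hy h, zero_mul]

lemma tsupport_cutoff (i : N) (a : Fin m) : tsupport (cutoff Λ i a) ⊆ partitionSupport J i :=
  hasCompactSupport_indicator fun y hy h => by rw [partitionAt_eq_zero hy h, zero_mul]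

lemma hasCompactSupport_cutoff (i : N) (a : Fin m) : HasCompactSupport (cutoff Λ i a) :=
  (isCompact_partitionSupport i).of_isClosed_subset (isClosed_tsupport _) (tsupport_cutoff i a)

/-- Integration by parts: the integral of the divergence of `Λ` reduces to integrals of divergences
of compactly supported functions in the charts. -/
lemma sum_integral_divergence
    (hdens : ∀ ξ : ∀ x : N, TangentSpace J x →L[ℝ] ℝ, IsDensity (wedgeCovector Λ ξ))
    (hsm : ∀ i a, ContDiffOn ℝ 1 (inFrame (fun x => Λ x a) i) (χⱼ i).target) :
    ∑ i ∈ chartIndices J N, ∫ y in (χⱼ i).target, partitionAt J i y *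
      ∑ a, fderivWithin ℝ (inFrame (fun x => Λ x a) i) (Set.range J) y
        (single a 1) =
    ∑ i ∈ chartIndices J N, ∫ y in Set.range J,
      ∑ a, fderivWithin ℝ (cutoff Λ i a) (Set.range J) y (single a 1) := by
  have key : ∀ i, ∫ y in Set.range J,
      ∑ a, fderivWithin ℝ (cutoff Λ i a) (Set.range J) y (single a 1) =
      (∫ y in (χⱼ i).target,
      ∑ a, fderivWithin ℝ (partitionAt J i) (Set.range J) y (single a 1) *
        inFrame (fun x => Λ x a) i y) + ∫ y in (χⱼ i).target, partitionAt J i y *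
      ∑ a, fderivWithin ℝ (inFrame (fun x => Λ x a) i) (Set.range J) y
        (single a 1) := fun i => by
    have hp0 : ∀ y ∈ (χⱼ i).target, y ∉ partitionSupport J i → ∀ v,
        fderivWithin ℝ (partitionAt J i) (Set.range J) y v = 0 := fun y hy h v => by
      have h1 : (partitionAt J i) =ᶠ[𝓝[Set.range J] y] fun _ => (0 : ℝ) := by
        filter_upwards [extChartAt_target_mem_nhdsWithin_of_mem hy, mem_nhdsWithin_of_mem_nhds
          ((isCompact_partitionSupport i).isClosed.isOpen_compl.mem_nhds h)] with z hz hz2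
        exact partitionAt_eq_zero hz hz2
      rw [h1.fderivWithin_eq (partitionAt_eq_zero hy h)]
      simp
    rw [← integral_add]
    · rw [setIntegral_eq_of_subset_of_forall_sdiff_eq_zero J.isClosed_range.measurableSet
        (extChartAt_target_subset_range i)]
      · refine setIntegral_congr_fun (measurableSet_extChartAt_target i) fun y hy => ?_
        simp only [mul_sum]
        rw [← sum_add_distrib]
        refine sum_congr rfl fun a _ => ?_
        have hn := extChartAt_target_mem_nhdsWithin_of_mem hy
        have hd1 := ((contDiffOn_partitionAt i).differentiableOn one_ne_zero y hy).mono_of_mem_nhdsWithin hn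
        have hd2 := ((hsm i a).differentiableOn one_ne_zero y hy).mono_of_mem_nhdsWithin hn
        have heq : cutoff Λ i a =ᶠ[𝓝[Set.range J] y]
            fun y => partitionAt J i y * inFrame (fun x => Λ x a) i y := by
          filter_upwards [hn] with z hz using Set.indicator_of_mem hz _
        rw [heq.fderivWithin_eq (Set.indicator_of_mem hy _), fderivWithin_fun_mul
          (J.uniqueDiffOn _ (extChartAt_target_subset_range i hy)) hd1 hd2]
        simp only [add_apply, smul_apply, smul_eq_mul]
        ring
      · rintro y ⟨-, hy⟩
        refine sum_eq_zero fun a _ => ?_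
        rw [fderivWithin_eq_zero_of_notMem_tsupport fun h =>
          hy (partitionSupport_subset i (tsupport_cutoff i a h)), zero_apply]
    · refine integrableOn_target ?_ ?_
      · exact continuousOn_finsetSum _ fun a _ =>
          (continuousOn_fderivWithin_target (contDiffOn_partitionAt i) _).mul (hsm i a).continuousOn
      · intro y hy h
        exact sum_eq_zero fun a _ => by rw [hp0 y hy h, zero_mul]
    · refine integrableOn_target ?_ ?_
      · exact (contDiffOn_partitionAt i).continuousOn.mul (continuousOn_finsetSum _ fun a _ =>
          continuousOn_fderivWithin_target (hsm i a) _)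
      · intro y hy h
        rw [partitionAt_eq_zero hy h, zero_mul]
  rw [sum_congr rfl fun i _ => key i, sum_add_distrib,
    sum_integral_wedgeCovector hdens hsm, zero_add]

/-- Stokes' theorem on a closed manifold. -/
lemma sum_integral_divergence_eq_zero (hI : Set.range J = Set.univ)
    (hdens : ∀ ξ : ∀ x : N, TangentSpace J x →L[ℝ] ℝ, IsDensity (wedgeCovector Λ ξ))
    (hsm : ∀ i a, ContDiffOn ℝ 1 (inFrame (fun x => Λ x a) i) (χⱼ i).target) :
    ∑ i ∈ chartIndices J N, ∫ y in (χⱼ i).target, partitionAt J i y *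
      ∑ a, fderivWithin ℝ (inFrame (fun x => Λ x a) i) (Set.range J) y
        (single a 1) = 0 := by
  rw [sum_integral_divergence hdens hsm]
  refine sum_eq_zero fun i _ => ?_
  have hcd : ∀ a, ContDiff ℝ 1 (cutoff Λ i a) := fun a => by
    have := contDiffOn_cutoff (hsm i a)
    rwa [hI, contDiffOn_univ] at this
  simp only [hI, fderivWithin_univ, Measure.restrict_univ]
  rw [integral_finsetSum]
  · exact sum_eq_zero fun a _ =>
      integral_fderiv_eq_zero volume (hcd a) (hasCompactSupport_cutoff i a) _
  · intro a _
    exact (((hcd a).continuous_fderiv one_ne_zero).clm_apply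
      continuous_const).integrable_of_hasCompactSupport
        ((hasCompactSupport_cutoff i a).fderiv_apply (𝕜 := ℝ) _)

end IntegrationByParts

/-! ### Differentiation under the integral sign -/

section ParametricIntegral

lemma hasDerivAt_fst {E : Type*} [NormedAddCommGroup E] [NormedSpace ℝ E] {G : ℝ × E → ℝ}
    {s : Set E} (hG : ContDiffOn ℝ 1 G (Set.univ ×ˢ s)) {y : E} (hy : y ∈ s) (t : ℝ) :
    HasDerivAt (fun t => G (t, y)) (fderivWithin ℝ G (Set.univ ×ˢ s) (t, y) (1, 0)) t := by
  have h1 : HasFDerivWithinAt G (fderivWithin ℝ G (Set.univ ×ˢ s) (t, y)) (Set.univ ×ˢ s) (t, y) :=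
    (hG.differentiableOn one_ne_zero _ ⟨Set.mem_univ _, hy⟩).hasFDerivWithinAt
  have h2 : HasDerivWithinAt (fun t : ℝ => (t, y)) ((1 : ℝ), (0 : E)) Set.univ t :=
    ((hasDerivAt_id t).prodMk (hasDerivAt_const t y)).hasDerivWithinAt
  have hm : Set.MapsTo (fun t : ℝ => (t, y)) Set.univ (Set.univ ×ˢ s) := fun τ _ =>
    ⟨Set.mem_univ _, hy⟩
  exact hasDerivWithinAt_univ.1 (h1.comp_hasDerivWithinAt t h2 hm)

/-- Differentiation of the integral of a density depending on a parameter. -/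
lemma hasDerivAt_integralDensity {D : ℝ → ∀ x : N, (Fin m → TangentSpace J x) → ℝ}
    (hD : ∀ i, ContDiffOn ℝ 1 (fun z : ℝ × 𝔼 m => inFrame (D z.1) i z.2)
      (Set.univ ×ˢ (χⱼ i).target)) :
    HasDerivAt (fun t => integralDensity J (D t))
      (integralDensity J fun x b => deriv (fun t => D t x b) 0) 0 := by
  simp_rw [integralDensity_eq_sum]
  refine HasDerivAt.fun_sum fun i _ => ?_
  set T := (χⱼ i).target with hT
  set G : ℝ × 𝔼 m → ℝ := fun z => inFrame (D z.1) i z.2 with hG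
  set K := partitionSupport J i with hK
  have hKc : IsCompact K := isCompact_partitionSupport i
  have hKT : K ⊆ T := partitionSupport_subset i
  have hKm : MeasurableSet K := hKc.isClosed.measurableSet
  have hder : ∀ y ∈ T, ∀ t, HasDerivAt (fun t => G (t, y))
      (fderivWithin ℝ G (Set.univ ×ˢ T) (t, y) (1, 0)) t := fun y hy t => hasDerivAt_fst (hD i) hy t
  have hu : UniqueDiffOn ℝ ((Set.univ : Set ℝ) ×ˢ T) :=
    uniqueDiffOn_univ.prod (uniqueDiffOn_extChartAt_target i)
  have hcont : ContinuousOn (fun z => fderivWithin ℝ G (Set.univ ×ˢ T) z ((1 : ℝ), 0))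
      (Set.univ ×ˢ T) :=
    ((hD i).continuousOn_fderivWithin hu le_rfl).clm_apply continuousOn_const
  obtain ⟨C, hC⟩ := ((isCompact_Icc (a := (-1 : ℝ)) (b := 1)).prod hKc).exists_bound_of_continuousOn
    (hcont.mono (Set.prod_mono (Set.subset_univ _) hKT))
  have hp : ContinuousOn (partitionAt J i) T := (contDiffOn_partitionAt i).continuousOn
  have hslice : ∀ t : ℝ, ContinuousOn (fun y => (t, y)) T := fun t => by fun_prop
  have hmaps : ∀ t : ℝ, Set.MapsTo (fun y => (t, y)) T ((Set.univ : Set ℝ) ×ˢ T) :=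
    fun t y hy => ⟨Set.mem_univ _, hy⟩
  have hFc : ∀ t, ContinuousOn (fun y => partitionAt J i y * G (t, y)) K := fun t =>
    (hp.mul ((hD i).continuousOn.comp (hslice t) (hmaps t))).mono hKT
  have hF'c : ContinuousOn (fun y => partitionAt J i y *
      fderivWithin ℝ G (Set.univ ×ˢ T) ((0 : ℝ), y) (1, 0)) K :=
    (hp.mul (hcont.comp (hslice 0) (hmaps 0))).mono hKT
  have hmain := (hasDerivAt_integral_of_dominated_loc_of_deriv_le (μ := volume.restrict K)
    (F := fun t y => partitionAt J i y * G (t, y))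
    (F' := fun t y => partitionAt J i y * fderivWithin ℝ G (Set.univ ×ˢ T) (t, y) (1, 0))
    (x₀ := (0 : ℝ)) (s := Set.Ioo (-1) 1) (bound := fun _ => C)
    (Ioo_mem_nhds (by norm_num) (by norm_num))
    (Filter.Eventually.of_forall fun t => (hFc t).aestronglyMeasurable hKm)
    ((hFc 0).integrableOn_compact hKc) (hF'c.aestronglyMeasurable hKm)
    ((ae_restrict_iff' hKm).2 (Filter.Eventually.of_forall fun y hy t ht => by
      rw [norm_mul, partitionAt, Real.norm_of_nonneg ((chartPartition J (N := N)).nonneg i _)]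
      exact (mul_le_of_le_one_left (norm_nonneg _) ((chartPartition J (N := N)).le_one i _)).trans
        (hC (t, y) ⟨⟨ht.1.le, ht.2.le⟩, hy⟩)))
    (integrableOn_const hKc.measure_lt_top.ne)
    ((ae_restrict_iff' hKm).2 (Filter.Eventually.of_forall fun y hy t _ =>
      (hder y (hKT hy) t).const_mul _))).2
  have hrestr : ∀ f : 𝔼 m → ℝ,
      ∫ y in T, partitionAt J i y * f y = ∫ y in K, partitionAt J i y * f y := fun f =>
    setIntegral_eq_of_subset_of_forall_sdiff_eq_zero (measurableSet_extChartAt_target i) hKT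
      fun y hy => by rw [partitionAt_eq_zero hy.1 hy.2, zero_mul]
  have h1 : ∀ t, ∫ y in T, chartPartition J (N := N) i ((χⱼ i).symm y)
      * D t ((χⱼ i).symm y) (coordFrame J i y) =
      ∫ y in K, partitionAt J i y * G (t, y) := fun t => hrestr fun y => G (t, y)
  simp_rw [h1]
  refine hmain.congr_deriv ?_
  refine Eq.trans ?_ (hrestr fun y => deriv (fun t => D t ((χⱼ i).symm y)
    (coordFrame J i y)) 0).symm
  refine setIntegral_congr_fun hKm fun y hy => ?_
  exact congrArg (partitionAt J i y * ·) (hder y (hKT hy) 0).deriv.symm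

end ParametricIntegral

/-! ### Fields along parametrized maps -/

section Along

variable {P : Type*} [NormedAddCommGroup P] [NormedSpace ℝ P]

variable (I) in
/-- The derivative of a map `C` from a subset of a normed space to `M`, in a direction `d`. -/
def velocity (C : P → M) (s : Set P) (p : P) (d : P) : TangentSpace I (C p) :=
  mfderivWithin 𝓘(ℝ, P) I C s p d

lemma contDiffWithinAt_extChartAt_comp {C : P → M} {s : Set P} {p : P} {x₁ : M}
    (hC : ContMDiffWithinAt 𝓘(ℝ, P) I ∞ C s p) (hx : C p ∈ (chartAt HM x₁).source) :
    ContDiffWithinAt ℝ ∞ (fun q => extChartAt I x₁ (C q)) s p :=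
  contMDiffWithinAt_iff_contDiffWithinAt.1
    ((contMDiffAt_extChartAt' hx).comp_contMDiffWithinAt p hC)

lemma hat_velocity {C : P → M} {s : Set P} {p : P} {x₁ : M}
    (hC : MDifferentiableWithinAt 𝓘(ℝ, P) I C s p) (hs : UniqueDiffWithinAt ℝ s p)
    (hx : C p ∈ (chartAt HM x₁).source) (d : P) :
    hat EM TM x₁ (C p) (velocity I C s p d) =
      fderivWithin ℝ (fun q => extChartAt I x₁ (C q)) s p d := by
  have h1 := (mdifferentiableAt_extChartAt (I := I) hx).hasMFDerivAt.comp_hasMFDerivWithinAt p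
    hC.hasMFDerivWithinAt
  let T₁ : EM →L[ℝ] EM := mfderiv I 𝓘(ℝ, EM) (extChartAt I x₁) (C p)
  let T₂ : P →L[ℝ] EM := mfderivWithin 𝓘(ℝ, P) I C s p
  have h2 : HasFDerivWithinAt (fun q => extChartAt I x₁ (C q)) (T₁.comp T₂) s p :=
    hasMFDerivWithinAt_iff_hasFDerivWithinAt.1 h1
  rw [h2.fderivWithin hs]
  exact congrArg (fun T : EM →L[ℝ] EM => T (velocity I C s p d)) (hat_tangent hx)

lemma contMDiffOn_velocity {C : P → M} {s : Set P} (hs : UniqueDiffOn ℝ s)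
    (hC : ContMDiffOn 𝓘(ℝ, P) I ∞ C s) (d : P) :
    ContMDiffOn 𝓘(ℝ, P) (I.prod 𝓘(ℝ, EM)) ∞
      (fun p => TotalSpace.mk' EM (E := TM) (C p) (velocity I C s p d))
      s := by
  intro p hp
  have hb : C p ∈ triv EM TM (C p) :=
    mem_triv EM TM (C p)
  refine (contMDiffWithinAt_hat (c := C) hb).2 ⟨hC p hp, ?_⟩
  have hev : ∀ᶠ q in 𝓝[s] p, q ∈ s ∧ C q ∈ (chartAt HM (C p)).source :=
    (eventually_mem_nhdsWithin).and ((hC p hp).continuousWithinAt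
      ((chartAt HM (C p)).open_source.mem_nhds (mem_chart_source HM (C p))))
  have hf := contDiffWithinAt_extChartAt_comp (hC p hp) (mem_chart_source HM (C p))
  have hder : ContDiffWithinAt ℝ ∞
      (fun q => fderivWithin ℝ (fun q => extChartAt I (C p) (C q)) s q d) s p :=
    (hf.fderivWithin_right hs (by simp) hp).clm_apply contDiffWithinAt_const
  refine contMDiffWithinAt_iff_contDiffWithinAt.2 ?_
  refine hder.congr_of_eventuallyEq (hev.mono fun q hq => ?_) ?_
  · exact hat_velocity ((hC q hq.1).mdifferentiableWithinAt infty_ne_zero) (hs q hq.1) hq.2 d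
  · exact hat_velocity ((hC p hp).mdifferentiableWithinAt infty_ne_zero) (hs p hp)
      (mem_chart_source HM (C p)) d

variable {ι : Type*} [Fintype ι] [DecidableEq ι]

/-- Smooth multilinear fields are smooth functions of smooth arguments. -/
lemma MixedField.contDiffWithinAt {Q : MixedField I V ι} (hQ : Q.IsSmooth F) {C : P → M}
    {s : Set P} {p : P} {z : ∀ q, ι → TangentSpace I (C q) × V (C q)}
    (hC : ContMDiffWithinAt 𝓘(ℝ, P) I ∞ C s p)
    (hw : ∀ i, ContMDiffWithinAt 𝓘(ℝ, P) (I.prod 𝓘(ℝ, EM)) ∞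
      (fun q => TotalSpace.mk' EM (E := TM) (C q) (z q i).1) s p)
    (ha : ∀ i, ContMDiffWithinAt 𝓘(ℝ, P) (I.prod 𝓘(ℝ, F)) ∞
      (fun q => TotalSpace.mk' F (C q) (z q i).2) s p) :
    ContDiffWithinAt ℝ ∞ (fun q => Q (C q) (z q)) s p := by
  have hT : C p ∈ triv EM TM (C p) :=
    mem_triv EM TM (C p)
  have hV : C p ∈ triv F V (C p) := mem_triv F V _
  have hev := hC.continuousWithinAt.eventually (Q.eventually_flat (F := F) (C p))
  have h1 := contDiffWithinAt_multilinear (f := fun q => Q.flat (C p) (C q))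
    (w := fun q i => hatPair F (C p) (C q) (z q i)) (k := ∞) (s := s) (x := p)
    (fun v => contMDiffWithinAt_iff_contDiffWithinAt.1
      (((hQ.flat (C p) v).contMDiffAt).comp_contMDiffWithinAt p hC))
    (fun i => ContDiffWithinAt.prodMk
      (contMDiffWithinAt_iff_contDiffWithinAt.1 ((contMDiffWithinAt_hat (c := C) hT).1 (hw i)).2)
      (contMDiffWithinAt_iff_contDiffWithinAt.1 ((contMDiffWithinAt_hat (c := C) hV).1 (ha i)).2))
  refine h1.congr_of_eventuallyEq (hev.mono fun q hq => hq _) ?_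
  exact (Q.eventually_flat (F := F) (C p)).self_of_nhds _

end Along

/-! ### The gauge variation in a chart of the worldvolume -/

section ChartVariation

variable [I.Boundaryless] {P : Type*} [NormedAddCommGroup P] [NormedSpace ℝ P] {ι : Type*}
  [Fintype ι] [DecidableEq ι]

/-- The product rule for a multilinear field evaluated on vectors along a parametrized map. -/
lemma MixedField.fderiv_apply {Q : MixedField I V ι} (hQ : Q.IsSmooth F) {C : P → M} {p : P}
    (hC : MDifferentiableAt 𝓘(ℝ, P) I C p)
    {z : ∀ q, ι → TangentSpace I (C q) × V (C q)} (d : P)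
    (hw : ∀ i, DifferentiableAt ℝ
      (fun q => hat EM TM (C p) (C q) (z q i).1) p)
    (ha : ∀ i, DifferentiableAt ℝ (fun q => hat F V (C p) (C q) (z q i).2) p)
    (hd : DifferentiableAt ℝ (fun q => Q (C q) (z q)) p)
    (W : ι → ΓT) (Y : ι → ΓE)
    (hWY : ∀ i, z p i = (W i (C p), Y i (C p))) {v : TangentSpace I (C p)}
    (hv : mfderiv 𝓘(ℝ, P) I C p d = v) :
    fderiv ℝ (fun q => Q (C q) (z q)) p d =
      mvfderiv I (fun x => Q x (fun i => (W i x, Y i x))) (C p) v +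
        ∑ i, Q (C p) (update (z p) i
          (fderiv ℝ (fun q => hat EM TM (C p) (C q) (z q i).1) p d
              - dhat (W i) (C p) v,
            unhat F V (C p) (C p)
              (fderiv ℝ (fun q => hat F V (C p) (C q) (z q i).2) p d - dhat (Y i) (C p) v))) := by
  subst hv
  obtain ⟨q, t, rfl⟩ : ∃ (q : P) (t : ℝ), p = q + t • d := ⟨p, 0, by simp⟩
  have hline : HasDerivAt (fun τ : ℝ => q + τ • d) d t := by
    simpa using ((hasDerivAt_id t).smul_const d).const_add q
  have hcm := hC.hasMFDerivAt.comp t (hasFDerivAt_iff_hasDerivAt.2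
    (by simpa using hline : HasDerivAt (fun τ : ℝ => q + τ • d)
      ((ContinuousLinearMap.smulRight (1 : ℝ →L[ℝ] ℝ) d) 1) t)).hasMFDerivAt
  have hv : mfderiv 𝓘(ℝ, ℝ) I (fun τ : ℝ => C (q + τ • d)) t (1 : ℝ) =
      mfderiv 𝓘(ℝ, P) I C (q + t • d) d := by
    refine (congrArg (fun T : ℝ →L[ℝ] EM => T 1) hcm.mfderiv).trans ?_
    refine congrArg (mfderiv 𝓘(ℝ, P) I C (q + t • d)) ?_
    change (1 : ℝ) • d = d
    exact one_smul _ _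
  have h := MixedField.hasDerivAt hQ (c := fun τ : ℝ => C (q + τ • d)) (t := t)
    hcm.mdifferentiableAt (z := fun τ => z (q + τ • d))
    (w' := fun i => fderiv ℝ (fun q' => hat EM TM (C (q + t • d)) (C q')
      (z q' i).1) (q + t • d) d)
    (a' := fun i => fderiv ℝ (fun q' => hat F V (C (q + t • d)) (C q') (z q' i).2) (q + t • d) d)
    (fun i => by
      have := (hw i).hasFDerivAt.comp_hasDerivAt t hline
      exact this)
    (fun i => by
      have := (ha i).hasFDerivAt.comp_hasDerivAt t hline
      exact this) W Y hWY
  rw [hv] at h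
  have h' := hd.hasFDerivAt.comp_hasDerivAt t hline
  exact HasDerivAt.unique (f := fun τ : ℝ => Q (C (q + τ • d)) (z (q + τ • d))) h' h

variable {E₀ : Type*} [NormedAddCommGroup E₀] [NormedSpace ℝ E₀] {n : ℕ}

/-- The arguments `(∂_l C, a_l)` of the action density in a chart of the worldvolume. -/
def chartArgs (C : ℝ × E₀ → M) (U : Set E₀) (d : ι → E₀) (a : ∀ p, ι → V (C p))
    (p : ℝ × E₀) (l : ι) : TangentSpace I (C p) × V (C p) :=
  (velocity I C (Set.univ ×ˢ U) p (0, d l), a p l)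

variable {C : ℝ × E₀ → M} {U : Set E₀}

/-- The product rules for a multilinear field along a gauge transformation, in a chart of the
worldvolume. The second derivatives `wt` and `wy` of the map occur in both of them. -/
lemma chart_first_order {Q : MixedField I V ι} (hQ : Q.IsSmooth F) (hU : IsOpen U)
    (hC : ContMDiffOn 𝓘(ℝ, ℝ × E₀) I ∞ C (Set.univ ×ˢ U)) (d : ι → E₀)
    {a : ∀ p, ι → V (C p)}
    (ha : ∀ l, ContMDiffOn 𝓘(ℝ, ℝ × E₀) (I.prod 𝓘(ℝ, F)) ∞
      (fun p => TotalSpace.mk' F (C p) (a p l)) (Set.univ ×ˢ U))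
    {b : ∀ y, V (C (0, y))}
    (hb : ContMDiffOn 𝓘(ℝ, E₀) (I.prod 𝓘(ℝ, F)) ∞ (fun y => TotalSpace.mk' F (C (0, y)) (b y)) U)
    (hvel : ∀ y ∈ U, velocity I C (Set.univ ×ˢ U) (0, y) (1, 0) = L.anchor _ (b y))
    {y : E₀} (hy : y ∈ U) (e : ΓE) (W : ι → ΓT)
    (Y : ι → ΓE) (he : e (C (0, y)) = b y)
    (hWY : ∀ l, chartArgs C U d a (0, y) l = (W l (C (0, y)), Y l (C (0, y)))) :
    DifferentiableAt ℝ (fun p => Q (C p) (chartArgs C U d a p)) (0, y) ∧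
    (∀ m, ContDiffAt ℝ ∞ (fun y' => Q (C (0, y'))
      (update (chartArgs C U d a (0, y')) m (graph L _ (b y')))) y) ∧
    ∃ (wt : ι → EM) (wy : ι → ι → EM), (∀ m l, wy m l = wy l m) ∧
    fderiv ℝ (fun p => Q (C p) (chartArgs C U d a p)) (0, y) (1, 0) =
      mvfderiv I (fun y => Q y (fun i => (W i y, Y i y))) (C (0, y)) (L.anchor _ (e (C (0, y)))) +
      ∑ l, Q (C (0, y)) (update (fun i => (W i (C (0, y)), Y i (C (0, y)))) l
        (wt l - dhat (W l) (C (0, y)) (L.anchor _ (e (C (0, y)))),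
          unhat F V (C (0, y)) (C (0, y))
            (fderiv ℝ (fun p => hat F V (C (0, y)) (C p) (a p l)) (0, y) (1, 0) -
              dhat (Y l) (C (0, y)) (L.anchor _ (e (C (0, y))))))) ∧
    ∀ m, fderiv ℝ (fun y' => Q (C (0, y'))
        (update (chartArgs C U d a (0, y')) m (graph L _ (b y')))) y (d m) =
      mvfderiv I (fun y => Q y (fun i => (update W m (ρsec L e) i y,
        update Y m e i y))) (C (0, y)) (W m (C (0, y))) +
      ∑ l, Q (C (0, y)) (update (fun i => (update W m (ρsec L e) i (C (0, y)),
        update Y m e i (C (0, y)))) l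
        (update (wy m) m (wt m) l -
            dhat (update W m (ρsec L e) l) (C (0, y)) (W m (C (0, y))),
          unhat F V (C (0, y)) (C (0, y)) (update
            (fun l => fderiv ℝ (fun p => hat F V (C (0, y)) (C p) (a p l)) (0, y) (0, d m)) m
            (fderiv ℝ (fun y' => hat F V (C (0, y)) (C (0, y')) (b y')) y (d m)) l -
            dhat (update Y m e l) (C (0, y)) (W m (C (0, y)))))) := by
  set x := C (0, y) with hx
  set s : Set (ℝ × E₀) := Set.univ ×ˢ U with hs
  have hso : IsOpen s := isOpen_univ.prod hU
  have hsy : ∀ y' ∈ U, s ∈ 𝓝 ((0 : ℝ), y') := fun y' h => hso.mem_nhds ⟨Set.mem_univ _, h⟩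
  have hT : x ∈ triv EM TM x :=
    mem_triv EM TM x
  have hV : x ∈ triv F V x := mem_triv F V x
  have hCat : ∀ p ∈ s, ContMDiffAt 𝓘(ℝ, ℝ × E₀) I ∞ C p := fun p hp =>
    (hC p hp).contMDiffAt (hso.mem_nhds hp)
  have hp0 : ((0 : ℝ), y) ∈ s := ⟨Set.mem_univ _, hy⟩
  set f : ℝ × E₀ → EM := fun q => extChartAt I x (C q) with hf
  have hfc : ContDiffAt ℝ ∞ f (0, y) := by
    have := contDiffWithinAt_extChartAt_comp (x₁ := x) (hC _ hp0) (mem_chart_source HM x)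
    exact this.contDiffAt (hsy y hy)
  have hf2 : ContDiffAt ℝ 1 (fderiv ℝ f) (0, y) :=
    hfc.fderiv_right (m := 1) (by rw [one_add_one_eq_two]; exact two_le_infty)
  have hDf : DifferentiableAt ℝ (fderiv ℝ f) (0, y) := hf2.differentiableAt one_ne_zero
  have hsymm : ∀ u v, fderiv ℝ (fderiv ℝ f) (0, y) u v = fderiv ℝ (fderiv ℝ f) (0, y) v u :=
    (hfc.isSymmSndFDerivAt (by simp [minSmoothness_of_isRCLikeNormedField]; exact two_le_infty)).eq
  have hsrc : ∀ᶠ p in 𝓝 ((0 : ℝ), y), p ∈ s ∧ C p ∈ (chartAt HM x).source :=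
    (show ∀ᶠ p in 𝓝 ((0 : ℝ), y), p ∈ s from hsy y hy).and ((hCat _ hp0).continuousAt
      ((chartAt HM x).open_source.mem_nhds (mem_chart_source HM x)))
  -- coordinates of the velocities near the base point
  have hvelf : ∀ v, (fun p => hat EM TM x (C p) (velocity I C s p v))
      =ᶠ[𝓝 ((0 : ℝ), y)] fun p => fderiv ℝ f p v := fun v =>
    hsrc.mono fun p hp => by
      have h := hat_velocity ((hC p hp.1).mdifferentiableWithinAt infty_ne_zero)
        (hso.uniqueDiffOn p hp.1) hp.2 v
      refine h.trans ?_
      rw [fderivWithin_of_isOpen hso hp.1]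
  have hvd : ∀ v, HasFDerivAt (fun p => fderiv ℝ f p v)
      ((fderiv ℝ (fderiv ℝ f) (0, y)).flip v) (0, y) := fun v => by
    have := hDf.hasFDerivAt.clm_apply (hasFDerivAt_const v _)
    refine this.congr_fderiv (ContinuousLinearMap.ext fun u => ?_)
    simp
  have hin : HasFDerivAt (fun y' : E₀ => ((0 : ℝ), y')) (ContinuousLinearMap.inr ℝ ℝ E₀) y :=
    hasFDerivAt_prodMk_right 0 y
  have hvelh : ∀ v, HasFDerivAt
      (fun p => hat EM TM x (C p) (velocity I C s p v))
      ((fderiv ℝ (fderiv ℝ f) (0, y)).flip v) (0, y) := fun v =>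
    (hvd v).congr_of_eventuallyEq (hvelf v)
  have hvelh0 : ∀ v, HasFDerivAt (fun y' => hat EM TM x (C (0, y'))
      (velocity I C s (0, y') v))
      (((fderiv ℝ (fderiv ℝ f) (0, y)).flip v).comp (ContinuousLinearMap.inr ℝ ℝ E₀)) y := fun v =>
    (hvelh v).comp y hin
  have hah : ∀ l, DifferentiableAt ℝ (fun p => hat F V x (C p) (a p l)) (0, y) := fun l => by
    have h := ((contMDiffWithinAt_hat (c := C) (x₀ := x) (y := ((0 : ℝ), y)) hV).1 (ha l _ hp0)).2
    exact ((contMDiffWithinAt_iff_contDiffWithinAt.1 h).contDiffAt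
      (hsy y hy)).differentiableAt infty_ne_zero
  have hbh : DifferentiableAt ℝ (fun y' => hat F V x (C (0, y')) (b y')) y := by
    have h := ((contMDiffWithinAt_hat (c := fun y' => C (0, y')) (x₀ := x) (y := y) hV).1
      (hb y hy)).2
    exact ((contMDiffWithinAt_iff_contDiffWithinAt.1 h).contDiffAt
      (hU.mem_nhds hy)).differentiableAt infty_ne_zero
  have hvs : ∀ v, mfderiv 𝓘(ℝ, ℝ × E₀) I C (0, y) v = velocity I C s (0, y) v := fun v => by
    have h := mfderivWithin_of_isOpen (I := 𝓘(ℝ, ℝ × E₀)) (I' := I) (f := C) hso hp0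
    exact (congrArg (fun T : ℝ × E₀ →L[ℝ] EM => T v) h).symm
  have hC0 : ContMDiffOn 𝓘(ℝ, E₀) I ∞ (fun y' => C (0, y')) U :=
    hC.comp (contMDiff_iff_contDiff.2 (by fun_prop : ContDiff ℝ ∞
      fun y' : E₀ => ((0 : ℝ), y'))).contMDiffOn fun y' h => ⟨Set.mem_univ _, h⟩
  have hCd := ((hCat _ hp0).mdifferentiableAt infty_ne_zero)
  have hC0d : HasMFDerivAt 𝓘(ℝ, E₀) I (fun y' => C (0, y')) y _ :=
    hCd.hasMFDerivAt.comp y hin.hasMFDerivAt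
  have hvs0 : ∀ v, mfderiv 𝓘(ℝ, E₀) I (fun y' => C (0, y')) y v = velocity I C s (0, y) (0, v) :=
    fun v => by
      refine Eq.trans ?_ (hvs (0, v))
      exact congrArg (fun T : E₀ →L[ℝ] EM => T v) hC0d.mfderiv
  have hWl : ∀ l, velocity I C s (0, y) (0, d l) = W l x := fun l => congrArg Prod.fst (hWY l)
  -- smoothness of the two families of arguments
  have hz1 : ∀ l, ContMDiffOn 𝓘(ℝ, ℝ × E₀) (I.prod 𝓘(ℝ, EM)) ∞
      (fun p => TotalSpace.mk' EM (E := TM) (C p)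
        (chartArgs C U d a p l).1) s := fun l =>
    contMDiffOn_velocity hso.uniqueDiffOn hC (0, d l)
  have hin' : ContMDiffOn 𝓘(ℝ, E₀) 𝓘(ℝ, ℝ × E₀) ∞ (fun y' : E₀ => ((0 : ℝ), y')) U :=
    (contMDiff_iff_contDiff.2 (by fun_prop : ContDiff ℝ ∞
      fun y' : E₀ => ((0 : ℝ), y'))).contMDiffOn
  have hmap : Set.MapsTo (fun y' : E₀ => ((0 : ℝ), y')) U s := fun y' h => ⟨Set.mem_univ _, h⟩
  have hE : DifferentiableAt ℝ (fun p => Q (C p) (chartArgs C U d a p)) (0, y) :=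
    ((MixedField.contDiffWithinAt hQ (hC _ hp0) (fun l => hz1 l _ hp0)
      fun l => ha l _ hp0).contDiffAt (hsy y hy)).differentiableAt infty_ne_zero
  have hΛ : ∀ m, ContDiffAt ℝ ∞ (fun y' => Q (C (0, y'))
      (update (chartArgs C U d a (0, y')) m (graph L _ (b y')))) y := fun m => by
    refine ((MixedField.contDiffWithinAt hQ (C := fun y' => C (0, y')) (hC0 y hy) (fun l => ?_)
      fun l => ?_).contDiffAt (hU.mem_nhds hy))
    · rcases eq_or_ne l m with rfl | hl
      · simp only [update_self]
        refine ((contMDiffOn_velocity hso.uniqueDiffOn hC ((1 : ℝ), (0 : E₀))).comp hin' hmap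
          y hy).congr (fun y' h => ?_) ?_
        · exact congrArg (TotalSpace.mk' EM (E := TM) (C (0, y')))
            (hvel y' h).symm
        · exact congrArg (TotalSpace.mk' EM (E := TM) (C (0, y)))
            (hvel y hy).symm
      · simp only [update_of_ne hl]
        exact (hz1 l).comp hin' hmap y hy
    · rcases eq_or_ne l m with rfl | hl
      · simp only [update_self]
        exact hb y hy
      · simp only [update_of_ne hl]
        exact (ha l).comp hin' hmap y hy
  have h1 := MixedField.fderiv_apply hQ hCd (z := chartArgs C U d a) ((1 : ℝ), (0 : E₀))
    (fun l => (hvelh (0, d l)).differentiableAt) hah hE W Y hWY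
    (v := L.anchor x (e x)) ((hvs _).trans ((hvel y hy).trans (by rw [he])))
  have hw2 : ∀ m l, HasFDerivAt (fun y' => hat EM TM x (C (0, y'))
      (update (chartArgs C U d a (0, y')) m (graph L _ (b y')) l).1)
      (((fderiv ℝ (fderiv ℝ f) (0, y)).flip
        (update (fun l => ((0 : ℝ), d l)) m (1, 0) l)).comp
          (ContinuousLinearMap.inr ℝ ℝ E₀)) y := fun m l => by
    rcases eq_or_ne l m with rfl | hl
    · simp only [update_self]
      refine (hvelh0 (1, 0)).congr_of_eventuallyEq ?_
      filter_upwards [hU.mem_nhds hy] with y' hy'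
      exact congrArg (hat EM TM x (C (0, y'))) (hvel y' hy').symm
    · simp only [update_of_ne hl]
      exact hvelh0 (0, d l)
  have ha2 : ∀ m l, HasFDerivAt (fun y' => hat F V x (C (0, y'))
      (update (chartArgs C U d a (0, y')) m (graph L _ (b y')) l).2)
      (update (fun l => (fderiv ℝ (fun p => hat F V x (C p) (a p l)) (0, y)).comp
          (ContinuousLinearMap.inr ℝ ℝ E₀)) m
        (fderiv ℝ (fun y' => hat F V x (C (0, y')) (b y')) y) l) y := fun m l => by
    rcases eq_or_ne l m with rfl | hl
    · simp only [update_self]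
      exact hbh.hasFDerivAt
    · simp only [update_of_ne hl]
      exact ((hah l).hasFDerivAt).comp y hin
  have h2 := fun m =>
    MixedField.fderiv_apply hQ (C := fun y' => C (0, y')) hC0d.mdifferentiableAt
      (z := fun y' => update (chartArgs C U d a (0, y')) m (graph L _ (b y'))) (d m)
      (fun l => (hw2 m l).differentiableAt) (fun l => (ha2 m l).differentiableAt) ((hΛ m).differentiableAt infty_ne_zero)
      (update W m (ρsec L e))
      (update Y m e) (fun l => by
        rcases eq_or_ne l m with rfl | hl
        · simp only [update_self]
          rw [← he]
          rfl
        · simp only [update_of_ne hl]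
          exact hWY l) (v := W m x) ((hvs0 _).trans (hWl m))
  have hzW : chartArgs C U d a (0, y) = fun i => (W i x, Y i x) := funext hWY
  refine ⟨hE, hΛ, fun l => fderiv ℝ (fderiv ℝ f) (0, y) (1, 0) (0, d l),
    fun m l => fderiv ℝ (fderiv ℝ f) (0, y) (0, d m) (0, d l), fun m l => hsymm _ _, ?_, ?_⟩
  · refine h1.trans ?_
    rw [hzW]
    congr 1
    refine sum_congr rfl fun l _ => ?_
    have hfd := (hvelh (0, d l)).fderiv
    exact congrArg (fun T : ℝ × E₀ →L[ℝ] EM => Q x (update (fun i => (W i x, Y i x)) l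
      (T (1, 0) - dhat (W l) x (L.anchor x (e x)), unhat F V x x
        (fderiv ℝ (fun p => hat F V x (C p) (a p l)) (0, y) (1, 0) -
          dhat (Y l) x (L.anchor x (e x)))))) hfd
  · intro m
    refine (h2 m).trans ?_
    have hzm : update (chartArgs C U d a (0, y)) m (graph L _ (b y)) =
        fun i => (update W m (ρsec L e) i x, update Y m e i x) := by
      funext l
      rcases eq_or_ne l m with rfl | hl
      · simp only [update_self]
        rw [← he]
        rfl
      · simp only [update_of_ne hl]
        exact hWY l
    rw [hzm]
    refine congrArg₂ (· + ·) rfl ?_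
    refine sum_congr rfl fun l _ => ?_
    refine congrArg (fun u => Q x (update (fun i => (update W m (ρsec L e) i x,
      update Y m e i x)) l u)) (Prod.ext ?_ ?_)
    · refine congrArg₂ (fun u v : EM => u - v) ?_ rfl
      refine (congrArg (fun T : E₀ →L[ℝ] EM => T (d m)) (hw2 m l).fderiv).trans ?_
      rcases eq_or_ne l m with rfl | hl
      · simp only [update_self]
        exact hsymm _ _
      · simp only [update_of_ne hl]
        rfl
    · refine congrArg (fun u : F => unhat F V x x (u - _)) ?_
      refine (congrArg (fun T : E₀ →L[ℝ] F => T (d m)) (ha2 m l).fderiv).trans ?_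
      rcases eq_or_ne l m with rfl | hl
      · simp only [update_self]
      · simp only [update_of_ne hl]
        rfl

/-- In a chart of the worldvolume, the variation of an alternating field along a gauge
transformation is a divergence, plus terms that do not involve second derivatives. -/
lemma chart_variation_identity {Q : ∀ x : M, (TangentSpace I x × V x) [⋀^Fin n]→ₗ[ℝ] ℝ}
    (hQ : MixedField.IsSmooth F (fun x => (Q x).toMultilinearMap))
    (hU : IsOpen U)
    (hC : ContMDiffOn 𝓘(ℝ, ℝ × E₀) I ∞ C (Set.univ ×ˢ U)) (d : Fin n → E₀)
    {a : ∀ p, Fin n → V (C p)}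
    (ha : ∀ l, ContMDiffOn 𝓘(ℝ, ℝ × E₀) (I.prod 𝓘(ℝ, F)) ∞
      (fun p => TotalSpace.mk' F (C p) (a p l)) (Set.univ ×ˢ U))
    {b : ∀ y, V (C (0, y))}
    (hb : ContMDiffOn 𝓘(ℝ, E₀) (I.prod 𝓘(ℝ, F)) ∞ (fun y => TotalSpace.mk' F (C (0, y)) (b y)) U)
    (hvel : ∀ y ∈ U, velocity I C (Set.univ ×ˢ U) (0, y) (1, 0) = L.anchor _ (b y))
    {y : E₀} (hy : y ∈ U) (e : ΓE) (W : Fin n → ΓT)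
    (Y : Fin n → ΓE) (he : e (C (0, y)) = b y)
    (hWY : ∀ l, chartArgs C U d a (0, y) l = (W l (C (0, y)), Y l (C (0, y))))
    (hinv : ∀ l, unhat F V (C (0, y)) (C (0, y))
        (fderiv ℝ (fun p => hat F V (C (0, y)) (C p) (a p l)) (0, y) (1, 0) -
          dhat (Y l) (C (0, y)) (L.anchor _ (e (C (0, y))))) -
      unhat F V (C (0, y)) (C (0, y))
        (fderiv ℝ (fun y' => hat F V (C (0, y)) (C (0, y')) (b y')) y (d l) -
          dhat e (C (0, y)) (W l (C (0, y)))) =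
      cov (fun y => e y) (C (0, y)) (W l (C (0, y)) - L.anchor _ (Y l (C (0, y)))) -
        L.bracket e (Y l) (C (0, y))) :
    fderiv ℝ (fun p => Q (C p) (chartArgs C U d a p)) (0, y) (1, 0) -
      ∑ m, fderiv ℝ (fun y' => Q (C (0, y'))
        (update (chartArgs C U d a (0, y')) m (graph L _ (b y')))) y (d m) =
    variation L cov Q e W Y (C (0, y)) -
      ∑ m, ∑ l, if l = m then 0 else
        Q (C (0, y)) (update (update (fun i => (W i (C (0, y)), Y i (C (0, y)))) m
          (graph L _ (e (C (0, y))))) l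
          (0, unhat F V (C (0, y)) (C (0, y))
            (fderiv ℝ (fun p => hat F V (C (0, y)) (C p) (a p l)) (0, y) (0, d m) -
              dhat (Y l) (C (0, y)) (W m (C (0, y)))))) := by
  obtain ⟨-, -, wt, wy, hsymm, h1, h2⟩ :=
    chart_first_order L hQ hU hC d ha hb hvel hy e W Y he hWY
  refine (congrArg₂ (fun r t : ℝ => r - t) h1 (sum_congr rfl fun m _ => h2 m)).trans ?_
  exact variation_identity L cov Q e W Y (C (0, y)) wt
    (fun l => fderiv ℝ (fun p => hat F V (C (0, y)) (C p) (a p l)) (0, y) (1, 0))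
    (fun l => fderiv ℝ (fun y' => hat F V (C (0, y)) (C (0, y')) (b y')) y (d l)) wy
    (fun m l => fderiv ℝ (fun p => hat F V (C (0, y)) (C p) (a p l)) (0, y) (0, d m)) hsymm hinv

/-- A multilinear field that vanishes on the graph of the anchor varies by its derivative along the
canonical `E`-connection. -/
lemma chart_variation_of_null {Q : MixedField I V ι} (hQ : Q.IsSmooth F)
    (hnull : ∀ x z m (u : V x), Q x (update z m (graph L x u)) = 0)
    (hU : IsOpen U) (hC : ContMDiffOn 𝓘(ℝ, ℝ × E₀) I ∞ C (Set.univ ×ˢ U)) (d : ι → E₀)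
    {a : ∀ p, ι → V (C p)}
    (ha : ∀ l, ContMDiffOn 𝓘(ℝ, ℝ × E₀) (I.prod 𝓘(ℝ, F)) ∞
      (fun p => TotalSpace.mk' F (C p) (a p l)) (Set.univ ×ˢ U))
    {b : ∀ y, V (C (0, y))}
    (hb : ContMDiffOn 𝓘(ℝ, E₀) (I.prod 𝓘(ℝ, F)) ∞ (fun y => TotalSpace.mk' F (C (0, y)) (b y)) U)
    (hvel : ∀ y ∈ U, velocity I C (Set.univ ×ˢ U) (0, y) (1, 0) = L.anchor _ (b y))
    {y : E₀} (hy : y ∈ U) (e : ΓE) (W : ι → ΓT)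
    (Y : ι → ΓE) (he : e (C (0, y)) = b y)
    (hWY : ∀ l, chartArgs C U d a (0, y) l = (W l (C (0, y)), Y l (C (0, y))))
    (hinv : ∀ l, unhat F V (C (0, y)) (C (0, y))
        (fderiv ℝ (fun p => hat F V (C (0, y)) (C p) (a p l)) (0, y) (1, 0) -
          dhat (Y l) (C (0, y)) (L.anchor _ (e (C (0, y))))) -
      unhat F V (C (0, y)) (C (0, y))
        (fderiv ℝ (fun y' => hat F V (C (0, y)) (C (0, y')) (b y')) y (d l) -
          dhat e (C (0, y)) (W l (C (0, y)))) =
      cov (fun y => e y) (C (0, y)) (W l (C (0, y)) - L.anchor _ (Y l (C (0, y)))) -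
        L.bracket e (Y l) (C (0, y))) :
    fderiv ℝ (fun p => Q (C p) (chartArgs C U d a p)) (0, y) (1, 0) =
      eDeriv L cov Q e W Y (C (0, y)) := by
  obtain ⟨-, -, wt, wy, hsymm, h1, h2⟩ :=
    chart_first_order L hQ hU hC d ha hb hvel hy e W Y he hWY
  set x := C (0, y) with hx
  rw [h1, eDeriv, sub_eq_add_neg, ← sum_neg_distrib]
  congr 1
  refine sum_congr rfl fun l _ => ?_
  set z : ι → TangentSpace I x × V x := fun i => (W i x, Y i x) with hz
  -- the derivative of the vanishing function `Q(…, graph, …)`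
  have h0 : Q x (update z l (wt l - dhat (ρsec L e) x (W l x), unhat F V x x
      (fderiv ℝ (fun y' => hat F V x (C (0, y')) (b y')) y (d l) - dhat e x (W l x)))) = 0 := by
    have h := h2 l
    have hg : ∀ x', (fun i => (update W l (ρsec L e) i x', update Y l e i x')) =
        update (fun i => (W i x', Y i x')) l (graph L x' (e x')) := fun x' => by
      funext i
      rcases eq_or_ne i l with rfl | hi
      · simp only [update_self]; rfl
      · simp only [update_of_ne hi]
    simp only [hg, hnull, fderiv_fun_const, Pi.zero_apply, zero_apply] at h
    rw [show mvfderiv I (fun _ : M => (0 : ℝ)) x (W l x) = 0 from by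
      rw [mvfderiv, mfderiv_const]; rfl, zero_add, sum_eq_single l] at h
    · simp only [update_self, Function.update_idem] at h
      exact h.symm
    · intro i _ hi
      rw [Function.update_comm hi.symm]
      exact hnull _ _ _ _
    · simp
  have hv : ((wt l - dhat (W l) x (L.anchor x (e x)), unhat F V x x
        (fderiv ℝ (fun p => hat F V x (C p) (a p l)) (0, y) (1, 0) -
          dhat (Y l) x (L.anchor x (e x)))) : TangentSpace I x × V x) =
      ((wt l - dhat (ρsec L e) x (W l x), unhat F V x x (fderiv ℝ (fun y' =>
        hat F V x (C (0, y')) (b y')) y (d l) - dhat e x (W l x))) : TangentSpace I x × V x) +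
      (graph L x (cov (fun y => e y) x (W l x)) +
        (-1 : ℝ) • (eConn L cov e (W l) x, eConnV L cov e (Y l) x)) := by
    have hm := mlieBracket_local (ρsec L e) (W l) x
    refine Prod.ext ?_ ?_
    · have key : ∀ p q r t c : EM, c = q - r → p - q = (p - r) + (t + (-1 : ℝ) • (c + t)) :=
        fun p q r t c hc => by rw [hc]; module
      exact key _ _ _ _ _ hm
    · have h := hinv l
      refine (eq_add_of_sub_eq h).trans ?_
      change _ = unhat F V x x _ + (cov (fun y => e y) x (W l x) +
        (-1 : ℝ) • (L.bracket e (Y l) x + cov (fun y => e y) x (L.anchor x (Y l x))))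
      rw [map_sub (cov (fun y => e y) x)]
      module
  refine (congrArg (fun u => Q x (update z l u)) hv).trans ?_
  rw [MultilinearMap.map_update_add, MultilinearMap.map_update_add, MultilinearMap.map_update_smul,
    h0, hnull]
  simp

end ChartVariation

/-! ### The exterior derivative and pull-backs -/

section Pullback

variable [I.Boundaryless] {P : Type*} [NormedAddCommGroup P] [NormedSpace ℝ P]

/-- A family of alternating maps on a finite-dimensional space is differentiable if its values are:
evaluation on the tuples of basis vectors embeds the space of alternating maps. -/
lemma differentiableAt_alternatingMap {G : Type*} [NormedAddCommGroup G] [NormedSpace ℝ G]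
    [FiniteDimensional ℝ G] {k : ℕ} {g : P → G [⋀^Fin k]→L[ℝ] ℝ} {p : P}
    (hg : ∀ v, DifferentiableAt ℝ (fun q => g q v) p) : DifferentiableAt ℝ g p := by
  set b := Module.finBasis ℝ G
  let ev : (G [⋀^Fin k]→L[ℝ] ℝ) →ₗ[ℝ] ((Fin k → Fin (Module.finrank ℝ G)) → ℝ) :=
    { toFun := fun f r => f (fun i => b (r i))
      map_add' := fun _ _ => rfl
      map_smul' := fun _ _ => rfl }
  have hinj : LinearMap.ker ev = ⊥ := by
    refine LinearMap.ker_eq_bot'.2 fun f hf => ?_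
    ext w
    have h := multilinear_eq_sum_basis f.toMultilinearMap b w
    refine h.trans (sum_eq_zero fun r _ => ?_)
    exact mul_eq_zero_of_right _ (congrFun hf r)
  obtain ⟨inv, hinv⟩ := ev.exists_leftInverse_of_injective hinj
  have hfac : g = fun q => (LinearMap.toContinuousLinearMap inv) (fun r => g q (fun i => b (r i))) := by
    funext q
    exact (congrArg (fun T : (G [⋀^Fin k]→L[ℝ] ℝ) →ₗ[ℝ] (G [⋀^Fin k]→L[ℝ] ℝ) => T (g q)) hinv).symm
  rw [hfac]
  exact (LinearMap.toContinuousLinearMap inv).differentiableAt.comp p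
    (differentiableAt_pi.2 fun r => hg _)

/-- A differential form read in the chart at `x`. -/
def flatForm {k : ℕ} (α : ∀ x : M, (TangentSpace I x) [⋀^Fin k]→L[ℝ] ℝ) (x : M) (y : EM) :
    EM [⋀^Fin k]→L[ℝ] ℝ :=
  (α ((extChartAt I x).symm y)).compContinuousLinearMap
    (mfderivWithin 𝓘(ℝ, EM) I (extChartAt I x).symm (Set.range I) y)

lemma mfderivWithin_symm_eq_unhat {x : M} {y : EM} (hy : y ∈ (extChartAt I x).target) (u : EM) :
    mfderivWithin 𝓘(ℝ, EM) I (extChartAt I x).symm (Set.range I) y u =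
      unhat EM TM x ((extChartAt I x).symm y) u := by
  have hs := (extChartAt I x).map_target hy
  rw [extChartAt_source] at hs
  have ht : (extChartAt I x).symm y ∈ triv EM TM x := by
    simpa [triv] using hs
  refine hat_injective (V := TM) ht ?_
  rw [hat_unhat ht, hat_tangent hs]
  exact congrArg (fun T : EM →L[ℝ] EM => T u)
    (mfderiv_extChartAt_comp_mfderivWithin_extChartAt_symm (I := I) hy)

lemma DForm.differentiableAt_flatForm {k : ℕ} (α : DForm I M k) (x : M) :
    DifferentiableAt ℝ (flatForm α.toFun x) (extChartAt I x x) := by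
  refine differentiableAt_alternatingMap fun v => ?_
  have h := contDiffAt_comp_symm (x := x)
    (α.smooth fun i => locFrame I EM TM x (v i)).contMDiffAt
  refine (h.differentiableAt infty_ne_zero).congr_of_eventuallyEq ?_
  have hc : Filter.Tendsto (extChartAt I x).symm (𝓝 (extChartAt I x x)) (𝓝 x) := by
    have := continuousAt_extChartAt_symm (I := I) x
    rwa [ContinuousAt, extChartAt_to_inv] at this
  filter_upwards [extChartAt_target_mem_nhds (I := I) x,
    hc.eventually (eventually_locFrame I EM TM x)] with y hy h
  refine congrArg (α.toFun ((extChartAt I x).symm y)) (funext fun i => ?_)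
  exact (mfderivWithin_symm_eq_unhat hy (v i)).trans (h.2 (v i)).symm

/-- The exterior derivative of the pull-back of a form by a map from a normed space. -/
lemma DForm.extD_pullback {k : ℕ} (α : DForm I M k) {C : P → M} {s : Set P} (hs : IsOpen s)
    (hC : ContMDiffOn 𝓘(ℝ, P) I ∞ C s) {p : P} (hp : p ∈ s) (v : Fin (k + 1) → P) :
    ∑ i : Fin (k + 1), (-1 : ℝ) ^ (i : ℕ) * fderiv ℝ
        (fun q => α.toFun (C q) (fun j => velocity I C s q (i.removeNth v j))) p (v i) =
      extD α.toFun (C p) (fun i => velocity I C s p (v i)) := by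
  set x := C p with hx
  set f : P → EM := fun q => extChartAt I x (C q) with hf
  have hfc : ContDiffAt ℝ ∞ f p :=
    (contDiffWithinAt_extChartAt_comp (x₁ := x) (hC _ hp) (mem_chart_source HM x)).contDiffAt
      (hs.mem_nhds hp)
  have hDf : DifferentiableAt ℝ (fderiv ℝ f) p :=
    (hfc.fderiv_right (m := 1) (by rw [one_add_one_eq_two]; exact two_le_infty)).differentiableAt
      one_ne_zero
  have hvel : ∀ q ∈ s, C q ∈ (chartAt HM x).source → ∀ u,
      hat EM TM x (C q) (velocity I C s q u) = fderiv ℝ f q u :=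
    fun q hq hqs u => (hat_velocity ((hC q hq).mdifferentiableWithinAt infty_ne_zero)
      (hs.uniqueDiffOn q hq) hqs u).trans (by rw [fderivWithin_of_isOpen hs hq])
  have hsrc : ∀ᶠ q in 𝓝 p, q ∈ s ∧ C q ∈ (chartAt HM x).source :=
    (show ∀ᶠ q in 𝓝 p, q ∈ s from hs.mem_nhds hp).and
      (((hC p hp).contMDiffAt (hs.mem_nhds hp)).continuousAt
        ((chartAt HM x).open_source.mem_nhds (mem_chart_source HM x)))
  set ϖ : P → P [⋀^Fin k]→L[ℝ] ℝ :=
    fun q => (flatForm α.toFun x (f q)).compContinuousLinearMap (fderiv ℝ f q) with hϖ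
  have hϖα : ∀ u : Fin k → P, (fun q => α.toFun (C q) (fun j => velocity I C s q (u j)))
      =ᶠ[𝓝 p] fun q => ϖ q u := fun u => hsrc.mono fun q hq => by
    have hinv : (extChartAt I x).symm (f q) = C q :=
      (extChartAt I x).left_inv (by rw [extChartAt_source]; exact hq.2)
    have hT : ∀ j, (velocity I C s q (u j) : EM) =
        mfderivWithin 𝓘(ℝ, EM) I (extChartAt I x).symm (Set.range I) (f q) (fderiv ℝ f q (u j)) :=
      fun j => by
        rw [← hvel q hq.1 hq.2, hat_tangent hq.2]
        exact (congrArg (fun T : EM →L[ℝ] EM => T (velocity I C s q (u j)))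
          (mfderivWithin_extChartAt_symm_comp_mfderiv_extChartAt' (I := I)
            (x := x) (y := C q) (by rw [extChartAt_source]; exact hq.2))).symm
    refine (congrArg (fun z => (α.toFun z : EM [⋀^Fin k]→L[ℝ] ℝ)
      (fun j => (velocity I C s q (u j) : EM))) hinv).symm.trans ?_
    exact congrArg (α.toFun ((extChartAt I x).symm (f q)) : EM [⋀^Fin k]→L[ℝ] ℝ) (funext hT)
  have hϖd : DifferentiableAt ℝ ϖ p :=
    DifferentiableAt.continuousAlternatingMapCompContinuousLinearMap
      (DifferentiableAt.comp p (f := f) (α.differentiableAt_flatForm x)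
        (hfc.differentiableAt infty_ne_zero)) hDf
  have h1 := extDeriv_apply hϖd v
  have h2 : extDeriv ϖ p = _ := extDeriv_pullback (f := f) (x := p)
    (α.differentiableAt_flatForm x) hfc
    (by simp only [minSmoothness_of_isRCLikeNormedField]; exact two_le_infty)
  have h3 : ∀ i, fderiv ℝ (fun q => α.toFun (C q) (fun j => velocity I C s q (i.removeNth v j))) p
      (v i) = fderiv ℝ (ϖ · (i.removeNth v)) p (v i) := fun i => by
    rw [(hϖα (i.removeNth v)).fderiv_eq]
  simp_rw [h3]
  refine Eq.trans (sum_congr rfl fun i _ => ?_) (h1.symm.trans ?_)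
  · rw [← Int.cast_smul_eq_zsmul ℝ, smul_eq_mul]
    push_cast
    rfl
  rw [h2]
  change extDeriv (flatForm α.toFun x) (extChartAt I x x) (fun i => fderiv ℝ f p (v i)) =
    extDerivWithin (flatForm α.toFun x) (Set.range I) (extChartAt I x x)
      (fun i => mfderiv I 𝓘(ℝ, EM) (extChartAt I x) x (velocity I C s p (v i)))
  rw [I.range_eq_univ, extDerivWithin_univ]
  refine congrArg _ (funext fun i => ?_)
  rw [← hvel p hp (mem_chart_source HM x), hat_tangent (mem_chart_source HM x)]
  rfl

/-- The variation of a pulled back form is a divergence plus the contraction of the exterior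
derivative with the velocity. -/
lemma DForm.chart_variation {k : ℕ} (α : DForm I M (k + 1)) {C : P → M} {s : Set P} (hs : IsOpen s)
    (hC : ContMDiffOn 𝓘(ℝ, P) I ∞ C s) {p : P} (hp : p ∈ s) (v₀ : P) (d : Fin (k + 1) → P) :
    fderiv ℝ (fun q => α.toFun (C q) (fun l => velocity I C s q (d l))) p v₀ -
      ∑ m, fderiv ℝ (fun q => α.toFun (C q)
        (update (fun l => velocity I C s q (d l)) m (velocity I C s q v₀))) p (d m) =
    extD α.toFun (C p) (Fin.cons (velocity I C s p v₀) (fun l => velocity I C s p (d l))) := by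
  have h := α.extD_pullback hs hC hp (Fin.cons v₀ d)
  rw [fin_cons_apply (fun u => velocity I C s p u)] at h
  rw [← h]
  refine Eq.trans ?_ (Fin.sum_univ_succ _).symm
  rw [sub_eq_add_neg, ← sum_neg_distrib]
  refine congrArg₂ (fun a b : ℝ => a + b) ?_ (sum_congr rfl fun m _ => ?_)
  · rw [Fin.val_zero, pow_zero, one_mul]
    rfl
  have hm : (fun q => α.toFun (C q)
      (update (fun l => velocity I C s q (d l)) m (velocity I C s q v₀))) =
      fun q => (-1 : ℝ) ^ (m : ℕ) * α.toFun (C q) (fun j => velocity I C s q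
        (m.succ.removeNth (α := fun _ => P) (Fin.cons v₀ d) j)) := by
    funext q
    refine (alt_update_eq_cons (α.toFun (C q)).toAlternatingMap (fun l => velocity I C s q (d l)) m
      (velocity I C s q v₀)).trans ?_
    refine congrArg ((-1 : ℝ) ^ (m : ℕ) * ·) (congrArg (α.toFun (C q)) (funext fun j => ?_))
    refine Fin.cases ?_ (fun j => ?_) j
    · simp [Fin.removeNth]
    · simp [Fin.removeNth]
  have hc : ∀ (r : ℝ) (g : P → ℝ) (u : P), fderiv ℝ (fun q => r * g q) p u = r * fderiv ℝ g p u :=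
    fun r g u => by
      have := congrFun (fderiv_const_smul_field (𝕜 := ℝ) (f := g) r) p
      exact congrArg (fun T : P →L[ℝ] ℝ => T u) this
  rw [hm, hc, Fin.cons_succ, Fin.val_succ, pow_succ]
  ring

end Pullback

/-! ### Alternating forms, determinants and signs -/

section Determinants

lemma AlternatingMap.apply_matrix {A : Type*} [AddCommGroup A] [Module ℝ A] {m : ℕ}
    (f : A [⋀^Fin m]→ₗ[ℝ] ℝ) (b : Fin m → A) (B : Matrix (Fin m) (Fin m) ℝ) :
    f (fun j => ∑ i, B i j • b i) = B.det * f b := by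
  set T : (Fin m → ℝ) →ₗ[ℝ] A := Fintype.linearCombination ℝ b
  have h := AlternatingMap.eq_smul_basis_det (Pi.basisFun ℝ (Fin m)) (f.compLinearMap T)
  have h1 := congrArg (fun g : (Fin m → ℝ) [⋀^Fin m]→ₗ[ℝ] ℝ => g (fun j => B.transpose j)) h
  have h2 : (f.compLinearMap T) (Pi.basisFun ℝ (Fin m)) = f b := by
    refine congrArg f (funext fun j => ?_)
    simp [T, Fintype.linearCombination_apply]
  have h3 : (f.compLinearMap T) (fun j => B.transpose j) = f (fun j => ∑ i, B i j • b i) := by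
    refine congrArg f (funext fun j => ?_)
    simp [T, Fintype.linearCombination_apply]
  rw [← h3]
  refine h1.trans ?_
  change (f.compLinearMap T) (Pi.basisFun ℝ (Fin m)) * _ = _
  rw [h2, Pi.basisFun_det, mul_comm]
  congr 1
  exact Matrix.det_transpose B

lemma Real.sign_mul' (a b : ℝ) : Real.sign (a * b) = Real.sign a * Real.sign b := by
  rcases lt_trichotomy a 0 with ha | rfl | ha <;> rcases lt_trichotomy b 0 with hb | rfl | hb
  · rw [Real.sign_of_neg ha, Real.sign_of_neg hb, Real.sign_of_pos (mul_pos_of_neg_of_neg ha hb)]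
    norm_num
  · simp
  · rw [Real.sign_of_neg ha, Real.sign_of_pos hb, Real.sign_of_neg (mul_neg_of_neg_of_pos ha hb)]
    norm_num
  · simp
  · simp
  · simp
  · rw [Real.sign_of_pos ha, Real.sign_of_neg hb, Real.sign_of_neg (mul_neg_of_pos_of_neg ha hb)]
    norm_num
  · simp
  · rw [Real.sign_of_pos ha, Real.sign_of_pos hb, Real.sign_of_pos (mul_pos ha hb)]
    norm_num

lemma Real.sign_mul_self (a : ℝ) : Real.sign a * a = |a| := by
  rcases lt_trichotomy a 0 with ha | rfl | ha
  · rw [Real.sign_of_neg ha, abs_of_neg ha]; ring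
  · simp
  · rw [Real.sign_of_pos ha, abs_of_pos ha, one_mul]

lemma Real.sign_eventuallyEq {X : Type*} [TopologicalSpace X] {f : X → ℝ} {s : Set X} {x : X}
    (hf : ContinuousWithinAt f s x) (hx : f x ≠ 0) :
    ∀ᶠ y in 𝓝[s] x, Real.sign (f y) = Real.sign (f x) := by
  rcases lt_or_gt_of_ne hx with h | h
  · filter_upwards [hf.eventually (gt_mem_nhds h)] with y hy
    rw [Real.sign_of_neg hy, Real.sign_of_neg h]
  · filter_upwards [hf.eventually (lt_mem_nhds h)] with y hy
    rw [Real.sign_of_pos hy, Real.sign_of_pos h]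

section Density

/-- The product of a top form with the sign of another one is a density. -/
lemma isDensity_sign_mul (f g : ∀ x : N, (TangentSpace J x) [⋀^Fin m]→ₗ[ℝ] ℝ) :
    IsDensity (fun x b => Real.sign (f x b) * g x b) := by
  intro x b A
  simp only
  rw [AlternatingMap.apply_matrix, AlternatingMap.apply_matrix, Real.sign_mul', ← Real.sign_mul_self]
  ring

lemma IsDensity.add {D D' : ∀ x : N, (Fin m → TangentSpace J x) → ℝ} (h : IsDensity D)
    (h' : IsDensity D') : IsDensity (fun x b => D x b + D' x b) := by
  intro x b A
  simp only [h x b A, h' x b A]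
  ring

lemma IsDensity.deriv {D : ℝ → ∀ x : N, (Fin m → TangentSpace J x) → ℝ} (h : ∀ t, IsDensity (D t)) :
    IsDensity (fun x b => deriv (fun t => D t x b) 0) := by
  intro x b A
  simp only [fun t => h t x b A]
  rw [deriv_const_mul_field]

/-- The density `½ √(det G) G^{ij} ⟨ζ_i, ζ_j⟩` of a symmetric bilinear expression, `G` being the
Gram matrix of a frame. -/
lemma isDensity_kinetic (γ : ∀ x : N, TangentSpace J x →ₗ[ℝ] TangentSpace J x →ₗ[ℝ] ℝ)
    (K : ∀ x : N, TangentSpace J x →ₗ[ℝ] TangentSpace J x →ₗ[ℝ] ℝ) :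
    IsDensity (fun x b => (1 / 2) * Real.sqrt (Matrix.of fun i j => γ x (b i) (b j)).det *
      ∑ i, ∑ j, (Matrix.of fun i j => γ x (b i) (b j))⁻¹ i j * K x (b i) (b j)) := by
  intro x b A
  have hB : ∀ T : TangentSpace J x →ₗ[ℝ] TangentSpace J x →ₗ[ℝ] ℝ,
      (Matrix.of fun i j => T (∑ k, A k i • b k) (∑ k, A k j • b k)) =
        A.transpose * (Matrix.of fun i j => T (b i) (b j)) * A := fun T => by
    ext i j
    simp only [Matrix.of_apply, map_sum, map_smul, LinearMap.sum_apply, LinearMap.smul_apply,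
      smul_eq_mul, Matrix.mul_apply, Matrix.transpose_apply, sum_mul]
    refine sum_congr rfl fun k _ => ?_
    rw [mul_sum]
    exact sum_congr rfl fun l _ => by ring
  have htr : ∀ (G P : Matrix (Fin m) (Fin m) ℝ), ∑ i, ∑ j, G i j * P i j =
      (G * P.transpose).trace := fun G P => by
    simp [Matrix.trace, Matrix.mul_apply]
  set G := Matrix.of fun i j => γ x (b i) (b j) with hG
  set P := Matrix.of fun i j => K x (b i) (b j) with hP
  have hP' : ∀ (G : Matrix (Fin m) (Fin m) ℝ) (c : Fin m → TangentSpace J x),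
      ∑ i, ∑ j, G i j * K x (c i) (c j) =
        (G * (Matrix.of fun i j => K x (c i) (c j)).transpose).trace := fun G c => htr G _
  simp only [hP']
  rw [hB, hB, ← hG, ← hP]
  rcases eq_or_ne A.det 0 with h0 | h0
  · simp [Matrix.det_mul, h0]
  · have hu : IsUnit A.det := isUnit_iff_ne_zero.2 h0
    have hdet : (A.transpose * G * A).det = A.det ^ 2 * G.det := by
      rw [Matrix.det_mul, Matrix.det_mul, Matrix.det_transpose]
      ring
    have htrace : ((A.transpose * G * A)⁻¹ * (A.transpose * P * A).transpose).trace =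
        (G⁻¹ * P.transpose).trace := by
      rw [Matrix.mul_inv_rev, Matrix.mul_inv_rev, Matrix.transpose_mul, Matrix.transpose_mul,
        Matrix.transpose_transpose]
      have h1 : A.transpose⁻¹ * A.transpose = 1 :=
        Matrix.nonsing_inv_mul _ (by rwa [Matrix.det_transpose])
      rw [show A⁻¹ * (G⁻¹ * A.transpose⁻¹) * (A.transpose * (P.transpose * A)) =
        A⁻¹ * (G⁻¹ * ((A.transpose⁻¹ * A.transpose) * (P.transpose * A))) by
          simp only [Matrix.mul_assoc], h1, Matrix.one_mul, Matrix.trace_mul_comm,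
          Matrix.mul_assoc, Matrix.mul_assoc, Matrix.mul_nonsing_inv _ hu, Matrix.mul_one]
    rw [hdet, htrace, Real.sqrt_mul (sq_nonneg _), Real.sqrt_sq_eq_abs]
    ring

end Density

/-- The value of a top form on a vector followed by vectors tangent to the hyperplane `x_0 = 0`. -/
lemma topForm_cons_tangential {n : ℕ}
    (f : 𝔼 (n + 1) [⋀^Fin (n + 1)]→ₗ[ℝ] ℝ)
    (v : 𝔼 (n + 1)) (w : Fin n → 𝔼 (n + 1))
    (hw : ∀ l, w l 0 = 0) :
    f (Fin.cons v w) = v 0 * (Matrix.of fun i l => w l (Fin.succ i)).det *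
      f (fun i => single i 1) := by
  set B : Matrix (Fin (n + 1)) (Fin (n + 1)) ℝ := Matrix.of fun i j =>
    (Fin.cons v w : Fin (n + 1) → 𝔼 (n + 1)) j i with hB
  have h1 : (Fin.cons v w : Fin (n + 1) → 𝔼 (n + 1)) =
      fun j => ∑ i, B i j • single i (1 : ℝ) := by
    funext j
    exact euclidean_eq_sum _
  have h2 : B.det = v 0 * (Matrix.of fun i l => w l (Fin.succ i)).det := by
    rw [Matrix.det_succ_row_zero, Fin.sum_univ_succ, sum_eq_zero]
    · simp only [hB, Matrix.of_apply, Fin.cons_zero, Fin.val_zero, pow_zero, one_mul, add_zero]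
      congr 2
    · intro l _
      simp [hB, hw]
  rw [← h2, h1]
  exact AlternatingMap.apply_matrix f _ B

/-- The value of a top form of the hyperplane `x_0 = 0` on vectors of this hyperplane. -/
lemma form_tangential {n : ℕ}
    (f : 𝔼 (n + 1) [⋀^Fin n]→ₗ[ℝ] ℝ)
    (w : Fin n → 𝔼 (n + 1))
    (hw : ∀ l, w l 0 = 0) :
    f w = (Matrix.of fun i l => w l (Fin.succ i)).det *
      f (fun i => single (Fin.succ i) 1) := by
  set B : Matrix (Fin n) (Fin n) ℝ := Matrix.of fun i l => w l (Fin.succ i) with hB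
  have h1 : w = fun j => ∑ i, B i j • single (Fin.succ i) (1 : ℝ) := by
    funext j
    conv_lhs => rw [euclidean_eq_sum (w j), Fin.sum_univ_succ, hw, zero_smul, zero_add]
    rfl
  conv_lhs => rw [h1]
  exact AlternatingMap.apply_matrix f _ B

end Determinants

/-! ### The boundary in the charts of a half-space manifold -/

/-- A smooth immersion into a manifold, possibly with boundary, has injective differentials. -/
lemma mfderiv_injective_of_isImmersion {E E' H' N N' : Type*}
    [NormedAddCommGroup E] [NormedSpace ℝ E] [NormedAddCommGroup E'] [NormedSpace ℝ E']
    [TopologicalSpace H'] {J : ModelWithCorners ℝ E' H'} [TopologicalSpace N] [ChartedSpace E N]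
    [IsManifold 𝓘(ℝ, E) ∞ N] [TopologicalSpace N'] [ChartedSpace H' N'] [IsManifold J ∞ N']
    {f : N → N'} (hf : IsImmersion 𝓘(ℝ, E) J ∞ f) (s : N) :
    Function.Injective (mfderiv 𝓘(ℝ, E) J f s) := by
  have h := hf.isImmersionAt s
  set e := h.domChart
  set e' := h.codChart
  -- a local left inverse of `f`, read off the immersion charts
  let g₁ : N' → E := fun z => (h.equiv.symm (e'.extend J z)).1
  let g : N' → N := fun z => (e.extend 𝓘(ℝ, E)).symm (g₁ z)
  have hg1 : ∀ z ∈ e.source, g₁ (f z) = e.extend 𝓘(ℝ, E) z := by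
    intro z hz
    have hz' : z ∈ (e.extend 𝓘(ℝ, E)).source := by rwa [e.extend_source]
    have h1 := h.writtenInCharts ((e.extend 𝓘(ℝ, E)).map_source hz')
    simp only [Function.comp_apply] at h1
    rw [(e.extend 𝓘(ℝ, E)).left_inv hz'] at h1
    change (h.equiv.symm (e'.extend J (f z))).1 = _
    rw [h1, h.equiv.symm_apply_apply]
  have hgf : ∀ z ∈ e.source, g (f z) = z := fun z hz => by
    change (e.extend 𝓘(ℝ, E)).symm (g₁ (f z)) = z
    rw [hg1 z hz]
    exact (e.extend 𝓘(ℝ, E)).left_inv (by rwa [e.extend_source])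
  have hs := h.mem_domChart_source
  have hd1 : MDifferentiableAt J 𝓘(ℝ, E) g₁ (f s) := by
    have h1 : MDifferentiableAt J 𝓘(ℝ, E') (e'.extend J) (f s) :=
      (e'.contMDiffAt_extend h.codChart_mem_maximalAtlas
        h.mem_codChart_source).mdifferentiableAt infty_ne_zero
    have h2 : MDifferentiableAt 𝓘(ℝ, E') 𝓘(ℝ, E) (fun v => (h.equiv.symm v).1)
        (e'.extend J (f s)) :=
      (h.equiv.symm.differentiableAt.fst).mdifferentiableAt
    exact h2.comp (f s) h1
  have hd2 : MDifferentiableAt 𝓘(ℝ, E) 𝓘(ℝ, E) (e.extend 𝓘(ℝ, E)).symm (g₁ (f s)) := by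
    have ht : 𝓘(ℝ, E) '' e.target ∈ 𝓝 (g₁ (f s)) := by
      rw [hg1 s hs]
      have : 𝓘(ℝ, E) '' e.target = e.target := by simp
      rw [this]
      exact e.open_target.mem_nhds (e.map_source hs)
    exact ((contMDiffOn_extend_symm h.domChart_mem_maximalAtlas).contMDiffAt
      ht).mdifferentiableAt infty_ne_zero
  have hd : MDifferentiableAt J 𝓘(ℝ, E) g (f s) := hd2.comp (f s) hd1
  have hdf : MDifferentiableAt 𝓘(ℝ, E) J f s := h.contMDiffAt.mdifferentiableAt infty_ne_zero
  have hcomp : (mfderiv J 𝓘(ℝ, E) g (f s)).comp (mfderiv 𝓘(ℝ, E) J f s) =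
      mfderiv 𝓘(ℝ, E) 𝓘(ℝ, E) (g ∘ f) s := (mfderiv_comp s hd hdf).symm
  have hid : mfderiv 𝓘(ℝ, E) 𝓘(ℝ, E) (g ∘ f) s = mfderiv 𝓘(ℝ, E) 𝓘(ℝ, E) (fun z : N => z) s := by
    refine Filter.EventuallyEq.mfderiv_eq ?_
    filter_upwards [e.open_source.mem_nhds hs] with z hz using hgf z hz
  have hid2 : mfderiv 𝓘(ℝ, E) 𝓘(ℝ, E) (fun z : N => z) s = ContinuousLinearMap.id ℝ _ := mfderiv_id
  intro u v huv
  have key : ∀ w : E, (mfderiv 𝓘(ℝ, E) 𝓘(ℝ, E) (g ∘ f) s : E → E) w = w := fun w => by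
    refine (congrArg (fun T : E →L[ℝ] TangentSpace 𝓘(ℝ, E) (g (f s)) => (T w : E)) hid).trans ?_
    exact congrArg (fun T : E →L[ℝ] E => T w) hid2
  have hc : ∀ w : E, (mfderiv J 𝓘(ℝ, E) g (f s) (mfderiv 𝓘(ℝ, E) J f s w) : E) = w := fun w =>
    (congrArg (fun T : E →L[ℝ] TangentSpace 𝓘(ℝ, E) (g (f s)) => (T w : E)) hcomp).trans (key w)
  exact (hc u).symm.trans ((congrArg (fun w => (mfderiv J 𝓘(ℝ, E) g (f s) w : E)) huv).trans (hc v))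

variable {n : ℕ} {Ξ : Type*} [TopologicalSpace Ξ] [ChartedSpace (EuclideanHalfSpace (n + 1)) Ξ]
  [IsManifold (𝓡∂ (n + 1)) ∞ Ξ]

local notation "E₊" => 𝔼 (n + 1)
local notation "χ₁" => extChartAt (𝓡∂ (n + 1))
local notation "R₁" => 𝓡∂ (n + 1)
local notation "κ₁" => chartAt (EuclideanHalfSpace (n + 1))

lemma range_halfSpace : Set.range R₁ = halfSpace n :=
  range_modelWithCornersEuclideanHalfSpace (n + 1)

lemma extChartAt_zero_nonneg (j ξ : Ξ) : 0 ≤ χ₁ j ξ 0 := by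
  have : χ₁ j ξ ∈ Set.range R₁ := ⟨_, rfl⟩
  rwa [range_halfSpace] at this

lemma mem_boundary_iff {j ξ : Ξ} (h : ξ ∈ (κ₁ j).source) :
    ξ ∈ (R₁).boundary Ξ ↔ χ₁ j ξ 0 = 0 := by
  have hm : χ₁ j ξ ∈ (χ₁ j).target :=
    (extChartAt _ j).map_source (by rwa [extChartAt_source])
  have h1 : ξ ∈ (R₁).interior Ξ ↔
      χ₁ j ξ ∈ interior (χ₁ j).target :=
    ModelWithCorners.isInteriorPoint_iff_of_mem_atlas infty_ne_zero (chart_mem_atlas _ j) h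
  have h2 : χ₁ j ξ ∈ interior (χ₁ j).target ↔
      0 < χ₁ j ξ 0 := by
    constructor
    · intro hi
      have := interior_mono (extChartAt_target_subset_range (I := R₁) j) hi
      rwa [interior_range_modelWithCornersEuclideanHalfSpace] at this
    · intro hp
      have hr : Set.range R₁ ∈ 𝓝 (χ₁ j ξ) := by
        rw [← mem_interior_iff_mem_nhds, interior_range_modelWithCornersEuclideanHalfSpace]
        exact hp
      have := extChartAt_target_mem_nhdsWithin_of_mem (I := R₁) hm
      rw [nhdsWithin_eq_nhds.2 hr] at this
      exact mem_interior_iff_mem_nhds.2 this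
  rw [← ModelWithCorners.compl_interior, Set.mem_compl_iff, h1, h2, not_lt]
  exact ⟨fun h => le_antisymm h (extChartAt_zero_nonneg j ξ), fun h => h.le⟩

/-- The differential at `ξ` of the chart at `j`, as an endomorphism of the model space. -/
def chartDiff (j ξ : Ξ) :
    E₊ →L[ℝ] E₊ :=
  mfderiv R₁ 𝓘(ℝ, E₊) (χ₁ j) ξ

/-- The coordinate frame of the chart at `j`, at the point `ξ`. -/
def frameAt (j ξ : Ξ) (a : Fin (n + 1)) : TangentSpace R₁ ξ :=
  mfderivWithin 𝓘(ℝ, E₊) R₁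
    (χ₁ j).symm (Set.range R₁) (χ₁ j ξ)
    (single a (1 : ℝ))

lemma frameAt_symm {j : Ξ} {y : E₊}
    (hy : y ∈ (χ₁ j).target) (a : Fin (n + 1)) :
    frameAt j ((χ₁ j).symm y) a = coordFrame R₁ j y a := by
  have h := (χ₁ j).right_inv hy
  change (mfderivWithin 𝓘(ℝ, E₊) R₁
    (χ₁ j).symm (Set.range R₁)
    (χ₁ j ((χ₁ j).symm y)) :
      E₊ → E₊) _ =
    (mfderivWithin 𝓘(ℝ, E₊) R₁
    (χ₁ j).symm (Set.range R₁) y :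
      E₊ → E₊) _
  rw [h]

lemma chartDiff_frameAt {j ξ : Ξ} (h : ξ ∈ (κ₁ j).source)
    (a : Fin (n + 1)) : chartDiff j ξ (frameAt j ξ a) = single a 1 := by
  have := mfderiv_extChartAt_comp_mfderivWithin_extChartAt_symm' (I := R₁) (x := j) (y := ξ)
    (by rwa [extChartAt_source])
  exact congrArg (fun T : E₊ →L[ℝ] E₊ =>
    T (single a 1)) this

lemma bijective_chartDiff {j ξ : Ξ} (h : ξ ∈ (κ₁ j).source) :
    Function.Bijective (chartDiff (n := n) j ξ) := by
  have : (chartDiff j ξ).IsInvertible :=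
    isInvertible_mfderiv_extChartAt (I := R₁) (by rwa [extChartAt_source])
  obtain ⟨e, he⟩ := this
  rw [← he]
  exact e.bijective

/-- The differential of a chart as a linear equivalence. -/
def chartDiffEquiv {j ξ : Ξ} (h : ξ ∈ (κ₁ j).source) :
    E₊ ≃ₗ[ℝ] E₊ :=
  LinearEquiv.ofBijective (chartDiff j ξ).toLinearMap (bijective_chartDiff h)

lemma hasFDerivWithinAt_chartDiff {j ξ : Ξ}
    (h : ξ ∈ (κ₁ j).source) :
    HasFDerivWithinAt (fun z => χ₁ j ((χ₁ ξ).symm z))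
      (chartDiff j ξ) (halfSpace n) (χ₁ ξ ξ) := by
  have := (mdifferentiableAt_extChartAt (I := R₁) h).hasMFDerivAt.2
  rw [← range_halfSpace]
  exact this

/-- At a boundary point, the differential of a chart maps inward vectors to inward vectors. -/
lemma chartDiff_single_zero_pos {j ξ : Ξ}
    (h : ξ ∈ (κ₁ j).source)
    (hb : ξ ∈ (R₁).boundary Ξ) :
    0 < chartDiff (n := n) j ξ (single 0 1) 0 := by
  set y := χ₁ ξ ξ with hy
  have hy0 : y 0 = 0 := (mem_boundary_iff (mem_chart_source _ ξ)).1 hb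
  have hf := (hasFDerivWithinAt_chartDiff h)
  have hf0 : HasFDerivWithinAt
      (fun z => χ₁ j ((χ₁ ξ).symm z) 0)
      ((EuclideanSpace.proj (0 : Fin (n + 1)) : E₊ →L[ℝ] ℝ).comp
        (chartDiff j ξ)) (halfSpace n) y :=
    (EuclideanSpace.proj (0 : Fin (n + 1)) :
      E₊ →L[ℝ] ℝ).hasFDerivAt.comp_hasFDerivWithinAt y hf
  have hmin : IsLocalMinOn
      (fun z => χ₁ j ((χ₁ ξ).symm z) 0)
      (halfSpace n) y := by
    refine Filter.Eventually.of_forall fun z => ?_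
    have : χ₁ j ((χ₁ ξ).symm y) 0 = 0 := by
      rw [hy, extChartAt_to_inv]
      exact (mem_boundary_iff h).1 hb
    simp only [this]
    exact extChartAt_zero_nonneg _ _
  -- the component `0` of the image of a vector of the half-space is nonnegative
  have hpos : ∀ v : E₊, 0 ≤ v 0 → 0 ≤ chartDiff j ξ v 0 := by
    intro v hv
    refine hmin.hasFDerivWithinAt_nonneg hf0 (mem_posTangentConeAt_of_segment_subset ?_)
    rintro _ ⟨a, b, ha, hb', -, rfl⟩
    change 0 ≤ (a • y + b • (y + v)) 0
    simp [hy0]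
    positivity
  refine lt_of_le_of_ne (hpos _ (by simp)) fun h0 => ?_
  have hzero : ∀ v, chartDiff (n := n) j ξ v 0 = 0 := by
    have hl : ∀ l : Fin (n + 1), chartDiff (n := n) j ξ (single l 1) 0 = 0 := by
      intro l
      refine Fin.cases h0.symm (fun l => le_antisymm ?_ (hpos _ (by simp))) l
      have := hpos (-single l.succ 1) (by simp)
      rw [map_neg, PiLp.neg_apply] at this
      linarith
    intro v
    rw [euclidean_eq_sum v, map_sum]
    simp [hl]
  obtain ⟨v, hv⟩ := (bijective_chartDiff (n := n) h).2 (single 0 1)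
  have := hzero v
  rw [hv] at this
  simp at this

lemma mfderiv_extChartAt_outward_neg {j ξ : Ξ}
    (h : ξ ∈ (κ₁ j).source)
    (hb : ξ ∈ (R₁).boundary Ξ) : chartDiff (n := n) j ξ (outward ξ) 0 < 0 := by
  have := chartDiff_single_zero_pos h hb
  change chartDiff j ξ (-single 0 1) 0 < 0
  rw [map_neg, PiLp.neg_apply]
  linarith

lemma topForm_frameAt {j ξ : Ξ} (h : ξ ∈ (κ₁ j).source)
    (f : E₊ [⋀^Fin (n + 1)]→ₗ[ℝ] ℝ)
    (v : E₊) (w : Fin n → E₊)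
    (hw : ∀ l, chartDiff j ξ (w l) 0 = 0) :
    f (Fin.cons v w) = chartDiff j ξ v 0 *
      (Matrix.of fun i l => chartDiff j ξ (w l) (Fin.succ i)).det * f (frameAt j ξ) := by
  have h1 := topForm_cons_tangential
    (f.compLinearMap (chartDiffEquiv h).symm.toLinearMap) (chartDiff j ξ v)
    (fun l => chartDiff j ξ (w l)) hw
  have hs : ∀ u, (chartDiffEquiv h).symm (chartDiff j ξ u) = u :=
    fun u => (chartDiffEquiv h).symm_apply_apply u
  simp only [AlternatingMap.compLinearMap_apply] at h1
  refine Eq.trans ?_ (h1.trans ?_)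
  · refine congrArg f (funext fun l => ?_)
    refine Fin.cases ?_ (fun l => ?_) l
    · exact (hs v).symm
    · exact (hs (w l)).symm
  · congr 2
    funext i
    have := hs (frameAt j ξ i)
    rw [chartDiff_frameAt h] at this
    exact this

lemma form_frameAt {j ξ : Ξ} (h : ξ ∈ (κ₁ j).source)
    (f : E₊ [⋀^Fin n]→ₗ[ℝ] ℝ)
    (w : Fin n → E₊)
    (hw : ∀ l, chartDiff j ξ (w l) 0 = 0) :
    f w = (Matrix.of fun i l => chartDiff j ξ (w l) (Fin.succ i)).det *
      f (fun i => frameAt j ξ (Fin.succ i)) := by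
  have h1 := form_tangential
    (f.compLinearMap (chartDiffEquiv h).symm.toLinearMap) (fun l => chartDiff j ξ (w l)) hw
  have hs : ∀ u, (chartDiffEquiv h).symm (chartDiff j ξ u) = u :=
    fun u => (chartDiffEquiv h).symm_apply_apply u
  simp only [AlternatingMap.compLinearMap_apply] at h1
  refine Eq.trans ?_ (h1.trans ?_)
  · exact congrArg f (funext fun l => (hs (w l)).symm)
  · congr 2
    funext i
    have := hs (frameAt j ξ (Fin.succ i))
    rw [chartDiff_frameAt h] at this
    exact this

/-! ### Orientations of the worldvolume and of its boundary in charts -/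

section FormsAlong

variable {P : Type*} [NormedAddCommGroup P] [NormedSpace ℝ P]

/-- A smooth form is a smooth function of smooth arguments. -/
lemma DForm.contDiffWithinAt {k : ℕ} (α : DForm I M k) {C : P → M} {s : Set P} {p : P}
    {w : ∀ q, Fin k → TangentSpace I (C q)}
    (hC : ContMDiffWithinAt 𝓘(ℝ, P) I ∞ C s p)
    (hw : ∀ i, ContMDiffWithinAt 𝓘(ℝ, P) (I.prod 𝓘(ℝ, EM)) ∞
      (fun q => TotalSpace.mk' EM (E := TM) (C q) (w q i)) s p) :
    ContDiffWithinAt ℝ ∞ (fun q => α.toFun (C q) (w q)) s p := by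
  let Q : MixedField I TM (Fin k) := fun x =>
    (α.toFun x).toMultilinearMap.compLinearMap
      (fun _ => LinearMap.fst ℝ (TangentSpace I x) (TangentSpace I x))
  have hQ : Q.IsSmooth EM := fun W _ => α.smooth W
  exact MixedField.contDiffWithinAt hQ (z := fun q i => (w q i, w q i)) hC hw hw

end FormsAlong

section Orientation

lemma contMDiffOn_coordFrame (i : N) (a : Fin m) :
    ContMDiffOn 𝓘(ℝ, 𝔼 m) (J.prod 𝓘(ℝ, 𝔼 m)) ∞
      (fun y => TotalSpace.mk' (𝔼 m) (E := fun x : N => TangentSpace J x)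
        ((χⱼ i).symm y) (coordFrame J i y a)) (χⱼ i).target := by
  have h := contMDiffOn_velocity (I := J) (uniqueDiffOn_extChartAt_target i)
    (contMDiffOn_extChartAt_symm (n := ∞) (I := J) i) (single a 1)
  refine h.congr fun y hy => ?_
  have : mfderivWithin 𝓘(ℝ, 𝔼 m) J (χⱼ i).symm (Set.range J) y =
      mfderivWithin 𝓘(ℝ, 𝔼 m) J (χⱼ i).symm
        (χⱼ i).target y := by
    exact (mfderivWithin_subset (extChartAt_target_subset_range i)
      (uniqueDiffOn_extChartAt_target i y hy).uniqueMDiffWithinAt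
      (mdifferentiableWithinAt_extChartAt_symm hy)).symm
  exact congrArg (fun T : 𝔼 m →L[ℝ]
    TangentSpace J ((χⱼ i).symm y) => TotalSpace.mk' (𝔼 m)
      (E := fun x : N => TangentSpace J x) ((χⱼ i).symm y)
      (T (single a 1))) this

end Orientation

variable [T2Space Ξ] [CompactSpace Ξ] {S : Type*} [TopologicalSpace S]
  [ChartedSpace (𝔼 n) S] [IsManifold (𝓡 n) ∞ S] [T2Space S] [CompactSpace S]
  {W : Worldvolume (n := n) Ξ S}

local notation "E₀" => 𝔼 n
local notation "R₀" => 𝓡 n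
local notation "χ" => extChartAt (𝓡 n)

section Boundary

variable (W)

/-- The orientation form on the coordinate frame of the chart at `j`. -/
def Worldvolume.orientAt (j ξ : Ξ) : ℝ := W.orient.toFun ξ (frameAt j ξ)

lemma Worldvolume.orientAt_ne_zero {j ξ : Ξ}
    (h : ξ ∈ (κ₁ j).source) : W.orientAt j ξ ≠ 0 := by
  let b : Module.Basis (Fin (n + 1)) ℝ E₊ :=
    (EuclideanSpace.basisFun (Fin (n + 1)) ℝ).toBasis.map (chartDiffEquiv h).symm
  have hb : ∀ a, b a = frameAt j ξ a := fun a => by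
    have : (chartDiffEquiv h) (frameAt j ξ a) = single a 1 := chartDiff_frameAt h a
    refine (chartDiffEquiv h).symm_apply_eq.2 (Eq.trans ?_ this.symm)
    simp
  have hb' : (b : Fin (n + 1) → E₊) = frameAt j ξ := funext hb
  have hne : (W.orient.toFun ξ).toAlternatingMap ≠ 0 := fun h0 => W.orient_ne ξ <| by
    ext v
    exact congrArg (fun f : E₊ [⋀^Fin (n + 1)]→ₗ[ℝ] ℝ => f v) h0
  have := (AlternatingMap.map_basis_ne_zero_iff b (W.orient.toFun ξ).toAlternatingMap).2 hne
  rw [hb'] at this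
  exact this

lemma Worldvolume.continuousOn_orientAt (j : Ξ) :
    ContinuousOn (W.orientAt j) (κ₁ j).source := by
  have h1 : ContinuousOn (fun y => W.orient.toFun ((χ₁ j).symm y)
      (coordFrame R₁ j y)) (χ₁ j).target := fun y hy =>
    (W.orient.contDiffWithinAt (contMDiffOn_extChartAt_symm (n := ∞) j y hy)
      (fun a => contMDiffOn_coordFrame j a y hy)).continuousWithinAt
  have h2 : ContinuousOn (χ₁ j)
      (κ₁ j).source := by
    have := continuousOn_extChartAt (I := R₁) j
    rwa [extChartAt_source] at this
  refine (h1.comp h2 fun ξ hξ => (extChartAt _ j).map_source (by rwa [extChartAt_source])).congr ?_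
  intro ξ hξ
  have hξ' : ξ ∈ (χ₁ j).source := by rwa [extChartAt_source]
  have h3 := (χ₁ j).left_inv hξ'
  change _ = W.orient.toFun ((χ₁ j).symm (χ₁ j ξ))
    (coordFrame R₁ j (χ₁ j ξ))
  have h4 : coordFrame R₁ j (χ₁ j ξ) =
      frameAt j ((χ₁ j).symm (χ₁ j ξ)) :=
    funext fun a => (frameAt_symm ((extChartAt _ j).map_source hξ') a).symm
  rw [h4, h3]
  rfl

lemma Worldvolume.mdifferentiableAt_incl (s : S) :
    MDifferentiableAt R₀ R₁ W.incl s :=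
  (W.incl_embedding.contMDiff s).mdifferentiableAt infty_ne_zero

lemma Worldvolume.incl_mem_boundary (s : S) : W.incl s ∈ (R₁).boundary Ξ := by
  rw [← W.range_incl]
  exact ⟨s, rfl⟩

/-- The differential of the inclusion of the boundary, in a chart of the worldvolume. -/
def Worldvolume.inclDiff (j : Ξ) (s : S) : E₀ →L[ℝ] E₊ :=
  (chartDiff j (W.incl s)).comp (mfderiv R₀ R₁ W.incl s : E₀ →L[ℝ] E₊)

lemma Worldvolume.eventually_incl {j : Ξ} {s : S}
    (h : W.incl s ∈ (κ₁ j).source) :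
    ∀ᶠ τ in 𝓝 s, W.incl τ ∈ (κ₁ j).source :=
  (W.mdifferentiableAt_incl s).continuousAt ((chartAt _ j).open_source.mem_nhds h)

lemma Worldvolume.hasMFDerivAt_inclDiff {j : Ξ} {s : S}
    (h : W.incl s ∈ (κ₁ j).source) :
    HasMFDerivAt R₀ 𝓘(ℝ, E₊) (fun τ => χ₁ j (W.incl τ)) s
      (W.inclDiff j s) :=
  (mdifferentiableAt_extChartAt (I := R₁) h).hasMFDerivAt.comp s
    (W.mdifferentiableAt_incl s).hasMFDerivAt

/-- The image of the boundary is tangent to the boundary of the half-space. -/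
lemma Worldvolume.inclDiff_zero {j : Ξ} {s : S}
    (h : W.incl s ∈ (κ₁ j).source) (u : E₀) :
    W.inclDiff j s u 0 = 0 := by
  let T : E₊ →L[ℝ] ℝ := EuclideanSpace.proj (0 : Fin (n + 1))
  have h1 : HasMFDerivAt 𝓘(ℝ, E₊) 𝓘(ℝ, ℝ) T (χ₁ j (W.incl s)) T :=
    T.hasFDerivAt.hasMFDerivAt
  have h2 := h1.comp s (W.hasMFDerivAt_inclDiff h)
  have h3 : HasMFDerivAt R₀ 𝓘(ℝ, ℝ) (fun _ : S => (0 : ℝ)) s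
      (T.comp (W.inclDiff j s) : E₀ →L[ℝ] ℝ) := by
    refine h2.congr_of_eventuallyEq ?_
    filter_upwards [W.eventually_incl h] with τ hτ
    exact ((mem_boundary_iff hτ).1 (W.incl_mem_boundary τ)).symm
  have h4 : HasMFDerivAt R₀ 𝓘(ℝ, ℝ) (fun _ : S => (0 : ℝ)) s (0 : E₀ →L[ℝ] ℝ) :=
    hasMFDerivAt_const (0 : ℝ) s
  have h5 := hasMFDerivAt_unique h3 h4
  exact congrArg (fun A : E₀ →L[ℝ] ℝ => A u) h5

/-- The coordinates of a boundary point in a chart of the worldvolume. -/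
def Worldvolume.bdryCoord (j : Ξ) (s : S) : E₀ :=
  WithLp.toLp 2 fun l => χ₁ j (W.incl s) (Fin.succ l)

/-- The matrix of the components of tangent vectors of the boundary along the boundary of the
half-space. -/
def Worldvolume.tailMatrix (j : Ξ) (s : S) (b : Fin n → TangentSpace R₀ s) :
    Matrix (Fin n) (Fin n) ℝ := Matrix.of fun i l => W.inclDiff j s (b l) (Fin.succ i)

/-- The projection to the last `n` coordinates. -/
def tailProj : E₊ →L[ℝ] E₀ :=
  ((PiLp.continuousLinearEquiv 2 ℝ fun _ : Fin n => ℝ).symm : (Fin n → ℝ) →L[ℝ] E₀).comp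
    (ContinuousLinearMap.pi fun l => (EuclideanSpace.proj (Fin.succ l) : E₊ →L[ℝ] ℝ))

/-- The differential of the boundary coordinates, in a chart of the boundary. -/
def Worldvolume.bdryDiff (j : Ξ) (i : S) (y : E₀) : E₀ →L[ℝ] E₀ :=
  tailProj.comp ((W.inclDiff j ((χ i).symm y)).comp
    (mfderivWithin 𝓘(ℝ, E₀) R₀ (χ i).symm (Set.range R₀) y : E₀ →L[ℝ] E₀))

lemma Worldvolume.hasFDerivAt_bdryCoord {j : Ξ} {i : S} {y : E₀}
    (hy : y ∈ (χ i).target)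
    (h : W.incl ((χ i).symm y) ∈ (κ₁ j).source) :
    HasFDerivAt (fun z => W.bdryCoord j ((χ i).symm z)) (W.bdryDiff j i y) y := by
  have h1 := (mdifferentiableWithinAt_extChartAt_symm hy (I := R₀)).hasMFDerivWithinAt
  have h2 := hasMFDerivWithinAt_iff_hasFDerivWithinAt.1
    ((W.hasMFDerivAt_inclDiff h).comp_hasMFDerivWithinAt y h1)
  have h3 := (tailProj (n := n)).hasFDerivAt.comp_hasFDerivWithinAt y h2
  have hr : Set.range R₀ = Set.univ := (R₀).range_eq_univ
  rw [hr, hasFDerivWithinAt_univ] at h3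
  exact h3.congr_fderiv (by rw [← hr]; rfl)

lemma Worldvolume.matrixOf_bdryDiff (j : Ξ) (i : S) (y : E₀) :
    matrixOf (W.bdryDiff j i y) = W.tailMatrix j _ (coordFrame R₀ i y) := by
  ext a l
  rfl

lemma Worldvolume.det_bdryDiff (j : Ξ) (i : S) (y : E₀) :
    (W.bdryDiff j i y).det = (W.tailMatrix j _ (coordFrame R₀ i y)).det := by
  rw [← det_matrixOf, W.matrixOf_bdryDiff]

lemma Worldvolume.det_bdryDiff_ne_zero {j : Ξ} {i : S} {y : E₀}
    (hy : y ∈ (χ i).target)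
    (h : W.incl ((χ i).symm y) ∈ (κ₁ j).source) :
    (W.bdryDiff j i y).det ≠ 0 := by
  have hinj : Function.Injective (W.bdryDiff j i y) := by
    rw [injective_iff_map_eq_zero]
    intro v hv
    set u : E₀ := (mfderivWithin 𝓘(ℝ, E₀) R₀ (χ i).symm (Set.range R₀) y :
      E₀ →L[ℝ] E₀) v with hu
    have h1 : W.inclDiff j ((χ i).symm y) u = 0 := by
      ext l
      refine Fin.cases (W.inclDiff_zero h u) (fun l => ?_) l
      exact congrArg (fun w : E₀ => w l) hv
    have h2 : (mfderiv R₀ R₁ W.incl ((χ i).symm y) u : E₊) = 0 := by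
      refine (bijective_chartDiff h).1 (h1.trans ?_)
      exact (map_zero (chartDiff j (W.incl ((χ i).symm y)))).symm
    have h3 : u = 0 := by
      refine mfderiv_injective_of_isImmersion W.incl_embedding.isImmersion _ (h2.trans ?_)
      exact (map_zero (mfderiv R₀ R₁ W.incl ((χ i).symm y))).symm
    have h4 := mfderiv_extChartAt_comp_mfderivWithin_extChartAt_symm (I := R₀) hy
    have h5 := congrArg (fun T : E₀ →L[ℝ] E₀ => T v) h4
    refine h5.symm.trans ?_
    change mfderiv R₀ 𝓘(ℝ, E₀) (χ i) ((χ i).symm y) u = 0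
    rw [h3]
    exact map_zero (mfderiv R₀ 𝓘(ℝ, E₀) (χ i) ((χ i).symm y))
  have := (LinearEquiv.ofInjectiveEndo (W.bdryDiff j i y).toLinearMap hinj).isUnit_det'
  exact this.ne_zero

lemma Worldvolume.continuousAt_det_bdryDiff {j : Ξ} {i : S} {y : E₀}
    (hy : y ∈ (χ i).target)
    (h : W.incl ((χ i).symm y) ∈ (κ₁ j).source) :
    ContinuousAt (fun z => (W.bdryDiff j i z).det) y := by
  have hc : ContinuousAt (χ i).symm y := continuousAt_extChartAt_symm'' hy
  have hev : ∀ᶠ z in 𝓝 y, z ∈ (χ i).target ∧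
      W.incl ((χ i).symm z) ∈ (κ₁ j).source :=
    (show ∀ᶠ z in 𝓝 y, z ∈ (χ i).target from
      (isOpen_extChartAt_target i).mem_nhds hy).and (hc.eventually (W.eventually_incl h))
  have hs : ContDiffAt ℝ ∞ (fun z => W.bdryCoord j ((χ i).symm z)) y := by
    have h1 : ContMDiffAt 𝓘(ℝ, E₀) R₀ ∞ (χ i).symm y :=
      (contMDiffOn_extChartAt_symm i).contMDiffAt ((isOpen_extChartAt_target i).mem_nhds hy)
    have h2 := (contMDiffAt_extChartAt' (n := ∞) (I := R₁) h).comp y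
      ((W.incl_embedding.contMDiff _).comp y h1)
    have h3 := contMDiffAt_iff_contDiffAt.1 h2
    exact (tailProj (n := n)).contDiff.contDiffAt.comp y h3
  have hf : ContinuousAt (fderiv ℝ fun z => W.bdryCoord j ((χ i).symm z)) y :=
    (hs.fderiv_right (m := 0) (by simp)).continuousAt
  have hd := (ContinuousLinearMap.continuous_det (E := E₀) (𝕜 := ℝ)).continuousAt.comp hf
  refine hd.congr (hev.mono fun z hz => ?_)
  change (fderiv ℝ _ z).det = _
  rw [(W.hasFDerivAt_bdryCoord hz.1 hz.2).fderiv]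

lemma Worldvolume.bdrySign_eq {j : Ξ} {s : S}
    (h : W.incl s ∈ (κ₁ j).source)
    (b : Fin n → TangentSpace R₀ s) :
    W.bdrySign s b =
      -(Real.sign (W.tailMatrix j s b).det * Real.sign (W.orientAt j (W.incl s))) := by
  have h1 := topForm_frameAt h (W.orient.toFun (W.incl s)).toAlternatingMap (outward (W.incl s))
    (fun a => mfderiv R₀ R₁ W.incl s (b a)) (fun l => W.inclDiff_zero h (b l))
  have h2 := mfderiv_extChartAt_outward_neg h (W.incl_mem_boundary s)
  change Real.sign ((W.orient.toFun (W.incl s)).toAlternatingMap _) = _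
  refine (congrArg Real.sign h1).trans ?_
  rw [Real.sign_mul', Real.sign_mul', Real.sign_of_neg h2]
  change -1 * Real.sign (W.tailMatrix j s b).det * Real.sign (W.orientAt j (W.incl s)) = _
  ring

/-- The boundary orientation sign of a coordinate frame is locally constant. -/
lemma Worldvolume.bdrySign_eventually_eq {i : S} {y : E₀}
    (hy : y ∈ (χ i).target) :
    ∀ᶠ z in 𝓝 y, W.bdrySign _ (coordFrame R₀ i z) = W.bdrySign _ (coordFrame R₀ i y) := by
  set j := W.incl ((χ i).symm y)
  have hj : j ∈ (κ₁ j).source := mem_chart_source _ j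
  have hc : ContinuousAt (χ i).symm y := continuousAt_extChartAt_symm'' hy
  have h1 := Real.sign_eventuallyEq (s := Set.univ)
    (W.continuousAt_det_bdryDiff hy hj).continuousWithinAt (W.det_bdryDiff_ne_zero hy hj)
  have h2 : ContinuousAt (fun z => W.orientAt j (W.incl ((χ i).symm z))) y := by
    have h3 : ContinuousAt (W.orientAt j) j :=
      (W.continuousOn_orientAt j).continuousAt ((chartAt _ j).open_source.mem_nhds hj)
    have h4 : ContinuousAt (fun z => W.incl ((χ i).symm z)) y :=
      ContinuousAt.comp (W.mdifferentiableAt_incl _).continuousAt hc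
    exact ContinuousAt.comp (g := W.orientAt j) h3 h4
  have h5 := Real.sign_eventuallyEq (s := Set.univ) h2.continuousWithinAt (W.orientAt_ne_zero hj)
  rw [nhdsWithin_univ] at h1 h5
  filter_upwards [h1, h5, hc.eventually (W.eventually_incl hj)] with z hz1 hz2 hz3
  rw [W.bdrySign_eq hz3, W.bdrySign_eq hj, ← W.det_bdryDiff, ← W.det_bdryDiff, hz1, hz2]

lemma Worldvolume.bdrySign_ne_zero {i : S} {y : E₀}
    (hy : y ∈ (χ i).target) : W.bdrySign _ (coordFrame R₀ i y) ≠ 0 := by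
  set j := W.incl ((χ i).symm y)
  have hj : j ∈ (κ₁ j).source := mem_chart_source _ j
  rw [W.bdrySign_eq hj, ← W.det_bdryDiff, neg_ne_zero]
  refine mul_ne_zero ?_ ?_
  · rw [Ne, Real.sign_eq_zero_iff]
    exact W.det_bdryDiff_ne_zero hy hj
  · rw [Ne, Real.sign_eq_zero_iff]
    exact W.orientAt_ne_zero hj

/-- The orientation sign of a coordinate frame is locally constant. -/
lemma Worldvolume.bulkSign_eventually_eq {j : Ξ} {y : E₊}
    (hy : y ∈ (χ₁ j).target) :
    ∀ᶠ z in 𝓝[(χ₁ j).target] y,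
      W.bulkSign _ (coordFrame R₁ j z) = W.bulkSign _ (coordFrame R₁ j y) := by
  refine Real.sign_eventuallyEq (f := fun z => W.orient.toFun _ (coordFrame R₁ j z)) ?_ ?_
  · exact (W.orient.contDiffWithinAt (contMDiffOn_extChartAt_symm (n := ∞) j y hy)
      (fun a => contMDiffOn_coordFrame j a y hy)).continuousWithinAt
  · have h1 : (χ₁ j).symm y ∈
        (κ₁ j).source := by
      rw [← extChartAt_source R₁]
      exact (extChartAt _ j).map_target hy
    have := W.orientAt_ne_zero h1
    rwa [Worldvolume.orientAt, show frameAt j ((χ₁ j).symm y) = _ from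
      funext (frameAt_symm hy)] at this

end Boundary

/-! ### Paths of fields in charts of the worldvolume -/

section ChartMap

/-- A time-dependent map `c`, in the chart of the source at `i`. -/
def chartMap (J : ModelWithCorners ℝ (𝔼 m) HN) (c : ℝ × N → M) (i : N)
    (p : ℝ × (𝔼 m)) : M := c (p.1, (extChartAt J i).symm p.2)

variable (J) in
/-- The domain of `chartMap`. -/
abbrev chartDomain (i : N) : Set (ℝ × (𝔼 m)) := Set.univ ×ˢ (χⱼ i).target

lemma uniqueDiffOn_chartDomain (i : N) : UniqueDiffOn ℝ (chartDomain J i) :=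
  uniqueDiffOn_univ.prod (uniqueDiffOn_extChartAt_target i)

lemma contMDiffOn_fst_symm (i : N) :
    ContMDiffOn 𝓘(ℝ, ℝ × (𝔼 m)) (𝓘(ℝ, ℝ).prod J) ∞
      (fun p : ℝ × (𝔼 m) => (p.1, (χⱼ i).symm p.2)) (chartDomain J i) := by
  refine ContMDiffOn.prodMk (contDiff_fst.contMDiff.contMDiffOn) ?_
  exact (contMDiffOn_extChartAt_symm (n := ∞) i).comp contDiff_snd.contMDiff.contMDiffOn
    fun p hp => hp.2

lemma contMDiffOn_chartMap {c : ℝ × N → M} (hc : ContMDiff (𝓘(ℝ, ℝ).prod J) I ∞ c) (i : N) :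
    ContMDiffOn 𝓘(ℝ, ℝ × (𝔼 m)) I ∞ (chartMap J c i) (chartDomain J i) :=
  hc.comp_contMDiffOn (contMDiffOn_fst_symm i)

lemma contMDiff_slice {c : ℝ × N → M} (hc : ContMDiff (𝓘(ℝ, ℝ).prod J) I ∞ c) (t : ℝ) :
    ContMDiff J I ∞ (fun x => c (t, x)) :=
  hc.comp (contMDiff_const.prodMk contMDiff_id)

lemma velocity_chartMap {c : ℝ × N → M} (hc : ContMDiff (𝓘(ℝ, ℝ).prod J) I ∞ c) (i : N) {t : ℝ}
    {y : (𝔼 m)} (hy : y ∈ (χⱼ i).target) (v : (𝔼 m)) :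
    velocity I (chartMap J c i) (chartDomain J i) (t, y) (0, v) =
      mfderiv J I (fun x => c (t, x)) ((χⱼ i).symm y)
        (mfderivWithin 𝓘(ℝ, (𝔼 m)) J (χⱼ i).symm (Set.range J) y v) := by
  have h1 := ((contMDiffOn_chartMap hc i (t, y) ⟨Set.mem_univ _, hy⟩).mdifferentiableWithinAt
    infty_ne_zero).hasMFDerivWithinAt
  have h2 : HasMFDerivWithinAt 𝓘(ℝ, (𝔼 m)) 𝓘(ℝ, ℝ × (𝔼 m)) (fun z : (𝔼 m) => (t, z))
      (χⱼ i).target y (ContinuousLinearMap.inr ℝ ℝ (𝔼 m)) :=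
    ((hasFDerivAt_const t y).prodMk (hasFDerivAt_id y)).hasFDerivWithinAt.hasMFDerivWithinAt
  have h3 := h1.comp y h2 (fun z hz => ⟨Set.mem_univ _, hz⟩)
  have h4 := (mdifferentiableWithinAt_extChartAt_symm hy (I := J)).hasMFDerivWithinAt.mono
    (extChartAt_target_subset_range i)
  have h5 := ((contMDiff_slice hc t).mdifferentiableAt (x := (χⱼ i).symm y)
    infty_ne_zero).hasMFDerivAt.comp_hasMFDerivWithinAt y h4
  have h6 := (uniqueDiffOn_extChartAt_target i y hy).uniqueMDiffWithinAt.eq h3 h5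
  exact congrArg (fun T : (𝔼 m) →L[ℝ] TangentSpace I (c (t, (χⱼ i).symm y)) => T v) h6

lemma velocity_chartMap_time {c : ℝ × N → M} (hc : ContMDiff (𝓘(ℝ, ℝ).prod J) I ∞ c) (i : N)
    {t : ℝ} {y : (𝔼 m)} (hy : y ∈ (χⱼ i).target) :
    velocity I (chartMap J c i) (chartDomain J i) (t, y) (1, 0) =
      mfderiv 𝓘(ℝ, ℝ) I (fun τ => c (τ, (χⱼ i).symm y)) t (1 : ℝ) := by
  have h1 := ((contMDiffOn_chartMap hc i (t, y) ⟨Set.mem_univ _, hy⟩).mdifferentiableWithinAt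
    infty_ne_zero).hasMFDerivWithinAt
  have h2 : HasMFDerivWithinAt 𝓘(ℝ, ℝ) 𝓘(ℝ, ℝ × (𝔼 m)) (fun τ : ℝ => (τ, y))
      Set.univ t (ContinuousLinearMap.inl ℝ ℝ (𝔼 m)) :=
    ((hasFDerivAt_id t).prodMk (hasFDerivAt_const y t)).hasFDerivWithinAt.hasMFDerivWithinAt
  have h3 := HasMFDerivWithinAt.comp (u := chartDomain J i) (f := fun τ : ℝ => (τ, y)) t h1 h2
    (fun τ _ => ⟨Set.mem_univ _, hy⟩)
  rw [hasMFDerivWithinAt_univ] at h3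
  exact (congrArg (fun T : ℝ →L[ℝ] TangentSpace I (c (t, (χⱼ i).symm y)) => T 1)
    h3.mfderiv).symm

/-- A form evaluated on the velocities of a smooth map is smooth. -/
lemma DForm.contDiffOn_velocity {k : ℕ} (α : DForm I M k) {P : Type*} [NormedAddCommGroup P]
    [NormedSpace ℝ P] {C : P → M} {s : Set P} (hs : UniqueDiffOn ℝ s)
    (hC : ContMDiffOn 𝓘(ℝ, P) I ∞ C s) (d : Fin k → P) :
    ContDiffOn ℝ ∞ (fun p => α.toFun (C p) (fun l => velocity I C s p (d l))) s := fun p hp =>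
  α.contDiffWithinAt (hC p hp) fun l => contMDiffOn_velocity hs hC (d l) p hp

end ChartMap

section Paths

variable {φ : ℝ → Fields W V}

/-- The restriction to `Σ` of a path of maps `X_t`. -/
def bdryPath (φ : ℝ → Fields W V) (z : ℝ × S) : M := (φ z.1).X (W.incl z.2)

/-- A path of maps `X_t`. -/
def bulkPath (φ : ℝ → Fields W V) (z : ℝ × Ξ) : M := (φ z.1).X z.2

lemma IsSmoothPath.bulk (hφ : IsSmoothPath I F φ) :
    ContMDiff (𝓘(ℝ, ℝ).prod R₁) I ∞ (bulkPath φ) := hφ.1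

lemma IsSmoothPath.bdry (hφ : IsSmoothPath I F φ) :
    ContMDiff (𝓘(ℝ, ℝ).prod R₀) I ∞ (bdryPath φ) :=
  hφ.1.comp (contMDiff_fst.prodMk (W.incl_embedding.contMDiff.comp contMDiff_snd))

lemma IsSmoothPath.dXbdry_eq (hφ : IsSmoothPath I F φ) (t : ℝ) (s : S) (u : TangentSpace R₀ s) :
    (φ t).dXbdry I s u = mfderiv R₀ I (fun τ => bdryPath φ (t, τ)) s u := by
  have h1 := ((contMDiff_slice hφ.bulk t).mdifferentiableAt (x := W.incl s)
    infty_ne_zero).hasMFDerivAt.comp s (W.mdifferentiableAt_incl s).hasMFDerivAt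
  exact (congrArg (fun T : E₀ →L[ℝ] TangentSpace I ((φ t).X (W.incl s)) => T u) h1.mfderiv).symm

/-- The maps `X_t` restricted to `Σ`, in a chart of `Σ`. -/
abbrev bdryMap (φ : ℝ → Fields W V) (i : S) : ℝ × E₀ → M := chartMap R₀ (bdryPath φ) i

/-- The component of `A_t` along the `l`-th coordinate vector of a chart of `Σ`. -/
def gaugeComp (φ : ℝ → Fields W V) (i : S) (p : ℝ × E₀) (l : Fin n) : V (bdryMap φ i p) :=
  (φ p.1).A ((χ i).symm p.2) (coordFrame R₀ i p.2 l)

lemma IsSmoothPath.velocity_bdryMap (hφ : IsSmoothPath I F φ) {i : S} {t : ℝ} {y : E₀}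
    (hy : y ∈ (χ i).target) (l : Fin n) :
    velocity I (bdryMap φ i) (chartDomain R₀ i) (t, y) (0, single l 1) =
      (φ t).dXbdry I ((χ i).symm y) (coordFrame R₀ i y l) :=
  (velocity_chartMap hφ.bdry i hy _).trans (hφ.dXbdry_eq t _ _).symm

lemma IsSmoothPath.contMDiffOn_gaugeComp (hφ : IsSmoothPath I F φ) (i : S) (l : Fin n) :
    ContMDiffOn 𝓘(ℝ, ℝ × E₀) (I.prod 𝓘(ℝ, F)) ∞
      (fun p => TotalSpace.mk' F (bdryMap φ i p) (gaugeComp φ i p l)) (chartDomain R₀ i) := by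
  have h1 : ContMDiffOn 𝓘(ℝ, ℝ × E₀) (𝓘(ℝ, ℝ).prod (R₀).tangent) ∞
      (fun p : ℝ × E₀ => (p.1, (TotalSpace.mk' E₀ (E := fun x : S => TangentSpace R₀ x)
        ((χ i).symm p.2) (coordFrame R₀ i p.2 l) : TangentBundle R₀ S)))
      (chartDomain R₀ i) := by
    refine ContMDiffOn.prodMk (contDiff_fst.contMDiff.contMDiffOn) ?_
    exact (contMDiffOn_coordFrame i l).comp contDiff_snd.contMDiff.contMDiffOn fun p hp => hp.2
  exact hφ.2.comp_contMDiffOn h1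

end Paths

/-! ### Stokes' theorem on the worldvolume -/

section Interior

/-- The alternating map `b ↦ ∑_a ξ(b_a) f(T b_1, …, u, …, T b_m)`, with `u` in the place `a`. -/
lemma exists_alternating_wedge {A B : Type*} [AddCommGroup A] [Module ℝ A] [AddCommGroup B]
    [Module ℝ B] {k : ℕ} (f : A [⋀^Fin (k + 1)]→ₗ[ℝ] ℝ) (T : B →ₗ[ℝ] A) (ξ : B →ₗ[ℝ] ℝ) (u : A) :
    ∃ g : B [⋀^Fin (k + 1)]→ₗ[ℝ] ℝ, ∀ b : Fin (k + 1) → B,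
      g b = ∑ a, ξ (b a) * f (update (fun l => T (b l)) a u) := by
  refine ⟨AlternatingMap.alternatizeUncurryFin
    (ξ.smulRight ((f.curryLeft u).compLinearMap T)), fun b => ?_⟩
  rw [AlternatingMap.alternatizeUncurryFin_apply]
  refine sum_congr rfl fun a _ => ?_
  rw [alt_update_eq_cons, ← Int.cast_smul_eq_zsmul ℝ]
  simp only [LinearMap.smulRight_apply, AlternatingMap.smul_apply, smul_eq_mul]
  push_cast
  rw [mul_left_comm]
  rfl

/-- The Stokes integrands `σ f(T b_1, …, u, …)` satisfy the density law of
`sum_integral_wedgeCovector`. -/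
lemma isDensity_wedgeCovector {k : ℕ} {HN : Type*} [TopologicalSpace HN]
    {J : ModelWithCorners ℝ (𝔼 (k + 1)) HN}
    {N : Type*} [TopologicalSpace N] [ChartedSpace HN N] [IsManifold J ∞ N] [T2Space N]
    [CompactSpace N] {A : N → Type*} [∀ x, AddCommGroup (A x)] [∀ x, Module ℝ (A x)]
    (o : ∀ x : N, (TangentSpace J x) [⋀^Fin (k + 1)]→ₗ[ℝ] ℝ)
    (f : ∀ x, (A x) [⋀^Fin (k + 1)]→ₗ[ℝ] ℝ) (T : ∀ x : N, TangentSpace J x →ₗ[ℝ] A x)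
    (u : ∀ x, A x) (ξ : ∀ x : N, TangentSpace J x →L[ℝ] ℝ) :
    IsDensity (wedgeCovector (fun x a b =>
      Real.sign (o x b) * f x (update (fun l => T x (b l)) a (u x))) ξ) := by
  choose g hg using fun x => exists_alternating_wedge (f x) (T x) (ξ x).toLinearMap (u x)
  have h := isDensity_sign_mul o g
  refine (congrArg IsDensity (funext fun x => funext fun b => ?_)).mp h
  rw [hg, wedgeCovector, mul_sum]
  exact sum_congr rfl fun a _ => mul_left_comm _ _ _

lemma contDiffOn_mul_of_locally_eq {E : Type*} [NormedAddCommGroup E] [NormedSpace ℝ E] {s : Set E}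
    {k : WithTop ℕ∞} {σ f : E → ℝ} (hσ : ∀ y ∈ s, ∀ᶠ z in 𝓝[s] y, σ z = σ y)
    (hf : ContDiffOn ℝ k f s) : ContDiffOn ℝ k (fun y => σ y * f y) s := fun y hy =>
  ((contDiffWithinAt_const (c := σ y)).mul (hf y hy)).congr_of_eventuallyEq
    ((hσ y hy).mono fun z hz => by simp only [hz]) rfl

variable {P : Type*} [NormedAddCommGroup P] [NormedSpace ℝ P]

lemma velocity_subset {C : P → M} {s s' : Set P} (hs : UniqueDiffOn ℝ s') (hss : s' ⊆ s)
    (hC : ContMDiffOn 𝓘(ℝ, P) I ∞ C s) {p : P} (hp : p ∈ s') (d : P) :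
    velocity I C s p d = velocity I C s' p d := by
  have h := mfderivWithin_subset hss (hs p hp).uniqueMDiffWithinAt
    ((hC p (hss hp)).mdifferentiableWithinAt infty_ne_zero)
  exact (congrArg (fun T : P →L[ℝ] TangentSpace I (C p) => T d) h).symm

end Interior

section Face

variable (W)

/-- The inclusion of the boundary of the half-space. -/
def faceMap (y : E₀) : E₊ := WithLp.toLp 2 (Fin.cons 0 y)

lemma continuous_faceMap : Continuous (faceMap (n := n)) := by
  refine (PiLp.continuous_toLp 2 _).comp (continuous_pi fun l => ?_)
  refine Fin.cases ?_ (fun l => ?_) l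
  · exact continuous_const
  · have : Continuous fun y : E₀ => y l := by fun_prop
    exact this

lemma hasCompactSupport_comp_faceMap {f : E₊ → ℝ} (hf : HasCompactSupport f) :
    HasCompactSupport (fun y => f (faceMap (n := n) y)) := by
  have hl : Function.LeftInverse (tailProj (n := n)) faceMap := fun y => by
    ext l; rfl
  exact hf.comp_isClosedEmbedding
    (hl.isClosedEmbedding (tailProj (n := n)).continuous continuous_faceMap)

lemma faceMap_bdryCoord {j : Ξ} {s : S}
    (h : W.incl s ∈ (κ₁ j).source) :
    faceMap (W.bdryCoord j s) = χ₁ j (W.incl s) := by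
  ext l
  refine Fin.cases ?_ (fun l => rfl) l
  exact ((mem_boundary_iff h).1 (W.incl_mem_boundary s)).symm

lemma inFrame_extChartAt (D : ∀ ξ : Ξ, (Fin (n + 1) → TangentSpace R₁ ξ) → ℝ) {j ξ : Ξ}
    (h : ξ ∈ (κ₁ j).source) :
    inFrame D j (χ₁ j ξ) = D ξ (frameAt j ξ) := by
  have h' : ξ ∈ (χ₁ j).source := by rwa [extChartAt_source]
  have h3 := (χ₁ j).left_inv h'
  rw [inFrame, show coordFrame R₁ j (χ₁ j ξ) = _ from
    funext fun a => (frameAt_symm ((extChartAt _ j).map_source h') a).symm, h3]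

/-- The contributions of the faces of the charts to Stokes' formula add up to the integral over the
boundary. -/
lemma Worldvolume.integralDensity_bdry
    {Λ : ∀ ξ : Ξ, Fin (n + 1) → (Fin (n + 1) → TangentSpace R₁ ξ) → ℝ}
    (θ : ∀ ξ : Ξ, (TangentSpace R₁ ξ) [⋀^Fin n]→ₗ[ℝ] ℝ)
    (hΛ : ∀ ξ b, Λ ξ 0 b = W.bulkSign ξ b * θ ξ (fun l => b (Fin.succ l)))
    (hsm : ∀ j, ContDiffOn ℝ 1 (inFrame (fun ξ => Λ ξ 0) j) (χ₁ j).target) :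
    integralDensity R₀ (fun s b => W.bdrySign s b *
        θ (W.incl s) (fun l => mfderiv R₀ R₁ W.incl s (b l))) =
      - ∑ j ∈ chartIndices R₁ Ξ, ∫ y, cutoff Λ j 0 (faceMap y) := by
  set D : ∀ s : S, (Fin n → TangentSpace R₀ s) → ℝ := fun s b => W.bdrySign s b *
    θ (W.incl s) (fun l => mfderiv R₀ R₁ W.incl s (b l)) with hD
  let Dj : Ξ → ∀ s : S, (Fin n → TangentSpace R₀ s) → ℝ := fun j s b =>
    chartPartition R₁ (N := Ξ) j (W.incl s) * D s b
  have key : ∀ j, (∀ i, IntegrableOn (fun y => chartPartition R₀ (N := S) i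
        ((χ i).symm y) * Dj j ((χ i).symm y) (coordFrame R₀ i y))
        (χ i).target) ∧
      integralDensity R₀ (Dj j) = ∫ y, -cutoff Λ j 0 (faceMap y) := by
    intro j
    set O : Set S := {s | W.incl s ∈ (κ₁ j).source} with hO
    have hzero : ∀ y ∉ W.bdryCoord j '' O, -cutoff Λ j 0 (faceMap y) = 0 := by
      intro y hy
      rw [neg_eq_zero, cutoff, Set.indicator_of_notMem]
      intro hy'
      refine hy ?_
      have hs := (χ₁ j).map_target hy'
      rw [extChartAt_source] at hs
      have hr := (χ₁ j).right_inv hy'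
      have hb := (mem_boundary_iff hs).2 (by rw [hr]; rfl)
      rw [← W.range_incl] at hb
      obtain ⟨s, hs'⟩ := hb
      refine ⟨s, by rw [hO, Set.mem_ofPred, hs']; exact hs, ?_⟩
      ext l
      change χ₁ j (W.incl s) (Fin.succ l) = y l
      rw [hs', hr]
      rfl
    have hcont : Continuous fun y => -cutoff Λ j 0 (faceMap (n := n) y) := by
      refine Continuous.neg ?_
      have := (contDiffOn_cutoff (hsm j)).continuousOn
      exact this.comp_continuous continuous_faceMap fun y => by
        rw [range_halfSpace]
        exact le_refl (0 : ℝ)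
    have hcs : HasCompactSupport fun y => -cutoff Λ j 0 (faceMap (n := n) y) :=
      (hasCompactSupport_comp_faceMap (hasCompactSupport_cutoff j 0)).neg
    have h := integralDensity_eq_setIntegral (J := R₀) (D := Dj j) (O := O)
      ((κ₁ j).open_source.preimage
        W.incl_embedding.isEmbedding.continuous)
      (fun s hs b => by
        change _ * _ = _
        rw [chartPartition_eq_zero_of_notMem hs, zero_mul])
      (κ := W.bdryCoord j)
      (fun s hs s' hs' hss => by
        have h1 := congrArg faceMap hss
        rw [faceMap_bdryCoord W hs, faceMap_bdryCoord W hs'] at h1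
        refine W.incl_embedding.isEmbedding.injective
          ((χ₁ j).injOn ?_ ?_ h1)
        · rw [extChartAt_source]; exact hs
        · rw [extChartAt_source]; exact hs')
      (g := fun y => -cutoff Λ j 0 (faceMap y))
      (hcont.integrable_of_hasCompactSupport hcs).integrableOn
      (fun i y hy hyO => ?_)
    · rwa [setIntegral_eq_integral_of_forall_compl_eq_zero hzero] at h
    · refine ⟨W.bdryDiff j i y, (W.hasFDerivAt_bdryCoord hy hyO).hasFDerivWithinAt, ?_⟩
      set s := (χ i).symm y with hs
      have hyO' : W.incl s ∈ (κ₁ j).source := hyO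
      have hm : χ₁ j (W.incl s) ∈ (χ₁ j).target :=
        (extChartAt _ j).map_source (by rwa [extChartAt_source])
      have hl : (χ₁ j).symm (χ₁ j (W.incl s)) =
        W.incl s := (extChartAt _ j).left_inv (by rwa [extChartAt_source])
      have h1 := form_frameAt hyO' (θ (W.incl s))
        (fun l => mfderiv R₀ R₁ W.incl s (coordFrame R₀ i y l))
        (fun l => W.inclDiff_zero hyO' (coordFrame R₀ i y l))
      have h2 : cutoff Λ j 0 (faceMap (W.bdryCoord j s)) =
          chartPartition R₁ (N := Ξ) j (W.incl s) *
            (Real.sign (W.orientAt j (W.incl s)) *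
              θ (W.incl s) (fun l => frameAt j (W.incl s) (Fin.succ l))) := by
        rw [faceMap_bdryCoord W hyO', cutoff, Set.indicator_of_mem hm, partitionAt, hl,
          inFrame_extChartAt _ hyO', hΛ]
        rfl
      have h3 : W.bdrySign s (coordFrame R₀ i y) =
          -(Real.sign (W.bdryDiff j i y).det * Real.sign (W.orientAt j (W.incl s))) := by
        rw [W.bdrySign_eq hyO', W.det_bdryDiff]
      change chartPartition R₁ (N := Ξ) j (W.incl s) * (W.bdrySign s
        (coordFrame R₀ i y) * θ (W.incl s) _) = |_| * -cutoff Λ j 0 (faceMap (W.bdryCoord j s))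
      rw [h2, h3, ← Real.sign_mul_self]
      have h4 : θ (W.incl s)
          (fun l => mfderiv R₀ R₁ W.incl s (coordFrame R₀ i y l)) =
          (W.bdryDiff j i y).det * θ (W.incl s) (fun l => frameAt j (W.incl s) (Fin.succ l)) := by
        rw [W.det_bdryDiff]
        exact h1
      rw [h4]
      ring
  have hsum : ∀ (s : S) b, D s b = ∑ j ∈ chartIndices R₁ Ξ, Dj j s b := fun s b => by
    change _ = ∑ j ∈ chartIndices R₁ Ξ, _ * D s b
    rw [← sum_mul, sum_chartPartition, one_mul]
  have h1 : integralDensity R₀ D =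
      ∑ j ∈ chartIndices R₁ Ξ, integralDensity R₀ (Dj j) := by
    simp_rw [integralDensity_eq_sum]
    rw [sum_comm]
    refine sum_congr rfl fun i _ => ?_
    rw [← integral_finsetSum _ fun j _ => (key j).1 i]
    refine integral_congr_ae (Filter.Eventually.of_forall fun y => ?_)
    simp only [hsum, mul_sum]
  rw [h1, ← sum_neg_distrib]
  refine sum_congr rfl fun j _ => ?_
  rw [(key j).2, integral_neg]

/-- Stokes' theorem: the integral over `Ξ` of the divergences `∑_a ∂_a Λ_a` in charts is a boundary
integral. -/
lemma Worldvolume.sum_integral_divergence_eq_bdry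
    {Λ : ∀ ξ : Ξ, Fin (n + 1) → (Fin (n + 1) → TangentSpace R₁ ξ) → ℝ}
    (θ : ∀ ξ : Ξ, (TangentSpace R₁ ξ) [⋀^Fin n]→ₗ[ℝ] ℝ)
    (hΛ : ∀ ξ b, Λ ξ 0 b = W.bulkSign ξ b * θ ξ (fun l => b (Fin.succ l)))
    (hdens : ∀ ξ : ∀ x : Ξ, TangentSpace R₁ x →L[ℝ] ℝ, IsDensity (wedgeCovector Λ ξ))
    (hsm : ∀ j a, ContDiffOn ℝ 1 (inFrame (fun ξ => Λ ξ a) j)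
      (χ₁ j).target) :
    ∑ j ∈ chartIndices R₁ Ξ, ∫ y in (χ₁ j).target,
      partitionAt R₁ j y * ∑ a, fderivWithin ℝ (inFrame (fun x => Λ x a) j)
        (Set.range R₁) y (single a 1) =
    integralDensity R₀ (fun s b => W.bdrySign s b *
        θ (W.incl s) (fun l => mfderiv R₀ R₁ W.incl s (b l))) := by
  rw [sum_integral_divergence hdens hsm, W.integralDensity_bdry θ hΛ fun j => hsm j 0,
    ← sum_neg_distrib]
  refine sum_congr rfl fun j _ => ?_
  have h := integral_halfSpace_divergence (fun a => cutoff Λ j a)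
    (fun a => by
      have := contDiffOn_cutoff (hsm j a)
      rwa [range_halfSpace] at this)
    (fun a => hasCompactSupport_cutoff j a)
  rw [range_halfSpace]
  exact h

end Face

/-! ### The variation of the Wess–Zumino term -/

section WessZumino

variable (W) [I.Boundaryless]

/-- The initial velocity of a path of maps. -/
def timeVel {N : Type*} (I : ModelWithCorners ℝ EM HM) (c : ℝ × N → M) (ξ : N) :
    TangentSpace I (c (0, ξ)) := mfderiv 𝓘(ℝ, ℝ) I (fun t => c (t, ξ)) 0 (1 : ℝ)

variable {W} in
lemma Worldvolume.bulkSign_eventually_eq_prod {j : Ξ} {p : ℝ × E₊}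
    (hp : p ∈ chartDomain R₁ j) :
    ∀ᶠ z in 𝓝[chartDomain R₁ j] p, W.bulkSign _ (coordFrame R₁ j z.2) =
      W.bulkSign _ (coordFrame R₁ j p.2) := by
  have : Filter.Tendsto (Prod.snd : ℝ × E₊ → E₊) (𝓝[chartDomain R₁ j] p)
      (𝓝[(χ₁ j).target] p.2) :=
    continuous_snd.continuousWithinAt.tendsto_nhdsWithin fun z hz => hz.2
  exact this.eventually (W.bulkSign_eventually_eq hp.2)

lemma velocity_update {P ι : Type*} [NormedAddCommGroup P] [NormedSpace ℝ P] [DecidableEq ι]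
    (C : P → M) (s : Set P) (p : P) (d : ι → P) (a : ι) (v : P) :
    (fun l => velocity I C s p (update d a v l)) =
      update (fun l => velocity I C s p (d l)) a (velocity I C s p v) :=
  funext fun l => Function.apply_update (fun _ => velocity I C s p) d a v l

/-- The derivative of `∫_Ξ X_t^*H`, for a closed form `H`. -/
lemma hasDerivAt_integral_pullback (H : DForm I M (n + 1)) (hH : ∀ x, extD H.toFun x = 0)
    {c : ℝ × Ξ → M} (hc : ContMDiff (𝓘(ℝ, ℝ).prod R₁) I ∞ c) :
    HasDerivAt (fun t => integralDensity R₁ (N := Ξ) (fun ξ b => W.bulkSign ξ b *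
        H.toFun (c (t, ξ)) (fun a => mfderiv R₁ I (fun ξ => c (t, ξ)) ξ (b a))))
      (integralDensity R₀ (N := S) fun s b => W.bdrySign s b *
        H.toFun (c (0, W.incl s)) (Fin.cons (timeVel I c (W.incl s))
          (fun l => mfderiv R₁ I (fun ξ => c (0, ξ)) (W.incl s)
            (mfderiv R₀ R₁ W.incl s (b l))))) 0 := by
  set J := R₁
  let e : Fin (n + 1) → ℝ × E₊ := fun l => (0, single l 1)
  let C : Ξ → ℝ × E₊ → M := fun j => chartMap J c j
  have hU : ∀ j : Ξ, UniqueDiffOn ℝ (chartDomain J j) := fun j => uniqueDiffOn_chartDomain j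
  have hC : ∀ j : Ξ, ContMDiffOn 𝓘(ℝ, ℝ × E₊) I ∞ (C j) (chartDomain J j) :=
    fun j => contMDiffOn_chartMap hc j
  let D : ℝ → ∀ ξ : Ξ, (Fin (n + 1) → TangentSpace J ξ) → ℝ := fun t ξ b => W.bulkSign ξ b *
    H.toFun (c (t, ξ)) (fun a => mfderiv J I (fun ξ => c (t, ξ)) ξ (b a))
  let h : Ξ → ℝ × E₊ → ℝ := fun j q => H.toFun (C j q)
    (fun l => velocity I (C j) (chartDomain J j) q (e l))
  have hh : ∀ j, ContDiffOn ℝ ∞ (h j) (chartDomain J j) := fun j =>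
    H.contDiffOn_velocity (hU j) (hC j) e
  have hDh : ∀ (j : Ξ) (q : ℝ × E₊), q ∈ chartDomain J j →
      inFrame (D q.1) j q.2 = W.bulkSign _ (coordFrame J j q.2) * h j q := by
    intro j q hq
    refine congrArg (fun w => _ * H.toFun (C j q) w) (funext fun l => ?_)
    exact (velocity_chartMap hc j hq.2 _).symm
  have hsmD : ∀ j : Ξ, ContDiffOn ℝ 1 (fun z : ℝ × E₊ => inFrame (D z.1) j z.2)
      (Set.univ ×ˢ (extChartAt J j).target) := fun j =>
    (contDiffOn_mul_of_locally_eq (fun p hp => Worldvolume.bulkSign_eventually_eq_prod hp)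
      ((hh j).of_le one_le_infty)).congr fun q hq => hDh j q hq
  refine (hasDerivAt_integralDensity hsmD).congr_deriv ?_
  -- the boundary integrand
  let A : ∀ ξ : Ξ, TangentSpace J ξ →ₗ[ℝ] TangentSpace I (c (0, ξ)) := fun ξ =>
    (mfderiv J I (fun ξ => c (0, ξ)) ξ).toLinearMap
  let Λ : ∀ ξ : Ξ, Fin (n + 1) → (Fin (n + 1) → TangentSpace J ξ) → ℝ := fun ξ a b =>
    Real.sign ((W.orient.toFun ξ).toAlternatingMap b) * (H.toFun (c (0, ξ))).toAlternatingMap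
      (update (fun l => A ξ (b l)) a (timeVel I c ξ))
  let k : Ξ → Fin (n + 1) → ℝ × E₊ → ℝ := fun j a q => H.toFun (C j q)
    (update (fun l => velocity I (C j) (chartDomain J j) q (e l)) a
      (velocity I (C j) (chartDomain J j) q (1, 0)))
  have hk : ∀ j a, ContDiffOn ℝ ∞ (k j a) (chartDomain J j) := fun j a => by
    refine (H.contDiffOn_velocity (hU j) (hC j) (update e a (1, 0))).congr fun q _ => ?_
    exact congrArg (H.toFun (C j q)) (velocity_update _ _ _ _ _ _).symm
  have hΛk : ∀ (j : Ξ) (a) (y : E₊), y ∈ (extChartAt J j).target →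
      inFrame (fun ξ => Λ ξ a) j y = W.bulkSign _ (coordFrame J j y) * k j a (0, y) := by
    intro j a y hy
    refine congrArg (fun w => _ * H.toFun (C j (0, y)) w) ?_
    rw [velocity_chartMap_time hc j hy]
    exact congrArg (fun w => update w a _)
      (funext fun l => (velocity_chartMap hc j hy _).symm)
  have hk0 : ∀ j a, ContDiffOn ℝ ∞ (fun y => k j a (0, y)) (extChartAt J j).target := fun j a =>
    (hk j a).comp (contDiff_prodMk_right (0 : ℝ)).contDiffOn fun y hy => ⟨Set.mem_univ _, hy⟩
  have hsm : ∀ j a, ContDiffOn ℝ 1 (inFrame (fun ξ => Λ ξ a) j) (extChartAt J j).target :=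
    fun j a => (contDiffOn_mul_of_locally_eq (fun y hy => W.bulkSign_eventually_eq hy)
      ((hk0 j a).of_le one_le_infty)).congr fun y hy => hΛk j a y hy
  have hst := W.sum_integral_divergence_eq_bdry (Λ := Λ)
    (fun ξ => ((H.toFun (c (0, ξ))).toAlternatingMap.curryLeft (timeVel I c ξ)).compLinearMap (A ξ))
    (fun ξ b => by
      refine congrArg (fun w => _ * H.toFun (c (0, ξ)) w) ?_
      funext l
      refine Fin.cases rfl (fun l => rfl) l)
    (fun ξ => isDensity_wedgeCovector _ _ _ _ ξ) hsm
  refine Eq.trans ?_ hst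
  rw [integralDensity_eq_sum]
  refine sum_congr rfl fun j _ => ?_
  refine setIntegral_congr_ae (measurableSet_extChartAt_target j) ?_
  -- the boundary face of the chart has measure zero
  have hnull : ∀ᵐ y : E₊, y 0 ≠ 0 := by
    let pr : E₊ →ₗ[ℝ] ℝ := (EuclideanSpace.proj (0 : Fin (n + 1)) : E₊ →L[ℝ] ℝ).toLinearMap
    have h0 : (volume : Measure E₊) (LinearMap.ker pr) = 0 := by
      refine Measure.addHaar_submodule _ _ fun htop => ?_
      have h1 : single (0 : Fin (n + 1)) (1 : ℝ) ∈ LinearMap.ker pr := by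
        rw [htop]; trivial
      have h2 : pr (single (0 : Fin (n + 1)) (1 : ℝ)) = 1 := by simp [pr]
      rw [LinearMap.mem_ker, h2] at h1
      exact one_ne_zero h1
    filter_upwards [compl_mem_ae_iff.2 h0] with y hy h
    exact hy h
  filter_upwards [hnull] with y hy0 hy
  refine congrArg (fun r => _ * r) ?_
  have hypos : 0 < y 0 := lt_of_le_of_ne
    (by have := extChartAt_target_subset_range j hy; rwa [range_halfSpace] at this) (Ne.symm hy0)
  set U : Set E₊ := interior (extChartAt J j).target with hUdef
  have hyU : y ∈ U := by
    rw [hUdef, mem_interior_iff_mem_nhds]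
    have h1 := extChartAt_target_mem_nhdsWithin_of_mem (I := J) hy
    have h2 : Set.range J ∈ 𝓝 y := by
      rw [← mem_interior_iff_mem_nhds, interior_range_modelWithCornersEuclideanHalfSpace]
      exact hypos
    rwa [nhdsWithin_eq_nhds.2 h2] at h1
  have hsU : IsOpen (Set.univ ×ˢ U : Set (ℝ × E₊)) := isOpen_univ.prod isOpen_interior
  have hsub : (Set.univ ×ˢ U : Set (ℝ × E₊)) ⊆ chartDomain J j :=
    Set.prod_mono subset_rfl interior_subset
  have hpU : ((0 : ℝ), y) ∈ (Set.univ ×ˢ U : Set (ℝ × E₊)) := ⟨Set.mem_univ _, hyU⟩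
  have hcv := H.chart_variation hsU ((hC j).mono hsub) hpU (1, 0) e
  have hvel : ∀ q ∈ (Set.univ ×ˢ U : Set (ℝ × E₊)), ∀ d,
      velocity I (C j) (Set.univ ×ˢ U) q d = velocity I (C j) (chartDomain J j) q d :=
    fun q hq d => (velocity_subset hsU.uniqueDiffOn hsub (hC j) hq d).symm
  have hnhds : ∀ᶠ q in 𝓝 ((0 : ℝ), y), q ∈ (Set.univ ×ˢ U : Set (ℝ × E₊)) := hsU.mem_nhds hpU
  rw [hH] at hcv
  have hh' : fderiv ℝ (fun q => H.toFun (C j q) fun l => velocity I (C j) (Set.univ ×ˢ U) q (e l))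
      (0, y) = fderiv ℝ (h j) (0, y) := by
    refine Filter.EventuallyEq.fderiv_eq (hnhds.mono fun q hq => ?_)
    exact congrArg (H.toFun (C j q)) (funext fun l => hvel q hq _)
  have hk' : ∀ m, fderiv ℝ (fun q => H.toFun (C j q)
      (update (fun l => velocity I (C j) (Set.univ ×ˢ U) q (e l)) m
        (velocity I (C j) (Set.univ ×ˢ U) q (1, 0)))) (0, y) = fderiv ℝ (k j m) (0, y) := by
    intro m
    refine Filter.EventuallyEq.fderiv_eq (hnhds.mono fun q hq => ?_)
    simp only [hvel q hq]
    rfl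
  rw [hh'] at hcv
  simp only [hk'] at hcv
  have hcv' : fderiv ℝ (h j) (0, y) (1, 0) = ∑ m, fderiv ℝ (k j m) (0, y) (e m) :=
    sub_eq_zero.1 hcv
  -- both sides in terms of the smooth functions `h` and `k`
  have hleft : deriv (fun t => D t ((extChartAt J j).symm y) (coordFrame J j y)) 0 =
      W.bulkSign _ (coordFrame J j y) * fderiv ℝ (h j) (0, y) (1, 0) := by
    have h1 : (fun t => D t ((extChartAt J j).symm y) (coordFrame J j y)) =
        fun t => W.bulkSign _ (coordFrame J j y) * h j (t, y) :=
      funext fun t => hDh j (t, y) ⟨Set.mem_univ _, hy⟩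
    have h2 : DifferentiableAt ℝ (h j) (0, y) :=
      ((hh j).contDiffAt (Filter.mem_of_superset (hsU.mem_nhds hpU) hsub)).differentiableAt
        infty_ne_zero
    have h3 : HasDerivAt (fun t : ℝ => (t, y)) ((1 : ℝ), (0 : E₊)) 0 :=
      (hasDerivAt_id _).prodMk (hasDerivAt_const _ _)
    have h4 : HasDerivAt (fun t => h j (t, y)) (fderiv ℝ (h j) (0, y) (1, 0)) 0 :=
      HasFDerivAt.comp_hasDerivAt (f := fun t : ℝ => (t, y)) 0 h2.hasFDerivAt h3
    rw [h1]
    exact (h4.const_mul _).deriv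
  have hright : ∀ m, fderivWithin ℝ (inFrame (fun x => Λ x m) j) (Set.range J) y
      (single m 1) =
      W.bulkSign _ (coordFrame J j y) * fderiv ℝ (k j m) (0, y) (e m) := by
    intro m
    have hUn : ∀ᶠ z in 𝓝 y, z ∈ U := isOpen_interior.mem_nhds hyU
    have htn : (extChartAt J j).target ∈ 𝓝 y := Filter.mem_of_superset hUn interior_subset
    have h1 : inFrame (fun x => Λ x m) j =ᶠ[𝓝 y]
        fun z => W.bulkSign _ (coordFrame J j y) * k j m (0, z) := by
      have hb := W.bulkSign_eventually_eq hy
      rw [nhdsWithin_eq_nhds.2 htn] at hb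
      filter_upwards [hb, htn] with z hz hzt
      rw [hΛk j m z hzt]
      exact congrArg (fun r => r * _) hz
    have h2 : DifferentiableAt ℝ (k j m) (0, y) :=
      ((hk j m).contDiffAt (Filter.mem_of_superset (hsU.mem_nhds hpU) hsub)).differentiableAt
        infty_ne_zero
    have h4 : HasFDerivAt (fun z => k j m (0, z))
        ((fderiv ℝ (k j m) (0, y)).comp (ContinuousLinearMap.inr ℝ ℝ E₊)) y :=
      HasFDerivAt.comp (f := fun z : E₊ => ((0 : ℝ), z)) y h2.hasFDerivAt
        ((hasFDerivAt_const (0 : ℝ) y).prodMk (hasFDerivAt_id y))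
    have h5 := ((h4.const_mul (W.bulkSign _ (coordFrame J j y))).congr_of_eventuallyEq h1)
    have hr : Set.range J ∈ 𝓝 y := Filter.mem_of_superset htn (extChartAt_target_subset_range j)
    rw [fderivWithin_of_mem_nhds hr, h5.fderiv]
    rfl
  refine hleft.trans ?_
  rw [hcv', mul_sum]
  exact sum_congr rfl fun m _ => (hright m).symm

end WessZumino

/-! ### Gauge variations without frames -/

section FrameDeriv

/-- The coefficients of a differentiable function with respect to a differentiable moving basis are
differentiable, and the product rule holds. -/
lemma moving_basis_deriv {P F : Type*} [NormedAddCommGroup P] [NormedSpace ℝ P]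
    [NormedAddCommGroup F] [NormedSpace ℝ F] {ι : Type*} [Fintype ι] (b : Module.Basis ι ℝ F)
    {T : ι → P → F} {κ : ι → P → ℝ} {w : P → F} {p : P}
    (hT : ∀ a, DifferentiableAt ℝ (T a) p) (hb : ∀ a, T a p = b a) (hw : DifferentiableAt ℝ w p)
    (hev : ∀ᶠ q in 𝓝 p, w q = ∑ a, κ a q • T a q) (v : P) :
    (∀ a, DifferentiableAt ℝ (κ a) p) ∧
    fderiv ℝ w p v = ∑ a, fderiv ℝ (κ a) p v • b a + ∑ a, κ a p • fderiv ℝ (T a) p v := by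
  have : FiniteDimensional ℝ F := b.finiteDimensional_of_finite
  let G : P → (ι → ℝ) →L[ℝ] F := fun q =>
    ∑ a, (ContinuousLinearMap.proj a : (ι → ℝ) →L[ℝ] ℝ).smulRight (T a q)
  have hG : DifferentiableAt ℝ G p := by
    refine DifferentiableAt.fun_sum fun a _ => ?_
    exact ((ContinuousLinearMap.smulRightL ℝ (ι → ℝ) F
      (ContinuousLinearMap.proj a)).differentiableAt).comp p (hT a)
  let e : (ι → ℝ) ≃L[ℝ] F := b.equivFunL.symm
  have hGp : G p = e := by
    refine ContinuousLinearMap.ext fun κ => ?_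
    change _ = b.equivFun.symm κ
    rw [Module.Basis.equivFun_symm_apply]
    simp [G, hb]
  have hinv : DifferentiableAt ℝ (fun q => (G q).inverse) p := by
    have h1 : ContDiffAt ℝ 1 ContinuousLinearMap.inverse (G p) := by
      rw [hGp]; exact contDiffAt_map_inverse e
    exact (h1.differentiableAt one_ne_zero).comp p hG
  have hκ : DifferentiableAt ℝ (fun q a => κ a q) p := by
    refine (hinv.clm_apply hw).congr_of_eventuallyEq ?_
    have hn : ∀ᶠ q in 𝓝 p, ∃ e' : (ι → ℝ) ≃L[ℝ] F, (e' : (ι → ℝ) →L[ℝ] F) = G q := by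
      have h2 : Set.range ((↑) : ((ι → ℝ) ≃L[ℝ] F) → (ι → ℝ) →L[ℝ] F) ∈ 𝓝 (G p) := by
        rw [hGp]; exact e.nhds
      exact hG.continuousAt h2
    filter_upwards [hev, hn] with q hq hq'
    obtain ⟨e', he'⟩ := hq'
    have h3 : w q = e' (fun a => κ a q) := by
      rw [hq, ← ContinuousLinearEquiv.coe_coe, he']
      simp [G]
    rw [← he', ContinuousLinearMap.inverse_equiv, h3]
    exact (e'.symm_apply_apply _).symm
  have hκa : ∀ a, DifferentiableAt ℝ (κ a) p := fun a => differentiableAt_pi.1 hκ a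
  have hd := HasFDerivAt.fun_sum (u := Finset.univ) fun a _ =>
    (hκa a).hasFDerivAt.smul (hT a).hasFDerivAt
  refine ⟨hκa, ?_⟩
  rw [(hd.congr_of_eventuallyEq hev).fderiv]
  simp only [sum_apply, add_apply, smul_apply, ContinuousLinearMap.smulRight_apply, hb]
  rw [sum_add_distrib, add_comm]

end FrameDeriv

variable {φ : ℝ → Fields W V} {ε : ∀ ξ : Ξ, V ((φ 0).X ξ)}

variable (I F) in
/-- Smoothness of a gauge parameter along the initial map of a path of fields. -/
abbrev IsSmoothParam (φ : ℝ → Fields W V) (ε : ∀ ξ : Ξ, V ((φ 0).X ξ)) : Prop :=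
  ContMDiff R₁ (I.prod 𝓘(ℝ, F)) ∞ (fun ξ => TotalSpace.mk' F ((φ 0).X ξ) (ε ξ))

section GaugeEq

/-- The gauge variation of `A` at a vector `u` tangent to `Σ`, expressed by means of global sections
`e` and `Y` extending the values of `ε` and of `A(u)`:
`(δA(u) - ρ(e)Y) - (dε(u) - dX(u)e) = ∇_{DX(u)} e - [e, Y]`. -/
def GaugeEqAt (φ : ℝ → Fields W V) (ε : ∀ ξ : Ξ, V ((φ 0).X ξ)) (s : S)
    (u : TangentSpace R₀ s) (e Y : ΓE) : Prop :=
  unhat F V ((φ 0).X (W.incl s)) ((φ 0).X (W.incl s))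
      (deriv (fun t => hat F V ((φ 0).X (W.incl s)) ((φ t).X (W.incl s)) ((φ t).A s u)) 0 -
        dhat Y ((φ 0).X (W.incl s)) (L.anchor _ (e ((φ 0).X (W.incl s))))) -
    unhat F V ((φ 0).X (W.incl s)) ((φ 0).X (W.incl s))
      (mvfderiv R₀ (fun τ : S => hat F V ((φ 0).X (W.incl s)) ((φ 0).X (W.incl τ))
          (ε (W.incl τ))) s u -
        dhat e ((φ 0).X (W.incl s)) ((φ 0).dXbdry I s u)) =
    cov (fun y => e y) ((φ 0).X (W.incl s))
        ((φ 0).dXbdry I s u - L.anchor _ (Y ((φ 0).X (W.incl s)))) -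
      L.bracket e Y ((φ 0).X (W.incl s))

variable {L cov}

/-- The frame-free gauge variation only depends on the values of the sections at the point. -/
lemma GaugeEqAt.congr {s : S} {u : TangentSpace R₀ s} {e e' Y Y' : ΓE}
    (h : GaugeEqAt L cov φ ε s u e Y)
    (he : e' ((φ 0).X (W.incl s)) = e ((φ 0).X (W.incl s)))
    (hY : Y' ((φ 0).X (W.incl s)) = Y ((φ 0).X (W.incl s))) : GaugeEqAt L cov φ ε s u e' Y' := by
  set x := (φ 0).X (W.incl s) with hx
  have hV : x ∈ triv F V x := mem_triv F V x
  unfold GaugeEqAt at h ⊢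
  rw [← hx] at h ⊢
  refine hat_injective hV ?_
  have h' := congrArg (hat F V x x) h
  simp only [map_sub, hat_unhat hV] at h' ⊢
  have hc1 := fun v => cov_local (cov := cov) e x v
  have hc2 := fun v => cov_local (cov := cov) e' x v
  simp only [he] at hc2
  have hb1 := bracket_local L e Y x
  have hb2 := bracket_local L e' Y' x
  rw [he, hY] at hb2
  rw [hc1, hc1, hb1] at h'
  rw [hc2, hc2, hb2, he, hY]
  rw [← sub_eq_zero] at h' ⊢
  rw [← h']
  abel

lemma IsSmoothPath.differentiableAt_hat (hφ : IsSmoothPath I F φ) (s : S)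
    (u : TangentSpace R₀ s) :
    DifferentiableAt ℝ
      (fun t => hat F V ((φ 0).X (W.incl s)) ((φ t).X (W.incl s)) ((φ t).A s u)) 0 := by
  have h1 : ContMDiff 𝓘(ℝ, ℝ) (I.prod 𝓘(ℝ, F)) ∞
      (fun t => TotalSpace.mk' F ((φ t).X (W.incl s)) ((φ t).A s u)) :=
    hφ.2.comp (contMDiff_id.prodMk
      (contMDiff_const (c := (⟨s, u⟩ : TangentBundle R₀ S))))
  have h2 := ((contMDiffAt_hat (c := fun t => (φ t).X (W.incl s)) (x₀ := (φ 0).X (W.incl s))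
    (mem_triv F V _)).1 (h1 0)).2
  exact (contMDiffAt_iff_contDiffAt.1 h2).differentiableAt infty_ne_zero

lemma mdifferentiableAt_hat_param
    (hε : IsSmoothParam I F φ ε)
    (s : S) : MDifferentiableAt R₀ 𝓘(ℝ, F)
      (fun τ : S => hat F V ((φ 0).X (W.incl s)) ((φ 0).X (W.incl τ)) (ε (W.incl τ))) s := by
  have h1 : ContMDiff R₀ (I.prod 𝓘(ℝ, F)) ∞
      (fun τ => TotalSpace.mk' F ((φ 0).X (W.incl τ)) (ε (W.incl τ))) :=
    hε.comp W.incl_embedding.contMDiff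
  have h2 := ((contMDiffAt_hat (c := fun τ => (φ 0).X (W.incl τ)) (x₀ := (φ 0).X (W.incl s))
    (mem_triv F V _)).1 (h1 s)).2
  exact contMDiff_mdifferentiableAt h2

lemma IsSmoothPath.mdifferentiableAt_time (hφ : IsSmoothPath I F φ) (ξ : Ξ) :
    MDifferentiableAt 𝓘(ℝ, ℝ) I (fun t => (φ t).X ξ) 0 :=
  (hφ.1.comp (contMDiff_id.prodMk (contMDiff_const (c := ξ))) 0).mdifferentiableAt infty_ne_zero

/-- The derivative of the coordinates of a section, as a linear function of the section. -/
def dhatHom (x : M) (v : TangentSpace I x) : ΓE →ₗ[ℝ] F where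
  toFun σ := dhat σ x v
  map_add' σ τ := dhat_add σ τ x v
  map_smul' r σ := by
    have h := mvfderiv_clm (r • ContinuousLinearMap.id ℝ F)
      (contMDiff_mdifferentiableAt (contMDiffAt_section_hat σ
        (mem_triv F V x))) v
    refine Eq.trans (mvfderiv_congr (Filter.Eventually.of_forall fun y => ?_) v) h
    exact map_smul (hat F V x y) r (σ y)

/-- The coordinates of the vectors of a fibre, as a linear equivalence. -/
def hatEquiv (F : Type*) [NormedAddCommGroup F] [NormedSpace ℝ F]
    {V : M → Type*} [TopologicalSpace (TotalSpace F V)]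
    [∀ x, AddCommGroup (V x)] [∀ x, Module ℝ (V x)] [∀ x, TopologicalSpace (V x)]
    [FiberBundle F V] [VectorBundle ℝ F V] {x₀ x : M} (hx : x ∈ triv F V x₀) : V x ≃ₗ[ℝ] F :=
  LinearEquiv.ofLinearMap (hat F V x₀ x).toLinearMap (unhat F V x₀ x).toLinearMap
    (LinearMap.ext fun u => hat_unhat hx u) (LinearMap.ext fun a => unhat_hat hx a)

lemma coeff_eq_repr {ι : Type*} {e : ι → ∀ x, V x} {U : Set M} (he : IsLocalFrameOn I F ∞ e U)
    {x : M} (hx : x ∈ U) (a : ι) (v : V x) : he.coeff a x v = (he.toBasisAt hx).repr v a := by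
  simp [IsLocalFrameOn.coeff, hx]

/-- The gauge variation in a frame is the frame-free one, for sections with constant coefficients
in the frame. -/
lemma gaugeEqAt_frame_iff (hφ : IsSmoothPath I F φ)
    (hε : IsSmoothParam I F φ ε)
    (hX : ∀ ξ : Ξ, mfderiv 𝓘(ℝ, ℝ) I (fun t : ℝ => (φ t).X ξ) 0 (1 : ℝ) = L.anchor _ (ε ξ))
    {U : Set M} (hU : IsOpen U) {e : Fin (Module.finrank ℝ F) → ΓE}
    (he : IsLocalFrameOn I F ∞ (fun a x => e a x) U) {s : S} (hs : (φ 0).X (W.incl s) ∈ U)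
    (u : TangentSpace R₀ s) :
    GaugeEqAt L cov φ ε s u (∑ a, he.coeff a _ (ε (W.incl s)) • e a)
      (∑ a, he.coeff a _ ((φ 0).A s u) • e a) ↔
    ∀ a, deriv (fun t : ℝ => he.coeff a ((φ t).X (W.incl s)) ((φ t).A s u)) 0 =
      mvfderiv R₀ (fun τ : S => he.coeff a ((φ 0).X (W.incl τ)) (ε (W.incl τ))) s u
      + (∑ b, ∑ c, he.coeff a _ (L.bracket (e b) (e c) ((φ 0).X (W.incl s)))
          * he.coeff b _ ((φ 0).A s u) * he.coeff c _ (ε (W.incl s)))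
      + ∑ b, he.coeff a _ (cov (fun y => e b y) ((φ 0).X (W.incl s)) ((φ 0).DX L s u))
          * he.coeff b _ (ε (W.incl s)) := by
  set x := (φ 0).X (W.incl s) with hx
  have hV : x ∈ triv F V x := mem_triv F V x
  set B := he.toBasisAt hs with hB
  have hBe : ∀ a, B a = e a x := fun a => he.toBasisAt_coe hs a
  let κ : Fin (Module.finrank ℝ F) → ℝ := fun a => he.coeff a x ((φ 0).A s u)
  let η : Fin (Module.finrank ℝ F) → ℝ := fun a => he.coeff a x (ε (W.incl s))
  have hco : ∀ (z : M) (hz : z ∈ U) (v : V z), v = ∑ a, he.coeff a z v • e a z := fun z hz v => by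
    conv_lhs => rw [← (he.toBasisAt hz).sum_repr v]
    exact sum_congr rfl fun a _ => by rw [coeff_eq_repr he hz, he.toBasisAt_coe hz]
  have hsec : ∀ (r : Fin (Module.finrank ℝ F) → ℝ), (∑ a, r a • e a) x = ∑ a, r a • e a x :=
    fun r => by
      change ContMDiffSection.coeAddHom I F ∞ V (∑ a, _) x = _
      rw [map_sum, Finset.sum_apply]
      rfl
  let b : Module.Basis (Fin (Module.finrank ℝ F)) ℝ F := B.map (hatEquiv F hV)
  have hb : ∀ a, hat F V x x (e a x) = b a := fun a => by
    change _ = hat F V x x (B a)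
    rw [hBe]
  have hea : ∀ a, ContMDiffAt I 𝓘(ℝ, F) ∞ (fun y => hat F V x y (e a y)) x := fun a =>
    contMDiffAt_section_hat (e a) hV
  have hsum : ∀ (z : M) (hz : z ∈ U) (v : V z),
      hat F V x z v = ∑ a, he.coeff a z v • hat F V x z (e a z) := fun z hz v => by
    conv_lhs => rw [hco z hz v, map_sum]
    simp only [map_smul]
  -- the derivative in time
  have hcd := hφ.mdifferentiableAt_time (W.incl s)
  have hT : ∀ a, HasDerivAt (fun t => hat F V x ((φ t).X (W.incl s)) (e a ((φ t).X (W.incl s))))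
      (dhat (e a) x (L.anchor x (ε (W.incl s)))) 0 := fun a => by
    rw [← hX]
    exact hasDerivAt_comp_curve (c := fun t => (φ t).X (W.incl s)) (hea a) hcd
  have h1 := (moving_basis_deriv b (p := (0 : ℝ))
    (κ := fun a t => he.coeff a ((φ t).X (W.incl s)) ((φ t).A s u))
    (fun a => (hT a).differentiableAt) hb (hφ.differentiableAt_hat s u)
    ((hcd.continuousAt.eventually (hU.mem_nhds hs)).mono fun t ht => hsum _ ht _) 1).2
  simp only [fderiv_apply_one_eq_deriv, (hT _).deriv] at h1
  -- the derivative along the boundary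
  have hXs : MDifferentiableAt R₀ I (fun τ => (φ 0).X (W.incl τ)) s :=
    (contMDiff_slice hφ.bdry 0).mdifferentiableAt infty_ne_zero
  have hcom : ∀ a, MDifferentiableAt R₀ 𝓘(ℝ, F)
      (fun τ : S => hat F V x ((φ 0).X (W.incl τ)) (e a ((φ 0).X (W.incl τ)))) s := fun a =>
    (contMDiff_mdifferentiableAt (hea a)).comp s hXs
  have hT' : ∀ a, mvfderiv R₀
      (fun τ : S => hat F V x ((φ 0).X (W.incl τ)) (e a ((φ 0).X (W.incl τ)))) s u =
      dhat (e a) x ((φ 0).dXbdry I s u) := fun a => by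
    have h2 := ((contMDiff_mdifferentiableAt (hea a)).hasMFDerivAt.comp s hXs.hasMFDerivAt).mfderiv
    refine (congrArg (fun T : E₀ →L[ℝ] F => T u) h2).trans ?_
    exact congrArg (dhat (e a) x) (hφ.dXbdry_eq 0 s u).symm
  have hy : (χ s).symm (χ s s) = s := extChartAt_to_inv s
  have hfd : ∀ {f : S → F}, MDifferentiableAt R₀ 𝓘(ℝ, F) f s →
      DifferentiableAt ℝ (f ∘ (χ s).symm) (χ s s) := fun hf => by
    have h3 := hf.differentiableWithinAt_writtenInExtChartAt
    rw [(R₀).range_eq_univ, differentiableWithinAt_univ] at h3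
    exact h3
  have hev : ∀ᶠ y in 𝓝 (χ s s),
      (φ 0).X (W.incl ((χ s).symm y)) ∈ U := by
    have h3 : ContinuousAt (fun y => (φ 0).X (W.incl ((χ s).symm y)))
        (χ s s) := by
      refine ContinuousAt.comp (g := fun τ => (φ 0).X (W.incl τ)) ?_ (continuousAt_extChartAt_symm s)
      rw [hy]
      exact hXs.continuousAt
    refine h3.eventually (hU.mem_nhds ?_)
    change (φ 0).X (W.incl ((χ s).symm (χ s s))) ∈ U
    rw [hy]
    exact hs
  have h4 := moving_basis_deriv b (p := χ s s)
    (κ := fun a y => he.coeff a _ (ε (W.incl ((χ s).symm y))))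
    (fun a => hfd (hcom a)) (fun a => by
      refine Eq.trans ?_ (hb a)
      simp only [Function.comp_apply]
      rw [hy]) (hfd (mdifferentiableAt_hat_param (W := W) hε s))
    (hev.mono fun y hy' => hsum _ hy' _) u
  have hκd : ∀ a, MDifferentiableAt R₀ 𝓘(ℝ, ℝ)
      (fun τ : S => he.coeff a ((φ 0).X (W.incl τ)) (ε (W.incl τ))) s := fun a => by
    have h5 := (h4.1 a).mdifferentiableAt.comp s
      (mdifferentiableAt_extChartAt (I := R₀) (mem_chart_source _ s))
    refine h5.congr_of_eventuallyEq ?_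
    filter_upwards [extChartAt_source_mem_nhds (I := R₀) s] with τ hτ
    simp only [Function.comp_apply]
    rw [(χ s).left_inv hτ]
  have h5 := h4.2
  rw [← mvfderiv_eq_fderiv (mdifferentiableAt_hat_param (W := W) hε s)] at h5
  simp only [← mvfderiv_eq_fderiv (hcom _), hT'] at h5
  have h6 : ∀ a, fderiv ℝ (fun y => he.coeff a _ (ε (W.incl ((χ s).symm y))))
      (χ s s) u =
      mvfderiv R₀ (fun τ : S => he.coeff a ((φ 0).X (W.incl τ)) (ε (W.incl τ))) s u := fun a =>
    (mvfderiv_eq_fderiv (hκd a) u).symm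
  have h7 : ∀ a, he.coeff a _ (ε (W.incl ((χ s).symm (χ s s)))) =
      η a := fun a => by rw [hy]
  simp only [h6, h7] at h5
  -- both sides are compared through their coefficients in the frame
  have hub : ∀ a, unhat F V x x (b a) = e a x := fun a => by rw [← hb, unhat_hat hV]
  have hd1 : ∀ v, dhat (∑ a, κ a • e a) x v = ∑ a, κ a • dhat (e a) x v := fun v => by
    change dhatHom x v _ = _
    simp only [map_sum, map_smul]
    rfl
  have hd2 : ∀ v, dhat (∑ a, η a • e a) x v = ∑ a, η a • dhat (e a) x v := fun v => by
    change dhatHom x v _ = _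
    simp only [map_sum, map_smul]
    rfl
  have hcv : ∀ v, cov (fun y => (∑ a, η a • e a : ΓE) y) x v =
      ∑ a, η a • cov (fun y => e a y) x v := fun v => by
    change covHom cov x v _ = _
    rw [map_sum]
    exact sum_congr rfl fun a _ => covHom_smul cov _ _ _ _
  have hbr : L.bracket (∑ a, η a • e a) (∑ a, κ a • e a) x =
      ∑ b, ∑ c, (κ b * η c) • L.bracket (e c) (e b) x := by
    have hev' : ∀ f : Fin (Module.finrank ℝ F) → ΓE, (∑ a, f a) x = ∑ a, f a x :=
      fun f => by
        change ContMDiffSection.coeAddHom I F ∞ V (∑ a, _) x = _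
        rw [map_sum, Finset.sum_apply]
        rfl
    have hsm : ∀ (r : ℝ) (σ : ΓE), (r • σ) x = r • σ x := fun _ _ => rfl
    simp only [map_sum, map_smul, LinearMap.sum_apply, LinearMap.smul_apply, hev', hsm,
      Finset.smul_sum, smul_smul]
  have hη : (∑ a, η a • e a : ΓE) x = ε (W.incl s) := by
    rw [hsec, ← hco x hs]
  have hκ : (∑ a, κ a • e a : ΓE) x = (φ 0).A s u := by
    rw [hsec, ← hco x hs]
  have hbs : ∀ c b, L.bracket (e c) (e b) x = -L.bracket (e b) (e c) x := fun c b => by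
    rw [bracket_neg]; rfl
  let Kd : Fin (Module.finrank ℝ F) → ℝ := fun a =>
    deriv (fun t : ℝ => he.coeff a ((φ t).X (W.incl s)) ((φ t).A s u)) 0
  let Ed : Fin (Module.finrank ℝ F) → ℝ := fun a =>
    mvfderiv R₀ (fun τ : S => he.coeff a ((φ 0).X (W.incl τ)) (ε (W.incl τ))) s u
  have hl : unhat F V x x
      (deriv (fun t => hat F V x ((φ t).X (W.incl s)) ((φ t).A s u)) 0 -
        dhat (∑ a, κ a • e a) x (L.anchor _ ((∑ a, η a • e a : ΓE) x))) =
      ∑ a, Kd a • e a x := by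
    rw [h1, hη, hd1, add_sub_cancel_right]
    simp only [map_sum, map_smul, hub]
    rfl
  have hr : unhat F V x x
      (mvfderiv R₀ (fun τ : S => hat F V x ((φ 0).X (W.incl τ)) (ε (W.incl τ))) s u -
        dhat (∑ a, η a • e a) x ((φ 0).dXbdry I s u)) = ∑ a, Ed a • e a x := by
    rw [h5, hd2, add_sub_cancel_right]
    simp only [map_sum, map_smul, hub]
    rfl
  have hc : cov (fun y => (∑ a, η a • e a : ΓE) y) x
      ((φ 0).dXbdry I s u - L.anchor x ((∑ a, κ a • e a : ΓE) x)) =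
      ∑ a, η a • cov (fun y => e a y) x ((φ 0).DX L s u) := by
    rw [hcv, hκ]
    rfl
  have hcoe : ∀ (r : Fin (Module.finrank ℝ F) → ℝ) a, he.coeff a x (∑ c, r c • e c x) = r a :=
    fun r a => by
      rw [coeff_eq_repr he hs, ← hB]
      simp only [← hBe]
      rw [B.repr_sum_self]
  have hmain : (∑ a, Kd a • e a x - ∑ a, Ed a • e a x =
      ∑ a, η a • cov (fun y => e a y) x ((φ 0).DX L s u) -
        ∑ b, ∑ c, (κ b * η c) • L.bracket (e c) (e b) x) ↔
      ∀ a, Kd a = Ed a + (∑ b, ∑ c, he.coeff a x (L.bracket (e b) (e c) x) * κ b * η c) +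
        ∑ b, he.coeff a x (cov (fun y => e b y) x ((φ 0).DX L s u)) * η b := by
    rw [B.ext_elem_iff]
    refine forall_congr' fun a => ?_
    rw [← coeff_eq_repr he hs, ← coeff_eq_repr he hs, map_sub, map_sub, hcoe, hcoe]
    have e0 : ∑ b, ∑ c, (κ b * η c) • L.bracket (e c) (e b) x =
        -∑ b, ∑ c, (κ b * η c) • L.bracket (e b) (e c) x := by
      simp only [← sum_neg_distrib, ← smul_neg]
      exact sum_congr rfl fun b _ => sum_congr rfl fun c _ => by rw [← hbs]
    rw [e0]
    simp only [map_sum, map_smul, smul_eq_mul, map_neg, sub_neg_eq_add]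
    have e1 : ∑ b, ∑ c, κ b * η c * he.coeff a x (L.bracket (e b) (e c) x) =
        ∑ b, ∑ c, he.coeff a x (L.bracket (e b) (e c) x) * κ b * η c :=
      sum_congr rfl fun b _ => sum_congr rfl fun c _ => by ring
    have e2 : ∑ b, η b * he.coeff a x (cov (fun y => e b y) x ((φ 0).DX L s u)) =
        ∑ b, he.coeff a x (cov (fun y => e b y) x ((φ 0).DX L s u)) * η b :=
      sum_congr rfl fun b _ => mul_comm _ _
    rw [e1, e2]
    constructor <;> intro h <;> linarith
  refine Iff.trans ?_ hmain
  rw [← hl, ← hr, ← hc, ← hbr]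
  exact Iff.rfl

lemma exists_isLocalFrameOn (x : M) : ∃ (U : Set M) (e : Fin (Module.finrank ℝ F) → ΓE),
    IsOpen U ∧ x ∈ U ∧ IsLocalFrameOn I F ∞ (fun a x => e a x) U := by
  obtain ⟨U, hUs, hU, hxU⟩ := eventually_nhds_iff.1 (eventually_locFrame I F V x)
  have hb : ∀ y (hy : y ∈ U), (fun a => locFrame I F V x (Module.finBasis ℝ F a) y) =
      (Module.finBasis ℝ F).map (hatEquiv F (hUs y hy).1).symm := fun y hy =>
    funext fun a => (hUs y hy).2 _
  refine ⟨U, fun a => locFrame I F V x (Module.finBasis ℝ F a), hU, hxU, ?_, ?_, ?_⟩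
  · intro y hy
    rw [hb y hy]
    exact Module.Basis.linearIndependent _
  · intro y hy
    rw [hb y hy, Module.Basis.span_eq]
  · intro a
    exact (locFrame I F V x (Module.finBasis ℝ F a)).contMDiff.contMDiffOn

lemma IsGaugeVariation.gaugeEqAt (h : IsGaugeVariation L cov φ ε) (hφ : IsSmoothPath I F φ)
    (hε : IsSmoothParam I F φ ε)
    {s : S} {u : TangentSpace R₀ s} {e Y : ΓE}
    (he : e ((φ 0).X (W.incl s)) = ε (W.incl s)) (hY : Y ((φ 0).X (W.incl s)) = (φ 0).A s u) :
    GaugeEqAt L cov φ ε s u e Y := by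
  obtain ⟨U, f, hU, hs, hf⟩ := exists_isLocalFrameOn (I := I) (F := F) (V := V)
    ((φ 0).X (W.incl s))
  have hsec : ∀ v : V ((φ 0).X (W.incl s)),
      (∑ a, hf.coeff a _ v • f a : ΓE) ((φ 0).X (W.incl s)) = v := fun v => by
    refine Eq.trans ?_ ((hf.toBasisAt hs).sum_repr v)
    change ContMDiffSection.coeAddHom I F ∞ V (∑ a, _) _ = _
    rw [map_sum, Finset.sum_apply]
    refine sum_congr rfl fun a _ => ?_
    rw [← coeff_eq_repr hf hs, hf.toBasisAt_coe hs]
    rfl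
  have := (gaugeEqAt_frame_iff hφ hε h.1 hU hf hs u).2 fun a => h.2 U hU f hf s hs u a
  exact this.congr (he.trans (hsec _).symm) (hY.trans (hsec _).symm)

lemma isGaugeVariation_of_gaugeEqAt (hφ : IsSmoothPath I F φ)
    (hε : IsSmoothParam I F φ ε)
    (hX : ∀ ξ : Ξ, mfderiv 𝓘(ℝ, ℝ) I (fun t : ℝ => (φ t).X ξ) 0 (1 : ℝ) = L.anchor _ (ε ξ))
    (h : ∀ (s : S) (u : TangentSpace R₀ s), ∃ e Y : ΓE,
      e ((φ 0).X (W.incl s)) = ε (W.incl s) ∧ Y ((φ 0).X (W.incl s)) = (φ 0).A s u ∧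
      GaugeEqAt L cov φ ε s u e Y) : IsGaugeVariation L cov φ ε := by
  refine ⟨hX, fun U hU f hf s hs u => (gaugeEqAt_frame_iff hφ hε hX hU hf hs u).1 ?_⟩
  have hsec : ∀ v : V ((φ 0).X (W.incl s)),
      (∑ a, hf.coeff a _ v • f a : ΓE) ((φ 0).X (W.incl s)) = v := fun v => by
    refine Eq.trans ?_ ((hf.toBasisAt hs).sum_repr v)
    change ContMDiffSection.coeAddHom I F ∞ V (∑ a, _) _ = _
    rw [map_sum, Finset.sum_apply]
    refine sum_congr rfl fun a _ => ?_
    rw [← coeff_eq_repr hf hs, hf.toBasisAt_coe hs]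
    rfl
  obtain ⟨e, Y, he, hY, h⟩ := h s u
  exact h.congr ((hsec _).trans he.symm) ((hsec _).trans hY.symm)

end GaugeEq

/-! ### Riemannian metrics and the kinetic term -/

section Gram

lemma contDiffOn_matrix_det {P ι : Type*} [NormedAddCommGroup P] [NormedSpace ℝ P] [Fintype ι]
    [DecidableEq ι] {A : P → Matrix ι ι ℝ} {s : Set P}
    (hA : ∀ i j, ContDiffOn ℝ ∞ (fun p => A p i j) s) : ContDiffOn ℝ ∞ (fun p => (A p).det) s := by
  simp only [Matrix.det_apply']
  exact ContDiffOn.sum fun w _ => contDiffOn_const.mul (contDiffOn_prod fun i _ => hA _ _)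

lemma contDiffOn_matrix_inv {P ι : Type*} [NormedAddCommGroup P] [NormedSpace ℝ P] [Fintype ι]
    [DecidableEq ι] {A : P → Matrix ι ι ℝ} {s : Set P}
    (hA : ∀ i j, ContDiffOn ℝ ∞ (fun p => A p i j) s) (h0 : ∀ p ∈ s, (A p).det ≠ 0) (i j : ι) :
    ContDiffOn ℝ ∞ (fun p => (A p)⁻¹ i j) s := by
  simp only [Matrix.inv_def, Ring.inverse_eq_inv', Matrix.smul_apply, smul_eq_mul,
    Matrix.adjugate_apply]
  refine ((contDiffOn_matrix_det hA).inv h0).mul (contDiffOn_matrix_det fun a b => ?_)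
  simp only [Matrix.updateRow_apply]
  split_ifs
  exacts [contDiffOn_const, hA _ _]

variable (g : ContMDiffRiemannianMetric I ∞ EM (fun x : M => TangentSpace I x))

lemma contMDiffWithinAt_metric {E' : Type*} [NormedAddCommGroup E'] [NormedSpace ℝ E']
    {H' : Type*} [TopologicalSpace H'] {J : ModelWithCorners ℝ E' H'}
    {N : Type*} [TopologicalSpace N] [ChartedSpace H' N] {c : N → M} {s : Set N} {p : N}
    (hc : ContMDiffWithinAt J I ∞ c s p) {v w : ∀ q, TangentSpace I (c q)}
    (hv : ContMDiffWithinAt J (I.prod 𝓘(ℝ, EM)) ∞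
      (fun q => TotalSpace.mk' EM (E := TM) (c q) (v q)) s p)
    (hw : ContMDiffWithinAt J (I.prod 𝓘(ℝ, EM)) ∞
      (fun q => TotalSpace.mk' EM (E := TM) (c q) (w q)) s p) :
    ContMDiffWithinAt J 𝓘(ℝ, ℝ) ∞ (fun q => g.inner (c q) (v q) (w q)) s p := by
  have h := ContMDiffWithinAt.clm_bundle_apply₂ (F₁ := EM) (F₂ := EM) (F₃ := ℝ)
    (E₁ := TM) (E₂ := TM)
    (E₃ := Bundle.Trivial M ℝ) (g.contMDiff.contMDiffAt.comp_contMDiffWithinAt p hc) hv hw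
  exact (Bundle.contMDiffWithinAt_totalSpace.1 h).2

variable
  (γ : ContMDiffRiemannianMetric J ∞ (𝔼 m) (fun x : N => TangentSpace J x))

/-- The Gram matrix of the coordinate frame. -/
def gram (i : N) (y : 𝔼 m) : Matrix (Fin m) (Fin m) ℝ :=
  Matrix.of fun a b => γ.inner _ (coordFrame J i y a) (coordFrame J i y b)

lemma contDiffOn_gram (i : N) (a b : Fin m) :
    ContDiffOn ℝ ∞ (fun y => gram γ i y a b) (χⱼ i).target := fun y hy =>
  contMDiffWithinAt_iff_contDiffWithinAt.1 (contMDiffWithinAt_metric γ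
    (contMDiffOn_extChartAt_symm i y hy) (contMDiffOn_coordFrame i a y hy)
    (contMDiffOn_coordFrame i b y hy))

lemma posDef_gram {i : N} {y : 𝔼 m} (hy : y ∈ (χⱼ i).target) :
    (gram γ i y).PosDef := by
  refine .of_dotProduct_mulVec_pos (Matrix.ext fun a b => ?_) fun v hv => ?_
  · exact γ.symm _ _ _
  · set T : 𝔼 m →L[ℝ] 𝔼 m :=
      mfderivWithin 𝓘(ℝ, 𝔼 m) J (χⱼ i).symm (Set.range J) y
    have hinj : Function.Injective T := (isInvertible_mfderivWithin_extChartAt_symm hy).injective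
    have hne : T (WithLp.toLp 2 v) ≠ 0 := fun h => hv <| by
      have := hinj (h.trans (map_zero T).symm)
      simpa using congrArg (WithLp.ofLp) this
    have h := γ.pos ((χⱼ i).symm y) (T (WithLp.toLp 2 v)) hne
    have hsum : (T (WithLp.toLp 2 v) : TangentSpace J ((χⱼ i).symm y)) =
        ∑ a, v a • coordFrame J i y a := by
      refine (congrArg T (euclidean_eq_sum (WithLp.toLp 2 v))).trans ?_
      rw [map_sum]
      exact sum_congr rfl fun a _ => map_smul T _ _
    rw [hsum] at h
    simp only [map_sum, map_smul, sum_apply, smul_apply, smul_eq_mul] at h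
    simp only [dotProduct, Matrix.mulVec, gram, Matrix.of_apply, mul_sum, star_trivial]
    refine h.trans_eq (sum_congr rfl fun a _ => ?_)
    rw [mul_sum]
    exact sum_congr rfl fun b _ => by rw [γ.symm]; ring

variable (L : LieAlgebroid I M F V) (cov : CovariantDerivative I F V)

/-- The bilinear form `g(v - ρ(a), w - ρ(b))` on `TM ⊕ E`. -/
def kineticField : MixedField I V (Fin 2) := fun x =>
  { toFun := fun z => g.inner x ((z 0).1 - L.anchor x (z 0).2) ((z 1).1 - L.anchor x (z 1).2)
    map_update_add' := fun {i} z m a b => by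
      rw [Subsingleton.elim i (instDecidableEqFin 2)]
      fin_cases m <;> simp [add_sub_add_comm]
    map_update_smul' := fun {i} z m a b => by
      rw [Subsingleton.elim i (instDecidableEqFin 2)]
      fin_cases m <;> simp [← smul_sub] }

lemma smooth_kineticField : MixedField.IsSmooth F (kineticField g L (V := V)) := fun W Y x =>
  contMDiffWithinAt_metric g (c := fun x => x) contMDiffWithinAt_id
    ((W 0 - ρsec L (Y 0)).contMDiff x) ((W 1 - ρsec L (Y 1)).contMDiff x)

lemma kineticField_graph (x : M) (z : Fin 2 → TangentSpace I x × V x) (m : Fin 2) (u : V x) :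
    kineticField g L x (update z m (graph L x u)) = 0 := by
  have hu : ((graph L x u).1 - L.anchor x (graph L x u).2 : TangentSpace I x) = 0 := sub_self _
  change g.inner x _ _ = 0
  fin_cases m <;> simp [hu]

variable [I.Boundaryless]

lemma MetricInvariant.eDeriv_kineticField (h : MetricInvariant L cov g) (e : ΓE)
    (W : Fin 2 → ΓT) (Y : Fin 2 → ΓE) (x : M) :
    eDeriv L cov (kineticField g L) e W Y x = 0 := by
  have hD : ∀ l, (eConn L cov e (W l) x - L.anchor x (eConnV L cov e (Y l) x) :
      TangentSpace I x) = eConn L cov e (W l - ρsec L (Y l)) x := fun l => by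
    rw [anchor_eConnV]
    have hs : ∀ v, dhat (W l - ρsec L (Y l)) x v = dhat (W l) x v - dhat (ρsec L (Y l)) x v :=
      fun v => by
        rw [eq_sub_iff_add_eq, ← dhat_add, sub_add_cancel]
    have key : ∀ a b c d p q C₁ C₂ C₃ P : EM, C₁ = a - b → C₂ = c - d → C₃ = (a - c) - (b - d) →
        P = p - q → C₁ + p - (C₂ + q) = C₃ + P := by
      intro a b c d p q C₁ C₂ C₃ P h₁ h₂ h₃ h₄
      rw [h₁, h₂, h₃, h₄]
      abel
    refine key _ _ _ _ _ _ _ _ _ _ (mlieBracket_local (ρsec L e) (W l) x)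
      (mlieBracket_local (ρsec L e) (ρsec L (Y l)) x)
      ((mlieBracket_local (ρsec L e) (W l - ρsec L (Y l)) x).trans (congrArg₂ (fun a b : EM => a - b)
        (hs _) (map_sub (dhat (ρsec L e) x) _ _))) ?_
    change L.anchor x (cov (fun y => e y) x (W l x - ρsec L (Y l) x)) = _
    rw [map_sub, map_sub]
    rfl
  have h' := h e (W 0 - ρsec L (Y 0)) (W 1 - ρsec L (Y 1)) x
  rw [← hD, ← hD] at h'
  rw [eDeriv, Fin.sum_univ_two, ← sub_sub]
  exact h'

lemma eDeriv_kineticField_pure (e : ΓE) (W : Fin 2 → ΓT) (x : M) :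
    eDeriv L cov (kineticField g L) e W 0 x =
      mvfderiv I (fun y => g.inner y (W 0 y) (W 1 y)) x (L.anchor x (e x)) -
      g.inner x (eConn L cov e (W 0) x) (W 1 x) - g.inner x (W 0 x) (eConn L cov e (W 1) x) := by
  have h0 : ∀ x, L.anchor x ((0 : ΓE) x) = 0 := fun x => map_zero (L.anchor x)
  have hV : eConnV L cov e 0 x = 0 := by
    rw [eConnV, map_zero, h0, map_zero]
    exact add_zero _
  have hq : ∀ y (u v : TangentSpace I y) (a b : V y), L.anchor y a = 0 → L.anchor y b = 0 →
      kineticField g L y (![(u, a), (v, b)]) = g.inner y u v := fun y u v a b ha hb => by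
    change g.inner y (u - L.anchor y a) (v - L.anchor y b) = _
    rw [ha, hb, sub_zero, sub_zero]
  have hW : ∀ y, (fun i => (W i y, (0 : Fin 2 → ΓE) i y)) =
      ![(W 0 y, 0), (W 1 y, 0)] := fun y => by
    funext i; fin_cases i <;> rfl
  rw [eDeriv, Fin.sum_univ_two, ← sub_sub]
  simp only [hW]
  simp only [hq _ _ _ _ _ (map_zero _) (map_zero _), Pi.zero_apply, hV]
  congr 1
  · congr 1
    refine Eq.trans ?_ (hq x _ _ _ _ (map_zero _) (map_zero _))
    congr 1
    funext i; fin_cases i <;> rfl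
  · refine Eq.trans ?_ (hq x _ _ _ _ (map_zero _) (map_zero _))
    congr 1
    funext i; fin_cases i <;> rfl

end Gram

/-! ### The boundary Lagrangian and its variation -/

variable [I.Boundaryless] (g : ContMDiffRiemannianMetric I ∞ EM (fun x : M => TangentSpace I x))
  (μtop : DForm I M n) (μt : Cochain I M F V n)

section BoundaryDensity

/-- The alternating form on `TM ⊕ E` whose value on `(dX, A)` is the integrand of `S_μ`. -/
def lagrangian (x : M) : (TangentSpace I x × V x) [⋀^Fin n]→ₗ[ℝ] ℝ :=
  (μtop.toFun x).toAlternatingMap.compLinearMap (LinearMap.fst ℝ (TangentSpace I x) (V x)) +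
    mixedSum μt x

lemma smooth_lagrangian :
    MixedField.IsSmooth F (fun x => (lagrangian μtop μt x).toMultilinearMap) := fun W Y =>
  (μtop.smooth W).add (smooth_mixedSum μt W Y)

variable (I) in
/-- The pair `(dX, A)` along the boundary. -/
def fieldHom (φ : Fields W V) (s : S) :
    TangentSpace R₀ s →ₗ[ℝ] TangentSpace I (φ.X (W.incl s)) × V (φ.X (W.incl s)) :=
  (((mfderiv R₁ I φ.X (W.incl s)).comp
    (mfderiv R₀ R₁ W.incl s)).toLinearMap).prod (φ.A s)

lemma sum_mixedForm (φ : Fields W V) (s : S) (b : Fin n → TangentSpace R₀ s) :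
    μtop.toFun (φ.X (W.incl s)) (fun a => φ.dXbdry I s (b a)) +
      ∑ k : Fin n, φ.mixedForm (show (k : ℕ) + (n - 1 - k) + 1 = n by omega)
        (μt k (n - 1 - k) (by omega)) s b =
    lagrangian μtop μt (φ.X (W.incl s)) (fun l => fieldHom I φ s (b l)) := by
  rw [lagrangian, AlternatingMap.add_apply, mixedSum_apply]
  refine congrArg₂ (· + ·) rfl (sum_congr rfl fun k _ => ?_)
  rw [mixedAlt_apply]
  rfl

/-- The integrand of `S_g + S_μ`. -/
def boundaryDensity (φ : Fields W V) (s : S) (b : Fin n → TangentSpace R₀ s) : ℝ :=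
  φ.kineticDensity L g s b +
    W.bdrySign s b * lagrangian μtop μt (φ.X (W.incl s)) (fun l => fieldHom I φ s (b l))

variable (W) in
/-- The form whose sign is the boundary orientation. -/
def Worldvolume.bdryForm (s : S) : (TangentSpace R₀ s) [⋀^Fin n]→ₗ[ℝ] ℝ :=
  ((W.orient.toFun (W.incl s)).toAlternatingMap.curryLeft (outward (W.incl s))).compLinearMap
    (mfderiv R₀ R₁ W.incl s).toLinearMap

lemma isDensity_boundaryDensity (φ : Fields W V) :
    IsDensity (boundaryDensity L g μtop μt φ) := by
  let D : ∀ s : S, TangentSpace R₀ s →ₗ[ℝ] TangentSpace I (φ.X (W.incl s)) := fun s =>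
    ((mfderiv R₁ I φ.X (W.incl s)).comp
      (mfderiv R₀ R₁ W.incl s)).toLinearMap - (L.anchor _).comp (φ.A s)
  have h1 := isDensity_kinetic (J := R₀)
    (fun s : S => LinearMap.mk₂ ℝ (fun u w => W.γ.inner s u w) (by simp) (by simp) (by simp)
      (by simp))
    (fun s : S => LinearMap.mk₂ ℝ (fun u w => g.inner (φ.X (W.incl s)) (D s u) (D s w))
      (fun _ _ _ => by rw [map_add, map_add, add_apply])
      (fun _ _ _ => by rw [map_smul, map_smul, smul_apply])
      (fun _ _ _ => by rw [map_add, map_add]) (fun _ _ _ => by rw [map_smul, map_smul]))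
  have h2 := isDensity_sign_mul (J := R₀) W.bdryForm
    fun s => (lagrangian μtop μt _).compLinearMap (fieldHom I φ s)
  exact h1.add h2

variable (I) in
/-- The pairs `(∂_l X, A_l)` in the chart of `Σ` at `i`, as a function of the path parameter and of
the coordinates. -/
abbrev fieldArgs (φ : ℝ → Fields W V) (i : S) {ι : Type*} (j : ι → Fin n) (p : ℝ × E₀) :
    ι → TangentSpace I (bdryMap φ i p) × V (bdryMap φ i p) :=
  chartArgs (bdryMap φ i) (χ i).target
    (fun l => single (j l) (1 : ℝ)) (fun p l => gaugeComp φ i p (j l)) p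

lemma IsSmoothPath.fieldArgs_eq (hφ : IsSmoothPath I F φ) {i : S} {t : ℝ} {y : E₀}
    (hy : y ∈ (χ i).target) {ι : Type*} (j : ι → Fin n) (l : ι) :
    fieldArgs I φ i j (t, y) l = fieldHom I (φ t) _ (coordFrame R₀ i y (j l)) :=
  Prod.ext (hφ.velocity_bdryMap hy (j l)) rfl

lemma inFrame_boundaryDensity (hφ : IsSmoothPath I F φ) {i : S} {t : ℝ} {y : E₀}
    (hy : y ∈ (χ i).target) :
    inFrame (boundaryDensity L g μtop μt (φ t)) i y =
      (1 / 2) * √(gram W.γ i y).det * ∑ a, ∑ b, (gram W.γ i y)⁻¹ a b *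
        kineticField g L _ (fieldArgs I φ i ![a, b] (t, y)) +
      W.bdrySign _ (coordFrame R₀ i y) *
        lagrangian μtop μt _ (fieldArgs I φ i id (t, y)) := by
  have h : ∀ {ι : Type} (j : ι → Fin n), fieldArgs I φ i j (t, y) =
      fun l => fieldHom I (φ t) _ (coordFrame R₀ i y (j l)) := fun j =>
    funext fun l => hφ.fieldArgs_eq hy j l
  simp only [h]
  rfl

section Smoothness

variable {ι : Type} [Fintype ι] [DecidableEq ι]

lemma IsSmoothPath.contDiffOn_fieldArgs (hφ : IsSmoothPath I F φ) {Q : MixedField I V ι}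
    (hQ : Q.IsSmooth F) (i : S) (j : ι → Fin n) :
    ContDiffOn ℝ ∞ (fun p => Q (bdryMap φ i p) (fieldArgs I φ i j p)) (chartDomain R₀ i) :=
  fun p hp => MixedField.contDiffWithinAt hQ (contMDiffOn_chartMap hφ.bdry i p hp)
    (fun l => contMDiffOn_velocity (uniqueDiffOn_chartDomain i) (contMDiffOn_chartMap hφ.bdry i) _
      p hp) fun l => hφ.contMDiffOn_gaugeComp i (j l) p hp

end Smoothness

lemma contDiffOn_lagrangianDensity (hφ : IsSmoothPath I F φ) (i : S) :
    ContDiffOn ℝ ∞ (fun z : ℝ × E₀ => inFrame (fun s b => W.bdrySign s b *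
      lagrangian μtop μt ((φ z.1).X (W.incl s)) (fun l => fieldHom I (φ z.1) s (b l))) i z.2)
      (chartDomain R₀ i) := by
  refine ContDiffOn.congr (contDiffOn_mul_of_locally_eq
    (σ := fun z => W.bdrySign _ (coordFrame R₀ i z.2)) (fun z hz => ?_)
    (hφ.contDiffOn_fieldArgs (smooth_lagrangian μtop μt) i id)) fun z hz => ?_
  · exact Filter.Tendsto.eventually (continuous_snd.continuousWithinAt (s := chartDomain R₀ i))
      (W.bdrySign_eventually_eq hz.2)
  · rw [show fieldArgs I φ i id z = _ from funext fun l => hφ.fieldArgs_eq hz.2 id l]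
    rfl

lemma contDiffOn_boundaryDensity (hφ : IsSmoothPath I F φ) (i : S) :
    ContDiffOn ℝ 1 (fun z : ℝ × E₀ => inFrame (boundaryDensity L g μtop μt (φ z.1)) i z.2)
      (Set.univ ×ˢ (χ i).target) := by
  have hsnd : ContDiffOn ℝ ∞ (fun z : ℝ × E₀ => z.2) (chartDomain R₀ i) := contDiffOn_snd
  have hmaps : Set.MapsTo (fun z : ℝ × E₀ => z.2) (chartDomain R₀ i)
    (χ i).target := fun z hz => hz.2
  have hG := fun a b => (contDiffOn_gram W.γ i a b).comp hsnd hmaps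
  have hpos : ∀ z ∈ chartDomain R₀ i, (gram W.γ i z.2).det ≠ 0 := fun z hz =>
    (posDef_gram W.γ hz.2).det_pos.ne'
  have h : ∀ z ∈ chartDomain R₀ i, inFrame (boundaryDensity L g μtop μt (φ z.1)) i z.2 = _ :=
    fun z hz => inFrame_boundaryDensity L g μtop μt hφ hz.2
  refine ContDiffOn.congr ?_ h
  refine ContDiffOn.of_le (n := ∞) (.add ?_ ?_) one_le_infty
  · refine (contDiffOn_const.mul ((contDiffOn_matrix_det hG).sqrt hpos)).mul
      (ContDiffOn.sum fun a _ => ContDiffOn.sum fun b _ => ?_)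
    exact (contDiffOn_matrix_inv hG hpos a b).mul
      (hφ.contDiffOn_fieldArgs (smooth_kineticField g L) i _)
  · refine (contDiffOn_lagrangianDensity μtop μt hφ i).congr fun z hz => ?_
    rw [show fieldArgs I φ i id (z.1, z.2) = _ from funext fun l => hφ.fieldArgs_eq hz.2 id l]
    rfl

/-- The boundary current of a gauge transformation: the Lagrangian with one of its arguments
replaced by `(ρ(ε), ε)`. -/
def gaugeCurrent (φ : Fields W V) (ε : ∀ ξ : Ξ, V (φ.X ξ)) (s : S) (m : Fin n)
    (b : Fin n → TangentSpace R₀ s) : ℝ :=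
  W.bdrySign s b * lagrangian μtop μt (φ.X (W.incl s))
    (update (fun l => fieldHom I φ s (b l)) m (graph L _ (ε (W.incl s))))

end BoundaryDensity

/-! ### The gauge variation of the boundary Lagrangian -/

section Residue

variable {L cov}

/-- The gauge variation of `A` in the chart of `Σ` at `i`. -/
lemma IsGaugeVariation.chart_eq (h : IsGaugeVariation L cov φ ε) (hφ : IsSmoothPath I F φ)
    (hε : IsSmoothParam I F φ ε)
    {i : S} {y : E₀} (hy : y ∈ (χ i).target) {e Y : ΓE} (l : Fin n)
    {w : TangentSpace I (bdryMap φ i (0, y))} (he : e (bdryMap φ i (0, y)) = ε (W.incl _))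
    (hY : fieldArgs I φ i id (0, y) l = (w, Y (bdryMap φ i (0, y)))) :
    unhat F V (bdryMap φ i (0, y)) (bdryMap φ i (0, y))
        (fderiv ℝ (fun p => hat F V (bdryMap φ i (0, y)) (bdryMap φ i p) (gaugeComp φ i p l))
          (0, y) (1, 0) - dhat Y (bdryMap φ i (0, y)) (L.anchor _ (e (bdryMap φ i (0, y))))) -
      unhat F V (bdryMap φ i (0, y)) (bdryMap φ i (0, y))
        (fderiv ℝ (fun y' => hat F V (bdryMap φ i (0, y)) (bdryMap φ i (0, y'))
          (ε (W.incl ((χ i).symm y')))) y (single l 1) -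
          dhat e (bdryMap φ i (0, y)) w) =
      cov (fun y => e y) (bdryMap φ i (0, y)) (w - L.anchor _ (Y (bdryMap φ i (0, y)))) -
        L.bracket e Y (bdryMap φ i (0, y)) := by
  have hw : w = (φ 0).dXbdry I _ (coordFrame R₀ i y l) :=
    (congrArg Prod.fst hY).symm.trans (hφ.velocity_bdryMap hy l)
  have h1 := h.gaugeEqAt hφ hε (s := (χ i).symm y) (u := coordFrame R₀ i y l)
    (e := e) (Y := Y) he (congrArg Prod.snd hY).symm
  rw [hw]
  have hV : bdryMap φ i (0, y) ∈ triv F V (bdryMap φ i (0, y)) :=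
    mem_triv F V _
  have hd : DifferentiableAt ℝ (fun p =>
      hat F V (bdryMap φ i (0, y)) (bdryMap φ i p) (gaugeComp φ i p l)) (0, y) := by
    have h2 := ((contMDiffWithinAt_hat (c := bdryMap φ i) (x₀ := bdryMap φ i (0, y))
      (y := ((0 : ℝ), y)) hV).1 (hφ.contMDiffOn_gaugeComp i l _ ⟨Set.mem_univ _, hy⟩)).2
    exact ((contMDiffWithinAt_iff_contDiffWithinAt.1 h2).contDiffAt
      ((isOpen_univ.prod (isOpen_extChartAt_target i)).mem_nhds
        ⟨Set.mem_univ _, hy⟩)).differentiableAt infty_ne_zero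
  have h3 : fderiv ℝ (fun p => hat F V (bdryMap φ i (0, y)) (bdryMap φ i p) (gaugeComp φ i p l))
      (0, y) (1, 0) = deriv (fun t => hat F V (bdryMap φ i (0, y)) (bdryMap φ i (t, y))
        (gaugeComp φ i (t, y) l)) 0 :=
    ((hd.hasFDerivAt.comp_hasDerivAt (0 : ℝ)
      ((hasDerivAt_id (0 : ℝ)).prodMk (hasDerivAt_const (0 : ℝ) y))).deriv).symm
  have h4 := mvfderiv_coordFrame (mdifferentiableAt_hat_param (W := W) hε _) hy l
  rw [(R₀).range_eq_univ, fderivWithin_univ] at h4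
  rw [h3, ← show _ = fderiv ℝ (fun y' => hat F V (bdryMap φ i (0, y)) (bdryMap φ i (0, y'))
    (ε (W.incl ((χ i).symm y')))) y (single l 1) from h4]
  exact h1

lemma IsGaugeVariation.velocity_time (h : IsGaugeVariation L cov φ ε) (hφ : IsSmoothPath I F φ)
    {i : S} {y : E₀} (hy : y ∈ (χ i).target) :
    velocity I (bdryMap φ i) (chartDomain R₀ i) (0, y) (1, 0) =
      L.anchor (bdryMap φ i (0, y)) (ε (W.incl ((χ i).symm y))) :=
  (velocity_chartMap_time hφ.bdry i hy).trans (h.1 (W.incl ((χ i).symm y)))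

lemma IsSmoothPath.contMDiffOn_param
    (hε : IsSmoothParam I F φ ε)
    (i : S) : ContMDiffOn 𝓘(ℝ, E₀) (I.prod 𝓘(ℝ, F)) ∞ (fun y => TotalSpace.mk' F
      (bdryMap φ i (0, y)) (ε (W.incl ((χ i).symm y))))
      (χ i).target :=
  (hε.comp W.incl_embedding.contMDiff).comp_contMDiffOn (contMDiffOn_extChartAt_symm i)

variable (L cov)

/-- The remainder, in the chart of `Σ` at `i`, of the gauge variation of the action density after
removing the divergence of the boundary current. -/
def residue (H : DForm I M (n + 1)) (φ : ℝ → Fields W V) (ε : ∀ ξ : Ξ, V ((φ 0).X ξ)) (i : S)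
    (y : E₀) : ℝ :=
  deriv (fun t => inFrame (boundaryDensity L g μtop μt (φ t)) i y) 0 +
    W.bdrySign _ (coordFrame R₀ i y) * H.toFun (bdryMap φ i (0, y))
      (Fin.cons (L.anchor _ (ε (W.incl ((χ i).symm y))))
        (fun l => (φ 0).dXbdry I _ (coordFrame R₀ i y l))) -
    ∑ m, fderivWithin ℝ (inFrame (fun s => gaugeCurrent L μtop μt (φ 0) ε s m) i)
      (Set.range R₀) y (single m 1)

/-- The expression of the remainder in terms of the geometry of the target: the derivative of the
metric, the derivatives of the forms, and a term `r` coming from the derivatives of `A`. -/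
def obstruction (H : DForm I M (n + 1)) (G : Matrix (Fin n) (Fin n) ℝ) (σ : ℝ)
    (e : ΓE) (Wf : Fin n → ΓT) (Y : Fin n → ΓE) (x : M)
    (r : Fin n → Fin n → V x) : ℝ :=
  (1 / 2) * √G.det * ∑ a, ∑ b, G⁻¹ a b *
    eDeriv L cov (kineticField g L) e (fun l => Wf (![a, b] l)) (fun l => Y (![a, b] l)) x +
  σ * ((extD μtop.toFun x + H.toFun x) (Fin.cons (L.anchor x (e x)) (fun l => Wf l x)) +
    variation L cov (mixedSum μt) e Wf Y x -
    ∑ m, ∑ l, if l = m then 0 else mixedSum μt x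
      (update (update (fun i => (Wf i x, Y i x)) m (graph L x (e x))) l
        (0, r m l)))

variable {L cov}

lemma inFrame_gaugeCurrent (hφ : IsSmoothPath I F φ) {i : S} {y : E₀}
    (hy : y ∈ (χ i).target) (m : Fin n) :
    inFrame (fun s => gaugeCurrent L μtop μt (φ 0) ε s m) i y =
      W.bdrySign _ (coordFrame R₀ i y) * lagrangian μtop μt (bdryMap φ i (0, y))
        (update (fieldArgs I φ i id (0, y)) m
          (graph L _ (ε (W.incl ((χ i).symm y))))) := by
  rw [show fieldArgs I φ i id (0, y) = fun l => fieldHom I (φ 0) _ (coordFrame R₀ i y l) from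
    funext fun l => hφ.fieldArgs_eq hy id l]
  rfl

/-- A section with a given value at a given point. -/
lemma exists_section_eq {x : M} (v : V x) : ∃ e : ΓE, e x = v :=
  ⟨_, locFrame_hat_self I v⟩

lemma contDiffOn_gaugeCurrent (h : IsGaugeVariation L cov φ ε) (hφ : IsSmoothPath I F φ)
    (hε : IsSmoothParam I F φ ε)
    (i : S) (m : Fin n) :
    ContDiffOn ℝ 1 (inFrame (fun s => gaugeCurrent L μtop μt (φ 0) ε s m) i)
      (χ i).target := by
  refine ContDiffOn.congr ?_ fun y hy => inFrame_gaugeCurrent μtop μt hφ hy m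
  refine contDiffOn_mul_of_locally_eq (fun y hy => nhdsWithin_le_nhds (W.bdrySign_eventually_eq hy))
    fun y hy => ContDiffAt.contDiffWithinAt (ContDiffAt.of_le ?_ one_le_infty)
  obtain ⟨e, he⟩ := exists_section_eq (I := I) (F := F) (ε (W.incl ((χ i).symm y)))
  choose Wf hWf using fun l => exists_section_eq (I := I) (F := EM) (fieldArgs I φ i id (0, y) l).1
  choose Y hY using fun l => exists_section_eq (I := I) (F := F) (fieldArgs I φ i id (0, y) l).2
  exact (chart_first_order L (smooth_lagrangian μtop μt) (isOpen_extChartAt_target i)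
    (contMDiffOn_chartMap hφ.bdry i) _ (fun l => hφ.contMDiffOn_gaugeComp i (id l))
    (IsSmoothPath.contMDiffOn_param hε i) (fun y' hy' => h.velocity_time hφ hy') hy e Wf Y he
    fun l => Prod.ext (hWf l).symm (hY l).symm).2.1 m

lemma IsGaugeVariation.top_variation (h : IsGaugeVariation L cov φ ε) (hφ : IsSmoothPath I F φ)
    (hn : n ≠ 0) {i : S} {y : E₀} (hy : y ∈ (χ i).target) :
    DifferentiableAt ℝ (fun p => μtop.toFun (bdryMap φ i p)
      (fun l => (fieldArgs I φ i id p l).1)) (0, y) ∧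
    (∀ m, DifferentiableAt ℝ (fun y' => μtop.toFun (bdryMap φ i (0, y'))
      (fun l => (update (fieldArgs I φ i id (0, y')) m
        (graph L _ (ε (W.incl ((χ i).symm y')))) l).1)) y) ∧
    fderiv ℝ (fun p => μtop.toFun (bdryMap φ i p)
      (fun l => (fieldArgs I φ i id p l).1)) (0, y) (1, 0) -
    ∑ m, fderiv ℝ (fun y' => μtop.toFun (bdryMap φ i (0, y'))
      (fun l => (update (fieldArgs I φ i id (0, y')) m
        (graph L _ (ε (W.incl ((χ i).symm y')))) l).1)) y
          (single m 1) =
    extD μtop.toFun (bdryMap φ i (0, y))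
      (Fin.cons (L.anchor _ (ε (W.incl ((χ i).symm y))))
        (fun l => (fieldArgs I φ i id (0, y) l).1)) := by
  obtain ⟨k, rfl⟩ := Nat.exists_eq_succ_of_ne_zero hn
  set s : Set (ℝ × 𝔼 (k + 1)) := chartDomain (𝓡 (k + 1)) i with hs
  have hso : IsOpen s := isOpen_univ.prod (isOpen_extChartAt_target i)
  have hC := contMDiffOn_chartMap hφ.bdry i
  set d : Fin (k + 1) → ℝ × 𝔼 (k + 1) := fun l =>
    (0, single l 1) with hd
  have hmem : ∀ y' ∈ (extChartAt (𝓡 (k + 1)) i).target, ((0 : ℝ), y') ∈ s := fun y' hy' =>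
    ⟨Set.mem_univ _, hy'⟩
  have hdiff : ∀ d' : Fin (k + 1) → ℝ × 𝔼 (k + 1), DifferentiableAt ℝ
      (fun p => μtop.toFun (bdryMap φ i p) (fun l => velocity I (bdryMap φ i) s p (d' l)))
      (0, y) := fun d' =>
    ((μtop.contDiffOn_velocity hso.uniqueDiffOn hC d').contDiffAt
      (hso.mem_nhds (hmem y hy))).differentiableAt infty_ne_zero
  have hin : HasFDerivAt (fun y' : 𝔼 (k + 1) => ((0 : ℝ), y'))
      (ContinuousLinearMap.inr ℝ ℝ _) y := hasFDerivAt_prodMk_right 0 y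
  have hfd : ∀ m, HasFDerivAt (fun y' => μtop.toFun (bdryMap φ i (0, y'))
      (fun l => (update (fieldArgs I φ i id (0, y')) m
        (graph L _ (ε (W.incl ((extChartAt (𝓡 (k + 1)) i).symm y')))) l).1))
      ((fderiv ℝ (fun p => μtop.toFun (bdryMap φ i p) (update
        (fun l => velocity I (bdryMap φ i) s p (d l)) m (velocity I (bdryMap φ i) s p (1, 0))))
        (0, y)).comp (ContinuousLinearMap.inr ℝ ℝ _)) y := fun m => by
    simp only [← velocity_update]
    refine ((hdiff _).hasFDerivAt.comp y hin).congr_of_eventuallyEq ?_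
    filter_upwards [(isOpen_extChartAt_target i).mem_nhds hy] with y' hy'
    refine congrArg (μtop.toFun (bdryMap φ i (0, y'))) (funext fun l => ?_)
    rcases eq_or_ne l m with rfl | hl
    · simp only [update_self]
      exact (h.velocity_time hφ hy').symm
    · simp only [update_of_ne hl]
      rfl
  refine ⟨hdiff d, fun m => (hfd m).differentiableAt, ?_⟩
  simp only [(hfd _).fderiv]
  refine (μtop.chart_variation hso hC (hmem y hy) (1, 0) d).trans ?_
  rw [h.velocity_time hφ hy]
  rfl

lemma IsGaugeVariation.residue_eq (h : IsGaugeVariation L cov φ ε) (hφ : IsSmoothPath I F φ)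
    (hε : IsSmoothParam I F φ ε)
    (hn : n ≠ 0) (H : DForm I M (n + 1)) {i : S} {y : E₀} (hy : y ∈ (χ i).target)
    (e : ΓE) (Wf : Fin n → ΓT) (Y : Fin n → ΓE)
    (he : e (bdryMap φ i (0, y)) = ε (W.incl ((χ i).symm y)))
    (hWY : ∀ l, fieldArgs I φ i id (0, y) l =
      (Wf l (bdryMap φ i (0, y)), Y l (bdryMap φ i (0, y)))) :
    residue L g μtop μt H φ ε i y =
      obstruction L cov g μtop μt H (gram W.γ i y) (W.bdrySign _ (coordFrame R₀ i y)) e Wf Y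
        (bdryMap φ i (0, y)) (fun m l => unhat F V (bdryMap φ i (0, y)) (bdryMap φ i (0, y))
          (fderiv ℝ (fun p => hat F V (bdryMap φ i (0, y)) (bdryMap φ i p) (gaugeComp φ i p l))
              (0, y) (0, single m 1) -
            dhat (Y l) (bdryMap φ i (0, y)) (Wf m (bdryMap φ i (0, y))))) := by
  have hU := isOpen_extChartAt_target (I := R₀) i
  have hC := contMDiffOn_chartMap hφ.bdry i
  have hb := IsSmoothPath.contMDiffOn_param hε i
  have hvel : ∀ y' ∈ (χ i).target, _ := fun y' hy' => h.velocity_time hφ hy'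
  have hinv := fun l => h.chart_eq hφ hε hy l he (hWY l)
  -- derivatives in the path parameter along the line through `(0, y)`
  have hline : HasDerivAt (fun t : ℝ => (t, y)) ((1 : ℝ), (0 : E₀)) 0 :=
    (hasDerivAt_id (0 : ℝ)).prodMk (hasDerivAt_const (0 : ℝ) y)
  have hkin : ∀ a b, HasDerivAt (fun t : ℝ => kineticField g L (bdryMap φ i (t, y))
      (fieldArgs I φ i ![a, b] (t, y))) (eDeriv L cov (kineticField g L) e
        (fun l => Wf (![a, b] l)) (fun l => Y (![a, b] l)) (bdryMap φ i (0, y))) 0 := fun a b => by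
    have ha := fun l => hφ.contMDiffOn_gaugeComp i (![a, b] l)
    have h1 := (chart_first_order L (smooth_kineticField g L) hU hC _ ha hb hvel hy e
      (fun l => Wf (![a, b] l)) (fun l => Y (![a, b] l)) he fun l => hWY _).1
    rw [← chart_variation_of_null L cov (smooth_kineticField g L) (kineticField_graph g L) hU hC _
      ha hb hvel hy e (fun l => Wf (![a, b] l)) (fun l => Y (![a, b] l)) he (fun l => hWY _)
      fun l => hinv _]
    exact h1.hasFDerivAt.comp_hasDerivAt (0 : ℝ) hline
  obtain ⟨ht1, ht2, ht3⟩ := h.top_variation μtop hφ hn hy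
  have ha := fun l => hφ.contMDiffOn_gaugeComp i (id l)
  obtain ⟨hm1, hm2, -⟩ := chart_first_order L (smooth_mixedSum μt) hU hC _ ha hb hvel hy e Wf Y he
    hWY
  have hm3 := chart_variation_identity L cov (smooth_mixedSum μt) hU hC _ ha hb hvel hy e Wf Y he
    hWY hinv
  have hlag := (ht1.hasFDerivAt.comp_hasDerivAt (0 : ℝ) hline).add
    (hm1.hasFDerivAt.comp_hasDerivAt (0 : ℝ) hline)
  have hD' := HasDerivAt.deriv (HasDerivAt.add ((HasDerivAt.fun_sum (u := Finset.univ) fun a _ =>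
    HasDerivAt.fun_sum (u := Finset.univ)
      fun b _ => (hkin a b).const_mul ((gram W.γ i y)⁻¹ a b)).const_mul
        ((1 / 2) * √(gram W.γ i y).det)) (hlag.const_mul (W.bdrySign _ (coordFrame R₀ i y))))
  have hD : deriv (fun t => inFrame (boundaryDensity L g μtop μt (φ t)) i y) 0 = _ :=
    (congrArg (fun f : ℝ → ℝ => deriv f 0) (funext fun t =>
      inFrame_boundaryDensity L g μtop μt hφ hy)).trans hD'
  have hΛ' := fun m => (((ht2 m).hasFDerivAt.add
    ((hm2 m).differentiableAt infty_ne_zero).hasFDerivAt).const_mul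
      (W.bdrySign _ (coordFrame R₀ i y))).congr_of_eventuallyEq
    (f₁ := inFrame (fun s => gaugeCurrent L μtop μt (φ 0) ε s m) i) (by
      filter_upwards [hU.mem_nhds hy, W.bdrySign_eventually_eq hy] with y' hy' hσ
      rw [inFrame_gaugeCurrent μtop μt hφ hy' m, hσ]
      rfl)
  have hΛ := fun m => congrArg (fun T : E₀ →L[ℝ] ℝ => T (single m 1)) (hΛ' m).fderiv
  simp only [smul_apply, add_apply, smul_eq_mul] at hΛ
  have hW : (fun l => (φ 0).dXbdry I _ (coordFrame R₀ i y l)) =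
      fun l => Wf l (bdryMap φ i (0, y)) :=
    funext fun l => (hφ.velocity_bdryMap hy l).symm.trans (congrArg Prod.fst (hWY l))
  have hW' : (fun l => (fieldArgs I φ i id (0, y) l).1) = fun l => Wf l (bdryMap φ i (0, y)) :=
    funext fun l => congrArg Prod.fst (hWY l)
  rw [hW'] at ht3
  rw [residue, hD, (R₀).range_eq_univ, hW, obstruction, ContinuousAlternatingMap.add_apply, he]
  simp only [fderivWithin_univ, hΛ, ← mul_sum, sum_add_distrib]
  have key : ∀ K σ Et Em St Sm h' v R X : ℝ, Et - St = X → Em - Sm = v - R →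
      K + σ * (Et + Em) + σ * h' - σ * (St + Sm) = K + σ * (X + h' + v - R) := by
    intro K σ Et Em St Sm h' v R X h1 h2
    linear_combination σ * (h1 + h2)
  exact key _ _ _ _ _ _ _ _ _ _ ht3 (by rw [← he]; exact hm3)

end Residue

/-! ### The derivative of the action -/

section ActionDerivative

lemma integralDensity_add {m : ℕ} {HN : Type*} [TopologicalSpace HN]
    {J : ModelWithCorners ℝ (𝔼 m) HN}
    {N : Type*} [TopologicalSpace N] [ChartedSpace HN N] [IsManifold J ∞ N] [T2Space N]
    [CompactSpace N] {D D' : ∀ x : N, (Fin m → TangentSpace J x) → ℝ}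
    (h : ∀ i, ContinuousOn (inFrame D i) (extChartAt J i).target)
    (h' : ∀ i, ContinuousOn (inFrame D' i) (extChartAt J i).target) :
    integralDensity J D + integralDensity J D' = integralDensity J fun x b => D x b + D' x b := by
  have hint : ∀ (D : ∀ x : N, (Fin m → TangentSpace J x) → ℝ) (i : N),
      ContinuousOn (inFrame D i) (extChartAt J i).target →
      IntegrableOn (fun y => partitionAt J i y * inFrame D i y) (extChartAt J i).target :=
    fun D i hD => integrableOn_target ((contDiffOn_partitionAt i).continuousOn.mul hD)
      fun y hy h => by rw [partitionAt_eq_zero hy h, zero_mul]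
  rw [integralDensity_eq_sum, integralDensity_eq_sum, integralDensity_eq_sum,
    ← sum_add_distrib]
  refine sum_congr rfl fun i _ => ?_
  refine (integral_add (hint D i (h i)) (hint D' i (h' i))).symm.trans ?_
  exact integral_congr_ae (Filter.Eventually.of_forall fun y => (mul_add _ _ _).symm)

variable {L cov}

variable (L) in
/-- The derivative of the integrand of `S_g + S_μ` along a path of fields, together with the boundary
term of the derivative of `S_H`. -/
def variationDensity (H : DForm I M (n + 1)) (φ : ℝ → Fields W V) (ε : ∀ ξ : Ξ, V ((φ 0).X ξ))
    (s : S) (b : Fin n → TangentSpace R₀ s) : ℝ :=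
  deriv (fun t => boundaryDensity L g μtop μt (φ t) s b) 0 +
    W.bdrySign s b * H.toFun ((φ 0).X (W.incl s))
      (Fin.cons (L.anchor _ (ε (W.incl s))) (fun l => (φ 0).dXbdry I s (b l)))

variable (H : DForm I M (n + 1))

lemma isDensity_variationDensity : IsDensity (variationDensity L g μtop μt H φ ε) :=
  (IsDensity.deriv fun t => isDensity_boundaryDensity L g μtop μt (φ t)).add
    (isDensity_sign_mul W.bdryForm fun s =>
      ((H.toFun ((φ 0).X (W.incl s))).toAlternatingMap.curryLeft
        (L.anchor _ (ε (W.incl s)))).compLinearMap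
          ((mfderiv R₁ I (φ 0).X (W.incl s)).comp
            (mfderiv R₀ R₁ W.incl s)).toLinearMap)

lemma inFrame_variationDensity (i : S) (y : E₀) :
    inFrame (variationDensity L g μtop μt H φ ε) i y = residue L g μtop μt H φ ε i y +
      ∑ m, fderivWithin ℝ (inFrame (fun s => gaugeCurrent L μtop μt (φ 0) ε s m) i)
        (Set.range R₀) y (single m 1) :=
  (sub_add_cancel _ _).symm

lemma continuousOn_deriv_boundaryDensity (hφ : IsSmoothPath I F φ) (i : S) :
    ContinuousOn (inFrame (fun s b => deriv (fun t => boundaryDensity L g μtop μt (φ t) s b) 0) i)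
      (χ i).target := by
  have h := contDiffOn_boundaryDensity L g μtop μt hφ i
  have h1 : ContinuousOn (fun y => fderivWithin ℝ (fun z : ℝ × E₀ =>
      inFrame (boundaryDensity L g μtop μt (φ z.1)) i z.2)
      (Set.univ ×ˢ (χ i).target) (0, y) (1, 0)) (χ i).target :=
    ((h.continuousOn_fderivWithin (uniqueDiffOn_chartDomain i) le_rfl).clm_apply
      continuousOn_const).comp (by fun_prop) fun y hy => ⟨Set.mem_univ _, hy⟩
  exact h1.congr fun y hy => (hasDerivAt_fst h hy 0).deriv

lemma IsGaugeVariation.continuousOn_flux (h : IsGaugeVariation L cov φ ε) (hφ : IsSmoothPath I F φ)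
    (i : S) : ContinuousOn (inFrame (fun s b => W.bdrySign s b * H.toFun ((φ 0).X (W.incl s))
      (Fin.cons (L.anchor _ (ε (W.incl s))) (fun l => (φ 0).dXbdry I s (b l)))) i)
      (χ i).target := by
  have h1 := (H.contDiffOn_velocity (uniqueDiffOn_chartDomain i) (contMDiffOn_chartMap hφ.bdry i)
    (Fin.cons (1, 0) fun l => (0, single l 1))).comp
    (contDiff_prodMk_right (0 : ℝ)).contDiffOn (s := (χ i).target)
    fun y hy => ⟨Set.mem_univ _, hy⟩
  refine ((contDiffOn_mul_of_locally_eq (fun y hy =>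
    nhdsWithin_le_nhds (W.bdrySign_eventually_eq hy)) h1).continuousOn).congr fun y hy => ?_
  refine congrArg (fun v => W.bdrySign _ (coordFrame R₀ i y) *
    H.toFun (bdryMap φ i (0, y)) v) (funext fun l => ?_)
  refine Fin.cases ?_ (fun l => ?_) l
  · exact (h.velocity_time hφ hy).symm
  · exact (hφ.velocity_bdryMap hy l).symm

lemma IsGaugeVariation.continuousOn_residue (h : IsGaugeVariation L cov φ ε)
    (hφ : IsSmoothPath I F φ)
    (hε : IsSmoothParam I F φ ε)
    (i : S) : ContinuousOn (residue L g μtop μt H φ ε i) (χ i).target :=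
  ((continuousOn_deriv_boundaryDensity g μtop μt hφ i).add (h.continuousOn_flux H hφ i)).sub
    (continuousOn_finsetSum _ fun m _ => continuousOn_fderivWithin_target
      (contDiffOn_gaugeCurrent μtop μt h hφ hε i m) _)

lemma IsGaugeVariation.hasDerivAt_action (h : IsGaugeVariation L cov φ ε)
    (hφ : IsSmoothPath I F φ) (hH : ∀ x, extD H.toFun x = 0) :
    HasDerivAt (fun t => action L g H μtop μt (φ t))
      (integralDensity R₀ (variationDensity L g μtop μt H φ ε)) 0 := by
  have hsum : ∀ t, action L g H μtop μt (φ t) =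
      integralDensity R₀ (boundaryDensity L g μtop μt (φ t)) + actionH H (φ t) := fun t => by
    have hc : ∀ i : S, ContinuousOn (fun y : E₀ => ((t, y) : ℝ × E₀)) (χ i).target :=
      fun i => by fun_prop
    have h2 := fun i => ((contDiffOn_lagrangianDensity μtop μt hφ i).continuousOn).comp (hc i)
      fun y hy => ⟨Set.mem_univ _, hy⟩
    have h1 := fun i => (((contDiffOn_boundaryDensity L g μtop μt hφ i).continuousOn).comp (hc i)
      fun y hy => ⟨Set.mem_univ _, hy⟩).sub (h2 i)
    rw [action, add_right_comm]
    congr 1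
    simp only [actionMu, sum_mixedForm]
    refine (integralDensity_add (fun i => (h1 i).congr fun y _ => ?_) h2)
    exact (add_sub_cancel_right _ _).symm
  simp only [hsum]
  have hd := (hasDerivAt_integralDensity (J := R₀) (N := S)
    (D := fun t => boundaryDensity L g μtop μt (φ t)) (contDiffOn_boundaryDensity L g μtop μt hφ)).add
    (hasDerivAt_integral_pullback W H hH hφ.bulk)
  have hflux : (fun (s : S) (b : Fin n → TangentSpace R₀ s) => W.bdrySign s b *
      H.toFun (bulkPath φ (0, W.incl s)) (Fin.cons (timeVel I (bulkPath φ) (W.incl s))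
        (fun l => mfderiv R₁ I (fun ξ => bulkPath φ (0, ξ)) (W.incl s)
          (mfderiv R₀ R₁ W.incl s (b l))))) = fun s b => W.bdrySign s b *
      H.toFun ((φ 0).X (W.incl s)) (Fin.cons (L.anchor _ (ε (W.incl s)))
        (fun l => (φ 0).dXbdry I s (b l))) := by
    funext s b
    rw [← h.1 (W.incl s)]
    rfl
  rw [hflux, integralDensity_add (continuousOn_deriv_boundaryDensity g μtop μt hφ)
    (h.continuousOn_flux H hφ)] at hd
  exact hd

lemma IsGaugeVariation.sum_integral_divergence_gaugeCurrent (h : IsGaugeVariation L cov φ ε)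
    (hφ : IsSmoothPath I F φ) (hn : n ≠ 0)
    (hε : IsSmoothParam I F φ ε) :
    ∑ i ∈ chartIndices R₀ S, ∫ y in (χ i).target, partitionAt R₀ i y *
      ∑ m, fderivWithin ℝ (inFrame (fun s => gaugeCurrent L μtop μt (φ 0) ε s m) i)
        (Set.range R₀) y (single m 1) = 0 := by
  obtain ⟨k, rfl⟩ := Nat.exists_eq_succ_of_ne_zero hn
  exact sum_integral_divergence_eq_zero (𝓡 (k + 1)).range_eq_univ
    (fun ξ => isDensity_wedgeCovector W.bdryForm (fun s => lagrangian μtop μt _)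
      (fun s => fieldHom I (φ 0) s) (fun s => graph L _ (ε (W.incl s))) ξ)
    (contDiffOn_gaugeCurrent μtop μt h hφ hε)

lemma IsGaugeVariation.integralDensity_eq_zero (h : IsGaugeVariation L cov φ ε)
    (hφ : IsSmoothPath I F φ) (hn : n ≠ 0)
    (hε : IsSmoothParam I F φ ε)
    (h0 : ∀ i, ∀ y ∈ (χ i).target, residue L g μtop μt H φ ε i y = 0) :
    integralDensity R₀ (variationDensity L g μtop μt H φ ε) = 0 := by
  rw [← h.sum_integral_divergence_gaugeCurrent μtop μt hφ hn hε, integralDensity_eq_sum]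
  refine sum_congr rfl fun i _ =>
    setIntegral_congr_fun (measurableSet_extChartAt_target i) fun y hy => ?_
  refine congrArg (partitionAt R₀ i y * ·) ?_
  refine (inFrame_variationDensity g μtop μt H i y).trans ?_
  rw [h0 i y hy, zero_add]

end ActionDerivative

/-! ### Linearity of the obstruction in the gauge parameter -/

section ObstructionLinear

variable (H : DForm I M (n + 1))

lemma dhat_smul (r : ℝ) (σ : ΓE) (x : M) (v : TangentSpace I x) :
    dhat (r • σ) x v = r • dhat σ x v := (dhatHom x v).map_smul r σ

lemma eConn_smul (r : ℝ) (e : ΓE) (v : ΓT) (x : M) :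
    eConn L cov (r • e) v x = r • eConn L cov e v x := by
  have h1 := mlieBracket_local (ρsec L (r • e)) v x
  have h2 := mlieBracket_local (ρsec L e) v x
  have h3 : ρsec L (r • e) = r • ρsec L e :=
    ContMDiffSection.ext fun y => map_smul (L.anchor y) r (e y)
  have h4 : L.anchor x (cov (fun y => (r • e) y) x (v x)) =
      r • L.anchor x (cov (fun y => e y) x (v x)) := by
    rw [← map_smul]
    exact congrArg _ (covHom_smul cov r e x (v x))
  have h5 : dhat (ρsec L (r • e)) x (v x) = r • dhat (ρsec L e) x (v x) := by
    rw [h3, dhat_smul]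
  have h6 : dhat v x (ρsec L (r • e) x) = r • dhat v x (ρsec L e x) := by
    rw [← map_smul, h3]; rfl
  have key : ∀ a b c d e' f B B' : EM, B = a - b → B' = c - d → a = r • c → b = r • d →
      e' = r • f → B + e' = r • (B' + f) := by
    rintro a b c d e' f B B' rfl rfl rfl rfl rfl
    module
  exact key _ _ _ _ _ _ _ _ h1 h2 h6 h5 h4

lemma eConnV_smul (r : ℝ) (e u : ΓE) (x : M) :
    eConnV L cov (r • e) u x = r • eConnV L cov e u x := by
  rw [eConnV, map_smul, eConnV, smul_add]
  exact congrArg₂ (· + ·) rfl (covHom_smul cov r e x _)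

lemma eDeriv_smul {ι : Type*} [Fintype ι] [DecidableEq ι] (Q : MixedField I V ι) (r : ℝ)
    (e : ΓE) (W : ι → ΓT) (Y : ι → ΓE) (x : M) :
    eDeriv L cov Q (r • e) W Y x = r * eDeriv L cov Q e W Y x := by
  have h : L.anchor x ((r • e) x) = r • L.anchor x (e x) := map_smul (L.anchor x) r (e x)
  simp only [eDeriv, eConn_smul, eConnV_smul, h, ← Prod.smul_mk, MultilinearMap.map_update_smul,
    smul_eq_mul, ← mul_sum, mul_sub]
  congr 1
  exact map_smul (mvfderiv I (fun y => Q y fun i => (W i y, Y i y)) x) r _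

lemma variation_smul {Q : ∀ x : M, (TangentSpace I x × V x) [⋀^Fin n]→ₗ[ℝ] ℝ}
    (hQ : MixedField.IsSmooth F (fun x => (Q x).toMultilinearMap)) (r : ℝ) (e : ΓE)
    (W : Fin n → ΓT) (Y : Fin n → ΓE) (x : M) :
    variation L cov Q (r • e) W Y x = r * variation L cov Q e W Y x := by
  have hg : ∀ y, graph L y ((r • e) y) = r • graph L y (e y) := fun y =>
    map_smul (graph L y) r (e y)
  have hc : ∀ l, cov (fun y => (r • e) y) x (W l x) = r • cov (fun y => e y) x (W l x) := fun l =>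
    covHom_smul cov r e x (W l x)
  have hd : ∀ m, MDifferentiableAt I 𝓘(ℝ, ℝ) (fun y => Q y (update
      (fun i => (W i y, Y i y)) m (graph L y (e y)))) x := fun m => by
    refine (contMDiff_mdifferentiableAt
      (hQ (update W m (ρsec L e)) (update Y m e) x)).congr_of_eventuallyEq ?_
    refine Filter.Eventually.of_forall fun y => congrArg (Q y) (funext fun i => ?_)
    rcases eq_or_ne i m with rfl | hi
    · simp only [update_self]; rfl
    · simp only [update_of_ne hi]
  have hcomm : ∀ m l (z : Fin n → TangentSpace I x × V x) (u b : TangentSpace I x × V x), m < l →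
      Q x (update (update z m (r • u)) l b) =
        r * Q x (update (update z m u) l b) := fun m l z u b hml => by
    rw [Function.update_comm hml.ne, Function.update_comm hml.ne, AlternatingMap.map_update_smul,
      smul_eq_mul]
  have hif : ∀ m l, (if m < l then Q x (update (update
      (fun i => (W i x, Y i x)) m (r • graph L x (e x))) l
        (mlieBracket I (fun y => W m y) (fun y => W l y) x, 0)) else 0) =
      r * (if m < l then Q x (update (update (fun i => (W i x, Y i x)) m
        (graph L x (e x))) l (mlieBracket I (fun y => W m y) (fun y => W l y) x, 0)) else 0) :=
    fun m l => by
      split_ifs with hml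
      exacts [hcomm m l _ _ _ hml, (mul_zero r).symm]
  simp only [variation, eDeriv_smul, hg, hc, map_smul (graph L x), hif,
    AlternatingMap.map_update_smul, smul_eq_mul, mvfderiv_const_mul r (hd _), ← mul_sum]
  ring

lemma obstruction_smul (G : Matrix (Fin n) (Fin n) ℝ) (σ r : ℝ) (e : ΓE)
    (W : Fin n → ΓT) (Y : Fin n → ΓE) (x : M) (β : Fin n → Fin n → V x) :
    obstruction L cov g μtop μt H G σ (r • e) W Y x β =
      r * obstruction L cov g μtop μt H G σ e W Y x β := by
  have hg : graph L x ((r • e) x) = r • graph L x (e x) := map_smul (graph L x) r (e x)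
  have ha : L.anchor x ((r • e) x) = r • L.anchor x (e x) := map_smul (L.anchor x) r (e x)
  have hif : ∀ m l, (if l = m then 0 else mixedSum μt x (update (update
      (fun i => (W i x, Y i x)) m (r • graph L x (e x))) l (0, β m l))) =
      r * (if l = m then 0 else mixedSum μt x (update (update
        (fun i => (W i x, Y i x)) m (graph L x (e x))) l (0, β m l))) := fun m l => by
    split_ifs with hml
    · exact (mul_zero r).symm
    · rw [Function.update_comm (Ne.symm hml), Function.update_comm (Ne.symm hml),
        AlternatingMap.map_update_smul, smul_eq_mul]
  have htop : (extD μtop.toFun x + H.toFun x) (Fin.cons (r • L.anchor x (e x)) fun l => W l x) =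
      r * (extD μtop.toFun x + H.toFun x) (Fin.cons (L.anchor x (e x)) fun l => W l x) := by
    have h := (extD μtop.toFun x + H.toFun x).toAlternatingMap.map_update_smul
      (Fin.cons (L.anchor x (e x)) fun l => W l x) 0 r (L.anchor x (e x))
    rw [Fin.update_cons_zero, Fin.update_cons_zero] at h
    exact h
  simp only [obstruction, eDeriv_smul, variation_smul L cov (smooth_mixedSum μt), hg, ha, hif, htop,
    ← mul_sum, mul_left_comm _ r]
  ring

end ObstructionLinear

/-! ### Vanishing of the obstruction -/

section ObstructionZero

variable {k : ℕ} (μtop : DForm I M (k + 1)) (μt : Cochain I M F V (k + 1))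
  (H : DForm I M (k + 1 + 1))

lemma rescaled_top : rescaled μt k 0 rfl = μt k 0 rfl := by
  have h : (-1 : ℝ) ^ (∑ j ∈ Finset.Icc (k + 2) (k + 1), j) = 1 := by simp
  have h' : ∀ x, (rescaled μt k 0 rfl).toFun x = (μt k 0 rfl).toFun x := fun x => by
    change (-1 : ℝ) ^ (∑ j ∈ Finset.Icc (k + 2) (k + 1), j) • (μt k 0 rfl).toFun x = _
    rw [h, one_smul]
  revert h'
  generalize rescaled μt k 0 rfl = a
  generalize μt k 0 rfl = b
  intro h'
  cases a; cases b
  congr 1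
  exact funext h'

lemma eDerivF_smul {p q : ℕ} (c : ℝ) (ν : EForm I M F V p q) (e : ΓE)
    (v : Fin p → ΓT) (a : Fin q → ΓE) (x : M) :
    eDerivF L cov (ν.smul c) e v a x = c * eDerivF L cov ν e v a x := by
  have h := mvfderiv_const_mul c (contMDiff_mdifferentiableAt (ν.smooth v a x))
    (L.anchor x (e x))
  simp only [eDerivF, mul_sub, mul_sum]
  exact congrArg₂ _ (congrArg₂ _ h rfl) rfl

lemma iotaPow_one {p : ℕ} (h : p + 1 = 1 + p)
    (Ω : ∀ x : M, (TangentSpace I x) [⋀^Fin (p + 1)]→L[ℝ] ℝ) (v : Fin p → ΓT)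
    (e : Fin 1 → ΓE) (x : M) :
    iotaPow L h Ω v e x = Ω x (Fin.cons (L.anchor x (e 0 x)) (fun l => v l x)) := by
  refine congrArg (Ω x) (funext fun i => ?_)
  refine Fin.cases ?_ (fun i => ?_) i
  · rfl
  · rw [Fin.cons_succ, show Fin.cast h i.succ = Fin.natAdd 1 i from Fin.ext (Nat.add_comm _ _),
      Fin.append_right]

/-- The first structure equation of a homotopy momentum section, for `μ_{n-1}`. -/
lemma covD_eq_iff (hn : k + 1 + 1 = 1 + (k + 1)) :
    (∀ (v : Fin (k + 1) → ΓT) (e : Fin 1 → ΓE) (x : M),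
      covD cov (rescaled μt k 0 rfl) v e x = - iotaPow L hn (modifiedForm H μtop) v e x) ↔
    ∀ (e : ΓE) (W : Fin (k + 1) → ΓT) (x : M),
      (extD μtop.toFun x + H.toFun x) (Fin.cons (L.anchor x (e x)) (fun l => W l x)) =
        (-1) ^ k * covD cov (μt k 0 rfl) W (fun _ => e) x := by
  have hs : (-1 : ℝ) ^ k * (-1) ^ k = 1 := by rw [← mul_pow]; simp
  have key : ∀ (v : Fin (k + 1) → ΓT) (e : Fin 1 → ΓE) (x : M),
      - iotaPow L hn (modifiedForm H μtop) v e x =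
      (-1) ^ k * (extD μtop.toFun x + H.toFun x)
        (Fin.cons (L.anchor x (e 0 x)) (fun l => v l x)) := fun v e x => by
    rw [iotaPow_one, modifiedForm, add_comm (H.toFun x), ContinuousAlternatingMap.smul_apply,
      smul_eq_mul, pow_succ]
    ring
  simp only [rescaled_top, key]
  constructor
  · intro h e W x
    rw [h, ← mul_assoc, hs, one_mul]
  · intro h v e x
    rw [h, ← mul_assoc, hs, one_mul]
    exact congrArg (fun e => covD cov (μt k 0 rfl) v e x)
      (funext fun i => by rw [Subsingleton.elim i 0])

variable {L cov μt μtop H}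

lemma GraphNull.sum_eq_zero {n : ℕ} {Q : ∀ x : M, (TangentSpace I x × V x) [⋀^Fin n]→ₗ[ℝ] ℝ}
    (h : GraphNull L Q) (x : M) (z : Fin n → TangentSpace I x × V x) (u : V x)
    (r : Fin n → Fin n → V x) : (∑ m, ∑ l, if l = m then 0 else
      Q x (update (update z m (graph L x u)) l (0, r m l))) = 0 :=
  Finset.sum_eq_zero fun m _ => Finset.sum_eq_zero fun l _ => by
    split_ifs with hlm
    exacts [rfl, h x z m l (Ne.symm hlm) u (r m l)]

lemma obstruction_eq_zero (h1 : MetricInvariant L cov g)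
    (h2 : IsHomotopyMomentumSection L cov (modifiedForm H μtop) (rescaled μt))
    (h3 : AlgebraicRelation L (rescaled μt)) (G : Matrix (Fin (k + 1)) (Fin (k + 1)) ℝ) (σ : ℝ)
    (e : ΓE) (W : Fin (k + 1) → ΓT) (Y : Fin (k + 1) → ΓE)
    (x : M) (r : Fin (k + 1) → Fin (k + 1) → V x) :
    obstruction L cov g μtop μt H G σ e W Y x r = 0 := by
  have hQ := (graphNull_iff μt).2 h3
  obtain ⟨h4, h5⟩ := (isHomotopyMomentumSection_iff h3).1 h2
  have h6 := (covD_eq_iff L cov μtop μt H _).1 h4 e W x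
  have h7 : eDeriv L cov (fun x => (mixedSum μt x).toMultilinearMap) e W Y x = 0 := by
    refine eDeriv_mixedSum_eq_zero (fun p q hpq e v a x => ?_) e W Y x
    have := h3.eDerivF_eq_zero h5 q p hpq e v a x
    rw [rescaled, eDerivF_smul] at this
    exact (mul_eq_zero.1 this).resolve_left (pow_ne_zero _ (by norm_num))
  simp only [obstruction, h1.eDeriv_kineticField, mul_zero, Finset.sum_const_zero,
    hQ.sum_eq_zero, variation_mixedSum hQ, h6, h7]
  ring

lemma eDeriv_tangent (e : ΓE) (W : Fin (k + 1) → ΓT) (x : M) :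
    eDeriv L cov (fun x => (mixedSum μt x).toMultilinearMap) e W 0 x = 0 := by
  have hV : eConnV L cov e 0 x = 0 := by
    have : L.anchor x ((0 : ΓE) x) = 0 := map_zero (L.anchor x)
    rw [eConnV, map_zero, this, map_zero]
    exact add_zero _
  have h0 : ∀ l, update (fun i => (W i x, (0 : ΓE) x)) l
      (eConn L cov e (W l) x, eConnV L cov e 0 x) =
      fun i => (update (fun i => W i x) l (eConn L cov e (W l) x) i, 0) := fun l => by
    funext i
    rcases eq_or_ne i l with rfl | hi
    · simp only [update_self, hV]
    · simp only [update_of_ne hi]; rfl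
  have h1 : ∀ y, mixedSum μt y (fun i => (W i y, (0 : ΓE) y)) = 0 := fun y =>
    mixedSum_tangent μt y fun i => W i y
  simp only [eDeriv, Pi.zero_apply, AlternatingMap.coe_multilinearMap, h0, h1, mixedSum_tangent,
    Finset.sum_const_zero, sub_zero]
  rw [mvfderiv, mfderiv_const]
  rfl

/-- With a single nonzero argument, `∇θ` is linear in the value of this argument. -/
lemma covD_update (θ : EForm I M F V k 1) (w : ΓT) (e : ΓE) (x : M) :
    covD cov θ (update 0 0 w) (fun _ => e) x =
      mvfderiv I (fun y => θ.toFun y 0 (fun _ => e y)) x (w x) -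
        θ.toFun x 0 (fun _ => cov (fun y => e y) x (w x)) := by
  have hz : ∀ (y : M) (i : Fin k), (update (0 : Fin (k + 1) → ΓT) 0 w) i.succ y
      = 0 := fun y i => by rw [update_of_ne (Fin.succ_ne_zero i)]; rfl
  have hbr : ∀ v : ΓT, mlieBracket I (fun y => v y) (fun y => (0 : ΓT) y) x = 0 ∧
      mlieBracket I (fun y => (0 : ΓT) y) (fun y => v y) x = 0 := fun v => by
    have h0 : ∀ u, dhat (0 : ΓT) x u = 0 := fun u => (dhatHom x u).map_zero
    refine ⟨(mlieBracket_local v 0 x).trans ?_, (mlieBracket_local 0 v x).trans ?_⟩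
    · rw [h0]; exact (congrArg (fun u : EM => 0 - u) (map_zero (dhat v x))).trans (sub_zero 0)
    · rw [h0]; exact (congrArg (fun u : EM => u - 0) (map_zero (dhat v x))).trans (sub_zero 0)
  have hz' : ∀ i : Fin k, (update (0 : Fin (k + 1) → ΓT) 0 w) i.succ = 0 :=
    fun i => update_of_ne (Fin.succ_ne_zero i) _ _
  rw [covD_one, Fin.sum_univ_succ]
  refine (congrArg₂ (· + ·) ?_ (sum_eq_zero fun i _ => ?_)).trans (add_zero _)
  · simp only [Fin.succAbove_zero, Fin.val_zero, pow_zero, one_mul, hz', update_self,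
      (hbr _).1]
    rw [sum_eq_zero, sub_zero]
    · rfl
    · intro j _
      split_ifs
      · rw [(θ.toFun x).map_update_zero]; rfl
      · rfl
  · have hbr' : ∀ j, mlieBracket I
        (fun y => (update (0 : Fin (k + 1) → ΓT) 0 w) i.succ y)
        (fun y => (update (0 : Fin (k + 1) → ΓT) 0 w) (i.succ.succAbove j) y) x
        = 0 := fun j => by
      rw [hz']; exact (hbr _).2
    have h1 : mvfderiv I (fun y => θ.toFun y
        (fun a => (update (0 : Fin (k + 1) → ΓT) 0 w) (i.succ.succAbove a) y)
        (fun _ => e y)) x 0 = 0 := map_zero _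
    have h2 : cov (fun y => e y) x (0 : TangentSpace I x) = 0 := map_zero _
    have h3 : θ.toFun x (fun a => (update (0 : Fin (k + 1) → ΓT) 0 w)
        (i.succ.succAbove a) x) (fun _ => (0 : V x)) = 0 :=
      (θ.toFun x _).map_coord_zero (0 : Fin 1) rfl
    rw [hz x i, h1, h2, h3, sum_eq_zero, sub_zero, sub_zero, mul_zero]
    intro j _
    split_ifs
    · rw [hbr', (θ.toFun x).map_update_zero]; rfl
    · rfl

lemma eConn_add (e : ΓE) (v w : ΓT) (x : M) :
    eConn L cov e (v + w) x = eConn L cov e v x + eConn L cov e w x := by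
  have h : L.anchor x (cov (fun y => e y) x ((v + w) x)) =
      L.anchor x (cov (fun y => e y) x (v x)) + L.anchor x (cov (fun y => e y) x (w x)) := by
    rw [← map_add, ← map_add]; rfl
  have key : ∀ a b c d p q A B C R : EM, A = (a + b) - (c + d) → B = a - c → C = b - d →
      R = p + q → A + R = B + p + (C + q) := by
    rintro a b c d p q A B C R rfl rfl rfl rfl
    abel
  exact key _ _ _ _ _ _ _ _ _ _ ((mlieBracket_local (ρsec L e) (v + w) x).trans
    (congrArg₂ (fun a b : EM => a - b) (dhat_add v w x _) (map_add (dhat (ρsec L e) x) _ _)))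
    (mlieBracket_local (ρsec L e) v x) (mlieBracket_local (ρsec L e) w x) h

/-- By polarization, the metric is invariant as soon as its diagonal values are. -/
lemma metricInvariant_of_diag (h : ∀ (e : ΓE) (v : ΓT) (x : M),
      mvfderiv I (fun y => g.inner y (v y) (v y)) x (L.anchor x (e x))
        - g.inner x (eConn L cov e v x) (v x) - g.inner x (v x) (eConn L cov e v x) = 0) :
    MetricInvariant L cov g := by
  intro e v w x
  have hd : ∀ v w : ΓT, MDifferentiableAt I 𝓘(ℝ, ℝ) (fun y => g.inner y (v y) (w y)) x :=
    fun v w => contMDiff_mdifferentiableAt (contMDiffWithinAt_metric g (c := fun y => y)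
      contMDiffWithinAt_id (v.contMDiff x) (w.contMDiff x))
  have hvw := h e (v + w) x
  have hexp : (fun y => g.inner y ((v + w) y) ((v + w) y)) = fun y =>
      ∑ j : Fin 3, (![1, 2, 1] : Fin 3 → ℝ) j * (![fun y => g.inner y (v y) (v y),
        fun y => g.inner y (v y) (w y), fun y => g.inner y (w y) (w y)] : Fin 3 → M → ℝ) j y := by
    funext y
    change g.inner y (v y + w y) (v y + w y) = _
    simp only [map_add, add_apply, g.symm y (w y) (v y), Fin.sum_univ_three, Matrix.cons_val_zero,
      Matrix.cons_val_one, Matrix.cons_val]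
    ring
  rw [hexp, mvfderiv_sum_mul _ (fun j => by fin_cases j; exacts [hd v v, hd v w, hd w w])] at hvw
  have hs : (v + w) x = v x + w x := rfl
  simp only [eConn_add, hs, map_add, add_apply, Fin.sum_univ_three, Matrix.cons_val_zero,
    Matrix.cons_val_one, Matrix.cons_val] at hvw
  linarith [h e v x, h e w x, g.symm x (eConn L cov e v x) (w x),
    g.symm x (eConn L cov e w x) (v x)]

/-- Conversely, the vanishing of the obstruction implies the structure equations. -/
lemma conditions_of_obstruction {G : Matrix (Fin (k + 1)) (Fin (k + 1)) ℝ} (hG : G.PosDef) {σ : ℝ}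
    (hσ : σ ≠ 0)
    (h : ∀ (e : ΓE) (W : Fin (k + 1) → ΓT)
      (Y : Fin (k + 1) → ΓE) (x : M), ∃ r : Fin (k + 1) → Fin (k + 1) → V x, ∀ β,
      obstruction L cov g μtop μt H G σ e W Y x (r + β) = 0) :
    MetricInvariant L cov g ∧
      IsHomotopyMomentumSection L cov (modifiedForm H μtop) (rescaled μt) ∧
      AlgebraicRelation L (rescaled μt) := by
  have h0 : ∀ e W Y x (β : Fin (k + 1) → Fin (k + 1) → V x),
      obstruction L cov g μtop μt H G σ e W Y x β = 0 := fun e W Y x β => by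
    obtain ⟨r, hr⟩ := h e W Y x
    have := hr (-r + β)
    rwa [add_neg_cancel_left] at this
  have hQ : GraphNull L (mixedSum μt) := fun x z m l hml u b => by
    obtain ⟨e, rfl⟩ := exists_section_eq (I := I) (F := F) u
    choose W hW using fun l => exists_section_eq (I := I) (F := EM) (z l).1
    choose Y hY using fun l => exists_section_eq (I := I) (F := F) (z l).2
    have hz : (fun i => (W i x, Y i x)) = z := funext fun i => Prod.ext (hW i) (hY i)
    have h1 := h0 e W Y x 0
    have h2 := h0 e W Y x (Pi.single m (Pi.single l b))
    have hsum : ∀ r : Fin (k + 1) → Fin (k + 1) → V x,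
        (∀ m' l', r m' l' = if m' = m ∧ l' = l then r m l else 0) → (∑ m', ∑ l', if l' = m' then 0
          else mixedSum μt x (update (update z m' (graph L x (e x))) l'
            (0, r m' l'))) = mixedSum μt x (update (update z m
              (graph L x (e x))) l (0, r m l)) := fun r hr => by
      rw [sum_eq_single m, sum_eq_single l, if_neg hml.symm]
      · intro l' _ hl'
        have h0' : r m l' = 0 := by rw [hr]; exact if_neg fun h => hl' h.2
        rw [h0']
        split_ifs
        exacts [rfl, (mixedSum μt x).map_coord_zero l' (update_self _ _ _)]
      · simp
      · intro m' _ hm'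
        refine sum_eq_zero fun l' _ => ?_
        have h0' : r m' l' = 0 := by rw [hr]; exact if_neg fun h => hm' h.1
        rw [h0']
        split_ifs
        exacts [rfl, (mixedSum μt x).map_coord_zero l' (update_self _ _ _)]
      · simp
    have hz0 : mixedSum μt x (update (update z m (graph L x (e x))) l
        (0, (0 : Fin (k + 1) → Fin (k + 1) → V x) m l)) = 0 :=
      (mixedSum μt x).map_coord_zero l (update_self _ _ _)
    have hs : (Pi.single m (Pi.single l b) : Fin (k + 1) → Fin (k + 1) → V x) m l = b := by simp
    rw [obstruction, hz, hsum 0 (fun m' l' => by simp), hz0] at h1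
    rw [obstruction, hz, hsum _ (fun m' l' => by
      rw [hs]
      rcases eq_or_ne m' m with rfl | hm' <;> rcases eq_or_ne l' l with rfl | hl' <;>
        simp [*]), hs] at h2
    have h3 : σ * mixedSum μt x (update (update z m (graph L x (e x))) l
        (0, b)) = 0 := by linear_combination h1 - h2
    exact (mul_eq_zero.1 h3).resolve_left hσ
  have h1 : ∀ e W Y x, (1 / 2) * √G.det * ∑ a, ∑ b, G⁻¹ a b *
      eDeriv L cov (kineticField g L) e (fun l => W (![a, b] l)) (fun l => Y (![a, b] l)) x +
      σ * ((extD μtop.toFun x + H.toFun x) (Fin.cons (L.anchor x (e x)) (fun l => W l x)) +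
        (eDeriv L cov (fun x => (mixedSum μt x).toMultilinearMap) e W Y x -
          (-1) ^ k * covD cov (μt k 0 rfl) W (fun _ => e) x)) = 0 := fun e W Y x => by
    have := h0 e W Y x 0
    rw [obstruction, hQ.sum_eq_zero, variation_mixedSum hQ, sub_zero] at this
    exact this
  have hm : MetricInvariant L cov g := by
    refine metricInvariant_of_diag g fun e v x => ?_
    -- the kinetic part is even and the remaining part is odd in `v`
    have hker : ∀ w : ΓT, ∑ a, ∑ b, G⁻¹ a b * eDeriv L cov (kineticField g L) e
        (fun l => (update 0 0 w : Fin (k + 1) → ΓT) (![a, b] l)) (fun _ => 0) x =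
        G⁻¹ 0 0 * (mvfderiv I (fun y => g.inner y (w y) (w y)) x (L.anchor x (e x)) -
          g.inner x (eConn L cov e w x) (w x) - g.inner x (w x) (eConn L cov e w x)) := fun w => by
      have hz : eConn L cov e (0 : ΓT) x = 0 := by
        have h' := eConn_add (L := L) (cov := cov) e 0 0 x
        rw [add_zero] at h'
        exact left_eq_add.1 h'
      have hne : ∀ a : Fin (k + 1), a ≠ 0 →
          (update 0 0 w : Fin (k + 1) → ΓT) a = 0 :=
        fun a ha => update_of_ne ha _ _
      have hc : ∀ c : ℝ, mvfderiv I (fun _ : M => c) x (L.anchor x (e x)) = 0 := fun c => by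
        rw [mvfderiv, mfderiv_const]; rfl
      have hz0 : ∀ y, (0 : ΓT) y = 0 := fun _ => rfl
      have hY : (fun _ : Fin 2 => (0 : ΓE)) = 0 := rfl
      simp only [hY, eDeriv_kineticField_pure, Matrix.cons_val_zero, Matrix.cons_val_one]
      rw [sum_eq_single 0, sum_eq_single 0, update_self]
      · intro b _ hb
        rw [hne b hb]
        simp only [hz0, map_zero, hz, hc, sub_zero, mul_zero]
      · simp
      · intro a _ ha
        refine sum_eq_zero fun b _ => ?_
        rw [hne a ha]
        simp only [hz0, map_zero, hz, hc, sub_zero, mul_zero, zero_apply]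
      · simp
    have hneg : ∀ x, (-v) x = -v x := fun _ => rfl
    have hcn : eConn L cov e (-v) x = -eConn L cov e v x := by
      have h' := eConn_add (L := L) (cov := cov) e v (-v) x
      have hz : eConn L cov e (0 : ΓT) x = 0 := by
        have h' := eConn_add (L := L) (cov := cov) e 0 0 x
        rw [add_zero] at h'
        exact left_eq_add.1 h'
      rw [add_neg_cancel, hz] at h'
      exact (neg_eq_of_add_eq_zero_right h'.symm).symm
    have e1 := h1 e (update 0 0 v) (fun _ => 0) x
    have e2 := h1 e (update 0 0 (-v)) (fun _ => 0) x
    have ht : ∀ W : Fin (k + 1) → ΓT, eDeriv L cov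
        (fun x => (mixedSum μt x).toMultilinearMap) e W (fun _ => 0) x = 0 := fun W =>
      eDeriv_tangent e W x
    have hf : ∀ w : ΓT, (extD μtop.toFun x + H.toFun x) (Fin.cons (L.anchor x (e x))
        (fun l => (update 0 0 w : Fin (k + 1) → ΓT) l x)) =
        (extD μtop.toFun x + H.toFun x) (update
          (Fin.cons (L.anchor x (e x)) 0 : Fin (k + 1 + 1) → TangentSpace I x) (Fin.succ 0) (w x)) :=
      fun w => by
        rw [← Fin.cons_update]
        refine congrArg (fun z => (extD μtop.toFun x + H.toFun x)
          (Fin.cons (L.anchor x (e x)) z : Fin (k + 1 + 1) → TangentSpace I x)) (funext fun l => ?_)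
        rcases eq_or_ne l 0 with rfl | hl
        · simp
        · simp only [update_of_ne hl]; rfl
    have h4 : cov (fun y => e y) x (-v x) = -cov (fun y => e y) x (v x) := map_neg _ _
    have h5 : (μt k 0 rfl).toFun x 0 (fun _ => -cov (fun y => e y) x (v x)) =
        -(μt k 0 rfl).toFun x 0 (fun _ => cov (fun y => e y) x (v x)) := by
      have := ((μt k 0 rfl).toFun x 0).map_update_neg (fun _ => cov (fun y => e y) x (v x)) 0
        (cov (fun y => e y) x (v x))
      have hu : ∀ u w : V x, update (fun _ : Fin (0 + 1) => u) 0 w = fun _ => w :=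
        fun u w => funext fun i => by rw [Subsingleton.elim (α := Fin 1) i 0, update_self]
      rwa [hu, hu] at this
    rw [hker, ht, hf, covD_update] at e1 e2
    simp only [hneg, hcn, map_neg, neg_apply, neg_neg, h4, h5] at e2
    have h6 := (extD μtop.toFun x + H.toFun x).map_update_neg
      (Fin.cons (L.anchor x (e x)) 0 : Fin (k + 1 + 1) → TangentSpace I x) (Fin.succ 0) (v x)
    have hK : √G.det * G⁻¹ 0 0 * (mvfderiv I (fun y => g.inner y (v y) (v y)) x
        (L.anchor x (e x)) - g.inner x (eConn L cov e v x) (v x) -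
        g.inner x (v x) (eConn L cov e v x)) = 0 := by
      linear_combination e1 + e2 - σ * h6
    exact (mul_eq_zero.1 hK).resolve_left
      (mul_pos (Real.sqrt_pos.2 hG.det_pos) hG.inv.diag_pos).ne'
  have h2 : ∀ e W Y x, (extD μtop.toFun x + H.toFun x)
      (Fin.cons (L.anchor x (e x)) (fun l => W l x)) +
      (eDeriv L cov (fun x => (mixedSum μt x).toMultilinearMap) e W Y x -
        (-1) ^ k * covD cov (μt k 0 rfl) W (fun _ => e) x) = 0 := fun e W Y x => by
    have := h1 e W Y x
    simp only [hm.eDeriv_kineticField, mul_zero, Finset.sum_const_zero, zero_add] at this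
    exact (mul_eq_zero.1 this).resolve_left hσ
  have h3 : ∀ (e : ΓE) (W : Fin (k + 1) → ΓT) (x : M),
      (extD μtop.toFun x + H.toFun x) (Fin.cons (L.anchor x (e x)) (fun l => W l x)) =
        (-1) ^ k * covD cov (μt k 0 rfl) W (fun _ => e) x := fun e W x => by
    have := h2 e W 0 x
    rw [eDeriv_tangent] at this
    linarith
  have hR := (graphNull_iff μt).1 hQ
  refine ⟨hm, (isHomotopyMomentumSection_iff hR).2
    ⟨(covD_eq_iff L cov μtop μt H _).2 h3, fun e v a x => ?_⟩, hR⟩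
  obtain ⟨W, Y, hWY⟩ := exists_eDeriv_mixedSum_eq (L := L) (cov := cov) μt (p := k) (q := 0) rfl e v a
  rw [rescaled_top, ← hWY]
  linarith [h2 e W Y x, h3 e W x]

end ObstructionZero

/-! ### Localization of the stationarity condition -/

section Localization

/-- The obstruction for a configuration of fields, in a chart of the boundary. -/
def boundaryObstruction (H : DForm I M (n + 1)) (i : S) (y : E₀) (e : ΓE)
    (Wf : Fin n → ΓT) (Y : Fin n → ΓE) (ψ : Fields W V) : ℝ :=
  obstruction L cov g μtop μt H (gram W.γ i y) (W.bdrySign _ (coordFrame R₀ i y)) e Wf Y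
    (ψ.X (W.incl ((χ i).symm y)))
    (fun m l => unhat F V (ψ.X (W.incl ((χ i).symm y)))
      (ψ.X (W.incl ((χ i).symm y)))
      (fderiv ℝ (fun z => hat F V (ψ.X (W.incl ((χ i).symm y)))
          (ψ.X (W.incl ((χ i).symm z)))
          (ψ.A ((χ i).symm z) (coordFrame R₀ i z l))) y
          (single m 1) -
        dhat (Y l) (ψ.X (W.incl ((χ i).symm y))) (Wf m _)))

variable (H : DForm I M (n + 1)) {φ' : ℝ → Fields W V} {ε' : ∀ ξ : Ξ, V ((φ' 0).X ξ)} {L cov}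

lemma IsGaugeVariation.residue_eq_boundaryObstruction (h : IsGaugeVariation L cov φ ε)
    (hφ : IsSmoothPath I F φ)
    (hε : IsSmoothParam I F φ ε)
    (hn : n ≠ 0) {i : S} {y : E₀} (hy : y ∈ (χ i).target)
    (e : ΓE) (Wf : Fin n → ΓT) (Y : Fin n → ΓE)
    (he : e _ = ε (W.incl ((χ i).symm y)))
    (hWY : ∀ l, fieldHom I (φ 0) _ (coordFrame R₀ i y l) = (Wf l _, Y l _)) :
    residue L g μtop μt H φ ε i y = boundaryObstruction L cov g μtop μt H i y e Wf Y (φ 0) := by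
  rw [h.residue_eq g μtop μt hφ hε hn H hy e Wf Y he fun l =>
    (hφ.fieldArgs_eq hy id l).trans (hWY l)]
  unfold boundaryObstruction
  refine congrArg (obstruction L cov g μtop μt H (gram W.γ i y) (W.bdrySign _
    (coordFrame R₀ i y)) e Wf Y (bdryMap φ i (0, y))) (funext fun m => funext fun l => ?_)
  have hmem : chartDomain R₀ i ∈ 𝓝 ((0 : ℝ), y) :=
    (isOpen_univ.prod (isOpen_extChartAt_target i)).mem_nhds ⟨Set.mem_univ _, hy⟩
  have h1 := (((contMDiffAt_hat (c := bdryMap φ i) (x₀ := bdryMap φ i (0, y))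
    (mem_triv F V _)).1
    ((hφ.contMDiffOn_gaugeComp i l).contMDiffAt hmem)).2).contDiffAt.differentiableAt infty_ne_zero
  have h2 := (h1.hasFDerivAt.comp y (hasFDerivAt_prodMk_right (𝕜 := ℝ) (0 : ℝ) y)).fderiv
  refine congrArg (unhat F V _ _) (congrArg (· - dhat (Y l) (bdryMap φ i (0, y)) (Wf m _)) ?_)
  exact (congrArg (fun T : E₀ →L[ℝ] F => T (single m 1)) h2).symm

/-- Two gauge variations of the same fields whose parameters are proportional at a point have
proportional remainders there. -/
lemma residue_eq_mul (h : IsGaugeVariation L cov φ ε) (h' : IsGaugeVariation L cov φ' ε')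
    (hφ : IsSmoothPath I F φ) (hφ' : IsSmoothPath I F φ')
    (hε : IsSmoothParam I F φ ε)
    (hε' : IsSmoothParam I F φ' ε')
    (hn : n ≠ 0) (h0 : φ' 0 = φ 0) {i : S} {y : E₀} (hy : y ∈ (χ i).target)
    (e : ΓE) (r : ℝ) (he : e _ = ε (W.incl ((χ i).symm y)))
    (he' : r • e _ = ε' (W.incl ((χ i).symm y))) :
    residue L g μtop μt H φ' ε' i y = r * residue L g μtop μt H φ ε i y := by
  choose Wf hWf using fun l => exists_section_eq (I := I) (F := EM)
    (fieldHom I (φ 0) _ (coordFrame R₀ i y l)).1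
  choose Y hY using fun l => exists_section_eq (I := I) (F := F)
    (fieldHom I (φ 0) _ (coordFrame R₀ i y l)).2
  have hWY : ∀ l, fieldHom I (φ 0) _ (coordFrame R₀ i y l) = (Wf l _, Y l _) :=
    fun l => Prod.ext (hWf l).symm (hY l).symm
  have hWY' : ∀ l, fieldHom I (φ' 0) _ (coordFrame R₀ i y l) = (Wf l _, Y l _) := by
    rw [h0]; exact hWY
  rw [h.residue_eq_boundaryObstruction g μtop μt H hφ hε hn hy e Wf Y he hWY,
    h'.residue_eq_boundaryObstruction g μtop μt H hφ' hε' hn hy (r • e) Wf Y he' hWY', h0]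
  have h1 := obstruction_smul L cov g μtop μt H (gram W.γ i y)
    (W.bdrySign _ (coordFrame R₀ i y)) r e Wf Y
    ((φ 0).X (W.incl ((χ i).symm y)))
  unfold boundaryObstruction
  exact h1 _

lemma IsDensity.eq_zero_of_coordFrame {D : ∀ s : S, (Fin n → TangentSpace R₀ s) → ℝ}
    (hD : IsDensity D) {s : S} (h : inFrame D s (χ s s) = 0)
    (b : Fin n → TangentSpace R₀ s) : D s b = 0 := by
  have hbasis : ∀ a, coordFrame R₀ s (χ s s) a =
      (single a (1 : ℝ) : E₀) := fun a => by
    have : IsManifold R₀ 1 S := .of_le (n := ∞) (by simp)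
    have h1 := mfderiv_extChartAt_comp_mfderivWithin_extChartAt_symm (I := R₀)
      (mem_extChartAt_target (I := R₀) s)
    have h2 : ∀ v : E₀, mfderiv R₀ 𝓘(ℝ, E₀) (χ s)
        ((χ s).symm (χ s s)) v = v := by
      rw [extChartAt_to_inv, mfderiv_extChartAt_self]
      exact fun _ => rfl
    exact (h2 _).symm.trans (congrArg (fun T : E₀ →L[ℝ] E₀ => T (single a 1)) h1)
  unfold inFrame at h
  rw [funext hbasis, extChartAt_to_inv] at h
  let b' : Fin n → E₀ := b
  have h3 := hD s (fun a => (single a (1 : ℝ) : E₀)) (Matrix.of fun i j => b' j i)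
  rw [h, mul_zero] at h3
  exact Eq.trans (congrArg (D s) (funext fun j => euclidean_eq_sum (b' j))) h3

lemma contDiff_indicator_of_isCompact {E : Type*} [NormedAddCommGroup E] [NormedSpace ℝ E]
    {U K : Set E} (hU : IsOpen U) (hK : IsCompact K) (hKU : K ⊆ U) {f : E → ℝ} {k : ℕ∞}
    (hf : ContDiffOn ℝ k f U) (h0 : ∀ z ∈ U, z ∉ K → f z = 0) :
    ContDiff ℝ k (U.indicator f) ∧ HasCompactSupport (U.indicator f) := by
  have hs : ∀ z ∉ K, U.indicator f z = 0 := fun z hz => by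
    by_cases hzU : z ∈ U
    · rw [Set.indicator_of_mem hzU, h0 z hzU hz]
    · exact Set.indicator_of_notMem hzU f
  refine ⟨contDiff_iff_contDiffAt.2 fun z => ?_, HasCompactSupport.intro hK hs⟩
  by_cases hz : z ∈ K
  · refine (hf.contDiffAt (hU.mem_nhds (hKU hz))).congr_of_eventuallyEq ?_
    filter_upwards [hU.mem_nhds (hKU hz)] with w hw using Set.indicator_of_mem hw f
  · refine (contDiffAt_const (c := (0 : ℝ))).congr_of_eventuallyEq ?_
    filter_upwards [hK.isClosed.isOpen_compl.mem_nhds hz] with w hw using hs w hw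

/-- The remainder vanishes if the action is stationary along enough gauge variations: the remainder
of the variation with parameter `f e` is `f` times that of the variation with parameter `e`, and its
integral vanishes for all cutoff functions `f`. -/
lemma residue_eq_zero_of_gaugeInvariant (hinv : GaugeInvariant W L cov g H μtop μt)
    (hH : ∀ x, extD H.toFun x = 0) (hn : n ≠ 0) (ψ : Fields W V) (e : ΓE)
    (hpath : ∀ f : Ξ → ℝ, ContMDiff R₁ 𝓘(ℝ, ℝ) ∞ f → ∃ φ : ℝ → Fields W V,
      IsSmoothPath I F φ ∧ φ 0 = ψ ∧
      ContMDiff R₁ (I.prod 𝓘(ℝ, F)) ∞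
        (fun ξ => TotalSpace.mk' F ((φ 0).X ξ) (f ξ • e ((φ 0).X ξ))) ∧
      IsGaugeVariation L cov φ (fun ξ => f ξ • e ((φ 0).X ξ)))
    {i : S} {y : E₀} (hy : y ∈ (χ i).target)
    (Wf : Fin n → ΓT) (Y : Fin n → ΓE)
    (hWY : ∀ l, fieldHom I ψ _ (coordFrame R₀ i y l) = (Wf l _, Y l _)) :
    boundaryObstruction L cov g μtop μt H i y e Wf Y ψ = 0 := by
  obtain ⟨φ, hφ, rfl, hε, h⟩ := hpath (fun _ => 1) contMDiff_const
  set R := residue L g μtop μt H φ (fun ξ => (1 : ℝ) • e ((φ 0).X ξ)) i with hR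
  rw [← h.residue_eq_boundaryObstruction g μtop μt H hφ hε hn hy e Wf Y (one_smul ℝ _).symm hWY]
  change R y = 0
  by_contra hne
  have hRc : ContinuousOn R (χ i).target :=
    h.continuousOn_residue g μtop μt H hφ hε i
  have hto := isOpen_extChartAt_target (I := R₀) i
  -- a neighbourhood of `y` on which the remainder has a constant sign
  set s₀ := (χ i).symm y with hs₀
  have hs₀i : s₀ ∈ (χ i).source := (χ i).map_target hy
  have hU : ∀ᶠ s in 𝓝 s₀, s ∈ (χ i).source ∧ 0 < R (χ i s) * R y := by
    refine (show ∀ᶠ s in 𝓝 s₀, s ∈ (χ i).source from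
      (isOpen_extChartAt_source i).mem_nhds hs₀i).and ?_
    have h1 : ContinuousAt (fun s => R (χ i s) * R y) s₀ := by
      refine ContinuousAt.mul ?_ continuousAt_const
      refine ContinuousAt.comp' ?_ (continuousAt_extChartAt' hs₀i)
      rw [hs₀, (χ i).right_inv hy]
      exact hRc.continuousAt (hto.mem_nhds hy)
    refine h1.eventually (lt_mem_nhds ?_)
    change 0 < R (χ i s₀) * R y
    rw [hs₀, (χ i).right_inv hy]
    exact mul_self_pos.2 hne
  rw [W.incl_embedding.isEmbedding.nhds_eq_comap] at hU
  obtain ⟨N, hN, hNU⟩ := Filter.mem_comap.1 hU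
  obtain ⟨f, hf, hf1, hfN, hf01⟩ := exists_bump (I := R₁) hN
  obtain ⟨φ', hφ', h0, hε', h'⟩ := hpath f hf
  have hmul : ∀ j : S, ∀ z ∈ (χ j).target,
      residue L g μtop μt H φ' (fun ξ => f ξ • e ((φ' 0).X ξ)) j z =
        f (W.incl ((χ j).symm z)) *
          residue L g μtop μt H φ (fun ξ => (1 : ℝ) • e ((φ 0).X ξ)) j z := fun j z hz =>
    residue_eq_mul g μtop μt H h h' hφ hφ' hε hε' hn h0 hz e _ (one_smul ℝ _).symm rfl
  -- the compact set of boundary points where the variation is supported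
  set K : Set S := W.incl ⁻¹' tsupport f with hK
  have hic : Continuous W.incl := W.incl_embedding.isEmbedding.continuous
  have hKc : IsCompact K := ((isClosed_tsupport f).preimage hic).isCompact
  have hKU : ∀ s ∈ K, s ∈ (χ i).source ∧ 0 < R (χ i s) * R y :=
    fun s hs => hNU (hfN hs)
  have hKt : IsCompact (χ i '' K) := hKc.image_of_continuousOn
    ((continuousOn_extChartAt i).mono fun s hs => (hKU s hs).1)
  have hKT : χ i '' K ⊆ (χ i).target := by
    rintro _ ⟨s, hs, rfl⟩
    exact (χ i).map_source (hKU s hs).1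
  have hnot : ∀ s ∉ K, f (W.incl s) = 0 := fun s hs => image_eq_zero_of_notMem_tsupport hs
  set Jf : S → Fin n → E₀ → ℝ := fun j m => inFrame
    (fun s => gaugeCurrent L μtop μt (φ' 0) (fun ξ => f ξ • e ((φ' 0).X ξ)) s m) j with hJf
  have hJ0 : ∀ j m z, (χ j).symm z ∉ K → Jf j m z = 0 := fun j m z hz => by
    have hz0 : f (W.incl ((χ j).symm z)) •
        e ((φ' 0).X (W.incl ((χ j).symm z))) = 0 := by rw [hnot _ hz, zero_smul]
    simp only [hJf, inFrame, gaugeCurrent, hz0, map_zero]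
    rw [(lagrangian μtop μt _).map_update_zero, mul_zero]
  have hev : ∀ j : S, ∀ z ∈ (χ j).target, (χ j).symm z ∉ K →
      ∀ᶠ z' in 𝓝 z, (χ j).symm z' ∉ K := fun j z hz hzK =>
    (((continuousOn_extChartAt_symm j).continuousAt
      ((isOpen_extChartAt_target j).mem_nhds hz)).eventually (hKc.isClosed.isOpen_compl.mem_nhds hzK))
  set D := variationDensity L g μtop μt H φ' (fun ξ => f ξ • e ((φ' 0).X ξ)) with hD
  have hDd : IsDensity D := isDensity_variationDensity g μtop μt H
  have hint : integralDensity R₀ D = 0 :=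
    (h'.hasDerivAt_action g μtop μt H hφ' hH).unique (hinv φ' hφ' _ hε' h')
  have hDf : ∀ (j : S) (z : E₀), inFrame D j z =
      residue L g μtop μt H φ' (fun ξ => f ξ • e ((φ' 0).X ξ)) j z +
      ∑ m, fderiv ℝ (Jf j m) z (single m 1) := fun j z => by
    refine (inFrame_variationDensity g μtop μt H j z).trans ?_
    rw [(R₀).range_eq_univ]
    simp only [fderivWithin_univ, hJf]
  have hDz : ∀ j : S, ∀ z ∈ (χ j).target, (χ j).symm z ∉ K →
      inFrame D j z = 0 := fun j z hz hzK => by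
    rw [hDf, hmul j z hz, hnot _ hzK, zero_mul, zero_add]
    refine sum_eq_zero fun m _ => ?_
    have : Jf j m =ᶠ[𝓝 z] fun _ => 0 := (hev j z hz hzK).mono fun z' hz' => hJ0 j m z' hz'
    rw [this.fderiv_eq]
    simp
  have hD0 : ∀ s ∉ (chartAt E₀ i).source, ∀ b, D s b = 0 := fun s hs b => by
    refine hDd.eq_zero_of_coordFrame (hDz s _ (mem_extChartAt_target s) ?_) b
    rw [extChartAt_to_inv]
    intro hsK
    exact hs (by have := (hKU s hsK).1; rwa [extChartAt_source] at this)
  set T := (χ i).target with hT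
  have hTK : ∀ z ∈ T, z ∉ χ i '' K → (χ i).symm z ∉ K :=
    fun z hz hzK hK => hzK ⟨_, hK, (χ i).right_inv hz⟩
  have hG := fun m => contDiff_indicator_of_isCompact (k := 1) hto hKt hKT
    (contDiffOn_gaugeCurrent μtop μt h' hφ' hε' i m) fun z hz hzK => hJ0 i m z (hTK z hz hzK)
  have hfc : ContinuousOn (fun z => f (W.incl ((χ i).symm z)) * R z) T :=
    (hf.continuous.comp hic |>.comp_continuousOn (continuousOn_extChartAt_symm i)).mul hRc
  obtain ⟨hfR, hfRc⟩ := contDiff_indicator_of_isCompact (k := 0) hto hKt hKT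
    (contDiffOn_zero.2 hfc) fun z hz hzK => by rw [hnot _ (hTK z hz hzK), zero_mul]
  have hfR := contDiff_zero.1 hfR
  have hind : ∀ z ∈ T, inFrame D i z =
      T.indicator (fun z => f (W.incl ((χ i).symm z)) * R z) z +
      ∑ m, fderiv ℝ (T.indicator (Jf i m)) z (single m 1) := fun z hz => by
    rw [hDf, hmul i z hz, Set.indicator_of_mem hz]
    refine congrArg₂ (· + ·) rfl (sum_congr rfl fun m _ => ?_)
    have : T.indicator (Jf i m) =ᶠ[𝓝 z] Jf i m :=
      Filter.mem_of_superset (hto.mem_nhds hz) fun w hw => Set.indicator_of_mem hw _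
    rw [this.fderiv_eq]
  have hI1 := hfR.integrable_of_hasCompactSupport (μ := volume) hfRc
  have hI2 : ∀ m, Integrable (fun z => fderiv ℝ (T.indicator (Jf i m)) z
      (single m 1)) := fun m =>
    (((hG m).1.continuous_fderiv one_ne_zero).clm_apply
      continuous_const).integrable_of_hasCompactSupport ((hG m).2.fderiv_apply ℝ _)
  have hIs := integrable_finsetSum Finset.univ fun m _ => hI2 m
  have hzero : ∀ z ∉ T, T.indicator (fun z => f (W.incl ((χ i).symm z)) * R z) z +
      ∑ m, fderiv ℝ (T.indicator (Jf i m)) z (single m 1) = 0 := fun z hz => by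
    rw [Set.indicator_of_notMem hz, zero_add]
    refine sum_eq_zero fun m _ => ?_
    have : T.indicator (Jf i m) =ᶠ[𝓝 z] fun _ => 0 := by
      filter_upwards [hKt.isClosed.isOpen_compl.mem_nhds fun hzK => hz (hKT hzK)] with w hw
      by_cases hwT : w ∈ T
      · rw [Set.indicator_of_mem hwT, hJ0 i m w (hTK w hwT hw)]
      · exact Set.indicator_of_notMem hwT _
    rw [this.fderiv_eq]
    simp
  have hon : IntegrableOn (fun z => D ((χ i).symm z) (coordFrame R₀ i z)) T :=
    (hI1.add hIs).integrableOn.congr_fun (fun z hz => (hind z hz).symm) hto.measurableSet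
  have hfinal : 0 = ∫ z in T, inFrame D i z := hint.symm.trans (hDd.integralDensity_eq i hD0 hon).2
  rw [setIntegral_congr_fun hto.measurableSet hind,
    setIntegral_eq_integral_of_forall_compl_eq_zero hzero, integral_add hI1 hIs,
    integral_finsetSum _ fun m _ => hI2 m, sum_eq_zero fun m _ =>
      integral_fderiv_eq_zero volume (hG m).1 (hG m).2 _, add_zero] at hfinal
  have hpos := Continuous.integral_pos_of_hasCompactSupport_nonneg_nonzero (μ := volume) (x := y)
    (f := fun z => T.indicator (fun z => f (W.incl ((χ i).symm z)) * R z) z * R y)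
    (hfR.mul continuous_const) hfRc.mul_right (fun z => ?_) ?_
  · rw [integral_mul_const, ← hfinal, zero_mul] at hpos
    exact lt_irrefl _ hpos
  · change 0 ≤ T.indicator (fun z => f (W.incl ((χ i).symm z)) * R z) z * R y
    by_cases hz : z ∈ T
    · rw [Set.indicator_of_mem hz]
      by_cases hzK : (χ i).symm z ∈ K
      · have h2 := (hKU _ hzK).2
        rw [(χ i).right_inv hz] at h2
        rw [mul_assoc]
        exact mul_nonneg (hf01 _).1 h2.le
      · rw [hnot _ hzK, zero_mul, zero_mul]
    · rw [Set.indicator_of_notMem hz, zero_mul]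
  · rw [Set.indicator_of_mem hy, show f (W.incl ((χ i).symm y)) = 1 from
      hf1.self_of_nhds, one_mul]
    exact mul_self_ne_zero.2 hne

end Localization

variable {L cov μtop μt} in
/-- The structure equations imply gauge invariance: the remainder vanishes identically. -/
lemma gaugeInvariant_of_conditions (H : DForm I M (n + 1)) (hn : n ≠ 0)
    (hH : ∀ x, extD H.toFun x = 0) (h1 : MetricInvariant L cov g)
    (h2 : IsHomotopyMomentumSection L cov (modifiedForm H μtop) (rescaled μt))
    (h3 : AlgebraicRelation L (rescaled μt)) : GaugeInvariant W L cov g H μtop μt := by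
  intro φ hφ ε hε h
  have h' := h.hasDerivAt_action g μtop μt H hφ hH
  rwa [h.integralDensity_eq_zero g μtop μt H hφ hn hε fun i y hy => ?_] at h'
  obtain ⟨e, he⟩ := exists_section_eq (I := I) (F := F) (ε (W.incl ((χ i).symm y)))
  choose Wf hWf using fun l => exists_section_eq (I := I) (F := EM)
    (fieldHom I (φ 0) _ (coordFrame R₀ i y l)).1
  choose Y hY using fun l => exists_section_eq (I := I) (F := F)
    (fieldHom I (φ 0) _ (coordFrame R₀ i y l)).2
  rw [h.residue_eq_boundaryObstruction g μtop μt H hφ hε hn hy e Wf Y he fun l =>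
    Prod.ext (hWf l).symm (hY l).symm]
  obtain ⟨k, rfl⟩ := Nat.exists_eq_succ_of_ne_zero hn
  exact obstruction_eq_zero g h1 h2 h3 _ _ _ _ _ _ _

/-! ### Construction of gauge variations -/

section GaugePath

/-- A smooth map of a vector space into a small ball which is the identity near the origin. -/
lemma exists_squash (E : Type*) [NormedAddCommGroup E] [NormedSpace ℝ E] [FiniteDimensional ℝ E]
    {r : ℝ} (hr : 0 < r) : ∃ q : E → E, ContDiff ℝ ∞ q ∧ (∀ v, ‖q v‖ < r) ∧ q =ᶠ[𝓝 0] id := by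
  let b : ContDiffBump (0 : E) := ⟨r / 2, r, by positivity, by linarith⟩
  refine ⟨fun v => b v • v, b.contDiff.smul contDiff_id, fun v => ?_, ?_⟩
  · change ‖b v • v‖ < r
    by_cases hv : ‖v‖ < r
    · rw [norm_smul, Real.norm_of_nonneg b.nonneg]
      exact (mul_le_of_le_one_left (norm_nonneg v) b.le_one).trans_lt hv
    · have : b v = 0 := b.zero_of_le_dist (by rw [dist_zero_right]; exact not_lt.1 hv)
      rw [this, zero_smul, norm_zero]
      exact hr
  · exact b.eventuallyEq_one.mono fun v hv => by
      change b v • v = v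
      rw [hv]
      exact one_smul ℝ v

variable [CovariantDerivative.ContMDiffCovariantDerivative cov ∞]

/-- A linear family of sections, evaluated along a map with smoothly varying parameters, is smooth. -/
lemma contMDiff_linear_family {P : Type*} [NormedAddCommGroup P] [NormedSpace ℝ P]
    [FiniteDimensional ℝ P] (Θ : P →ₗ[ℝ] ΓE)
    {E' : Type*} [NormedAddCommGroup E'] [NormedSpace ℝ E']
    {H' : Type*} [TopologicalSpace H'] {J : ModelWithCorners ℝ E' H'}
    {N : Type*} [TopologicalSpace N] [ChartedSpace H' N] {c : N → M} {κ : N → P}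
    (hc : ContMDiff J I ∞ c) (hκ : ContMDiff J 𝓘(ℝ, P) ∞ κ) :
    ContMDiff J (I.prod 𝓘(ℝ, F)) ∞ (fun y => TotalSpace.mk' F (c y) (Θ (κ y) (c y))) := by
  intro y
  have hx := mem_triv F V (c y)
  refine (contMDiffAt_hat (x₀ := c y) hx).2 ⟨hc y, ?_⟩
  let b := Module.finBasis ℝ P
  have h : ∀ y', hat F V (c y) (c y') (Θ (κ y') (c y')) =
      ∑ j, b.repr (κ y') j • hat F V (c y) (c y') (Θ (b j) (c y')) := fun y' => by
    conv_lhs => rw [← b.sum_repr (κ y'), map_sum]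
    refine (congrArg (hat F V (c y) (c y')) (?_ : _ =
      ∑ j, b.repr (κ y') j • Θ (b j) (c y'))).trans ((map_sum _ _ _).trans ?_)
    · change ContMDiffSection.coeAddHom I F ∞ V (∑ j, _) (c y') = _
      rw [map_sum, Finset.sum_apply]
      refine sum_congr rfl fun j _ => ?_
      rw [map_smul]
      rfl
    · exact sum_congr rfl fun j _ => map_smul _ _ _
  simp only [h]
  refine ContMDiffAt.sum fun j _ => ?_
  have h1 := ((LinearMap.toContinuousLinearMap (b.coord j)).contMDiff.comp hκ) y
  exact h1.smul ((contMDiffAt_section_hat (Θ (b j)) hx).comp y (hc y))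

lemma contMDiff_mvfderiv {E' : Type*} [NormedAddCommGroup E'] [NormedSpace ℝ E'] {v : S → E'}
    (hv : ContMDiff R₀ 𝓘(ℝ, E') ∞ v) :
    ContMDiff (R₀).tangent 𝓘(ℝ, E') ∞
      (fun z : TangentBundle R₀ S => mvfderiv R₀ v z.proj z.snd) :=
  (contMDiff_snd_tangentBundle_modelSpace E' 𝓘(ℝ, E')).comp
    (hv.contMDiff_tangentMap (m := ∞) (by simp))

/-- Evaluation of sections at a point. -/
def evalAt (x : M) : ΓE →ₗ[ℝ] V x where
  toFun σ := σ x
  map_add' _ _ := rfl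
  map_smul' _ _ := rfl

/-- The covariant derivative of a section along vector fields. -/
def covAlong (e : ΓE) : ΓT →ₗ[ℝ] ΓE where
  toFun v := ⟨fun x => cov (fun y => e y) x (v x), by
    have h1 := (CovariantDerivative.ContMDiffCovariantDerivative.contMDiff (cov := cov)
      (k := ∞)).contMDiff (σ := fun y => e y) (by simpa using e.contMDiff.contMDiffOn)
    exact ContMDiff.clm_bundle_apply (contMDiffOn_univ.1 h1) v.contMDiff⟩
  map_add' v w := ContMDiffSection.ext fun x => map_add (cov (fun y => e y) x) (v x) (w x)
  map_smul' r v := ContMDiffSection.ext fun x => map_smul (cov (fun y => e y) x) r (v x)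

/-- The anchor on sections, as a linear map. -/
def anchorHom : ΓE →ₗ[ℝ] ΓT where
  toFun σ := ρsec L σ
  map_add' σ τ := ContMDiffSection.ext fun x => map_add (L.anchor x) (σ x) (τ x)
  map_smul' r σ := ContMDiffSection.ext fun x => map_smul (L.anchor x) r (σ x)

variable (W) in
/-- The fields given by a map and a one-form on the boundary with values in sections of `E`. -/
def Fields.ofSections (X : Ξ → M) (Λ : ∀ s : S, TangentSpace R₀ s →ₗ[ℝ] ΓE) :
    Fields W V := ⟨X, fun s => evalAt (X (W.incl s)) ∘ₗ Λ s⟩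

/-- The one-form with values in sections of `E` given by the velocity of the gauge variation of `A`
with parameter `f e`; here `κ` are the coordinates of `dX` and `α` those of `A`. -/
def gaugeVelocity (e : ΓE) (x₀ : M) (f : S → ℝ) (s : S)
    (κ : TangentSpace R₀ s →ₗ[ℝ] EM) (α : TangentSpace R₀ s →ₗ[ℝ] F) :
    TangentSpace R₀ s →ₗ[ℝ] ΓE :=
  (mvfderiv R₀ f s).toLinearMap.smulRight e +
    f s • (covAlong cov e ∘ₗ locFrame I EM TM x₀ ∘ₗ κ -
      (covAlong cov e ∘ₗ anchorHom L + L.bracket e) ∘ₗ locFrame I F V x₀ ∘ₗ α)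

lemma gaugeEqAt_of_sections {X : ℝ → Ξ → M} {Λ Λ' : ∀ s : S, TangentSpace R₀ s →ₗ[ℝ]
      ΓE} (e : ΓE) {f : Ξ → ℝ} (hf : ContMDiff R₁ 𝓘(ℝ, ℝ) ∞ f)
    (hφ : IsSmoothPath I F fun t => Fields.ofSections W (X t) fun s => Λ s + t • Λ' s) (s : S)
    (u : TangentSpace R₀ s)
    (hX : mfderiv 𝓘(ℝ, ℝ) I (fun t : ℝ => X t (W.incl s)) 0 (1 : ℝ) =
      L.anchor _ (f (W.incl s) • e (X 0 (W.incl s))))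
    (h : Λ' s u (X 0 (W.incl s)) = mvfderiv R₀ (fun τ => f (W.incl τ)) s u • e _ +
      f (W.incl s) • (cov (fun y => e y) _ (mfderiv R₁ I (X 0) (W.incl s)
        (mfderiv R₀ R₁ W.incl s u) - L.anchor _ (Λ s u _)) - L.bracket e (Λ s u) _)) :
    GaugeEqAt L cov (fun t => Fields.ofSections W (X t) fun s => Λ s + t • Λ' s)
      (fun ξ => f ξ • e _) s u (f (W.incl s) • e) (Λ s u) := by
  set x := X 0 (W.incl s) with hx
  have hxV := mem_triv F V x
  have hXd : MDifferentiableAt 𝓘(ℝ, ℝ) I (fun t : ℝ => X t (W.incl s)) 0 :=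
    hφ.mdifferentiableAt_time (W.incl s)
  have hσ : ∀ σ : ΓE, HasDerivAt (fun t => hat F V x (X t (W.incl s)) (σ _))
      (dhat σ x (L.anchor _ (f (W.incl s) • e x))) 0 := fun σ => by
    rw [← hX]
    exact hasDerivAt_comp_curve (contMDiffAt_section_hat σ hxV) hXd
  have h1 : deriv (fun t => hat F V x (X t (W.incl s)) ((Λ s + t • Λ' s) u (X t (W.incl s)))) 0 =
      dhat (Λ s u) x (L.anchor _ (f (W.incl s) • e x)) + hat F V x x (Λ' s u x) := by
    have h2 := (hσ (Λ s u)).add ((hasDerivAt_id (0 : ℝ)).smul (hσ (Λ' s u)))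
    rw [id, zero_smul, one_smul, zero_add] at h2
    refine (h2.congr_of_eventuallyEq (Filter.Eventually.of_forall fun t => ?_)).deriv
    refine (map_add (hat F V x (X t (W.incl s))) (Λ s u _) (t • Λ' s u _)).trans ?_
    rw [map_smul]
    rfl
  have hXs : ContMDiff R₁ I ∞ (X 0) := contMDiff_slice hφ.bulk 0
  have h3 : mvfderiv R₀ (fun τ : S => hat F V x (X 0 (W.incl τ)) (f (W.incl τ) • e _)) s u =
      mvfderiv R₀ (fun τ => f (W.incl τ)) s u • hat F V x x (e x) +
      f (W.incl s) • dhat e x (mfderiv R₁ I (X 0) (W.incl s)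
        (mfderiv R₀ R₁ W.incl s u)) := by
    have ha : MDifferentiableAt R₀ 𝓘(ℝ, ℝ) (fun τ => f (W.incl τ)) s :=
      contMDiff_mdifferentiableAt (hf.comp W.incl_embedding.contMDiff s)
    have hXi : MDifferentiableAt R₀ I (fun τ => X 0 (W.incl τ)) s :=
      (hXs.comp W.incl_embedding.contMDiff s).mdifferentiableAt infty_ne_zero
    have hG : MDifferentiableAt I 𝓘(ℝ, F) (fun y => hat F V x y (e y)) x :=
      contMDiff_mdifferentiableAt (contMDiffAt_section_hat e hxV)
    have hg : MDifferentiableAt R₀ 𝓘(ℝ, F) (fun τ => hat F V x (X 0 (W.incl τ)) (e _)) s :=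
      hG.comp s hXi
    have h1 := (hG.hasMFDerivAt.comp s hXi.hasMFDerivAt).mfderiv
    have h2 : mfderiv R₀ I (fun τ => X 0 (W.incl τ)) s =
        (mfderiv R₁ I (X 0) (W.incl s)).comp (mfderiv R₀ R₁ W.incl s) :=
      (((hXs (W.incl s)).mdifferentiableAt infty_ne_zero).hasMFDerivAt.comp s
        (W.mdifferentiableAt_incl s).hasMFDerivAt).mfderiv
    rw [h2] at h1
    have h3 := congrArg (fun T : E₀ →L[ℝ] F => T u) (mvfderiv_fun_smul ha hg)
    simp only [map_smul]
    refine h3.trans ((add_comm _ _).trans (congrArg₂ (· + ·) rfl ?_))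
    exact congrArg (fun T : E₀ →L[ℝ] F => f (W.incl s) • T u) h1
  have h4 : dhat (f (W.incl s) • e) x = f (W.incl s) • dhat e x :=
    ContinuousLinearMap.ext fun v => dhat_smul _ e x v
  have h5 : cov (fun y => (f (W.incl s) • e) y) x = f (W.incl s) • cov (fun y => e y) x :=
    ContinuousLinearMap.ext fun v => covHom_smul cov _ e x v
  have h6 : L.bracket (f (W.incl s) • e) (Λ s u) x = f (W.incl s) • L.bracket e (Λ s u) x := by
    rw [map_smul]; rfl
  change unhat F V x x (deriv (fun t => hat F V x (X t (W.incl s))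
      ((Λ s + t • Λ' s) u (X t (W.incl s)))) 0 -
      dhat (Λ s u) x (L.anchor x (f (W.incl s) • e x))) -
    unhat F V x x (mvfderiv R₀ (fun τ : S => hat F V x (X 0 (W.incl τ))
      (f (W.incl τ) • e (X 0 (W.incl τ)))) s u - dhat (f (W.incl s) • e) x
        (mfderiv R₁ I (X 0) (W.incl s) (mfderiv R₀ R₁ W.incl s u))) =
    cov (fun y => (f (W.incl s) • e) y) x
      (mfderiv R₁ I (X 0) (W.incl s) (mfderiv R₀ R₁ W.incl s u) -
        L.anchor x (Λ s u x)) - L.bracket (f (W.incl s) • e) (Λ s u) x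
  rw [h1, h3, h4, h5, h6, add_sub_cancel_left, smul_apply, smul_apply, add_sub_cancel_right,
    map_smul, unhat_hat hxV, unhat_hat hxV, h, smul_sub]
  abel

/-- Given fields whose map takes values in a chart, every `f e`, for a section `e` of `E` and a
function `f` on the worldvolume, is the parameter of a gauge variation of these fields. -/
lemma exists_gaugeVariation (x₀ : M) {r : ℝ} (hr : 0 < r) {X : Ξ → M}
    (hX : ContMDiff R₁ I ∞ X)
    (hXs : ∀ ξ, X ξ ∈ (extChartAt I x₀).source ∧
      Metric.ball (extChartAt I x₀ (X ξ)) r ⊆ (extChartAt I x₀).target ∧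
      ∀ w, locFrame I EM TM x₀ w (X ξ) =
        unhat EM TM x₀ (X ξ) w)
    {α : ∀ s : S, TangentSpace R₀ s →ₗ[ℝ] F}
    (hα : ContMDiff (R₀).tangent 𝓘(ℝ, F) ∞
      (fun z : TangentBundle R₀ S => α z.proj z.snd))
    (e : ΓE) {f : Ξ → ℝ} (hf : ContMDiff R₁ 𝓘(ℝ, ℝ) ∞ f) :
    ∃ φ : ℝ → Fields W V, IsSmoothPath I F φ ∧
      φ 0 = Fields.ofSections W X (fun s => locFrame I F V x₀ ∘ₗ α s) ∧
      ContMDiff R₁ (I.prod 𝓘(ℝ, F)) ∞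
        (fun ξ => TotalSpace.mk' F ((φ 0).X ξ) (f ξ • e ((φ 0).X ξ))) ∧
      IsGaugeVariation L cov φ (fun ξ => f ξ • e ((φ 0).X ξ)) := by
  obtain ⟨q, hq, hqr, hq1⟩ := exists_squash EM hr
  have hq0 : q 0 = 0 := hq1.self_of_nhds
  set c := extChartAt I x₀ with hc
  have hcs : ∀ x ∈ c.source, ContMDiffAt I 𝓘(ℝ, EM) ∞ c x := fun x hx =>
    contMDiffAt_extChartAt' (by rwa [hc, extChartAt_source] at hx)
  have htr : ∀ ξ, X ξ ∈ triv EM TM x₀ := fun ξ => by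
    have := (hXs ξ).1
    rw [hc, extChartAt_source] at this
    exact this
  let ρX : Ξ → EM := fun ξ => hat EM TM x₀ (X ξ) (ρsec L e (X ξ))
  have hρX : ContMDiff R₁ 𝓘(ℝ, EM) ∞ ρX := fun ξ =>
    (contMDiffAt_section_hat (ρsec L e) (htr ξ)).comp ξ (hX ξ)
  let Z : ℝ × Ξ → EM := fun p => c (X p.2) + q (p.1 • f p.2 • ρX p.2)
  have hZ : ContMDiff (𝓘(ℝ, ℝ).prod R₁) 𝓘(ℝ, EM) ∞ Z := by
    have h1 : ContMDiff R₁ 𝓘(ℝ, EM) ∞ fun ξ => c (X ξ) := fun ξ =>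
      (hcs _ (hXs ξ).1).comp ξ (hX ξ)
    exact (h1.comp contMDiff_snd).add (hq.contMDiff.comp
      (contMDiff_fst.smul ((hf.smul hρX).comp contMDiff_snd)))
  have hZt : ∀ p, Z p ∈ c.target := fun p => (hXs p.2).2.1 (by
    rw [Metric.mem_ball, dist_eq_norm, add_sub_cancel_left]
    exact hqr _)
  let Xt : ℝ → Ξ → M := fun t ξ => c.symm (Z (t, ξ))
  have hXt : ContMDiff (𝓘(ℝ, ℝ).prod R₁) I ∞ fun p : ℝ × Ξ => Xt p.1 p.2 :=
    (contMDiffOn_extChartAt_symm x₀).comp_contMDiff hZ hZt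
  have hX0 : Xt 0 = X := funext fun ξ => by
    change c.symm (c (X ξ) + q ((0 : ℝ) • f ξ • ρX ξ)) = X ξ
    rw [zero_smul, hq0, add_zero]
    exact c.left_inv (hXs ξ).1
  have hvel : ∀ ξ, mfderiv 𝓘(ℝ, ℝ) I (fun t : ℝ => Xt t ξ) 0 (1 : ℝ) =
      L.anchor _ (f ξ • e (Xt 0 ξ)) := fun ξ => by
    have hs : Xt 0 ξ ∈ c.source := by rw [hX0]; exact (hXs ξ).1
    have hd : MDifferentiableAt 𝓘(ℝ, ℝ) I (fun t => Xt t ξ) 0 :=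
      (hXt.comp (contMDiff_id.prodMk (contMDiff_const (c := ξ))) 0).mdifferentiableAt infty_ne_zero
    refine (isInvertible_mfderiv_extChartAt hs).injective ?_
    have h1 := (hasDerivAt_comp_curve (hcs _ hs) hd).deriv
    have h2 : (fun t => c (Xt t ξ)) =ᶠ[𝓝 0] fun t => c (X ξ) + t • f ξ • ρX ξ := by
      have h3 : Filter.Tendsto (fun t : ℝ => t • f ξ • ρX ξ) (𝓝 0) (𝓝 0) := by
        have : Continuous fun t : ℝ => t • f ξ • ρX ξ := by fun_prop
        simpa using this.tendsto 0
      filter_upwards [h3.eventually hq1] with t ht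
      exact (c.right_inv (hZt (t, ξ))).trans (congrArg (c (X ξ) + ·) ht)
    have h4 : HasDerivAt (fun t : ℝ => c (X ξ) + t • f ξ • ρX ξ) (f ξ • ρX ξ) 0 := by
      have := ((hasDerivAt_id (0 : ℝ)).smul_const (f ξ • ρX ξ)).const_add (c (X ξ))
      rwa [one_smul] at this
    rw [h2.deriv_eq, h4.deriv] at h1
    refine h1.symm.trans ?_
    have h5 : ∀ x, x ∈ (chartAt HM x₀).source → hat EM TM x₀ x
        (L.anchor x (f ξ • e x)) = mfderiv I 𝓘(ℝ, EM) c x (L.anchor x (f ξ • e x)) := fun x hx => by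
      rw [hat_tangent hx]
      rfl
    refine Eq.trans ?_ (h5 _ (by rwa [hc, extChartAt_source] at hs))
    rw [hX0, map_smul, map_smul]
    rfl
  let κ : ∀ s : S, TangentSpace R₀ s →ₗ[ℝ] EM := fun s =>
    (hat EM TM x₀ (X (W.incl s))).toLinearMap ∘ₗ
      (mfderiv R₀ I (fun τ => X (W.incl τ)) s).toLinearMap
  have hXi : ContMDiff R₀ I ∞ fun τ => X (W.incl τ) := hX.comp W.incl_embedding.contMDiff
  have hκ : ContMDiff (R₀).tangent 𝓘(ℝ, EM) ∞
      (fun z : TangentBundle R₀ S => κ z.proj z.snd) := fun z =>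
    ((contMDiffAt_hat (V := TM)
      (c := fun z : TangentBundle R₀ S => X (W.incl z.proj)) (htr _)).1
      (hXi.contMDiff_tangentMap (m := ∞) (by simp) z)).2
  let Λ' : ∀ s : S, TangentSpace R₀ s →ₗ[ℝ] ΓE := fun s =>
    gaugeVelocity L cov e x₀ (fun τ => f (W.incl τ)) s (κ s) (α s)
  have hfi : ContMDiff R₀ 𝓘(ℝ, ℝ) ∞ fun τ => f (W.incl τ) := hf.comp W.incl_embedding.contMDiff
  let φ : ℝ → Fields W V := fun t => Fields.ofSections W (Xt t)
    fun s => locFrame I F V x₀ ∘ₗ α s + t • Λ' s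
  have hφ : IsSmoothPath I F φ := by
    refine ⟨hXt, ?_⟩
    let Θ : F × ℝ × EM × F →ₗ[ℝ] ΓE :=
      (locFrame I F V x₀).coprod ((LinearMap.toSpanSingleton ℝ _ e).coprod
        ((covAlong cov e ∘ₗ locFrame I EM TM x₀).coprod
          (-((covAlong cov e ∘ₗ anchorHom L + L.bracket e) ∘ₗ locFrame I F V x₀))))
    have hpr : ContMDiff (R₀).tangent R₀ ∞ fun z : TangentBundle R₀ S => z.proj :=
      contMDiff_proj _
    have hbase : ContMDiff (𝓘(ℝ, ℝ).prod (R₀).tangent) I ∞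
        fun z : ℝ × TangentBundle R₀ S => Xt z.1 (W.incl z.2.proj) :=
      hXt.comp (contMDiff_fst.prodMk
        ((W.incl_embedding.contMDiff.comp hpr).comp contMDiff_snd))
    have ht : ContMDiff (𝓘(ℝ, ℝ).prod (R₀).tangent) 𝓘(ℝ, ℝ) ∞
        fun z : ℝ × TangentBundle R₀ S => z.1 := contMDiff_fst
    have htf := ht.mul ((hfi.comp hpr).comp (contMDiff_snd (I := 𝓘(ℝ, ℝ)) (M := ℝ)))
    have h := contMDiff_linear_family Θ hbase ((hα.comp contMDiff_snd).prodMk_space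
      ((ht.mul ((contMDiff_mvfderiv hfi).comp contMDiff_snd)).prodMk_space
      ((htf.smul (hκ.comp contMDiff_snd)).prodMk_space (htf.smul (hα.comp contMDiff_snd)))))
    refine h.congr fun z => congrArg (TotalSpace.mk' F _) ?_
    change (locFrame I F V x₀ (α z.2.proj z.2.snd) + z.1 • Λ' z.2.proj z.2.snd) _ =
      Θ (α z.2.proj z.2.snd, z.1 * mvfderiv R₀ (fun τ => f (W.incl τ)) z.2.proj z.2.snd,
        (z.1 * f (W.incl z.2.proj)) • κ z.2.proj z.2.snd,
        (z.1 * f (W.incl z.2.proj)) • α z.2.proj z.2.snd) _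
    refine congrArg (fun σ : ΓE => σ (Xt z.1 (W.incl z.2.proj))) ?_
    have h1 : ∀ a b c d : ΓE, ∀ t r p : ℝ, a + t • (p • b + r • (c - d)) =
        a + ((t * p) • b + ((t * r) • c + (t * r) • -d)) := fun a b c d t r p => by module
    refine (h1 _ _ _ _ z.1 (f (W.incl z.2.proj)) (mvfderiv R₀ (fun τ => f (W.incl τ)) z.2.proj
      z.2.snd)).trans ?_
    simp only [Θ, LinearMap.coprod_apply, map_smul]
    rfl
  have h0 : ∀ s, locFrame I F V x₀ ∘ₗ α s + (0 : ℝ) • Λ' s = locFrame I F V x₀ ∘ₗ α s :=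
    fun s => by rw [zero_smul, add_zero]
  have hε : ContMDiff R₁ (I.prod 𝓘(ℝ, F)) ∞
      (fun ξ => TotalSpace.mk' F ((φ 0).X ξ) (f ξ • e ((φ 0).X ξ))) :=
    contMDiff_linear_family (LinearMap.toSpanSingleton ℝ _ e) (contMDiff_slice hφ.bulk 0) hf
  refine ⟨φ, hφ, ?_, hε, isGaugeVariation_of_gaugeEqAt hφ hε hvel fun s u =>
    ⟨f (W.incl s) • e, locFrame I F V x₀ (α s u), rfl, ?_, ?_⟩⟩
  · change Fields.ofSections W (Xt 0) _ = _
    rw [hX0, funext h0]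
  · change _ = ((locFrame I F V x₀ ∘ₗ α s + (0 : ℝ) • Λ' s) u) (Xt 0 (W.incl s))
    rw [h0]
    rfl
  · have hB : ∀ X' : Ξ → M, X = X' → Λ' s u (X' (W.incl s)) =
        mvfderiv R₀ (fun τ => f (W.incl τ)) s u • e (X' (W.incl s)) + f (W.incl s) •
        (cov (fun y => e y) (X' (W.incl s)) (mfderiv R₁ I X' (W.incl s)
          (mfderiv R₀ R₁ W.incl s u) - L.anchor _ (locFrame I F V x₀ (α s u) _)) -
          L.bracket e (locFrame I F V x₀ (α s u)) (X' (W.incl s))) := by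
      rintro _ rfl
      have h1 : locFrame I EM TM x₀ (κ s u) (X (W.incl s)) =
          mfderiv R₁ I X (W.incl s) (mfderiv R₀ R₁ W.incl s u) := by
        rw [(hXs _).2.2]
        refine (unhat_hat (htr _) _).trans ?_
        have h2 := (((hX (W.incl s)).mdifferentiableAt infty_ne_zero).hasMFDerivAt.comp s
          (W.mdifferentiableAt_incl s).hasMFDerivAt).mfderiv
        exact congrArg (fun T : E₀ →L[ℝ] EM => T u) h2
      rw [map_sub, ← h1, sub_sub]
      rfl
    exact gaugeEqAt_of_sections L cov (Λ := fun s => locFrame I F V x₀ ∘ₗ α s) e hf hφ s u (hvel _)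
      (hB _ hX0.symm)

end GaugePath

/-! ### Necessity of the structure equations -/

section Necessity

lemma exists_clm_single {G : Type*} [NormedAddCommGroup G] [NormedSpace ℝ G]
    (a : Fin n → G) :
    ∃ T : E₀ →L[ℝ] G, ∀ l, T (single l 1) = a l := by
  refine ⟨∑ l, (EuclideanSpace.proj l : E₀ →L[ℝ] ℝ).smulRight (a l),
    fun l => ?_⟩
  simp

variable [CovariantDerivative.ContMDiffCovariantDerivative cov ∞]

variable (W) in
/-- The coordinates of a boundary chart extend, to first order at a given point, to functions on the
worldvolume. -/
lemma exists_coordinate {i : S} {y : E₀} (hy : y ∈ (χ i).target) :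
    ∃ u : Ξ → E₀, ContMDiff R₁ 𝓘(ℝ, E₀) ∞ u ∧
      u (W.incl ((χ i).symm y)) = 0 ∧
      ∀ a, fderiv ℝ (fun z => u (W.incl ((χ i).symm z))) y
        (single a 1) = single a 1 := by
  set s := (χ i).symm y with hs
  set ξ := W.incl s with hξ
  have hξs : ξ ∈ (χ₁ ξ).source := mem_extChartAt_source ξ
  let T : E₀ →L[ℝ] E₊ := (mfderiv R₁ 𝓘(ℝ, E₊) (χ₁ ξ) ξ).comp
    ((mfderiv R₀ R₁ W.incl s).comp
      (mfderivWithin 𝓘(ℝ, E₀) R₀ (χ i).symm (Set.range R₀) y))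
  have hT : Function.Injective T := (isInvertible_mfderiv_extChartAt hξs).injective.comp
    ((mfderiv_injective_of_isImmersion W.incl_embedding.isImmersion s).comp
      (isInvertible_mfderivWithin_extChartAt_symm hy).injective)
  obtain ⟨P, hP⟩ := LinearMap.exists_leftInverse_of_injective T.toLinearMap
    (LinearMap.ker_eq_bot.2 hT)
  let P' : E₊ →L[ℝ] E₀ := LinearMap.toContinuousLinearMap P
  obtain ⟨ψ, -, -⟩ := (SmoothBumpFunction.nhds_basis_tsupport (I := R₁) ξ).mem_iff.1
    Filter.univ_mem
  have hext : ContMDiffOn R₁ 𝓘(ℝ, E₀) ∞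
      (fun ζ => P' (χ₁ ξ ζ - χ₁ ξ ξ))
      (κ₁ ξ).source :=
    P'.contMDiff.comp_contMDiffOn (contMDiffOn_extChartAt.sub contMDiffOn_const)
  refine ⟨_, ψ.contMDiff_smul hext, ?_, fun a => ?_⟩
  · change ψ ξ • P' (χ₁ ξ ξ - χ₁ ξ ξ) = 0
    rw [sub_self, map_zero, smul_zero]
  · have h1 : HasFDerivAt (fun z => χ₁ ξ
        (W.incl ((χ i).symm z))) T y := by
      have h2 := (mdifferentiableWithinAt_extChartAt_symm (I := R₀) hy).hasMFDerivWithinAt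
      rw [(R₀).range_eq_univ, hasMFDerivWithinAt_univ] at h2
      have h3 : MDifferentiableAt R₁ 𝓘(ℝ, E₊) (χ₁ ξ) ξ :=
        (contMDiffAt_extChartAt (n := ∞)).mdifferentiableAt infty_ne_zero
      have h4 := hasMFDerivAt_iff_hasFDerivAt.1
        (h3.hasMFDerivAt.comp y ((W.mdifferentiableAt_incl s).hasMFDerivAt.comp y h2))
      refine h4.congr_fderiv ?_
      simp only [T, (R₀).range_eq_univ]
      rfl
    have h5 : (fun z => ψ (W.incl ((χ i).symm z)) •
        P' (χ₁ ξ (W.incl ((χ i).symm z)) -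
          χ₁ ξ ξ)) =ᶠ[𝓝 y] fun z => P' (χ₁ ξ
        (W.incl ((χ i).symm z)) - χ₁ ξ ξ) := by
      have hcont : ContinuousAt (fun z => W.incl ((χ i).symm z)) y :=
        W.incl_embedding.isEmbedding.continuous.continuousAt.comp
          ((continuousOn_extChartAt_symm i).continuousAt ((isOpen_extChartAt_target i).mem_nhds hy))
      filter_upwards [hcont.eventually ψ.eventuallyEq_one] with z hz
      rw [hz]
      exact one_smul ℝ _
    rw [h5.fderiv_eq]
    refine (congrArg (fun T : E₀ →L[ℝ] E₀ => T (single a 1))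
      (P'.hasFDerivAt.comp y (h1.sub_const _)).fderiv).trans ?_
    exact congrArg (fun T : E₀ →ₗ[ℝ] E₀ => T (single a 1)) hP

lemma boundaryObstruction_eq (g : ContMDiffRiemannianMetric I ∞ EM (fun x : M => TangentSpace I x))
    (μtop : DForm I M n) (μt : Cochain I M F V n) (H : DForm I M (n + 1)) {i : S} {y : E₀}
    (e : ΓE) (Wf : Fin n → ΓT) (Y : Fin n → ΓE)
    {ψ : Fields W V} {x : M} (hx : ψ.X (W.incl ((χ i).symm y)) = x)
    {D : Fin n → Fin n → F}
    (hD : ∀ m l, fderiv ℝ (fun z => hat F V x (ψ.X (W.incl ((χ i).symm z)))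
      (ψ.A ((χ i).symm z) (coordFrame R₀ i z l))) y
        (single m 1) = D m l) :
    boundaryObstruction L cov g μtop μt H i y e Wf Y ψ =
      obstruction L cov g μtop μt H (gram W.γ i y) (W.bdrySign _ (coordFrame R₀ i y)) e Wf Y x
        (fun m l => unhat F V x x (D m l - dhat (Y l) x (Wf m x))) := by
  subst hx
  unfold boundaryObstruction
  simp only [hD]

/-- If the action is gauge invariant, then the obstruction vanishes for arbitrary values of the
fields and of their first derivatives at a point. -/
lemma obstruction_eq_zero_of_gaugeInvariant
    (g : ContMDiffRiemannianMetric I ∞ EM (fun x : M => TangentSpace I x))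
    (μtop : DForm I M n) (μt : Cochain I M F V n) (H : DForm I M (n + 1))
    (hinv : GaugeInvariant W L cov g H μtop μt)
    (hH : ∀ x, extD H.toFun x = 0) (hn : n ≠ 0) {i : S} {y : E₀}
    (hy : y ∈ (χ i).target)
    (e : ΓE) (Wf : Fin n → ΓT) (Y : Fin n → ΓE) (x₀ : M) :
    ∃ r : Fin n → Fin n → V x₀, ∀ β, obstruction L cov g μtop μt H (gram W.γ i y)
      (W.bdrySign _ (coordFrame R₀ i y)) e Wf Y x₀ (r + β) = 0 := by
  set c := extChartAt I x₀ with hc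
  have hcx : x₀ ∈ c.source := mem_extChartAt_source x₀
  -- a ball in the chart at `x₀` over which the preferred local frames are defined
  have hball : {z | z ∈ c.target ∧ ((∀ w, locFrame I EM TM x₀ w
        (c.symm z) = unhat EM TM x₀ (c.symm z) w) ∧
      (c.symm z ∈ triv F V x₀ ∧ ∀ w, locFrame I F V x₀ w (c.symm z) = unhat F V x₀ (c.symm z) w))}
      ∈ 𝓝 (c x₀) := by
    have h1 : ContinuousAt c.symm (c x₀) := continuousAt_extChartAt_symm x₀
    have h2 : c.symm (c x₀) = x₀ := c.left_inv hcx
    have h3 := ((eventually_locFrame I EM TM x₀).mono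
      fun _ h => h.2).and (eventually_locFrame I F V x₀)
    refine (show ∀ᶠ z in 𝓝 (c x₀), z ∈ c.target from
      extChartAt_target_mem_nhds (I := I) x₀).and ?_
    exact h1.eventually (by rw [h2]; exact h3)
  obtain ⟨R, hR, hRb⟩ := Metric.mem_nhds_iff.1 hball
  obtain ⟨q, hq, hqr, hq1⟩ := exists_squash EM (half_pos hR)
  have hq0 : q 0 = 0 := hq1.self_of_nhds
  obtain ⟨u, hu, hu0, hud⟩ := exists_coordinate W hy
  obtain ⟨A, hA⟩ := exists_clm_single fun l => (mvfderiv I c x₀ (Wf l x₀) : EM)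
  obtain ⟨Λ, hΛ⟩ := exists_clm_single fun l => hat F V x₀ x₀ (Y l x₀)
  set ν : E₀ → E₀ := fun z => u (W.incl ((χ i).symm z)) with hν
  have hto := isOpen_extChartAt_target (I := R₀) i
  have hui : ContMDiff R₀ 𝓘(ℝ, E₀) ∞ fun τ => u (W.incl τ) := hu.comp W.incl_embedding.contMDiff
  have hνs : ContDiffOn ℝ ∞ ν (χ i).target :=
    (hui.comp_contMDiffOn (contMDiffOn_extChartAt_symm i)).contDiffOn
  have hνy := hνs.contDiffAt (hto.mem_nhds hy)
  have hνd : DifferentiableAt ℝ ν y := hνy.differentiableAt infty_ne_zero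
  have hν0 : ν y = 0 := hu0
  let X : Ξ → M := fun ξ => c.symm (c x₀ + q (A (u ξ)))
  have hZ : ∀ ξ, c x₀ + q (A (u ξ)) ∈ Metric.ball (c x₀) (R / 2) := fun ξ => by
    rw [Metric.mem_ball, dist_eq_norm, add_sub_cancel_left]
    exact hqr _
  have hZ' := fun ξ => hRb (Metric.ball_subset_ball (half_le_self hR.le) (hZ ξ))
  have hX : ContMDiff R₁ I ∞ X := (contMDiffOn_extChartAt_symm x₀).comp_contMDiff
    (contMDiff_const.add (hq.contMDiff.comp (A.contMDiff.comp hu))) fun ξ => (hZ' ξ).1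
  have hcX : ∀ ξ, c (X ξ) = c x₀ + q (A (u ξ)) := fun ξ => c.right_inv (hZ' ξ).1
  have hX0 : X (W.incl ((χ i).symm y)) = x₀ := by
    change c.symm (c x₀ + q (A (u _))) = x₀
    rw [hu0, map_zero, hq0, add_zero]
    exact c.left_inv hcx
  have hXs : ∀ ξ, X ξ ∈ c.source ∧ Metric.ball (c (X ξ)) (R / 2) ⊆ c.target ∧
      ∀ w, locFrame I EM TM x₀ w (X ξ) =
        unhat EM TM x₀ (X ξ) w := fun ξ => by
    refine ⟨c.map_target (hZ' ξ).1, fun z hz => (hRb ?_).1, (hZ' ξ).2.1⟩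
    rw [hcX] at hz
    refine Metric.mem_ball.2 ((dist_triangle z (c x₀ + q (A (u ξ))) (c x₀)).trans_lt ?_)
    linarith [Metric.mem_ball.1 hz, Metric.mem_ball.1 (hZ ξ)]
  refine ⟨fun m l => unhat F V x₀ x₀ (fderiv ℝ (fun z => Λ (fderiv ℝ ν z
    (single l 1))) y (single m 1) - dhat (Y l) x₀ (Wf m x₀)),
    fun β => ?_⟩
  choose B₁ hB₁ using fun m => exists_clm_single fun l => hat F V x₀ x₀ (β m l)
  obtain ⟨B, hB⟩ := exists_clm_single B₁
  -- the derivatives of the components of `A` at the point are shifted by `β`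
  let α : ∀ s : S, TangentSpace R₀ s →ₗ[ℝ] F := fun s =>
    (Λ + B (u (W.incl s))).toLinearMap ∘ₗ (mvfderiv R₀ (fun τ => u (W.incl τ)) s).toLinearMap
  have hα : ContMDiff (R₀).tangent 𝓘(ℝ, F) ∞
      (fun z : TangentBundle R₀ S => α z.proj z.snd) := by
    have h1 : ContMDiff (R₀).tangent R₀ ∞ fun z : TangentBundle R₀ S => z.proj :=
      contMDiff_proj _
    exact ContMDiff.clm_apply (contMDiff_const.add (B.contMDiff.comp (hui.comp h1)))
      (contMDiff_mvfderiv hui)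
  have hαν : ∀ z ∈ (χ i).target, ∀ l, α ((χ i).symm z)
      (coordFrame R₀ i z l) = (Λ + B (ν z)) (fderiv ℝ ν z (single l 1)) :=
    fun z hz l => by
      have h1 := mvfderiv_coordFrame (contMDiff_mdifferentiableAt (hui _)) hz l
      rw [(R₀).range_eq_univ, fderivWithin_univ] at h1
      exact congrArg (Λ + B (ν z)) h1
  set ψ : Fields W V := Fields.ofSections W X (fun s => locFrame I F V x₀ ∘ₗ α s) with hψ
  have hWY : ∀ l, fieldHom I ψ _ (coordFrame R₀ i y l) = (Wf l _, Y l _) := fun l => by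
    refine Prod.ext ?_ ?_
    · have hG : ContMDiff R₀ 𝓘(ℝ, EM) ∞ fun τ => c (X (W.incl τ)) := fun τ =>
        (contMDiffAt_extChartAt' (by have := (hXs (W.incl τ)).1; rwa [hc, extChartAt_source] at this)
          ).comp τ (hX.comp W.incl_embedding.contMDiff τ)
      have h1 := mvfderiv_coordFrame (contMDiff_mdifferentiableAt (hG _)) hy l
      rw [(R₀).range_eq_univ, fderivWithin_univ] at h1
      have h2 : (fun z => c (X (W.incl ((χ i).symm z)))) =ᶠ[𝓝 y]
          fun z => c x₀ + A (ν z) := by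
        have h3 : Filter.Tendsto (fun z => A (ν z)) (𝓝 y) (𝓝 0) := by
          have h4 := (A.continuous.continuousAt.comp hνd.continuousAt).tendsto
          rwa [Function.comp_apply, hν0, map_zero] at h4
        filter_upwards [h3.eventually hq1] with z hz
        exact (hcX _).trans (congrArg (c x₀ + ·) hz)
      have h3 : fderiv ℝ (fun z => c x₀ + A (ν z)) y (single l 1) =
          mvfderiv I c x₀ (Wf l x₀) := by
        have h4 := ((A.hasFDerivAt.comp y hνd.hasFDerivAt).const_add (c x₀)).fderiv
        refine (congrArg (fun T : E₀ →L[ℝ] EM => T (single l 1)) h4).trans ?_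
        exact (congrArg A (hud l)).trans (hA l)
      have h5 : ∀ x', x₀ = x' → mvfderiv I c x₀ (Wf l x₀) = mvfderiv I c x' (Wf l x') := by
        rintro _ rfl
        rfl
      rw [h2.fderiv_eq, h3, h5 _ hX0.symm] at h1
      have h6 := ((contMDiff_mdifferentiableAt (contMDiffAt_extChartAt' (by
        have := (hXs (W.incl ((χ i).symm y))).1
        rwa [hc, extChartAt_source] at this))).hasMFDerivAt.comp ((χ i).symm y)
          (((hX _).mdifferentiableAt infty_ne_zero).hasMFDerivAt.comp _
            (W.mdifferentiableAt_incl _).hasMFDerivAt)).mfderiv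
      refine (isInvertible_mfderiv_extChartAt (hXs (W.incl ((χ i).symm y))).1).injective
        (Eq.trans ?_ h1)
      exact (congrArg (fun T : E₀ →L[ℝ] EM => T (coordFrame R₀ i y l)) h6).symm
    · have h1 : α _ (coordFrame R₀ i y l) = hat F V x₀ x₀ (Y l x₀) := by
        rw [hαν y hy, hud, show ν y = 0 from hu0, map_zero, add_zero, hΛ]
      have h2 : ∀ x', x₀ = x' → locFrame I F V x₀ (hat F V x₀ x₀ (Y l x₀)) x' = Y l x' := by
        rintro _ rfl
        exact locFrame_hat_self I _
      refine Eq.trans ?_ (h2 _ hX0.symm)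
      rw [← h1]
      rfl
  have h0 := residue_eq_zero_of_gaugeInvariant g μtop μt H hinv hH hn ψ e
    (fun f hf => exists_gaugeVariation L cov x₀ (half_pos hR) hX hXs hα e hf) hy Wf Y hWY
  have hD : ∀ m l, fderiv ℝ (fun z => hat F V x₀ (ψ.X (W.incl ((χ i).symm z)))
      (ψ.A ((χ i).symm z) (coordFrame R₀ i z l))) y (single m 1) =
      fderiv ℝ (fun z => Λ (fderiv ℝ ν z (single l 1))) y
        (single m 1) + hat F V x₀ x₀ (β m l) := fun m l => by
    have h1 : (fun z => hat F V x₀ (ψ.X (W.incl ((χ i).symm z)))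
        (ψ.A ((χ i).symm z) (coordFrame R₀ i z l))) =ᶠ[𝓝 y] fun z =>
        Λ (fderiv ℝ ν z (single l 1)) +
          B (ν z) (fderiv ℝ ν z (single l 1)) := by
      filter_upwards [hto.mem_nhds hy] with z hz
      have h2 := hZ' (W.incl ((χ i).symm z))
      refine (congrArg (hat F V x₀ _) (h2.2.2.2 _)).trans ((hat_unhat h2.2.2.1 _).trans ?_)
      exact hαν z hz l
    have hb : DifferentiableAt ℝ (fun z => fderiv ℝ ν z (single l 1)) y :=
      ((hνy.fderiv_right (m := ∞) (by simp)).differentiableAt infty_ne_zero).clm_apply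
        (differentiableAt_const _)
    have h3 := ((Λ.differentiableAt.comp y hb).hasFDerivAt.add
      ((B.hasFDerivAt.comp y hνd.hasFDerivAt).clm_apply hb.hasFDerivAt)).fderiv
    rw [h1.fderiv_eq]
    refine (congrArg (fun T : E₀ →L[ℝ] F => T (single m 1)) h3).trans ?_
    rw [add_apply]
    refine congrArg₂ (· + ·) rfl ?_
    change B (ν y) _ + B (fderiv ℝ ν y (single m 1))
      (fderiv ℝ ν y (single l 1)) = _
    rw [hν0, hud, hud, hB, hB₁, map_zero, zero_apply, zero_add]
  rw [boundaryObstruction_eq L cov g μtop μt H e Wf Y hX0 hD] at h0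
  rw [← h0]
  refine congrArg (obstruction L cov g μtop μt H _ _ e Wf Y x₀) (funext fun m => funext fun l => ?_)
  have h1 := unhat_hat (mem_triv F V x₀) (β m l)
  rw [add_sub_right_comm, map_add, h1]
  rfl

end Necessity

variable {L cov μtop μt} in
/-- Gauge invariance implies the structure equations. -/
lemma conditions_of_gaugeInvariant (H : DForm I M (n + 1)) (hn : n ≠ 0)
    [CovariantDerivative.ContMDiffCovariantDerivative cov ∞] [Nonempty S]
    (hH : ∀ x, extD H.toFun x = 0) (hinv : GaugeInvariant W L cov g H μtop μt) :
    MetricInvariant L cov g ∧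
      IsHomotopyMomentumSection L cov (modifiedForm H μtop) (rescaled μt) ∧
      AlgebraicRelation L (rescaled μt) := by
  obtain ⟨i⟩ := ‹Nonempty S›
  have hy := mem_extChartAt_target (I := R₀) i
  have h := fun e Wf Y x =>
    obstruction_eq_zero_of_gaugeInvariant L cov g μtop μt H hinv hH hn hy e Wf Y x
  have hp := posDef_gram W.γ hy
  have hs := W.bdrySign_ne_zero hy
  obtain ⟨k, rfl⟩ := Nat.exists_eq_succ_of_ne_zero hn
  exact conditions_of_obstruction g hp hs h

end LASigma

end

theorem mainTheorem6 {n d : ℕ} (hn : 1 ≤ n)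
    {M : Type*} [TopologicalSpace M] [ChartedSpace (EuclideanSpace ℝ (Fin d)) M]
    [IsManifold (𝓡 d) ∞ M] [T2Space M] [SigmaCompactSpace M]
    {F : Type*} [NormedAddCommGroup F] [NormedSpace ℝ F] [FiniteDimensional ℝ F]
    {V : M → Type*} [TopologicalSpace (TotalSpace F V)]
    [∀ x, AddCommGroup (V x)] [∀ x, Module ℝ (V x)] [∀ x, TopologicalSpace (V x)]
    [∀ x, IsTopologicalAddGroup (V x)] [∀ x, ContinuousSMul ℝ (V x)]
    [FiberBundle F V] [VectorBundle ℝ F V] [ContMDiffVectorBundle ∞ F V (𝓡 d)]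
    (L : LASigma.LieAlgebroid (𝓡 d) M F V)
    (cov : CovariantDerivative (𝓡 d) F V) [CovariantDerivative.ContMDiffCovariantDerivative cov ∞]
    (g : ContMDiffRiemannianMetric (𝓡 d) ∞ (EuclideanSpace ℝ (Fin d))
      (fun x : M => TangentSpace (𝓡 d) x))
    (H : LASigma.DForm (𝓡 d) M (n + 1)) (hH : ∀ x, LASigma.extD H.toFun x = 0)
    {Ξ : Type*} [TopologicalSpace Ξ] [ChartedSpace (EuclideanHalfSpace (n + 1)) Ξ]
    [IsManifold (𝓡∂ (n + 1)) ∞ Ξ] [T2Space Ξ] [CompactSpace Ξ]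
    {S : Type*} [TopologicalSpace S] [ChartedSpace (EuclideanSpace ℝ (Fin n)) S]
    [IsManifold (𝓡 n) ∞ S] [T2Space S] [CompactSpace S] [Nonempty S]
    (W : LASigma.Worldvolume (n := n) Ξ S)
    (μtop : LASigma.DForm (𝓡 d) M n) (μt : LASigma.Cochain (𝓡 d) M F V n) :
    LASigma.GaugeInvariant W L cov g H μtop μt ↔
      LASigma.MetricInvariant L cov g ∧
      LASigma.IsHomotopyMomentumSection L cov (LASigma.modifiedForm H μtop)
        (LASigma.rescaled μt) ∧
      LASigma.AlgebraicRelation L (LASigma.rescaled μt) := by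
  exact ⟨LASigma.conditions_of_gaugeInvariant g H (by omega) hH, fun h =>
    LASigma.gaugeInvariant_of_conditions g H (by omega) hH h.1 h.2.1 h.2.2⟩
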